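/- **Setting.** Let $S$ be a surface and $L\subset J^1S=T^*S\times\mathbb R$ an embedded Legendrian surface whose base projection $\pi_x:L\to S$ is proper (e.g. $L$ compact), with generic front and base projections. Thus $L=L_0\sqcup L_1\sqcup L_2$: near $L_0$ the front (the image in $S\times\mathbb R_z$) is a graph, $L_1$ consists of cusp edges, $L_2$ of upward or downward swallowtail points; the other front singularities are transverse crossing arcs, triple points and cusp-sheet intersections; and two arcs of the base projection $\Sigma\subset S$ of the singular set that come from different points of the front meet only at transverse double points of $\Sigma$, which lie under no further singular point. Let $\mathcal E$ be an $L$-compatible polygonal decomposition of $S$: a CW decomposition with cells of dimension $\le 2$ and smooth characteristic maps of 1-cells, such that the boundary circle of the disk of each 2-cell is divided by finitely many (at least one) points, mapped to 0-cells, into intervals mapped homeomorphically onto 1-cells, and such that $\Sigma$ is contained in the 1-skeleton. **Algebra.** The sheets above a cell $e$ are the components of $L\cap\pi_x^{-1}(e)$ not contained in a cusp edge (a swallowtail point is a sheet above its 0-cell); write $S_p\prec S_q$ if $z(S_p)>z(S_q)$ above $e$. $\mathcal A$ is the free unital associative $\mathbb Z/2$-algebra with one generator for each cell and each pair $S_p\prec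 S_q$ of sheets above it, denoted $a_{p,q}$, $b_{p,q}$, $c_{p,q}$ for 0-, 1- and 2-cells. Extending $\prec$ to a total order, arrange the generators of a cell in a strictly upper triangular matrix $A$, $B$ or $C$. Generators of a cell in the boundary of $e$ are arranged in a matrix indexed by the sheets above $e$ by means of the point of the boundary sheet that is in the closure of each sheet of $e$; for two sheets meeting at a cusp above the boundary cell, a block $\left[\begin{smallmatrix}0&1\\0&0\end{smallmatrix}\right]$ (boundary 0-cells) or a zero block (boundary 1-cells) is inserted. **Swallowtails.** At each swallowtail point label one of the two regions bordering the crossing arc that ends there by $S$ and the other one by $T$. Let $k,k+1,k+2$ (upward) or $l-2,l-1,l$ (downward) be the three sheets meeting there, and $\widehat A_{i,j}$ the matrix of the 0-cell with a block $\left[\begin{smallmatrix}0&1\\0&0\end{smallmatrix}\right]$ inserted at rows and columns $i,j$. Put, in the upward case, $A_S=(I+E_{k+2,k+1})\widehat A_{k,k+2}(I+E_{k+2,k+1})$, $A_T=(I+E_{k+1,k+2})\widehat A_{k,k+1}(I+E_{k+1,k+2})$, $S=I+\widehat A_{k,k+1}E_{k+2,k}+E_{k+1,k+2}$, $T=I+E_{k+1,k+2}$,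 and in the downward case $A_S=(I+E_{l-1,l-2})\widehat A_{l-2,l}(I+E_{l-1,l-2})$, $A_T=(I+E_{l-2,l-1})\widehat A_{l-1,l}(I+E_{l-2,l-1})$, $S=I+E_{l,l-2}\widehat A_{l-1,l}+E_{l-2,l-1}$, $T=I+E_{l-2,l-1}$. Where a cell is, near a swallowtail vertex, in the interior of the swallowtail region (the region with two more sheets), the matrix of this vertex is $\widehat A_{k,k+1}$ (resp. $\widehat A_{l-1,l}$), except that for a 1-cell in the crossing arc it is $A_S$ or $A_T$ if the total order used is the one on the side labeled $S$ or $T$. For a 2-cell, cut out each corner labeled $S$ or $T$ from its polygon by an extra edge, oriented away from the crossing arc, with matrix $Y=S$ or $T$; in the new polygon $Q$ the endpoint of this edge on the crossing arc has matrix $A_S$ or $A_T$, and the other one has $\widehat A_{k,k+1}$ (resp. $\widehat A_{l-1,l}$). The other edges of $Q$ have $Y=I+B$. **Differential.** $\partial$ is the derivation of $\mathcal A$ with $\partial 1=0$ and $$\partial A=A^2,\qquad \partial B=A_+(I+B)+(I+B)A_-,\qquad \partial C=A_{v_1}C+CA_{v_0}+Y_j^{\eta_j}\cdots Y_1^{\eta_1}+Y_m^{\eta_m}\cdots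 Y_{j+1}^{\eta_{j+1}}$$ for all 0-, 1- and 2-cells. Here $A_\pm$ belong to the terminal/initial vertex of the 1-cell; $v_0,v_1$ are chosen vertices of $Q$ (with a chosen direction if $v_0=v_1$); $Y_1,\dots,Y_j$ and $Y_{j+1},\dots,Y_m$ belong to the successive edges of the counter-clockwise and the clockwise path from $v_0$ to $v_1$; and $\eta_i=\pm1$ according to whether the edge is traversed along or against its orientation. **Theorem.** The cellular DGA is well defined: there are finitely many sheets above each cell (so that the total orders exist), and there is exactly one derivation $\partial$ satisfying the defining equations; it is independent of the choice of the total orders extending $\prec$. Moreover $\partial^2=0$. Let $m(L)\ge 0$ be the Maslov number (the smallest positive value of the number of down-crossings minus the number of up-crossings of cusp edges along generic loops in $L$, or $0$ if there is none) and let $\mu:L_0\to\mathbb Z/m(L)$ be a Maslov potential (locally constant, increasing by $1$ from the lower to the upper sheet at each cusp edge; at a swallowtail point its value is the one on the single nearby sheet outside of the swallowtail region). Then $|a_{p,q}|=\mu(S_p)-\mu(S_q)-1$, $|b_{p,q}|=\mu(S_p)-\mu(S_q)$, $|c_{p,q}|=\mu(S_p)-\mu(S_q)+1$ defines a $\mathbb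 Z/m(L)$-grading of the algebra $\mathcal A$ for which $\partial$ has degree $-1$. -/

import Mathlib

open scoped Manifold ContDiff Topology

noncomputable section

namespace CellularDGA

open Set Metric Topology Topology.RelCWComplex
open scoped Classical

/-! ## The 1-jet space and Legendrian surfaces -/

/-- The model plane `ℝ²`. -/
abbrev Plane := EuclideanSpace ℝ (Fin 2)

/-- The cotangent bundle `T^*S` of a surface `S`. -/
abbrev CotangentBundle (S : Type*) [TopologicalSpace S] [ChartedSpace Plane S]
    [IsManifold (𝓡 2) ∞ S] :=
  Bundle.TotalSpace (Plane →L[ℝ] ℝ)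
    (fun u : S => TangentSpace (𝓡 2) u →L[ℝ] Bundle.Trivial S ℝ u)

/-- The 1-jet space `J^1 S = T^*S × ℝ`. -/
abbrev JetSpace (S : Type*) [TopologicalSpace S] [ChartedSpace Plane S]
    [IsManifold (𝓡 2) ∞ S] :=
  CotangentBundle S × ℝ

/-- The model with corners (without boundary) of the 5-manifold `J^1 S`. -/
abbrev jetModel := (((𝓡 2).prod 𝓘(ℝ, Plane →L[ℝ] ℝ)).prod 𝓘(ℝ, ℝ))

/-- An (embedded) Legendrian surface `L ⊆ J^1 S`, given by a smooth embedding of a surface `Λ`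
along which the contact form `dz - λ` vanishes, where `λ` is the Liouville form; the base
projection `L → S` is proper (this is automatic when `L` is compact). -/
structure LegendrianSurface (S Λ : Type*)
    [TopologicalSpace S] [ChartedSpace Plane S] [IsManifold (𝓡 2) ∞ S]
    [TopologicalSpace Λ] [ChartedSpace Plane Λ] where
  /-- the embedding -/
  toJet : Λ → JetSpace S
  isSmoothEmbedding : Manifold.IsSmoothEmbedding (𝓡 2) jetModel ∞ toJet
  legendrian : ∀ (p : Λ) (v : TangentSpace (𝓡 2) p),
    mfderiv (𝓡 2) 𝓘(ℝ, ℝ) (fun q => (toJet q).2) p v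
      = (toJet p).1.snd (mfderiv (𝓡 2) (𝓡 2) (fun q => (toJet q).1.proj) p v)
  isProperMap : IsProperMap (fun q => (toJet q).1.proj)

namespace LegendrianSurface

variable {S Λ : Type*} [TopologicalSpace S] [ChartedSpace Plane S] [IsManifold (𝓡 2) ∞ S]
  [TopologicalSpace Λ] [ChartedSpace Plane Λ]
  (L : LegendrianSurface S Λ)

/-- The base projection `π_x` restricted to `L`. -/
def x (p : Λ) : S := (L.toJet p).1.proj

/-- The `T^*S`-fibre coordinate on `L`; it is a covector at `L.x p`. (The tangent space of `S` at
a point is, in Mathlib, a copy of `ℝ²`, so covectors at one base point can be subtracted.) -/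
def y (p : Λ) : Plane →L[ℝ] ℝ := (L.toJet p).1.snd

/-- The `z`-coordinate on `L`. The front projection of `p` is `(L.x p, L.z p)`. -/
def z (p : Λ) : ℝ := (L.toJet p).2

/-- The derivative of the base projection at `p`. -/
def dx (p : Λ) : Plane →L[ℝ] Plane := mfderiv (𝓡 2) (𝓡 2) L.x p

/-! ### Singularities of the front projection -/

/-- Near `p`, the front projection of `L` is brought to the form `nf` by the coordinates `φ` of
`L` at `p` and by a local diffeomorphism `(u, w) ↦ (ψ u, g (u, w))` of `S × ℝ` which covers a local
diffeomorphism of `S` and preserves the upward direction. -/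
def HasFrontForm (nf : Plane → Plane × ℝ) (p : Λ) (φ : OpenPartialHomeomorph Λ Plane) : Prop :=
  φ ∈ IsManifold.maximalAtlas (𝓡 2) ∞ Λ ∧ p ∈ φ.source ∧ φ p = 0 ∧
  ∃ ψ ∈ IsManifold.maximalAtlas (𝓡 2) ∞ S, L.x p ∈ ψ.source ∧ ψ (L.x p) = 0 ∧
  ∃ g : S × ℝ → ℝ,
    ContMDiffAt ((𝓡 2).prod 𝓘(ℝ, ℝ)) 𝓘(ℝ, ℝ) ∞ g (L.x p, L.z p) ∧
    0 < deriv (fun w => g (L.x p, w)) (L.z p) ∧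
    ∀ᶠ q in 𝓝 p, ψ (L.x q) = (nf (φ q)).1 ∧ g (L.x q, L.z q) = (nf (φ q)).2

/-- The standard cusp edge: a semi-cubical cusp times an interval. -/
def cuspForm (a : Plane) : Plane × ℝ := (!₂[a 0, a 1 ^ 2], a 1 ^ 3)

/-- The standard upward swallowtail: the front of the generating family
`F (x₁, x₂; e) = e⁴ - x₁ e² + x₂ e`, parametrized by `(x₁, e)`; the equation `∂F/∂e = 0` gives
`x₂ = 2 x₁ e - 4 e³`. -/
def swallowForm (a : Plane) : Plane × ℝ :=
  (!₂[a 0, 2 * a 0 * a 1 - 4 * a 1 ^ 3],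
    a 1 ^ 4 - a 0 * a 1 ^ 2 + (2 * a 0 * a 1 - 4 * a 1 ^ 3) * a 1)

/-- The set `L_0` of points near which the front projection is the graph of a smooth function. -/
def regular : Set Λ := {p | IsLocalDiffeomorphAt (𝓡 2) (𝓡 2) ∞ L.x p}

/-- `φ` is a system of coordinates adapted to a cusp edge through `p`: the cusp edge is
`{φ₁ = 0}` and the upper (lower) sheet is `{φ₁ > 0}` (`{φ₁ < 0}`). -/
def IsCuspChart (p : Λ) (φ : OpenPartialHomeomorph Λ Plane) : Prop := L.HasFrontForm cuspForm p φ

/-- The set `L_1`, i.e. the union of the cusp edges. -/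
def cuspEdge : Set Λ := {p | ∃ φ, L.IsCuspChart p φ}

/-- The upward swallowtail points. -/
def swallowUp : Set Λ := {p | ∃ φ, L.HasFrontForm swallowForm p φ}

/-- The downward swallowtail points. -/
def swallowDown : Set Λ :=
  {p | ∃ φ, L.HasFrontForm (fun a => ((swallowForm a).1, -(swallowForm a).2)) p φ}

/-- The set `L_2` of swallowtail points. -/
def swallowtail : Set Λ := L.swallowUp ∪ L.swallowDown

/-- The points of `L` with front projection `(u, w)`. -/
def frontFiber (u : S) (w : ℝ) : Set Λ := {p | L.x p = u ∧ L.z p = w}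

/-- The front projection is non-singular at `(u, w)`. -/
def IsSmoothFront (u : S) (w : ℝ) : Prop :=
  L.frontFiber u w = ∅ ∨ ∃ p ∈ L.regular, L.frontFiber u w = {p}

/-- `(u, w)` lies on a crossing arc: two sheets cross (transversally, as `L` is embedded). -/
def IsCrossingPoint (u : S) (w : ℝ) : Prop :=
  ∃ p ∈ L.regular, ∃ q ∈ L.regular, p ≠ q ∧ L.frontFiber u w = {p, q}

/-- `(u, w)` lies on a cusp edge, away from the other sheets. -/
def IsCuspPoint (u : S) (w : ℝ) : Prop :=
  ∃ p ∈ L.cuspEdge, L.frontFiber u w = {p}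

/-- `(u, w)` is a triple point: three sheets meet, pairwise transversally, and the crossing arc of
any two of them is transverse to the third one. -/
def IsTriplePoint (u : S) (w : ℝ) : Prop :=
  ∃ p ∈ L.regular, ∃ q ∈ L.regular, ∃ r ∈ L.regular,
    L.frontFiber u w = {p, q, r} ∧ LinearIndependent ℝ ![L.y p - L.y q, L.y p - L.y r]

/-- `(u, w)` is a cusp-sheet intersection: a cusp edge (through `p`) cuts transversally through a
sheet (at `q`). The tangent plane of the sheet is the graph of `L.y q`, and the tangent line of the
cusp edge is spanned by the vectors `(L.dx p v, L.y p (L.dx p v))`. -/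
def IsCuspSheetPoint (u : S) (w : ℝ) : Prop :=
  ∃ p ∈ L.cuspEdge, ∃ q ∈ L.regular, L.frontFiber u w = {p, q} ∧
    ∃ v, (L.y p - L.y q) (L.dx p v) ≠ 0

/-- `(u, w)` is a swallowtail point, away from the other sheets. -/
def IsSwallowtailPoint (u : S) (w : ℝ) : Prop :=
  ∃ p ∈ L.swallowtail, L.frontFiber u w = {p}

/-- The codimension 1 singularities of the front. -/
def IsCodimOne (u : S) (w : ℝ) : Prop := L.IsCrossingPoint u w ∨ L.IsCuspPoint u w

/-- At a codimension 1 singularity `(u, w)` of the front, the vectors tangent at `u` to the base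
projection of the crossing arc or cusp edge. -/
def IsTangentToBase (u : S) (w : ℝ) (v : Plane) : Prop :=
  (∃ p ∈ L.frontFiber u w, ∃ q ∈ L.frontFiber u w, p ≠ q ∧ (L.y p - L.y q) v = 0) ∨
  (∃ p ∈ L.frontFiber u w, p ∈ L.cuspEdge ∧ v ∈ Set.range (L.dx p))

/-- `L` has generic front and base projections: the front has only the standard singularities,
and in the base projection at most two singular points of the front lie above one point of `S`;
if there are two, then both are of codimension 1 and the base projections of the two arcs are
transverse. -/
structure IsGeneric : Prop where
  front : ∀ u w, L.IsSmoothFront u w ∨ L.IsCodimOne u w ∨ L.IsTriplePoint u w ∨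
    L.IsCuspSheetPoint u w ∨ L.IsSwallowtailPoint u w
  base : ∀ u w w', w ≠ w' → ¬ L.IsSmoothFront u w → ¬ L.IsSmoothFront u w' →
    L.IsCodimOne u w ∧ L.IsCodimOne u w' ∧
    (∀ v, L.IsTangentToBase u w v → L.IsTangentToBase u w' v → v = 0) ∧
    ∀ w'', ¬ L.IsSmoothFront u w'' → w'' = w ∨ w'' = w'

/-- The base projection `Σ` of the singular set of `L`. -/
def baseSingularSet : Set S := {u | ∃ w, ¬ L.IsSmoothFront u w}

/-! ### Maslov number and Maslov potentials -/

/-- A generic loop in `L`: it avoids the swallowtail points and is transverse to the cusp edges. -/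
structure IsGenericLoop (γ : ℝ → Λ) : Prop where
  smooth : ContMDiff 𝓘(ℝ, ℝ) (𝓡 2) ∞ γ
  periodic : Function.Periodic γ 1
  avoids : ∀ t, γ t ∉ L.swallowtail
  transverse : ∀ t, ∀ φ, L.IsCuspChart (γ t) φ → deriv (fun s => φ (γ s) 1) t ≠ 0

/-- The number `D(γ)` of times at which `γ` passes from the upper to the lower sheet at a
cusp edge. -/
def downCusps (γ : ℝ → Λ) : ℕ :=
  {t ∈ Ico (0 : ℝ) 1 | ∃ φ, L.IsCuspChart (γ t) φ ∧ deriv (fun s => φ (γ s) 1) t < 0}.ncard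

/-- The number `U(γ)` of times at which `γ` passes from the lower to the upper sheet at a
cusp edge. -/
def upCusps (γ : ℝ → Λ) : ℕ :=
  {t ∈ Ico (0 : ℝ) 1 | ∃ φ, L.IsCuspChart (γ t) φ ∧ 0 < deriv (fun s => φ (γ s) 1) t}.ncard

/-- The Maslov number `m(L)`: the smallest positive value of `D(γ) - U(γ)` over the generic loops
`γ`, or `0` if there is none (`sInf ∅ = 0` in `ℕ`). -/
def maslovNumber : ℕ :=
  sInf {k : ℕ | 0 < k ∧ ∃ γ, L.IsGenericLoop γ ∧ (L.downCusps γ : ℤ) - L.upCusps γ = k}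

/-- A Maslov potential: a locally constant function `L_0 → ℤ/m(L)` that increases by `1` from the
lower to the upper sheet at each cusp edge. -/
structure MaslovPotential where
  toFun : L.regular → ZMod L.maslovNumber
  isLocallyConstant : IsLocallyConstant toFun
  cusp : ∀ p ∈ L.cuspEdge, ∃ W ∈ 𝓝 p, ∀ q q' : L.regular, (q : Λ) ∈ W → (q' : Λ) ∈ W →
    L.x q = L.x q' → L.z q' < L.z q → toFun q = toFun q' + 1

variable {L} in
/-- `v` is the value of the Maslov potential at `p`. For `p` in `L_0` this is the value of the
function; at a swallowtail point it is the value on the single sheet outside of the swallowtail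
region that has `p` in its closure, i.e. at nearby points that are alone, near `p`, in their fibre
of the base projection. -/
def MaslovPotential.HasValueAt (μ : L.MaslovPotential) (p : Λ) (v : ZMod L.maslovNumber) : Prop :=
  ∃ W ∈ 𝓝 p, ∃ᶠ q in 𝓝 p, ∃ h : q ∈ L.regular,
    (∀ q' ∈ W, L.x q' = L.x q → q' = q) ∧ μ.toFun ⟨q, h⟩ = v

variable {L} in
/-- The value of a Maslov potential on a sheet `s` of `L` above a cell. -/
def MaslovPotential.onSheet (μ : L.MaslovPotential) (s : Set Λ) : ZMod L.maslovNumber :=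
  Classical.epsilon fun v => ∃ p ∈ s, μ.HasValueAt p v

end LegendrianSurface

/-! ## Polygonal decompositions -/

/-- The cells of dimension `n` of a CW decomposition of `S`. -/
abbrev Cell (S : Type*) [TopologicalSpace S] [CWComplex (univ : Set S)] (n : ℕ) : Type _ :=
  cell (univ : Set S) n

/-- The counter-clockwise parametrization by the angle of the boundary of the 2-disk. (The domain
of the characteristic map of a 2-cell is the unit ball of `ℝ²` for the maximum norm.) -/
def circlePoint (t : ℝ) : Fin 2 → ℝ :=
  ‖![Real.cos t, Real.sin t]‖⁻¹ • ![Real.cos t, Real.sin t]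

/-- The initial (`false`) and the terminal (`true`) end of the domain `[-1, 1]` of the
characteristic map of a 1-cell. -/
def endPoint (ε : Bool) : Fin 1 → ℝ := fun _ => if ε then 1 else -1

/-- A CW decomposition of the surface `S` is polygonal: there are only cells of dimension at most
`2`, the characteristic maps of the 1-cells are smooth, and the boundary circle of the domain of
each 2-cell is divided by finitely many points (and at least one), mapped to 0-cells, into
intervals that are mapped homeomorphically onto 1-cells. The division points ("corners") and the
intervals ("sides") are listed counter-clockwise and periodically: side `k` runs from corner `k` to
corner `k + 1`. (A continuous bijection between open intervals is a homeomorphism.) -/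
structure PolygonalDecomposition (S : Type*) [TopologicalSpace S] [ChartedSpace Plane S]
    [CWComplex (univ : Set S)] where
  isEmpty_cell : ∀ n, 2 < n → IsEmpty (Cell S n)
  smooth : ∀ β : Cell S 1,
    ContMDiffOn 𝓘(ℝ, Fin 1 → ℝ) (𝓡 2) ∞ (map 1 β) (closedBall 0 1)
  /-- the number of corners of a 2-cell -/
  corners : Cell S 2 → ℕ
  corners_pos : ∀ α, 0 < corners α
  /-- the angle of the `k`-th corner -/
  angle : Cell S 2 → ℤ → ℝ
  strictMono_angle : ∀ α, StrictMono (angle α)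
  angle_add : ∀ α k, angle α (k + corners α) = angle α k + 2 * Real.pi
  angle_mem : ∀ α k, ∃ v : Cell S 0, map 2 α (circlePoint (angle α k)) ∈ openCell 0 v
  /-- the 1-cell onto which the `k`-th side is mapped -/
  side : Cell S 2 → ℤ → Cell S 1
  bijOn_side : ∀ α k, BijOn (fun t => map 2 α (circlePoint t))
    (Ioo (angle α k) (angle α (k + 1))) (openCell 1 (side α k))

namespace PolygonalDecomposition

variable {S : Type*} [TopologicalSpace S] [ChartedSpace Plane S] [CWComplex (univ : Set S)]
  (P : PolygonalDecomposition S)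

/-- The point of the boundary of the disk at the `k`-th corner. -/
def cornerPoint (α : Cell S 2) (k : ℤ) : Fin 2 → ℝ := circlePoint (P.angle α k)

/-- A point of the boundary of the disk in the interior of the `k`-th side. -/
def sidePoint (α : Cell S 2) (k : ℤ) : Fin 2 → ℝ :=
  circlePoint ((P.angle α k + P.angle α (k + 1)) / 2)

/-- The counter-clockwise orientation of the `k`-th side agrees with the orientation of the 1-cell
that is given by its characteristic map. -/
def SidePositive (α : Cell S 2) (k : ℤ) : Prop :=
  StrictMonoOn (fun t => (map 1 (P.side α k)).symm (map 2 α (circlePoint t)) 0)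
    (Ioo (P.angle α k) (P.angle α (k + 1)))

/-- The end of the 1-cell `P.side α k` at the corner `k` at which side `k` starts. -/
def startEnd (α : Cell S 2) (k : ℤ) : Bool := if P.SidePositive α k then false else true

/-- The end of the 1-cell `P.side α k` at the corner `k + 1` at which side `k` finishes. -/
def finishEnd (α : Cell S 2) (k : ℤ) : Bool := if P.SidePositive α k then true else false

end PolygonalDecomposition

section

variable {S Λ : Type*} [TopologicalSpace S] [ChartedSpace Plane S] [IsManifold (𝓡 2) ∞ S]
  [TopologicalSpace Λ] [ChartedSpace Plane Λ] [CWComplex (univ : Set S)]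
  (L : LegendrianSurface S Λ) (P : PolygonalDecomposition S)

/-- The cell decomposition of `S` is `L`-compatible: `Σ` is contained in the 1-skeleton. -/
def IsCompatible : Prop :=
  ∀ u ∈ L.baseSingularSet, ∃ n ≤ 1, ∃ e : Cell S n, u ∈ openCell n e

/-! ## Sheets above cells -/

/-- `s` is a sheet of `L` above the cell `e ⊆ S`: a component of `L ∩ π_x⁻¹(e)` that is not
contained in a cusp edge. -/
def IsSheet (e : Set S) (s : Set Λ) : Prop :=
  (∃ p ∈ L.x ⁻¹' e, s = connectedComponentIn (L.x ⁻¹' e) p) ∧ ¬ s ⊆ L.cuspEdge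

/-- The set `L(e)` of sheets of `L` above a cell. -/
abbrev Sheet (n : ℕ) (e : Cell S n) : Type _ := {s : Set Λ // IsSheet L (openCell n e) s}

variable {L} in
/-- `s ≺ t`: the sheet `s` lies above the sheet `t`. -/
def Sheet.Above {n : ℕ} {e : Cell S n} (s t : Sheet L n e) : Prop :=
  ∀ p ∈ s.1, ∀ q ∈ t.1, L.x p = L.x q → L.z q < L.z p

variable {L} in
/-- For a point `θ` of the boundary of the domain of the characteristic map `c` of the cell `e`, the
point `p` of `L` (which lies above `c θ`) is in the closure of the sheet `s` near `θ`: it is a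
limit of points of `s` above `c θ'` with `θ'` in the open ball tending to `θ`. -/
def Sheet.Adherent {n : ℕ} {e : Cell S n} (s : Sheet L n e) (θ : Fin n → ℝ) (p : Λ) : Prop :=
  ClusterPt p (Filter.principal s.1 ⊓
    Filter.comap L.x (Filter.map (map n e) (𝓝[ball 0 1] θ)))

variable {L} in
/-- The point above `c θ` that is in the closure of the sheet `s` near `θ` (the default value in
the last branch is never used, as there is exactly one such point). -/
def Sheet.limit {n : ℕ} {e : Cell S n} (s : Sheet L n e) (θ : Fin n → ℝ) : Λ :=
  if h : ∃ p, s.Adherent θ p then h.choose else s.2.1.choose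

/-- A bijection `ι : {1, …, n} → L(e)` that extends the partial order `≺` to a total one. -/
structure Enumeration (n : ℕ) (e : Cell S n) where
  num : ℕ
  sheet : Fin num ≃ Sheet L n e
  lt_of_above : ∀ i j, (sheet i).Above (sheet j) → i < j

/-! ## The algebra -/

/-- The generators: one for each cell and each pair `s ≺ t` of sheets above the cell. -/
structure Gen where
  dim : ℕ
  cell : Cell S dim
  upper : Sheet L dim cell
  lower : Sheet L dim cell
  above : upper.Above lower

/-- The free unital associative `ℤ/2`-algebra on the generators. -/
abbrev Alg : Type _ := FreeAlgebra (ZMod 2) (Gen L)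

variable {L} in
/-- The degree of a generator: `μ(S_p) - μ(S_q) + 1`, `μ(S_p) - μ(S_q)`, `μ(S_p) - μ(S_q) - 1` for
cells of dimension `2`, `1`, `0`. -/
def Gen.degree (μ : L.MaslovPotential) (g : Gen L) : ZMod L.maslovNumber :=
  μ.onSheet g.upper.1 - μ.onSheet g.lower.1 + (g.dim - 1)

variable {L} in
/-- The homogeneous elements of degree `k`: the span of the words in the generators of total
degree `k`. -/
def gradedPiece (μ : L.MaslovPotential) (k : ZMod L.maslovNumber) : Submodule (ZMod 2) (Alg L) :=
  Submodule.span (ZMod 2)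
    {a | ∃ w : List (Gen L), (w.map (Gen.degree μ)).sum = k ∧
      a = (w.map (FreeAlgebra.ι (ZMod 2))).prod}

/-- For two points `p`, `q` of `L` above one point of `S`: the generator of the sheets
that contain `p` and `q` if these exist and satisfy `≺`, and `0` otherwise. -/
def genAt (p q : Λ) : Alg L :=
  if h : ∃ g : Gen L, p ∈ g.upper.1 ∧ q ∈ g.lower.1 then FreeAlgebra.ι (ZMod 2) h.choose else 0

/-! ## Matrices -/

namespace Enumeration

variable {L} {n : ℕ} {e : Cell S n} (E : Enumeration L n e) (θ : Fin n → ℝ)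

/-- The matrix (`A`, `B` or `C`) of the generators of the cell itself. -/
def cellMatrix : Matrix (Fin E.num) (Fin E.num) (Alg L) :=
  Matrix.of fun i j => if h : (E.sheet i).Above (E.sheet j) then
    FreeAlgebra.ι (ZMod 2) ⟨n, e, E.sheet i, E.sheet j, h⟩ else 0

/-- The point above the boundary point `θ` that is in the closure of the `i`-th sheet. -/
def lim (i : Fin E.num) : Λ := (E.sheet i).limit θ

/-- The generators of a cell in the boundary, arranged in a matrix by means of the sheets above
`e`; there are zeros in the rows and columns of sheets that meet at a cusp above `θ`. -/
def edgeMatrix : Matrix (Fin E.num) (Fin E.num) (Alg L) :=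
  Matrix.of fun i j => genAt L (E.lim θ i) (E.lim θ j)

/-- The generators of a 0-cell in the boundary, arranged in a matrix by means of the sheets above
`e`, with a block `[0 1; 0 0]` for each pair of sheets that meet at a cusp above `θ`. -/
def plainMatrix : Matrix (Fin E.num) (Fin E.num) (Alg L) :=
  Matrix.of fun i j =>
    if i < j ∧ E.lim θ i = E.lim θ j ∧ E.lim θ i ∈ L.cuspEdge then 1
    else genAt L (E.lim θ i) (E.lim θ j)

/-- The matrix `Â_{k,l}` at a swallowtail point: a block `[0 1; 0 0]` in the rows and columns
`k`, `l`, and the generators of the swallowtail 0-cell in the other ones. -/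
def hatMatrix (k l : Fin E.num) : Matrix (Fin E.num) (Fin E.num) (Alg L) :=
  Matrix.of fun i j =>
    if i = k ∧ j = l then 1
    else if i = k ∨ i = l ∨ j = k ∨ j = l then 0
    else genAt L (E.lim θ i) (E.lim θ j)

/-- The three sheets `p < q < r` meet at a swallowtail point above `θ`. This happens exactly when
`e` is, near `θ`, in the interior of the swallowtail region of a swallowtail point above `θ`;
otherwise only one sheet above `e` contains the swallowtail point in its closure near `θ`. The
numbers `(p, q, r)` are `(k, k + 1, k + 2)` or `(l - 2, l - 1, l)` if the swallowtail point is
upward or downward. -/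
def IsTriple (t : Fin E.num × Fin E.num × Fin E.num) : Prop :=
  t.1 < t.2.1 ∧ t.2.1 < t.2.2 ∧ E.lim θ t.1 = E.lim θ t.2.1 ∧ E.lim θ t.2.1 = E.lim θ t.2.2 ∧
    E.lim θ t.1 ∈ L.swallowtail

/-- The matrix unit `E_{i,j}`. -/
def unit (i j : Fin E.num) : Matrix (Fin E.num) (Fin E.num) (Alg L) := Matrix.single i j 1

/-- The matrix of a boundary vertex without decoration: in the interior of a swallowtail region it
is `Â_{k,k+1}` (upward) or `Â_{l-1,l}` (downward). -/
def vertexMatrix : Matrix (Fin E.num) (Fin E.num) (Alg L) :=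
  if h : ∃ t, E.IsTriple θ t then
    match h.choose with
    | (p, q, r) => if E.lim θ p ∈ L.swallowUp then E.hatMatrix θ p q else E.hatMatrix θ q r
  else E.plainMatrix θ

/-- The matrix `A_S` (only used in the interior of a swallowtail region, as the next three). -/
def matrixAS : Matrix (Fin E.num) (Fin E.num) (Alg L) :=
  if h : ∃ t, E.IsTriple θ t then
    match h.choose with
    | (p, q, r) =>
      if E.lim θ p ∈ L.swallowUp then
        (1 + E.unit r q) * E.hatMatrix θ p r * (1 + E.unit r q)
      else (1 + E.unit q p) * E.hatMatrix θ p r * (1 + E.unit q p)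
  else 0

/-- The matrix `A_T`. -/
def matrixAT : Matrix (Fin E.num) (Fin E.num) (Alg L) :=
  if h : ∃ t, E.IsTriple θ t then
    match h.choose with
    | (p, q, r) =>
      if E.lim θ p ∈ L.swallowUp then
        (1 + E.unit q r) * E.hatMatrix θ p q * (1 + E.unit q r)
      else (1 + E.unit p q) * E.hatMatrix θ q r * (1 + E.unit p q)
  else 0

/-- The matrix `S`. -/
def matrixS : Matrix (Fin E.num) (Fin E.num) (Alg L) :=
  if h : ∃ t, E.IsTriple θ t then
    match h.choose with
    | (p, q, r) =>
      if E.lim θ p ∈ L.swallowUp then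
        1 + E.hatMatrix θ p q * E.unit r p + E.unit q r
      else 1 + E.unit r p * E.hatMatrix θ q r + E.unit p q
  else 1

/-- The matrix `T`. -/
def matrixT : Matrix (Fin E.num) (Fin E.num) (Alg L) :=
  if h : ∃ t, E.IsTriple θ t then
    match h.choose with
    | (p, q, r) =>
      if E.lim θ p ∈ L.swallowUp then 1 + E.unit q r else 1 + E.unit p q
  else 1

end Enumeration

/-! ## Decorations at swallowtail points -/

/-- The sheets `s` and `t` cross above the 1-cell `β` and meet at a swallowtail point above the end
`ε` of `β`; in particular `β` is, near this end, the crossing arc that ends at the swallowtail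
point. -/
def CrossAt (β : Cell S 1) (ε : Bool) (s t : Sheet L 1 β) : Prop :=
  s ≠ t ∧ ¬ s.Above t ∧ ¬ t.Above s ∧
    s.limit (endPoint ε) = t.limit (endPoint ε) ∧ s.limit (endPoint ε) ∈ L.swallowtail

/-- The end `ε` of the 1-cell `β` is the end at a swallowtail point of the crossing arc that
terminates there. -/
def IsCrossingEnd (β : Cell S 1) (ε : Bool) : Prop := ∃ s t, CrossAt L β ε s t

/-- The decorations at the swallowtail points. Each swallowtail point is the end of exactly one
crossing arc, and the two regions that border this arc near the swallowtail point differ in which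
one of the two crossing sheets is the upper one. The labels `S` and `T` are recorded by the choice,
among the two crossing sheets, of the one that is the upper one in the region labeled `S`. -/
abbrev Decoration : Type _ :=
  ∀ (β : Cell S 1) (ε : Bool), IsCrossingEnd L β ε → {s : Sheet L 1 β // ∃ t, CrossAt L β ε s t}

variable {L} (D : Decoration L)

/-- The matrix `A_-` (`ε = false`) or `A_+` (`ε = true`) of a 1-cell. On the crossing arc that ends
at a swallowtail point it is `A_S` or `A_T`, according to whether the total order of the sheets
is the one on the side labeled `S` or the one on the side labeled `T`. -/
def endMatrix {β : Cell S 1} (E : Enumeration L 1 β) (ε : Bool) :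
    Matrix (Fin E.num) (Fin E.num) (Alg L) :=
  if h : IsCrossingEnd L β ε then
    if ∃ t, CrossAt L β ε (D β ε h).1 t ∧ E.sheet.symm (D β ε h).1 < E.sheet.symm t then
      E.matrixAS (endPoint ε)
    else E.matrixAT (endPoint ε)
  else E.vertexMatrix (endPoint ε)

/-! ## The polygon `Q` of a 2-cell -/

variable (L) in
/-- The side that ends at corner `k` is the crossing arc that terminates at a swallowtail point
there. -/
def CrossingIn (α : Cell S 2) (k : ℤ) : Prop :=
  IsCrossingEnd L (P.side α (k - 1)) (P.finishEnd α (k - 1))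

variable (L) in
/-- The side that starts at corner `k` is the crossing arc that terminates at a swallowtail point
there. -/
def CrossingOut (α : Cell S 2) (k : ℤ) : Prop :=
  IsCrossingEnd L (P.side α k) (P.startEnd α k)

/-- Side `j` of the 2-cell `α` being a crossing arc with the end `ε` at a swallowtail point, the
region of `α` that borders it is labeled `S`: above `α`, a sheet that contains the chosen crossing
sheet in its closure along side `j` is above one that contains the other crossing sheet. -/
def SideLabeledS (α : Cell S 2) (j : ℤ) (ε : Bool) : Prop :=
  ∃ h : IsCrossingEnd L (P.side α j) ε, ∃ t, CrossAt L (P.side α j) ε (D _ ε h).1 t ∧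
    ∃ X Y : Sheet L 2 α, X.Above Y ∧
      X.limit (P.sidePoint α j) ∈ (D _ ε h).1.1 ∧ Y.limit (P.sidePoint α j) ∈ t.1

/-- The corner `k` of the 2-cell `α` maps to a region labeled `S`. -/
def CornerLabeledS (α : Cell S 2) (k : ℤ) : Prop :=
  SideLabeledS P D α (k - 1) (P.finishEnd α (k - 1)) ∨ SideLabeledS P D α k (P.startEnd α k)

/-- The edges of the polygon `Q`: the sides of the 2-cell, and the additional edges that cut out
the corners labeled `S` or `T`. -/
inductive QEdge
  | side (k : ℤ)
  | corner (k : ℤ)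

variable (L) in
/-- The edges of `Q`, counter-clockwise, from corner `0` on. -/
def qEdges (α : Cell S 2) : List QEdge :=
  (List.range (P.corners α)).flatMap fun k : ℕ =>
    (if CrossingIn L P α (k : ℤ) ∨ CrossingOut L P α (k : ℤ) then [QEdge.corner (k : ℤ)] else []) ++
      [QEdge.side (k : ℤ)]

variable (L) in
/-- The `i`-th edge of `Q`, with indices modulo the number of edges. The `i`-th vertex of `Q` is
the point at which the `i`-th edge starts (counter-clockwise). -/
def qEdge (α : Cell S 2) (i : ℕ) : QEdge :=
  (qEdges L P α).getD (i % (qEdges L P α).length) (QEdge.side 0)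

variable (L) in
/-- The orientation of an edge of `Q` is the counter-clockwise one. Edges that cut out
corners point away from the crossing arc. -/
def QEdge.IsCcw (α : Cell S 2) : QEdge → Prop
  | .side k => P.SidePositive α k
  | .corner k => CrossingIn L P α k

section

variable {α : Cell S 2} (E : Enumeration L 2 α)

/-- The matrix `A_S` or `A_T` at a decorated corner. -/
def decoratedMatrix (k : ℤ) : Matrix (Fin E.num) (Fin E.num) (Alg L) :=
  if CornerLabeledS P D α k then E.matrixAS (P.cornerPoint α k)
  else E.matrixAT (P.cornerPoint α k)

/-- The matrix `Y_e` of an edge of `Q`. -/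
def QEdge.matrix : QEdge → Matrix (Fin E.num) (Fin E.num) (Alg L)
  | .side k => 1 + E.edgeMatrix (P.sidePoint α k)
  | .corner k =>
    if CornerLabeledS P D α k then E.matrixS (P.cornerPoint α k)
    else E.matrixT (P.cornerPoint α k)

/-- The matrix `A_v` of the vertex `v` of `Q` at which an edge starts, counter-clockwise. It is
`A_S` or `A_T` if `v` is the vertex of an edge cutting out a corner that is shared with the crossing
arc. -/
def QEdge.startMatrix : QEdge → Matrix (Fin E.num) (Fin E.num) (Alg L)
  | .side k =>
    if CrossingOut L P α k then decoratedMatrix P D E k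
    else E.vertexMatrix (P.cornerPoint α k)
  | .corner k =>
    if CrossingIn L P α k then decoratedMatrix P D E k
    else E.vertexMatrix (P.cornerPoint α k)

/-- The product `Y_j^{η_j} ⋯ Y_1^{η_1}` for the successive edges of a path along the boundary of
`Q` that proceeds counter-clockwise (`ccw = true`) or clockwise (`ccw = false`). -/
def pathMatrix (ccw : Bool) (path : List QEdge) : Matrix (Fin E.num) (Fin E.num) (Alg L) :=
  (path.map fun e => if (e.IsCcw L P α ↔ ccw = true) then e.matrix P D E
    else Ring.inverse (e.matrix P D E)).reverse.prod

end

variable (L) in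
/-- For each 2-cell, the choice of the initial and terminal vertices `v₀` and `v₁` among the
vertices of `Q`, and of a direction if `v₀ = v₁`: the vertex `v₀`, and the number (between `0` and
the number of edges of `Q`) of edges of the counter-clockwise path from `v₀` to `v₁`. -/
structure VertexChoice where
  init : ∀ α : Cell S 2, Fin (qEdges L P α).length
  len : ∀ α : Cell S 2, Fin ((qEdges L P α).length + 1)

namespace VertexChoice

variable {P} (V : VertexChoice L P) (α : Cell S 2)

/-- The counter-clockwise path `γ₊` from `v₀` to `v₁`. -/
def pathPlus : List QEdge :=
  (List.range (V.len α)).map fun i => qEdge L P α (V.init α + i)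

/-- The clockwise path `γ₋` from `v₀` to `v₁`. -/
def pathMinus : List QEdge :=
  (List.range ((qEdges L P α).length - V.len α)).map fun i =>
    qEdge L P α (V.init α + (qEdges L P α).length - 1 - i)

end VertexChoice

/-! ## The differential -/

/-- The map `d` is the differential of the cellular algebra formed by means of the total orders
`E` of the sheets above the cells: it is a derivation and satisfies the defining matrix
equations. -/
structure IsCellularDifferential (V : VertexChoice L P)
    (E : ∀ (n : ℕ) (e : Cell S n), Enumeration L n e)
    (d : Alg L →ₗ[ZMod 2] Alg L) : Prop where
  map_one : d 1 = 0
  leibniz : ∀ a b, d (a * b) = d a * b + a * d b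
  zero_cell : ∀ v : Cell S 0,
    (E 0 v).cellMatrix.map d = (E 0 v).cellMatrix * (E 0 v).cellMatrix
  one_cell : ∀ β : Cell S 1,
    (E 1 β).cellMatrix.map d =
      endMatrix D (E 1 β) true * (1 + (E 1 β).cellMatrix) +
        (1 + (E 1 β).cellMatrix) * endMatrix D (E 1 β) false
  two_cell : ∀ α : Cell S 2,
    (E 2 α).cellMatrix.map d =
      (qEdge L P α (V.init α + V.len α)).startMatrix P D (E 2 α) * (E 2 α).cellMatrix +
        (E 2 α).cellMatrix * (qEdge L P α (V.init α)).startMatrix P D (E 2 α) +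
        pathMatrix P D (E 2 α) true (V.pathPlus α) +
        pathMatrix P D (E 2 α) false (V.pathMinus α)

end

end CellularDGA

end

noncomputable section
namespace CellularDGA
open Set Metric Topology Topology.RelCWComplex Filter
open scoped Classical

section CW

variable {S : Type*} [TopologicalSpace S] [CWComplex (univ : Set S)]

lemma exists_mem_openCell (u : S) : ∃ n, ∃ e : Cell S n, u ∈ openCell n e := by
  have h : u ∈ ⋃ (n : ℕ) (j : Cell S n), openCell n j := by
    rw [CWComplex.iUnion_openCell_eq_complex]; trivial
  simpa using h

lemma eq_of_mem_openCell {u : S} {n m : ℕ} {e : Cell S n} {e' : Cell S m}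
    (h : u ∈ openCell n e) (h' : u ∈ openCell m e') : (⟨n, e⟩ : Σ n, Cell S n) = ⟨m, e'⟩ :=
  eq_of_not_disjoint_openCell (not_disjoint_iff.2 ⟨u, h, h'⟩)

lemma dim_eq_of_mem_openCell {u : S} {n m : ℕ} {e : Cell S n} {e' : Cell S m}
    (h : u ∈ openCell n e) (h' : u ∈ openCell m e') : n = m :=
  congrArg Sigma.fst (eq_of_mem_openCell h h')

lemma cell_eq_of_mem_openCell {u : S} {n : ℕ} {e e' : Cell S n}
    (h : u ∈ openCell n e) (h' : u ∈ openCell n e') : e = e' := by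
  have := eq_of_mem_openCell h h'
  simpa using this

lemma closedCell_one_subset (β : Cell S 1) :
    closedCell 1 β ⊆ openCell 1 β ∪ ⋃ v : Cell S 0, openCell 0 v := by
  rw [← cellFrontier_union_openCell_eq_closedCell]
  obtain ⟨x, y, h⟩ := CWComplex.exists_cellFrontier_one_eq β
  rintro u (hu | hu)
  · right
    rw [h] at hu
    rw [mem_iUnion]
    rcases hu with hu | hu
    · exact ⟨x, by rwa [openCell_zero_eq_singleton, ← closedCell_zero_eq_singleton]⟩
    · exact ⟨y, by rwa [openCell_zero_eq_singleton, ← closedCell_zero_eq_singleton]⟩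
  · exact Or.inl hu

lemma map_mem_openCell {n : ℕ} (e : Cell S n) {θ : Fin n → ℝ} (h : θ ∈ ball (0 : Fin n → ℝ) 1) :
    map n e θ ∈ openCell n e := mem_image_of_mem _ h

lemma symm_map {n : ℕ} (e : Cell S n) {θ : Fin n → ℝ} (h : θ ∈ ball (0 : Fin n → ℝ) 1) :
    (map n e).symm (map n e θ) = θ :=
  (map n e).left_inv (by rwa [source_eq])

lemma target_eq_openCell {n : ℕ} (e : Cell S n) : (map n e).target = openCell n e := by
  rw [← PartialEquiv.image_source_eq_target, source_eq]; rfl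

lemma map_symm {n : ℕ} (e : Cell S n) {u : S} (h : u ∈ openCell n e) :
    map n e ((map n e).symm u) = u :=
  (map n e).right_inv (by rwa [target_eq_openCell])

lemma symm_mem_ball {n : ℕ} (e : Cell S n) {u : S} (h : u ∈ openCell n e) :
    (map n e).symm u ∈ ball (0 : Fin n → ℝ) 1 := by
  rw [← source_eq n e]; exact (map n e).map_target (by rwa [target_eq_openCell])

lemma continuousOn_symm' {n : ℕ} (e : Cell S n) :
    ContinuousOn (map n e).symm (openCell n e) := by
  rw [← target_eq_openCell]; exact continuousOn_symm n e

variable [T2Space S]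

lemma isOpen_openCell_two (h2 : ∀ n, 2 < n → IsEmpty (Cell S n)) (α : Cell S 2) :
    IsOpen (openCell 2 α) := by
  rw [← isClosed_compl_iff]
  refine CWComplex.isClosed_of_isClosed_inter_openCell_or_isClosed_inter_closedCell
    (C := univ) (subset_univ _) fun n hn e => Or.inr ?_
  have hn2 : n ≤ 2 := by
    by_contra hc
    exact (h2 n (by omega)).elim e
  obtain rfl | rfl : n = 1 ∨ n = 2 := by omega
  · have : (openCell 2 α)ᶜ ∩ closedCell 1 e = closedCell 1 e := by
      refine inter_eq_right.2 fun u hu hu' => ?_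
      rcases closedCell_one_subset e hu with h | h
      · exact absurd (dim_eq_of_mem_openCell h hu') (by omega)
      · obtain ⟨v, hv⟩ := mem_iUnion.1 h
        exact absurd (dim_eq_of_mem_openCell hv hu') (by omega)
    rw [this]; exact isClosed_closedCell
  · by_cases hα : e = α
    · subst hα
      have : (openCell 2 e)ᶜ ∩ closedCell 2 e = cellFrontier 2 e := by
        rw [← cellFrontier_union_openCell_eq_closedCell]
        ext u
        constructor
        · rintro ⟨h, h' | h'⟩
          · exact h'
          · exact absurd h' h
        · intro h
          refine ⟨fun h' => ?_, Or.inl h⟩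
          obtain ⟨I, hI⟩ := CWComplex.cellFrontier_subset_finite_openCell 2 e
          have := hI h
          simp only [mem_iUnion] at this
          obtain ⟨m, hm, j, _, hj⟩ := this
          exact absurd (dim_eq_of_mem_openCell hj h') (by omega)
      rw [this]; exact isClosed_cellFrontier
    · have : (openCell 2 α)ᶜ ∩ closedCell 2 e = closedCell 2 e := by
        refine inter_eq_right.2 fun u hu hu' => ?_
        rw [← cellFrontier_union_openCell_eq_closedCell] at hu
        rcases hu with h | h
        · obtain ⟨I, hI⟩ := CWComplex.cellFrontier_subset_finite_openCell 2 e
          have := hI h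
          simp only [mem_iUnion] at this
          obtain ⟨m, hm, j, _, hj⟩ := this
          exact absurd (dim_eq_of_mem_openCell hj hu') (by omega)
        · exact hα (cell_eq_of_mem_openCell h hu')
      rw [this]; exact isClosed_closedCell

/-- An open 1-cell is relatively open in the 1-skeleton. -/
lemma eventually_mem_openCell_one {β : Cell S 1} {u : S} (hu : u ∈ openCell 1 β) :
    ∀ᶠ u' in 𝓝 u, (∃ n ≤ 1, ∃ e : Cell S n, u' ∈ openCell n e) → u' ∈ openCell 1 β := by
  set A : Set S := {u' | u' ∉ openCell 1 β ∧ ∃ n ≤ 1, ∃ e : Cell S n, u' ∈ openCell n e} with hA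
  have hcl : IsClosed A := by
    refine CWComplex.isClosed_of_disjoint_openCell_or_isClosed_inter_closedCell
      (C := univ) (subset_univ _) fun n hn e => ?_
    by_cases hn1 : n = 1
    · subst hn1
      by_cases hβ : e = β
      · subst hβ
        exact Or.inl (disjoint_left.2 fun u' h h' => h.1 h')
      · right
        have : A ∩ closedCell 1 e = closedCell 1 e := by
          refine inter_eq_right.2 fun u' hu' => ?_
          rcases closedCell_one_subset e hu' with h | h
          · exact ⟨fun h' => hβ (cell_eq_of_mem_openCell h h'), 1, le_rfl, e, h⟩
          · obtain ⟨v, hv⟩ := mem_iUnion.1 h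
            exact ⟨fun h' => absurd (dim_eq_of_mem_openCell hv h') (by omega), 0, by omega, v, hv⟩
        rw [this]; exact isClosed_closedCell
    · left
      refine disjoint_left.2 fun u' h h' => ?_
      obtain ⟨_, m, hm, e', he'⟩ := h
      exact absurd (dim_eq_of_mem_openCell he' h') (by omega)
  have : Aᶜ ∈ 𝓝 u := hcl.isOpen_compl.mem_nhds fun h => h.1 hu
  filter_upwards [this] with u' h h'
  by_contra hc
  exact h ⟨hc, h'⟩

/-- An injective path in the 1-skeleton through a point of an open 1-cell covers a neighbourhood of
this point in the 1-cell. -/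
lemma eventually_mem_image_of_path {β : Cell S 1} {γ : ℝ → S} {ε : ℝ} (hε : 0 < ε)
    (hc : ContinuousOn γ (Ioo (-ε) ε)) (hi : InjOn γ (Ioo (-ε) ε)) (h0 : γ 0 ∈ openCell 1 β)
    (hs : ∀ t ∈ Ioo (-ε) ε, ∃ n ≤ 1, ∃ e : Cell S n, γ t ∈ openCell n e) :
    ∀ᶠ u in 𝓝 (γ 0), u ∈ openCell 1 β → u ∈ γ '' Ioo (-ε) ε := by
  have hc0 : ContinuousAt γ 0 := hc.continuousAt (Ioo_mem_nhds (by linarith) hε)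
  obtain ⟨δ, hδ, hδ'⟩ : ∃ δ > 0, ∀ t, |t| < δ → γ t ∈ openCell 1 β ∧ t ∈ Ioo (-ε) ε := by
    have h1 := hc0.eventually (eventually_mem_openCell_one h0)
    have h2 : ∀ᶠ t in 𝓝 (0 : ℝ), t ∈ Ioo (-ε) ε := Ioo_mem_nhds (by linarith) hε
    obtain ⟨δ, hδ, h⟩ := Metric.eventually_nhds_iff.1 (h1.and h2)
    refine ⟨δ, hδ, fun t ht => ?_⟩
    have := h (y := t) (by simpa [Real.dist_eq] using ht)
    exact ⟨this.1 (hs t this.2), this.2⟩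
  set τ : ℝ → ℝ := fun t => (map 1 β).symm (γ t) 0 with hτ
  have hsub : Ioo (-δ) δ ⊆ Ioo (-ε) ε := fun t ht => (hδ' t (abs_lt.2 ht)).2
  have hτc : ContinuousOn τ (Ioo (-δ) δ) := by
    have h1 : ContinuousOn (fun t => (map 1 β).symm (γ t)) (Ioo (-δ) δ) :=
      (continuousOn_symm' β).comp (hc.mono hsub) fun t ht => (hδ' t (abs_lt.2 ht)).1
    exact (continuous_apply 0).comp_continuousOn h1
  have hτi : InjOn τ (Ioo (-δ) δ) := by
    intro t ht t' ht' h
    have h1 : (map 1 β).symm (γ t) = (map 1 β).symm (γ t') := by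
      ext i; fin_cases i; exact h
    have h2 := congrArg (map 1 β) h1
    rw [map_symm β (hδ' t (abs_lt.2 ht)).1, map_symm β (hδ' t' (abs_lt.2 ht')).1] at h2
    exact hi (hsub ht) (hsub ht') h2
  have hd2 : Icc (-(δ/2)) (δ/2) ⊆ Ioo (-δ) δ := fun t ht => ⟨by linarith [ht.1], by linarith [ht.2]⟩
  have hm1 : -(δ/2) ∈ Ioo (-δ) δ := ⟨by linarith, by linarith⟩
  have hm2 : δ/2 ∈ Ioo (-δ) δ := ⟨by linarith, by linarith⟩
  have hm0 : (0:ℝ) ∈ Ioo (-δ) δ := ⟨by linarith, by linarith⟩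
  have key : τ '' Icc (-(δ/2)) (δ/2) ∈ 𝓝 (τ 0) := by
    have hmono := hτc.strictMonoOn_of_injOn_Ioo (by linarith) hτi
    rcases hmono with hm | hm
    · refine mem_of_superset (Icc_mem_nhds (hm hm1 hm0 (by linarith)) (hm hm0 hm2 (by linarith))) ?_
      exact intermediate_value_Icc (by linarith) (hτc.mono hd2)
    · refine mem_of_superset (Icc_mem_nhds (hm hm0 hm2 (by linarith)) (hm hm1 hm0 (by linarith))) ?_
      exact intermediate_value_Icc' (by linarith) (hτc.mono hd2)
  have hcs : ContinuousWithinAt (fun u => (map 1 β).symm u 0) (openCell 1 β) (γ 0) :=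
    ((continuous_apply 0).comp_continuousOn (continuousOn_symm' β)) _ h0
  have := hcs.preimage_mem_nhdsWithin key
  have := eventually_nhdsWithin_iff.1 this
  filter_upwards [this] with u hu hu'
  obtain ⟨t, ht, hte⟩ := hu hu'
  refine ⟨t, hsub (hd2 ht), ?_⟩
  have h1 : (map 1 β).symm (γ t) = (map 1 β).symm u := by
    ext i; fin_cases i; exact hte
  have h2 := congrArg (map 1 β) h1
  rwa [map_symm β (hδ' t (abs_lt.2 (hd2 ht))).1, map_symm β hu'] at h2

end CW

section Hausdorff

lemma t2Space_totalSpace {B F : Type*} (E : B → Type*) [TopologicalSpace B] [TopologicalSpace F]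
    [∀ b, TopologicalSpace (E b)] [TopologicalSpace (Bundle.TotalSpace F E)] [FiberBundle F E]
    [T2Space B] [T2Space F] : T2Space (Bundle.TotalSpace F E) := by
  rw [t2Space_iff_disjoint_nhds]
  intro p q hpq
  by_cases hb : p.proj = q.proj
  · set e := trivializationAt F E p.proj
    have hp : p ∈ e.source := FiberBundle.mem_trivializationAt_proj_source
    have hq : q ∈ e.source := by
      rw [e.mem_source, ← hb]; exact FiberBundle.mem_baseSet_trivializationAt F E p.proj
    have hne : e p ≠ e q := fun h => hpq (e.injOn hp hq h)
    have hd := disjoint_nhds_nhds.2 hne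
    exact ((e.continuousAt hp).tendsto.disjoint hd (e.continuousAt hq))
  · have hc := FiberBundle.continuous_proj F E
    exact (hc.continuousAt.tendsto.disjoint (disjoint_nhds_nhds.2 hb) hc.continuousAt)

end Hausdorff

namespace LegendrianSurface

variable {S Λ : Type*} [TopologicalSpace S] [ChartedSpace Plane S] [IsManifold (𝓡 2) ∞ S]
  [TopologicalSpace Λ] [ChartedSpace Plane Λ] (L : LegendrianSurface S Λ)

lemma t2Space [T2Space S] (L : LegendrianSurface S Λ) : T2Space Λ := by
  have : T2Space (CotangentBundle S) := t2Space_totalSpace _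
  exact T2Space.of_injective_continuous L.isSmoothEmbedding.isEmbedding.injective
    L.isSmoothEmbedding.isEmbedding.continuous

lemma continuous_x : Continuous L.x := L.isProperMap.continuous

lemma contMDiff_toJet [IsManifold (𝓡 2) ∞ Λ] : ContMDiff (𝓡 2) jetModel ∞ L.toJet :=
  L.isSmoothEmbedding.contMDiff

lemma continuous_z : Continuous L.z :=
  continuous_snd.comp L.isSmoothEmbedding.isEmbedding.continuous

lemma contMDiff_z [IsManifold (𝓡 2) ∞ Λ] : ContMDiff (𝓡 2) 𝓘(ℝ, ℝ) ∞ L.z :=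
  contMDiff_snd.comp L.contMDiff_toJet

lemma contMDiff_x [IsManifold (𝓡 2) ∞ Λ] : ContMDiff (𝓡 2) (𝓡 2) ∞ L.x :=
  (Bundle.contMDiff_proj _).comp (contMDiff_fst.comp L.contMDiff_toJet)

end LegendrianSurface

section Monotone

variable {S : Type*} [TopologicalSpace S] [ChartedSpace Plane S] [IsManifold (𝓡 2) ∞ S]

lemma exists_strictMonoOn_of_deriv_pos {g : S × ℝ → ℝ} {u : S} {w : ℝ}
    (hg : ContMDiffAt ((𝓡 2).prod 𝓘(ℝ, ℝ)) 𝓘(ℝ, ℝ) ∞ g (u, w))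
    (hd : 0 < deriv (fun w' => g (u, w')) w) :
    ∃ U ∈ 𝓝 u, ∃ ε > 0, ∀ u' ∈ U, StrictMonoOn (fun w' => g (u', w')) (Ioo (w - ε) (w + ε)) := by
  set χ := chartAt Plane u with hχ
  have hus : u ∈ χ.source := mem_chart_source _ _
  set G : Plane × ℝ → ℝ := fun a => g (χ.symm a.1, a.2) with hG
  have hGs : ContDiffAt ℝ ∞ G (χ u, w) := by
    rw [← contMDiffAt_iff_contDiffAt]
    have h1 : ContMDiffAt 𝓘(ℝ, Plane × ℝ) (𝓡 2) ∞ (fun a : Plane × ℝ => χ.symm a.1) (χ u, w) := by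
      have h3 : ContMDiffAt (𝓡 2) (𝓡 2) ∞ χ.symm (χ u) :=
        (contMDiffOn_chart_symm (I := 𝓡 2) (n := ∞) (x := u)).contMDiffAt
          (χ.open_target.mem_nhds (χ.map_source hus))
      exact ContMDiffAt.comp (χ u, w) (g := χ.symm) (f := Prod.fst) h3
        contDiff_fst.contMDiff.contMDiffAt
    have h2 : ContMDiffAt 𝓘(ℝ, Plane × ℝ) 𝓘(ℝ, ℝ) ∞ (fun a : Plane × ℝ => a.2) (χ u, w) :=
      contDiff_snd.contMDiff.contMDiffAt
    have h4 := h1.prodMk h2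
    refine ContMDiffAt.comp (χ u, w) (g := g) ?_ h4
    simpa [χ.left_inv hus] using hg
  have hdiff : ∀ᶠ a in 𝓝 (χ u, w), DifferentiableAt ℝ G a := by
    have := (hGs.of_le (m := 1) (by exact_mod_cast le_top)).eventually (by simp)
    filter_upwards [this] with a ha
    exact ha.differentiableAt one_ne_zero
  have hline : ∀ a : Plane × ℝ, DifferentiableAt ℝ G a →
      HasDerivAt (fun w' => G (a.1, w')) (fderiv ℝ G a (0, 1)) a.2 := by
    intro a ha
    have h1 : HasDerivAt (fun w' : ℝ => (a.1, w')) ((0 : Plane), (1 : ℝ)) a.2 :=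
      (hasDerivAt_const a.2 a.1).prodMk (hasDerivAt_id a.2)
    exact ha.hasFDerivAt.comp_hasDerivAt a.2 h1
  have hpos : ∀ᶠ a in 𝓝 (χ u, w), 0 < fderiv ℝ G a (0, 1) := by
    have hc : ContinuousAt (fun a => fderiv ℝ G a (0, 1)) (χ u, w) := by
      have : ContDiffAt ℝ 0 (fderiv ℝ G) (χ u, w) := hGs.fderiv_right (m := 0) (by simp)
      exact (this.continuousAt).clm_apply continuousAt_const
    refine hc.eventually_const_lt ?_
    have h1 := (hline _ hdiff.self_of_nhds).deriv
    simp only at h1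
    change 0 < fderiv ℝ G (χ u, w) (0, 1)
    rw [← h1]
    simpa [hG, χ.left_inv hus] using hd
  obtain ⟨A, hA, B, hB, hAB⟩ := mem_nhds_prod_iff.1 (hdiff.and hpos)
  obtain ⟨ε, hε, hεB⟩ := Metric.mem_nhds_iff.1 hB
  refine ⟨χ.source ∩ χ ⁻¹' A, inter_mem (χ.open_source.mem_nhds hus)
    ((χ.continuousAt hus).preimage_mem_nhds hA), ε, hε, fun u' hu' => ?_⟩
  rw [← Real.ball_eq_Ioo]
  have heq : (fun w' => g (u', w')) = fun w' => G (χ u', w') := by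
    funext w'; simp [hG, χ.left_inv hu'.1]
  have hd' : ∀ w' ∈ ball w ε, HasDerivAt (fun w' => g (u', w')) (fderiv ℝ G (χ u', w') (0, 1)) w' := by
    intro w' hw'
    rw [heq]
    exact hline (χ u', w') (hAB (mk_mem_prod hu'.2 (hεB hw'))).1
  refine strictMonoOn_of_deriv_pos (convex_ball w ε)
    (fun w' hw' => (hd' w' hw').continuousAt.continuousWithinAt) fun w' hw' => ?_
  rw [isOpen_ball.interior_eq] at hw'
  rw [(hd' w' hw').deriv]
  exact (hAB (mk_mem_prod hu'.2 (hεB hw'))).2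

end Monotone

namespace LegendrianSurface

variable {S Λ : Type*} [TopologicalSpace S] [ChartedSpace Plane S] [IsManifold (𝓡 2) ∞ S]
  [TopologicalSpace Λ] [ChartedSpace Plane Λ] {L : LegendrianSurface S Λ}

/-- `φ`, `ψ` and `W` exhibit the local normal form `nf` of the front: on `W` the base projection is
the first component of `nf`, and the order of the points above one point of `S` is that of the second
component. -/
structure IsLocalForm (L : LegendrianSurface S Λ) (nf : Plane → Plane × ℝ) (p : Λ)
    (φ : OpenPartialHomeomorph Λ Plane) (ψ : OpenPartialHomeomorph S Plane) (W : Set Λ) : Prop where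
  isOpen : IsOpen W
  mem : p ∈ W
  source : W ⊆ φ.source
  map_eq_zero : φ p = 0
  base_mem : L.x p ∈ ψ.source
  base_eq_zero : ψ (L.x p) = 0
  base : ∀ q ∈ W, L.x q ∈ ψ.source ∧ ψ (L.x q) = (nf (φ q)).1
  order : ∀ q ∈ W, ∀ q' ∈ W, L.x q = L.x q' → (L.z q < L.z q' ↔ (nf (φ q)).2 < (nf (φ q')).2)

lemma HasFrontForm.exists_isLocalForm {nf : Plane → Plane × ℝ} {p : Λ}
    {φ : OpenPartialHomeomorph Λ Plane} (h : L.HasFrontForm nf p φ) :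
    ∃ ψ W, L.IsLocalForm nf p φ ψ W := by
  obtain ⟨-, hp, hp0, ψ, -, hψ, hψ0, g, hg, hgd, hev⟩ := h
  obtain ⟨U, hU, ε, hε, hmono⟩ := exists_strictMonoOn_of_deriv_pos hg hgd
  set W : Set Λ := {q | q ∈ φ.source ∧ L.x q ∈ ψ.source ∧ L.x q ∈ U ∧
    L.z q ∈ Ioo (L.z p - ε) (L.z p + ε) ∧ ψ (L.x q) = (nf (φ q)).1 ∧
    g (L.x q, L.z q) = (nf (φ q)).2}
  have hW : W ∈ 𝓝 p := by
    have h1 := (L.continuous_x.continuousAt (x := p)).eventually (ψ.open_source.mem_nhds hψ)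
    have h2 := (L.continuous_x.continuousAt (x := p)).eventually hU
    have h3 := (L.continuous_z.continuousAt (x := p)).eventually
      (Ioo_mem_nhds (by linarith : L.z p - ε < L.z p) (by linarith : L.z p < L.z p + ε))
    filter_upwards [φ.open_source.mem_nhds hp, h1, h2, h3, hev] with q a1 a2 a3 a4 a5
    exact ⟨a1, a2, a3, a4, a5.1, a5.2⟩
  refine ⟨ψ, interior W, isOpen_interior, mem_interior_iff_mem_nhds.2 hW,
    fun q hq => (interior_subset hq).1, hp0, hψ, hψ0,
    fun q hq => ⟨(interior_subset hq).2.1, (interior_subset hq).2.2.2.2.1⟩,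
    fun q hq q' hq' hx => ?_⟩
  obtain ⟨-, -, hqU, hqz, -, hqg⟩ := interior_subset hq
  obtain ⟨-, -, hqU', hqz', -, hqg'⟩ := interior_subset hq'
  rw [← hqg, ← hqg', ← hx]
  exact ((hmono _ hqU).lt_iff_lt hqz hqz').symm

namespace IsLocalForm

variable {nf : Plane → Plane × ℝ} {p : Λ} {φ : OpenPartialHomeomorph Λ Plane}
  {ψ : OpenPartialHomeomorph S Plane} {W : Set Λ}

lemma mem_nhds (h : L.IsLocalForm nf p φ ψ W) : W ∈ 𝓝 p := h.isOpen.mem_nhds h.mem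

lemma mem_source (h : L.IsLocalForm nf p φ ψ W) : p ∈ φ.source := h.source h.mem

/-- Points close to `φ q` in the coordinates `φ` are points of a given neighbourhood of `q`. -/
lemma exists_radius (h : L.IsLocalForm nf p φ ψ W) {q : Λ} (hq : q ∈ W) {W' : Set Λ}
    (hW' : W' ∈ 𝓝 q) :
    ∃ r > 0, ∀ a : Plane, |a 0 - φ q 0| < r → |a 1 - φ q 1| < r →
      φ.symm a ∈ W' ∧ φ.symm a ∈ W ∧ φ (φ.symm a) = a := by
  have ht : φ q ∈ φ.target := φ.map_source (h.source hq)
  have hs : φ.symm (φ q) = q := φ.left_inv (h.source hq)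
  have h1 : φ.target ∩ φ.symm ⁻¹' (W' ∩ W) ∈ 𝓝 (φ q) :=
    inter_mem (φ.open_target.mem_nhds ht)
      ((φ.continuousAt_symm ht).preimage_mem_nhds
        (by rw [hs]; exact inter_mem hW' (h.isOpen.mem_nhds hq)))
  obtain ⟨r, hr, hrs⟩ := Metric.mem_nhds_iff.1 h1
  refine ⟨r / 2, by linarith, fun a h0 h1 => ?_⟩
  have ha : a ∈ ball (φ q) r := by
    rw [mem_ball, EuclideanSpace.dist_eq, Real.sqrt_lt' hr]
    simp only [Fin.sum_univ_two, Real.dist_eq, sq_abs]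
    nlinarith [sq_lt_sq' (by linarith [abs_lt.1 h0]) (abs_lt.1 h0).2,
      sq_lt_sq' (by linarith [abs_lt.1 h1]) (abs_lt.1 h1).2]
  exact ⟨(hrs ha).2.1, (hrs ha).2.2, φ.right_inv (hrs ha).1⟩

/-- A neighbourhood of `q` on which the coordinates `φ` are close to those of `q`. -/
lemma nhds_of_radius (h : L.IsLocalForm nf p φ ψ W) {q : Λ} (hq : q ∈ W) {r : ℝ} (hr : 0 < r) :
    {q' | q' ∈ W ∧ |φ q' 0 - φ q 0| < r ∧ |φ q' 1 - φ q 1| < r} ∈ 𝓝 q := by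
  have hc : ContinuousAt φ q := φ.continuousAt (h.source hq)
  have h0 : ContinuousAt (fun q' => |φ q' 0 - φ q 0|) q := by
    have : ContinuousAt (fun q' => φ q' 0) q :=
      (EuclideanSpace.proj (𝕜 := ℝ) (0 : Fin 2)).continuous.continuousAt.comp hc
    exact (this.sub continuousAt_const).abs
  have h1 : ContinuousAt (fun q' => |φ q' 1 - φ q 1|) q := by
    have : ContinuousAt (fun q' => φ q' 1) q :=
      (EuclideanSpace.proj (𝕜 := ℝ) (1 : Fin 2)).continuous.continuousAt.comp hc
    exact (this.sub continuousAt_const).abs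
  filter_upwards [h.isOpen.mem_nhds hq, h0.eventually_lt continuousAt_const (by simpa using hr),
    h1.eventually_lt continuousAt_const (by simpa using hr)] with q' a b c
  exact ⟨a, b, c⟩

/-- Points of `S` close to `x p` have small coordinates. -/
lemma eventually_base (h : L.IsLocalForm nf p φ ψ W) {r : ℝ} (hr : 0 < r) :
    ∀ᶠ u in 𝓝 (L.x p), u ∈ ψ.source ∧ |ψ u 0| < r ∧ |ψ u 1| < r := by
  have hc : ContinuousAt ψ (L.x p) := ψ.continuousAt h.base_mem
  have h0 : ContinuousAt (fun u => |ψ u 0|) (L.x p) :=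
    ((EuclideanSpace.proj (𝕜 := ℝ) (0 : Fin 2)).continuous.continuousAt.comp hc).abs
  have h1 : ContinuousAt (fun u => |ψ u 1|) (L.x p) :=
    ((EuclideanSpace.proj (𝕜 := ℝ) (1 : Fin 2)).continuous.continuousAt.comp hc).abs
  filter_upwards [ψ.open_source.mem_nhds h.base_mem,
    h0.eventually_lt continuousAt_const (by simpa [h.base_eq_zero] using hr),
    h1.eventually_lt continuousAt_const (by simpa [h.base_eq_zero] using hr)] with u a b c
  exact ⟨a, b, c⟩

lemma eq_of_map_eq (h : L.IsLocalForm nf p φ ψ W) {q q' : Λ} (hq : q ∈ W) (hq' : q' ∈ W)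
    (he : φ q = φ q') : q = q' := φ.injOn (h.source hq) (h.source hq') he

lemma x_eq_iff (h : L.IsLocalForm nf p φ ψ W) {q q' : Λ} (hq : q ∈ W) (hq' : q' ∈ W) :
    L.x q = L.x q' ↔ (nf (φ q)).1 = (nf (φ q')).1 := by
  rw [← (h.base q hq).2, ← (h.base q' hq').2]
  exact ⟨fun he => by rw [he], fun he => ψ.injOn (h.base q hq).1 (h.base q' hq').1 he⟩

lemma x_eq_iff' (h : L.IsLocalForm nf p φ ψ W) {q : Λ} (hq : q ∈ W) {u : S} (hu : u ∈ ψ.source) :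
    L.x q = u ↔ (nf (φ q)).1 = ψ u := by
  rw [← (h.base q hq).2]
  exact ⟨fun he => by rw [he], fun he => ψ.injOn (h.base q hq).1 hu he⟩

end IsLocalForm

end LegendrianSurface

lemma abs_lt_of {x r : ℝ} (h : x < r) (h' : -x < r) : |x| < r := abs_lt.2 ⟨by linarith, h⟩

lemma Plane.ext {a b : Plane} (h0 : a 0 = b 0) (h1 : a 1 = b 1) : a = b := by
  ext i; fin_cases i
  · exact h0
  · exact h1

namespace LegendrianSurface

/-- The standard upward (`σ = 1`) or downward (`σ = -1`) swallowtail. -/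
def swForm (σ : ℝ) (a : Plane) : Plane × ℝ := ((swallowForm a).1, σ * (swallowForm a).2)

lemma cuspForm_eq_iff (a b : Plane) :
    (cuspForm a).1 = (cuspForm b).1 ↔ a 0 = b 0 ∧ a 1 ^ 2 = b 1 ^ 2 := by
  constructor
  · intro h
    exact ⟨by simpa [cuspForm] using congrArg (fun v : Plane => v 0) h,
      by simpa [cuspForm] using congrArg (fun v : Plane => v 1) h⟩
  · rintro ⟨h0, h1⟩
    exact Plane.ext (by simpa [cuspForm] using h0) (by simpa [cuspForm] using h1)

lemma swForm_eq_iff (σ : ℝ) (a b : Plane) :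
    (swForm σ a).1 = (swForm σ b).1 ↔
      a 0 = b 0 ∧ 2 * a 0 * a 1 - 4 * a 1 ^ 3 = 2 * b 0 * b 1 - 4 * b 1 ^ 3 := by
  constructor
  · intro h
    exact ⟨by simpa [swForm, swallowForm] using congrArg (fun v : Plane => v 0) h,
      by simpa [swForm, swallowForm] using congrArg (fun v : Plane => v 1) h⟩
  · rintro ⟨h0, h1⟩
    exact Plane.ext (by simpa [swForm, swallowForm] using h0)
      (by simpa [swForm, swallowForm] using h1)

lemma swallow_double {x e e' : ℝ} (h : 2 * x * e - 4 * e ^ 3 = 2 * x * e' - 4 * e' ^ 3)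
    (hne : e ≠ e') : x = 2 * (e ^ 2 + e * e' + e' ^ 2) := by
  have : (e - e') * (x - 2 * (e ^ 2 + e * e' + e' ^ 2)) = 0 := by linear_combination h / 2
  rcases mul_eq_zero.1 this with h | h
  · exact absurd (by linarith) hne
  · linarith

lemma swallow_triple {x e e' e'' : ℝ} (h : 2 * x * e - 4 * e ^ 3 = 2 * x * e' - 4 * e' ^ 3)
    (h' : 2 * x * e - 4 * e ^ 3 = 2 * x * e'' - 4 * e'' ^ 3)
    (h1 : e ≠ e') (h2 : e ≠ e'') (h3 : e' ≠ e'') : e'' = -(e + e') := by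
  have a := swallow_double h h1
  have b := swallow_double h' h2
  have : (e' - e'') * (e + e' + e'') = 0 := by linear_combination (b - a) / 2
  rcases mul_eq_zero.1 this with h | h
  · exact absurd (by linarith) h3
  · linarith

lemma swForm_height {σ : ℝ} {a b : Plane} (h : (swForm σ a).1 = (swForm σ b).1) (hne : a 1 ≠ b 1) :
    (swForm σ a).2 - (swForm σ b).2 = -(σ * (a 1 - b 1) ^ 3 * (a 1 + b 1)) := by
  obtain ⟨h0, h1⟩ := (swForm_eq_iff σ a b).1 h
  rw [← h0] at h1
  have hx := swallow_double h1 hne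
  simp only [swForm, swallowForm]
  rw [← h0, hx]; ring

variable {S Λ : Type*} [TopologicalSpace S] [ChartedSpace Plane S] [IsManifold (𝓡 2) ∞ S]
  [TopologicalSpace Λ] [ChartedSpace Plane Λ] {L : LegendrianSurface S Λ}

lemma exists_homeo_of_regular {p : Λ} (hp : p ∈ L.regular) :
    ∃ f : OpenPartialHomeomorph Λ S, p ∈ f.source ∧ ∀ q ∈ f.source, f q = L.x q := by
  obtain ⟨Φ, hΦ, h⟩ := hp
  exact ⟨Φ.toOpenPartialHomeomorph, hΦ, fun q hq => (h hq).symm⟩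

lemma exists_injOn_of_regular {p : Λ} (hp : p ∈ L.regular) : ∃ W ∈ 𝓝 p, InjOn L.x W := by
  obtain ⟨f, hf, h⟩ := exists_homeo_of_regular hp
  refine ⟨f.source, f.open_source.mem_nhds hf, fun q hq q' hq' he => f.injOn hq hq' ?_⟩
  rw [h q hq, h q' hq', he]

/-- There are three points near `p` above one point of `S`. -/
def HasTriples (L : LegendrianSurface S Λ) (p : Λ) : Prop :=
  ∀ W ∈ 𝓝 p, ∃ a ∈ W, ∃ b ∈ W, ∃ c ∈ W, a ≠ b ∧ a ≠ c ∧ b ≠ c ∧ L.x a = L.x b ∧ L.x a = L.x c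

lemma HasTriples.not_injOn {p : Λ} (h : L.HasTriples p) : ∀ W ∈ 𝓝 p, ¬ InjOn L.x W := by
  intro W hW hi
  obtain ⟨a, ha, b, hb, c, -, hab, -, -, hx, -⟩ := h W hW
  exact hab (hi ha hb hx)

section Cusp

variable {p : Λ} {φ : OpenPartialHomeomorph Λ Plane} {ψ : OpenPartialHomeomorph S Plane} {W : Set Λ}

lemma IsLocalForm.cusp_injOn (h : L.IsLocalForm cuspForm p φ ψ W) {q : Λ} (hq : q ∈ W)
    (h0 : φ q 1 ≠ 0) : ∃ W' ∈ 𝓝 q, InjOn L.x W' := by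
  refine ⟨_, h.nhds_of_radius hq (abs_pos.2 h0), ?_⟩
  rintro a ⟨ha, -, ha1⟩ b ⟨hb, -, hb1⟩ hab
  obtain ⟨e0, e1⟩ := (cuspForm_eq_iff _ _).1 ((h.x_eq_iff ha hb).1 hab)
  refine h.eq_of_map_eq ha hb (Plane.ext e0 ?_)
  rcases sq_eq_sq_iff_eq_or_eq_neg.1 e1 with e | e
  · exact e
  · exfalso
    rw [e] at ha1
    rcases abs_cases (φ q 1) with ⟨h3, h4⟩ | ⟨h3, h4⟩ <;> rw [h3] at ha1 hb1 <;>
      linarith [abs_lt.1 ha1, abs_lt.1 hb1]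

lemma IsLocalForm.cusp_not_injOn (h : L.IsLocalForm cuspForm p φ ψ W) {q : Λ} (hq : q ∈ W)
    (h0 : φ q 1 = 0) : ∀ W' ∈ 𝓝 q, ¬ InjOn L.x W' := by
  intro W' hW' hi
  obtain ⟨r, hr, hs⟩ := h.exists_radius hq hW'
  obtain ⟨a1, a2, a3⟩ := hs !₂[φ q 0, r / 2] (by simpa using hr)
    (abs_lt_of (by simp [h0]; linarith) (by simp [h0]; linarith))
  obtain ⟨b1, b2, b3⟩ := hs !₂[φ q 0, -(r / 2)] (by simpa using hr)
    (abs_lt_of (by simp [h0]; linarith) (by simp [h0]; linarith))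
  have := hi a1 b1 ((h.x_eq_iff a2 b2).2 ((cuspForm_eq_iff _ _).2 (by rw [a3, b3]; simp)))
  have h2 := congrArg (fun q => φ q 1) this
  simp only [a3, b3] at h2
  simp at h2
  linarith

lemma IsLocalForm.cusp_not_hasTriples (h : L.IsLocalForm cuspForm p φ ψ W) {q : Λ} (hq : q ∈ W) :
    ¬ L.HasTriples q := by
  intro ht
  obtain ⟨a, ha, b, hb, c, hc, hab, hac, hbc, x1, x2⟩ := ht W (h.isOpen.mem_nhds hq)
  obtain ⟨e0, e1⟩ := (cuspForm_eq_iff _ _).1 ((h.x_eq_iff ha hb).1 x1)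
  obtain ⟨f0, f1⟩ := (cuspForm_eq_iff _ _).1 ((h.x_eq_iff ha hc).1 x2)
  have hab' : φ a 1 ≠ φ b 1 := fun e => hab (h.eq_of_map_eq ha hb (Plane.ext e0 e))
  have hac' : φ a 1 ≠ φ c 1 := fun e => hac (h.eq_of_map_eq ha hc (Plane.ext f0 e))
  have g1 := (sq_eq_sq_iff_eq_or_eq_neg.1 e1).resolve_left hab'
  have g2 := (sq_eq_sq_iff_eq_or_eq_neg.1 f1).resolve_left hac'
  exact hbc (h.eq_of_map_eq hb hc (Plane.ext (e0 ▸ f0) (by linarith)))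

end Cusp

section Swallow

variable {σ : ℝ} {p : Λ} {φ : OpenPartialHomeomorph Λ Plane} {ψ : OpenPartialHomeomorph S Plane}
  {W : Set Λ}

lemma IsLocalForm.sw_injOn (h : L.IsLocalForm (swForm σ) p φ ψ W) {q : Λ} (hq : q ∈ W)
    (h0 : φ q 0 - 6 * φ q 1 ^ 2 ≠ 0) : ∃ W' ∈ 𝓝 q, InjOn L.x W' := by
  set x := φ q 0
  set e := φ q 1
  have hc : Continuous fun v : ℝ × ℝ × ℝ => v.1 - 2 * (v.2.1 ^ 2 + v.2.1 * v.2.2 + v.2.2 ^ 2) := by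
    fun_prop
  have hev := (hc.continuousAt (x := (x, e, e))).eventually_ne
    (show x - 2 * (e ^ 2 + e * e + e ^ 2) ≠ 0 from fun h => h0 (by linarith))
  obtain ⟨r, hr, hs⟩ := Metric.eventually_nhds_iff.1 hev
  refine ⟨_, h.nhds_of_radius hq hr, ?_⟩
  rintro a ⟨ha, ha0, ha1⟩ b ⟨hb, -, hb1⟩ hab
  obtain ⟨e0, e1⟩ := (swForm_eq_iff _ _ _).1 ((h.x_eq_iff ha hb).1 hab)
  refine h.eq_of_map_eq ha hb (Plane.ext e0 ?_)
  by_contra hne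
  rw [← e0] at e1
  refine hs (y := (φ a 0, φ a 1, φ b 1)) ?_ (sub_eq_zero.2 (swallow_double e1 hne))
  simp only [Prod.dist_eq, Real.dist_eq, max_lt_iff]
  exact ⟨ha0, ha1, hb1⟩

lemma IsLocalForm.sw_not_injOn (h : L.IsLocalForm (swForm σ) p φ ψ W) {q : Λ} (hq : q ∈ W)
    (h0 : φ q 0 - 6 * φ q 1 ^ 2 = 0) : ∀ W' ∈ 𝓝 q, ¬ InjOn L.x W' := by
  intro W' hW' hi
  obtain ⟨r, hr, hs⟩ := h.exists_radius hq hW'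
  set t := min (r / 2) (1 / 4) with ht
  have ht0 : 0 < t := by positivity
  have ht1 : t ≤ r / 2 := min_le_left _ _
  have ht2 : t ≤ 1 / 4 := min_le_right _ _
  have htt : 2 * t ^ 2 < r := by nlinarith
  obtain ⟨a1, a2, a3⟩ := hs !₂[φ q 0 + 2 * t ^ 2, φ q 1 + t]
    (abs_lt_of (by simp; linarith) (by simp; nlinarith)) (abs_lt_of (by simp; linarith) (by simp; linarith))
  obtain ⟨b1, b2, b3⟩ := hs !₂[φ q 0 + 2 * t ^ 2, φ q 1 - t]
    (abs_lt_of (by simp; linarith) (by simp; nlinarith)) (abs_lt_of (by simp; linarith) (by simp; linarith))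
  have := hi a1 b1 ((h.x_eq_iff a2 b2).2 ((swForm_eq_iff _ _ _).2 (by
    rw [a3, b3]; simp; linear_combination 4 * t * h0)))
  have h2 := congrArg (fun q => φ q 1) this
  simp only [a3, b3] at h2
  simp at h2
  linarith

lemma IsLocalForm.sw_hasTriples (h : L.IsLocalForm (swForm σ) p φ ψ W) : L.HasTriples p := by
  intro W' hW'
  obtain ⟨r, hr, hs⟩ := h.exists_radius h.mem hW'
  rw [h.map_eq_zero] at hs
  set t := min (r / 2) (1 / 4) with ht
  have ht0 : 0 < t := by positivity
  have ht1 : t ≤ r / 2 := min_le_left _ _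
  have ht2 : t ≤ 1 / 4 := min_le_right _ _
  have htt : 2 * t ^ 2 < r := by nlinarith
  obtain ⟨a1, a2, a3⟩ := hs !₂[2 * t ^ 2, 0]
    (abs_lt_of (by simp; linarith) (by simp; nlinarith)) (by simpa using hr)
  obtain ⟨b1, b2, b3⟩ := hs !₂[2 * t ^ 2, t]
    (abs_lt_of (by simp; linarith) (by simp; nlinarith)) (abs_lt_of (by simp; linarith) (by simp; linarith))
  obtain ⟨c1, c2, c3⟩ := hs !₂[2 * t ^ 2, -t]
    (abs_lt_of (by simp; linarith) (by simp; nlinarith)) (abs_lt_of (by simp; linarith) (by simp; linarith))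
  have hne : ∀ {q q' : Λ}, φ q 1 ≠ φ q' 1 → q ≠ q' := fun h h' => h (by rw [h'])
  refine ⟨_, a1, _, b1, _, c1, hne ?_, hne ?_, hne ?_, ?_, ?_⟩
  · rw [a3, b3]; simp; linarith
  · rw [a3, c3]; simp; linarith
  · rw [b3, c3]; simp; linarith
  · exact (h.x_eq_iff a2 b2).2 ((swForm_eq_iff _ _ _).2 (by rw [a3, b3]; simp; ring))
  · exact (h.x_eq_iff a2 c2).2 ((swForm_eq_iff _ _ _).2 (by rw [a3, c3]; simp; ring))

lemma IsLocalForm.sw_not_hasTriples (h : L.IsLocalForm (swForm σ) p φ ψ W) {q : Λ} (hq : q ∈ W)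
    (h0 : φ q 1 ≠ 0) : ¬ L.HasTriples q := by
  intro ht
  obtain ⟨a, ⟨ha, -, ha1⟩, b, ⟨hb, -, hb1⟩, c, ⟨hc, -, hc1⟩, hab, hac, hbc, x1, x2⟩ :=
    ht _ (h.nhds_of_radius hq (abs_pos.2 h0))
  obtain ⟨e0, e1⟩ := (swForm_eq_iff _ _ _).1 ((h.x_eq_iff ha hb).1 x1)
  obtain ⟨f0, f1⟩ := (swForm_eq_iff _ _ _).1 ((h.x_eq_iff ha hc).1 x2)
  have hab' : φ a 1 ≠ φ b 1 := fun e => hab (h.eq_of_map_eq ha hb (Plane.ext e0 e))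
  have hac' : φ a 1 ≠ φ c 1 := fun e => hac (h.eq_of_map_eq ha hc (Plane.ext f0 e))
  have hbc' : φ b 1 ≠ φ c 1 := fun e => hbc (h.eq_of_map_eq hb hc (Plane.ext (e0 ▸ f0) e))
  rw [← e0] at e1
  rw [← f0] at f1
  have := swallow_triple e1 f1 hab' hac' hbc'
  rcases abs_cases (φ q 1) with ⟨h3, h4⟩ | ⟨h3, h4⟩ <;> rw [h3] at ha1 hb1 hc1 <;>
    linarith [abs_lt.1 ha1, abs_lt.1 hb1, abs_lt.1 hc1]

end Swallow

/-- The sign that distinguishes upward from downward swallowtail points. -/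
def swSign (L : LegendrianSurface S Λ) (p : Λ) : ℝ := if p ∈ L.swallowUp then 1 else -1

lemma exists_isLocalForm_of_cusp {p : Λ} (hp : p ∈ L.cuspEdge) :
    ∃ φ ψ W, L.IsLocalForm cuspForm p φ ψ W := by
  obtain ⟨φ, hφ⟩ := hp
  exact ⟨φ, HasFrontForm.exists_isLocalForm hφ⟩

lemma exists_isLocalForm_of_swallow {p : Λ} (hp : p ∈ L.swallowtail) :
    ∃ φ ψ W, L.IsLocalForm (swForm (L.swSign p)) p φ ψ W := by
  by_cases h : p ∈ L.swallowUp
  · have : swForm (L.swSign p) = swallowForm := by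
      funext a; simp [swForm, swSign, h]
    rw [this]
    obtain ⟨φ, hφ⟩ := h
    exact ⟨φ, HasFrontForm.exists_isLocalForm hφ⟩
  · obtain ⟨φ, hφ⟩ := hp.resolve_left h
    have : swForm (L.swSign p) = fun a => ((swallowForm a).1, -(swallowForm a).2) := by
      funext a; simp [swForm, swSign, h]
    rw [this]
    exact ⟨φ, HasFrontForm.exists_isLocalForm hφ⟩

lemma not_regular_of_cusp {p : Λ} (hp : p ∈ L.cuspEdge) : p ∉ L.regular := by
  intro hr
  obtain ⟨φ, ψ, W, h⟩ := exists_isLocalForm_of_cusp hp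
  obtain ⟨W', hW', hi⟩ := exists_injOn_of_regular hr
  exact h.cusp_not_injOn h.mem (by simp [h.map_eq_zero]) W' hW' hi

lemma hasTriples_of_swallow {p : Λ} (hp : p ∈ L.swallowtail) : L.HasTriples p := by
  obtain ⟨φ, ψ, W, h⟩ := exists_isLocalForm_of_swallow hp
  exact h.sw_hasTriples

lemma not_hasTriples_of_cusp {p : Λ} (hp : p ∈ L.cuspEdge) : ¬ L.HasTriples p := by
  obtain ⟨φ, ψ, W, h⟩ := exists_isLocalForm_of_cusp hp
  exact h.cusp_not_hasTriples h.mem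

lemma not_regular_of_swallow {p : Λ} (hp : p ∈ L.swallowtail) : p ∉ L.regular := by
  intro hr
  obtain ⟨W', hW', hi⟩ := exists_injOn_of_regular hr
  exact (hasTriples_of_swallow hp).not_injOn W' hW' hi

lemma not_swallow_of_cusp {p : Λ} (hp : p ∈ L.cuspEdge) : p ∉ L.swallowtail :=
  fun h => not_hasTriples_of_cusp hp (hasTriples_of_swallow h)

namespace IsGeneric

variable (hL : L.IsGeneric)
include hL

lemma cases (p : Λ) : p ∈ L.regular ∨ p ∈ L.cuspEdge ∨ p ∈ L.swallowtail := by
  have hp : p ∈ L.frontFiber (L.x p) (L.z p) := ⟨rfl, rfl⟩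
  rcases hL.front (L.x p) (L.z p) with (h | ⟨q, hq, h⟩) | (⟨q, hq, r, hr, -, h⟩ | ⟨q, hq, h⟩) |
    ⟨q, hq, r, hr, s, hs, h, -⟩ | ⟨q, hq, r, hr, h, -⟩ | ⟨q, hq, h⟩ <;> rw [h] at hp
  · exact absurd hp (notMem_empty _)
  · left; rwa [mem_singleton_iff.1 hp]
  · left; rcases hp with rfl | rfl
    exacts [hq, hr]
  · right; left; rwa [mem_singleton_iff.1 hp]
  · left; rcases hp with rfl | rfl | rfl
    exacts [hq, hr, hs]
  · rcases hp with rfl | rfl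
    exacts [Or.inr (Or.inl hq), Or.inl hr]
  · right; right; rwa [mem_singleton_iff.1 hp]

lemma regular_of_injOn {p : Λ} (h : ∃ W ∈ 𝓝 p, InjOn L.x W) : p ∈ L.regular := by
  obtain ⟨W, hW, hi⟩ := h
  rcases hL.cases p with h | h | h
  · exact h
  · obtain ⟨φ, ψ, W', h'⟩ := exists_isLocalForm_of_cusp h
    exact absurd hi (h'.cusp_not_injOn h'.mem (by simp [h'.map_eq_zero]) W hW)
  · exact absurd hi ((hasTriples_of_swallow h).not_injOn W hW)

lemma cusp_of_not_injOn {p : Λ} (h : ∀ W ∈ 𝓝 p, ¬ InjOn L.x W) (h3 : ¬ L.HasTriples p) :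
    p ∈ L.cuspEdge := by
  rcases hL.cases p with h' | h' | h'
  · obtain ⟨W, hW, hi⟩ := exists_injOn_of_regular h'
    exact absurd hi (h W hW)
  · exact h'
  · exact absurd (hasTriples_of_swallow h') h3

omit hL in
/-- Points that are not in `L_0` lie above the base singular set. -/
lemma _root_.CellularDGA.LegendrianSurface.mem_baseSingularSet {p : Λ} (hp : p ∉ L.regular) : L.x p ∈ L.baseSingularSet := by
  refine ⟨L.z p, ?_⟩
  have hm : p ∈ L.frontFiber (L.x p) (L.z p) := ⟨rfl, rfl⟩
  rintro (h | ⟨q, hq, h⟩) <;> rw [h] at hm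
  · exact hm
  · rw [mem_singleton_iff.1 hm] at hp; exact hp hq

end IsGeneric

lemma mem_baseSingularSet_of_ne {p q : Λ} (hpq : p ≠ q) (hx : L.x p = L.x q) (hz : L.z p = L.z q) :
    L.x p ∈ L.baseSingularSet := by
  refine ⟨L.z p, ?_⟩
  have hm : p ∈ L.frontFiber (L.x p) (L.z p) := ⟨rfl, rfl⟩
  have hm' : q ∈ L.frontFiber (L.x p) (L.z p) := ⟨hx.symm, hz.symm⟩
  rintro (h | ⟨r, hr, h⟩) <;> rw [h] at hm hm'
  · exact hm
  · exact hpq ((mem_singleton_iff.1 hm).trans (mem_singleton_iff.1 hm').symm)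

end LegendrianSurface

section Calculus

/-- The zero set of a function with non-zero derivative contains an injective path. -/
lemma exists_path_in_zero_set {H : Plane → ℝ} {a : Plane} {H' : Plane →L[ℝ] ℝ}
    (hH : HasStrictFDerivAt H H' a) (h0 : H a = 0) (hH' : H' ≠ 0) {N : Set Plane} (hN : N ∈ 𝓝 a) :
    ∃ ε > 0, ∃ γ : ℝ → Plane, ContinuousOn γ (Ioo (-ε) ε) ∧ InjOn γ (Ioo (-ε) ε) ∧ γ 0 = a ∧
      ∀ t ∈ Ioo (-ε) ε, γ t ∈ N ∧ H (γ t) = 0 := by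
  have hsurj : H'.range = ⊤ := by
    rw [LinearMap.range_eq_top]
    obtain ⟨w, hw⟩ : ∃ w, H' w ≠ 0 := by
      by_contra hc; push Not at hc; exact hH' (by ext w; simp [hc])
    intro c
    exact ⟨(c / H' w) • w, by simp [hw]⟩
  obtain ⟨v, hv, hv0⟩ : ∃ v ∈ H'.ker, v ≠ 0 := by
    have h2 : H'.ker ≠ ⊥ := by
      have hlt : Module.finrank ℝ ℝ < Module.finrank ℝ Plane := by simp
      exact LinearMap.ker_ne_bot_of_finrank_lt hlt
    exact (Submodule.ne_bot_iff _).1 h2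
  set e := hH.implicitToOpenPartialHomeomorph H H' hsurj with he
  have hes : a ∈ e.source := hH.mem_implicitToOpenPartialHomeomorph_source hsurj
  have hea : e a = (0, 0) := by
    rw [he, hH.implicitToOpenPartialHomeomorph_self hsurj, h0]
  have het : ((0 : ℝ), (0 : H'.ker)) ∈ e.target := by rw [← hea]; exact e.map_source hes
  have hsa : e.symm (0, 0) = a := by rw [← hea]; exact e.left_inv hes
  set κ : ℝ → ℝ × H'.ker := fun t => (0, t • ⟨v, hv⟩) with hκ
  have hκc : Continuous κ := by fun_prop
  have hκ0 : κ 0 = (0, 0) := by simp [hκ]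
  have hnh : κ ⁻¹' (e.target ∩ e.symm ⁻¹' N) ∈ 𝓝 (0 : ℝ) := by
    refine hκc.continuousAt.preimage_mem_nhds ?_
    rw [hκ0]
    exact inter_mem (e.open_target.mem_nhds het)
      ((e.continuousAt_symm het).preimage_mem_nhds (by rw [hsa]; exact hN))
  obtain ⟨ε, hε, hs⟩ := Metric.mem_nhds_iff.1 hnh
  rw [Real.ball_eq_Ioo] at hs
  simp only [zero_sub, zero_add] at hs
  refine ⟨ε, hε, fun t => e.symm (κ t), ?_, ?_, ?_, ?_⟩
  · exact e.continuousOn_symm.comp hκc.continuousOn fun t ht => (hs ht).1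
  · intro t ht t' ht' h
    have := e.symm.injOn (hs ht).1 (hs ht').1 h
    have h2 := congrArg (fun w => (w.2 : Plane)) this
    simp only [hκ, Submodule.coe_smul] at h2
    exact smul_left_injective ℝ hv0 h2
  · simp only [hκ0, hsa]
  · intro t ht
    refine ⟨(hs ht).2, ?_⟩
    have := hH.implicitToOpenPartialHomeomorph_fst hsurj (e.symm (κ t))
    rw [← this]
    change (e (e.symm (κ t))).1 = 0
    rw [e.right_inv (hs ht).1]

end Calculus

namespace LegendrianSurface

variable {S Λ : Type*} [TopologicalSpace S] [ChartedSpace Plane S] [IsManifold (𝓡 2) ∞ S]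
  [TopologicalSpace Λ] [ChartedSpace Plane Λ] {L : LegendrianSurface S Λ}

lemma cotangent_ext {t t' : CotangentBundle S} (h : t.proj = t'.proj)
    (h' : (show Plane →L[ℝ] ℝ from t.snd) = t'.snd) : t = t' := by
  rcases t with ⟨b, v⟩
  rcases t' with ⟨b', v'⟩
  obtain rfl : b = b' := h
  have h'' : v = v' := h'
  rw [h'']

lemma y_ne_of_ne {p q : Λ} (hpq : p ≠ q) (hx : L.x p = L.x q) (hz : L.z p = L.z q) :
    L.y p ≠ L.y q := by
  intro hy
  refine hpq (L.isSmoothEmbedding.isEmbedding.injective (Prod.ext ?_ hz))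
  exact cotangent_ext hx hy

variable [IsManifold (𝓡 2) ∞ Λ]

/-- Near a regular point, the height is a smooth function of the base point, whose derivative is the
covector `y`. -/
lemma exists_section_of_regular {p : Λ} (hp : p ∈ L.regular) {W : Set Λ} (hW : W ∈ 𝓝 p) :
    ∃ s : S → Λ, s (L.x p) = p ∧ (∀ᶠ u in 𝓝 (L.x p), s u ∈ W ∧ L.x (s u) = u) ∧
      ContMDiffAt (𝓡 2) 𝓘(ℝ, ℝ) ∞ (fun u => L.z (s u)) (L.x p) ∧
      HasMFDerivAt (𝓡 2) 𝓘(ℝ, ℝ) (fun u => L.z (s u)) (L.x p) (L.y p) := by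
  obtain ⟨Φ, hΦ, h⟩ := hp
  have hxp : L.x p = Φ p := h hΦ
  have hs : Φ.symm (L.x p) = p := by rw [hxp]; exact Φ.left_inv hΦ
  have htm : L.x p ∈ Φ.target := by rw [hxp]; exact Φ.map_source hΦ
  have hsm : ContMDiffAt (𝓡 2) (𝓡 2) ∞ Φ.symm (L.x p) :=
    Φ.contMDiffOn_invFun.contMDiffAt (Φ.open_target.mem_nhds htm)
  have hinv : ∀ᶠ u in 𝓝 (L.x p), Φ.symm u ∈ W ∧ L.x (Φ.symm u) = u := by
    have h1 : ∀ᶠ u in 𝓝 (L.x p), Φ.symm u ∈ W :=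
      hsm.continuousAt.eventually (by rw [hs]; exact hW)
    filter_upwards [h1, Φ.open_target.mem_nhds htm] with u hu hu'
    refine ⟨hu, ?_⟩
    rw [show L.x (Φ.symm u) = Φ (Φ.symm u) from h (Φ.map_target hu')]
    exact Φ.right_inv hu'
  have hzs : ContMDiffAt (𝓡 2) 𝓘(ℝ, ℝ) ∞ (fun u => L.z (Φ.symm u)) (L.x p) :=
    ContMDiffAt.comp (L.x p) (g := L.z) (L.contMDiff_z _) hsm
  refine ⟨Φ.symm, hs, hinv, hzs, ?_⟩
  have hsd : HasMFDerivAt (𝓡 2) (𝓡 2) Φ.symm (L.x p) (mfderiv (𝓡 2) (𝓡 2) Φ.symm (L.x p)) :=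
    (hsm.mdifferentiableAt (by simp)).hasMFDerivAt
  have hzd : HasMFDerivAt (𝓡 2) 𝓘(ℝ, ℝ) L.z (Φ.symm (L.x p))
      (mfderiv (𝓡 2) 𝓘(ℝ, ℝ) L.z (Φ.symm (L.x p))) :=
    ((L.contMDiff_z _).mdifferentiableAt (by simp)).hasMFDerivAt
  have hxd : HasMFDerivAt (𝓡 2) (𝓡 2) L.x (Φ.symm (L.x p))
      (mfderiv (𝓡 2) (𝓡 2) L.x (Φ.symm (L.x p))) :=
    ((L.contMDiff_x _).mdifferentiableAt (by simp)).hasMFDerivAt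
  have hcomp := hzd.comp (L.x p) hsd
  have hcx := hxd.comp (L.x p) hsd
  have hid : HasMFDerivAt (𝓡 2) (𝓡 2) (L.x ∘ Φ.symm) (L.x p)
      (ContinuousLinearMap.id ℝ (TangentSpace (𝓡 2) (L.x p))) := by
    refine (hasMFDerivAt_id (L.x p)).congr_of_eventuallyEq ?_
    filter_upwards [hinv] with u hu using hu.2
  have heq := hasMFDerivAt_unique hcx hid
  refine (hcomp.congr_mfderiv ?_)
  ext w
  have hleg := L.legendrian (Φ.symm (L.x p)) (mfderiv (𝓡 2) (𝓡 2) Φ.symm (L.x p) w)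
  have hw : mfderiv (𝓡 2) (𝓡 2) L.x (Φ.symm (L.x p)) (mfderiv (𝓡 2) (𝓡 2) Φ.symm (L.x p) w) = w :=
    congrArg (fun A : Plane →L[ℝ] Plane => A w) heq
  change mfderiv (𝓡 2) 𝓘(ℝ, ℝ) L.z (Φ.symm (L.x p)) (mfderiv (𝓡 2) (𝓡 2) Φ.symm (L.x p) w) = L.y p w
  refine hleg.trans ?_
  change L.y (Φ.symm (L.x p)) _ = _
  have : (mfderiv (𝓡 2) (𝓡 2) L.x (Φ.symm (L.x p)) (mfderiv (𝓡 2) (𝓡 2) Φ.symm (L.x p) w) : Plane) = w := hw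
  refine (congrArg (L.y (Φ.symm (L.x p))) this).trans ?_
  rw [hs]

/-- The crossing arc through a crossing of the sheets at `p` and `q`. -/
lemma exists_crossing_path {p q : Λ} (hp : p ∈ L.regular) (hq : q ∈ L.regular) (hpq : p ≠ q)
    (hx : L.x p = L.x q) (hz : L.z p = L.z q) {W W' : Set Λ} (hW : W ∈ 𝓝 p) (hW' : W' ∈ 𝓝 q) :
    ∃ ε > 0, ∃ γ : ℝ → S, ContinuousOn γ (Ioo (-ε) ε) ∧ InjOn γ (Ioo (-ε) ε) ∧ γ 0 = L.x p ∧
      ∀ t ∈ Ioo (-ε) ε, ∃ p' ∈ W, ∃ q' ∈ W', L.x p' = γ t ∧ L.x q' = γ t ∧ L.z p' = L.z q' := by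
  obtain ⟨s, hs, hsW, hsm, hsd⟩ := exists_section_of_regular hp hW
  obtain ⟨s', hs', hsW', hsm', hsd'⟩ := exists_section_of_regular hq hW'
  rw [← hx] at hsd' hsW' hs' hsm'
  set χ := chartAt Plane (L.x p)
  have hus : L.x p ∈ χ.source := mem_chart_source _ _
  have hut : χ (L.x p) ∈ χ.target := χ.map_source hus
  have hχs : χ.symm (χ (L.x p)) = L.x p := χ.left_inv hus
  set h : S → ℝ := fun u => L.z (s u) - L.z (s' u) with hh
  have hhm : ContMDiffAt (𝓡 2) 𝓘(ℝ, ℝ) ∞ h (L.x p) := hsm.sub hsm'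
  have hhd : HasMFDerivAt (𝓡 2) 𝓘(ℝ, ℝ) h (L.x p) (L.y p - L.y q) := hsd.sub hsd'
  set H : Plane → ℝ := fun a => h (χ.symm a) with hH
  have hHs : ContDiffAt ℝ ∞ H (χ (L.x p)) := by
    rw [← contMDiffAt_iff_contDiffAt]
    have h3 : ContMDiffAt (𝓡 2) (𝓡 2) ∞ χ.symm (χ (L.x p)) :=
      (contMDiffOn_chart_symm (I := 𝓡 2) (n := ∞) (x := L.x p)).contMDiffAt
        (χ.open_target.mem_nhds hut)
    exact ContMDiffAt.comp (χ (L.x p)) (g := h) (by rw [hχs]; exact hhm) h3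
  have hstrict := hHs.hasStrictFDerivAt (by simp)
  have hne : fderiv ℝ H (χ (L.x p)) ≠ 0 := by
    intro h0
    rw [h0] at hstrict
    have h1 : HasMFDerivAt 𝓘(ℝ, Plane) 𝓘(ℝ, ℝ) H (χ (L.x p)) (0 : Plane →L[ℝ] ℝ) :=
      hstrict.hasFDerivAt.hasMFDerivAt
    have h2 : HasMFDerivAt (𝓡 2) (𝓡 2) χ (L.x p) (mfderiv (𝓡 2) (𝓡 2) χ (L.x p)) := by
      refine MDifferentiableAt.hasMFDerivAt ?_
      exact ((contMDiffOn_chart (I := 𝓡 2) (n := ∞) (x := L.x p)).contMDiffAt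
        (χ.open_source.mem_nhds hus)).mdifferentiableAt (by simp)
    have h3 := h1.comp (L.x p) h2
    have h4 : HasMFDerivAt (𝓡 2) 𝓘(ℝ, ℝ) h (L.x p) _ := h3.congr_of_eventuallyEq (by
      filter_upwards [χ.open_source.mem_nhds hus] with u hu
      simp [hH, χ.left_inv hu])
    have h5 := hasMFDerivAt_unique hhd h4
    refine y_ne_of_ne hpq hx hz (sub_eq_zero.1 (h5.trans ?_))
    ext w; rfl
  have hN : {a | a ∈ χ.target ∧ (s (χ.symm a) ∈ W ∧ L.x (s (χ.symm a)) = χ.symm a) ∧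
      s' (χ.symm a) ∈ W' ∧ L.x (s' (χ.symm a)) = χ.symm a} ∈ 𝓝 (χ (L.x p)) := by
    have hc := χ.continuousAt_symm hut
    have := hc.eventually (p := fun u => (s u ∈ W ∧ L.x (s u) = u) ∧ s' u ∈ W' ∧ L.x (s' u) = u)
      (by rw [hχs]; exact hsW.and hsW')
    filter_upwards [χ.open_target.mem_nhds hut, this] with a ha hb using ⟨ha, hb⟩
  obtain ⟨ε, hε, γ, hγc, hγi, hγ0, hγ⟩ := exists_path_in_zero_set hstrict
    (by simp [hH, hh, hχs, hs, hs', hz]) hne hN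
  refine ⟨ε, hε, fun t => χ.symm (γ t), ?_, ?_, by simp [hγ0, hχs], fun t ht => ?_⟩
  · exact χ.continuousOn_symm.comp hγc fun t ht => (hγ t ht).1.1
  · intro t ht t' ht' he
    exact hγi ht ht' (χ.symm.injOn (hγ t ht).1.1 (hγ t' ht').1.1 he)
  · obtain ⟨⟨-, ⟨h1, h2⟩, h3, h4⟩, h5⟩ := hγ t ht
    exact ⟨_, h1, _, h3, h2, h4, sub_eq_zero.1 h5⟩

end LegendrianSurface

namespace LegendrianSurface

section Fibers

variable {S Λ : Type*} [TopologicalSpace S] [ChartedSpace Plane S] [IsManifold (𝓡 2) ∞ S]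
  [TopologicalSpace Λ] [ChartedSpace Plane Λ] {L : LegendrianSurface S Λ}
  {σ : ℝ} {p : Λ} {φ : OpenPartialHomeomorph Λ Plane} {ψ : OpenPartialHomeomorph S Plane}
  {W : Set Λ}

lemma eventually_fiber_of_regular (hp : p ∈ L.regular) {W : Set Λ} (hW : W ∈ 𝓝 p)
    (hi : InjOn L.x W) : ∀ᶠ u in 𝓝 (L.x p), ∃ q, W ∩ L.x ⁻¹' {u} = {q} := by
  obtain ⟨f, hf, h⟩ := exists_homeo_of_regular hp
  have hfp : L.x p = f p := (h p hf).symm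
  have ht : L.x p ∈ f.target := by rw [hfp]; exact f.map_source hf
  have hs : f.symm (L.x p) = p := by rw [hfp]; exact f.left_inv hf
  filter_upwards [f.open_target.mem_nhds ht, (f.continuousAt_symm ht).preimage_mem_nhds
    (by rw [hs]; exact hW)] with u hu hu'
  have hxu : L.x (f.symm u) = u := by
    rw [← h _ (f.map_target hu), f.right_inv hu]
  refine ⟨f.symm u, eq_singleton_iff_unique_mem.2 ⟨⟨hu', hxu⟩, fun q hq => ?_⟩⟩
  exact hi hq.1 hu' ((show L.x q = u from hq.2).trans hxu.symm)

/-- The points near a cusp edge above a point of `S` near its base projection. -/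
lemma IsGeneric.eventually_fiber_of_cusp (hL : L.IsGeneric) (h : L.IsLocalForm cuspForm p φ ψ W)
    {W' : Set Λ} (hW' : W' ∈ 𝓝 p) (hs : W' ⊆ W) :
    ∀ᶠ u in 𝓝 (L.x p), W' ∩ L.x ⁻¹' {u} = ∅ ∨ (∃ q ∈ L.cuspEdge, W' ∩ L.x ⁻¹' {u} = {q}) ∨
      ∃ q ∈ L.regular, ∃ q' ∈ L.regular, L.z q' < L.z q ∧ W' ∩ L.x ⁻¹' {u} = {q, q'} := by
  obtain ⟨r, hr, hsr⟩ := h.exists_radius h.mem hW'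
  rw [h.map_eq_zero] at hsr
  simp only [PiLp.zero_apply, sub_zero] at hsr
  filter_upwards [h.eventually_base (lt_min hr (sq_pos_of_pos hr))] with u ⟨hu, hu0, hu1⟩
  have hiff : ∀ q ∈ W, L.x q = u ↔ φ q 0 = ψ u 0 ∧ φ q 1 ^ 2 = ψ u 1 := by
    intro q hq
    rw [h.x_eq_iff' hq hu]
    constructor
    · intro he
      exact ⟨by simpa [cuspForm] using congrArg (fun v : Plane => v 0) he,
        by simpa [cuspForm] using congrArg (fun v : Plane => v 1) he⟩
    · rintro ⟨h0, h1⟩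
      exact Plane.ext (by simpa [cuspForm] using h0) (by simpa [cuspForm] using h1)
  have hmk : ∀ e : ℝ, |e| < r → e ^ 2 = ψ u 1 → φ.symm !₂[ψ u 0, e] ∈ W' ∩ L.x ⁻¹' {u} ∧
      φ (φ.symm !₂[ψ u 0, e]) = !₂[ψ u 0, e] := by
    intro e he he'
    obtain ⟨a1, a2, a3⟩ := hsr !₂[ψ u 0, e] (by simpa using lt_of_lt_of_le hu0 (min_le_left _ _))
      (by simpa using he)
    exact ⟨⟨a1, (hiff _ a2).2 (by rw [a3]; simpa using he')⟩, a3⟩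
  rcases lt_trichotomy (ψ u 1) 0 with hlt | heq | hgt
  · left
    refine eq_empty_of_forall_notMem fun q hq => ?_
    have := ((hiff q (hs hq.1)).1 hq.2).2
    nlinarith [sq_nonneg (φ q 1)]
  · right; left
    obtain ⟨a1, a2⟩ := hmk 0 (by simpa using hr) (by simp [heq])
    refine ⟨_, hL.cusp_of_not_injOn (h.cusp_not_injOn (hs a1.1) (by rw [a2]; simp))
      (h.cusp_not_hasTriples (hs a1.1)), eq_singleton_iff_unique_mem.2 ⟨a1, fun q hq => ?_⟩⟩
    obtain ⟨h0, h1⟩ := (hiff q (hs hq.1)).1 hq.2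
    refine h.eq_of_map_eq (hs hq.1) (hs a1.1) (Plane.ext ?_ ?_) <;> rw [a2]
    · simpa using h0
    · rw [heq] at h1; simpa using h1
  · right; right
    have hsq : |√(ψ u 1)| < r := by
      rw [abs_of_nonneg (Real.sqrt_nonneg _), Real.sqrt_lt' hr]
      exact lt_of_le_of_lt (le_abs_self _) (lt_of_lt_of_le hu1 (min_le_right _ _))
    have hpos : 0 < √(ψ u 1) := Real.sqrt_pos.2 hgt
    obtain ⟨a1, a2⟩ := hmk _ hsq (Real.sq_sqrt hgt.le)
    obtain ⟨b1, b2⟩ := hmk (-√(ψ u 1)) (by rwa [abs_neg]) (by rw [neg_sq, Real.sq_sqrt hgt.le])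
    refine ⟨_, hL.regular_of_injOn (h.cusp_injOn (hs a1.1) (by rw [a2]; simpa using hpos.ne')),
      _, hL.regular_of_injOn (h.cusp_injOn (hs b1.1) (by rw [b2]; simpa using hpos.ne')), ?_, ?_⟩
    · rw [h.order _ (hs b1.1) _ (hs a1.1) (b1.2.trans a1.2.symm), a2, b2]
      simp only [cuspForm]
      have := pow_pos hpos 3
      simp only [Matrix.cons_val_one, Matrix.cons_val_fin_one]
      nlinarith
    · ext q
      constructor
      · intro hq
        obtain ⟨h0, h1⟩ := (hiff q (hs hq.1)).1 hq.2
        rw [← Real.sq_sqrt hgt.le] at h1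
        rcases sq_eq_sq_iff_eq_or_eq_neg.1 h1 with h1 | h1
        · left; exact h.eq_of_map_eq (hs hq.1) (hs a1.1) (Plane.ext (by rw [a2]; simpa using h0)
            (by rw [a2]; simpa using h1))
        · right; exact h.eq_of_map_eq (hs hq.1) (hs b1.1) (Plane.ext (by rw [b2]; simpa using h0)
            (by rw [b2]; simpa using h1))
      · rintro (rfl | rfl)
        exacts [a1, b1]

/-- The discriminant `x₁ - 6 e²` at a point near a swallowtail point: negative on the two outer
sheets and positive on the middle one. -/
def disc (φ : OpenPartialHomeomorph Λ Plane) (q : Λ) : ℝ := φ q 0 - 6 * φ q 1 ^ 2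

/-- The structure of the points near a swallowtail point above one point of `S`. -/
inductive SwallowFiber (L : LegendrianSurface S Λ) (σ : ℝ) (φ : OpenPartialHomeomorph Λ Plane)
    (W : Set Λ) (u : S) : Prop
  | one (q : Λ) (hq : q ∈ L.regular) (hd : disc φ q < 0) (h : W ∩ L.x ⁻¹' {u} = {q})
  | two (c q : Λ) (hc : c ∈ L.cuspEdge) (hq : q ∈ L.regular) (hd : disc φ q < 0)
      (hz : 0 < σ * (L.z c - L.z q)) (h : W ∩ L.x ⁻¹' {u} = {c, q})
  | three (a b c : Λ) (ha : a ∈ L.regular) (hb : b ∈ L.regular) (hc : c ∈ L.regular) (hbc : b ≠ c)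
      (hda : 0 < disc φ a) (hdb : disc φ b < 0) (hdc : disc φ c < 0)
      (hzb : 0 < σ * (L.z a - L.z b)) (hzc : 0 < σ * (L.z a - L.z c))
      (h : W ∩ L.x ⁻¹' {u} = {a, b, c})

lemma exists_cubic_root {x y s η : ℝ} (hs : 0 < s) (hη : η * (2 * s + 1) < 4 * s ^ 3)
    (hx : |x| < η) (hy : |y| < η) : ∃ e : ℝ, 2 * x * e - 4 * e ^ 3 = y := by
  have hc : ContinuousOn (fun e : ℝ => 2 * x * e - 4 * e ^ 3) (Icc (-s) s) := by fun_prop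
  have := intermediate_value_Icc' (by linarith : -s ≤ s) hc
  obtain ⟨e, -, he⟩ := this (show y ∈ _ from by
    obtain ⟨x1, x2⟩ := abs_lt.1 hx
    obtain ⟨y1, y2⟩ := abs_lt.1 hy
    constructor <;> nlinarith)
  exact ⟨e, he⟩

lemma cubic_root_lt {x y s η e : ℝ} (hs : 0 < s) (hη : η * (2 * s + 1) < 4 * s ^ 3)
    (hx : |x| < η) (hy : |y| < η) (he : 2 * x * e - 4 * e ^ 3 = y) : |e| < s := by
  by_contra hc
  push Not at hc
  have h1 : |4 * e ^ 3| ≤ 2 * |x| * |e| + |y| := by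
    have : 4 * e ^ 3 = 2 * x * e - y := by linarith
    rw [this]
    refine (abs_sub _ _).trans ?_
    rw [abs_mul, abs_mul]; norm_num
  rw [abs_mul, abs_pow] at h1
  norm_num at h1
  have hη0 : 0 < η := lt_of_le_of_lt (abs_nonneg _) hx
  have h2 : 4 * |e| ^ 3 < 2 * η * |e| + η := by nlinarith [abs_nonneg e]
  have h3 : 2 * η < 4 * s ^ 2 := by
    by_contra h; push Not at h; nlinarith
  nlinarith [mul_le_mul_of_nonneg_right hc (by positivity : 0 ≤ |e| * (|e| + s)),
    mul_nonneg (sub_nonneg.2 hc) (by nlinarith [sq_nonneg s, mul_le_mul hc hc hs.le (by positivity)] : 0 ≤ 4 * (|e| ^ 2 + |e| * s + s ^ 2) - 2 * η)]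

lemma IsLocalForm.sw_x_eq_iff (h : L.IsLocalForm (swForm σ) p φ ψ W) {q : Λ} (hq : q ∈ W) {u : S}
    (hu : u ∈ ψ.source) :
    L.x q = u ↔ φ q 0 = ψ u 0 ∧ 2 * ψ u 0 * φ q 1 - 4 * φ q 1 ^ 3 = ψ u 1 := by
  rw [h.x_eq_iff' hq hu]
  constructor
  · intro he
    have h0 : φ q 0 = ψ u 0 := by
      simpa [swForm, swallowForm] using congrArg (fun v : Plane => v 0) he
    exact ⟨h0, by rw [← h0]; simpa [swForm, swallowForm] using congrArg (fun v : Plane => v 1) he⟩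
  · rintro ⟨h0, h1⟩
    exact Plane.ext (by simpa [swForm, swallowForm] using h0)
      (by rw [← h0] at h1; simpa [swForm, swallowForm] using h1)

lemma IsLocalForm.sw_lt_iff (h : L.IsLocalForm (swForm σ) p φ ψ W) (hσ : σ = 1 ∨ σ = -1) {q q' : Λ}
    (hq : q ∈ W) (hq' : q' ∈ W) (hx : L.x q = L.x q') (hne : φ q 1 ≠ φ q' 1) :
    0 < σ * (L.z q - L.z q') ↔ 0 < -((φ q 1 - φ q' 1) ^ 3 * (φ q 1 + φ q' 1)) := by
  have h1 := swForm_height ((h.x_eq_iff hq hq').1 hx) hne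
  have h2 := h.order q hq q' hq' hx
  have h3 := h.order q' hq' q hq hx.symm
  rcases hσ with rfl | rfl
  · rw [one_mul, sub_pos, h3, ← sub_pos, h1, one_mul]
  · have : 0 < -1 * (L.z q - L.z q') ↔ L.z q < L.z q' := by constructor <;> intro h <;> linarith
    rw [this, h2, ← sub_neg, h1]
    constructor <;> intro h <;> linarith

lemma IsLocalForm.eq_iff (h : L.IsLocalForm (swForm σ) p φ ψ W) {q q' : Λ}
    (hq : q ∈ W) (hq' : q' ∈ W) (hx : L.x q = L.x q') : q = q' ↔ φ q 1 = φ q' 1 := by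
  refine ⟨fun e => by rw [e], fun e => h.eq_of_map_eq hq hq' (Plane.ext ?_ e)⟩
  exact ((swForm_eq_iff _ _ _).1 ((h.x_eq_iff hq hq').1 hx)).1

/-- The points near a swallowtail point above a point of `S` near its base projection. -/
lemma IsGeneric.eventually_fiber_of_swallow (hL : L.IsGeneric)
    (h : L.IsLocalForm (swForm σ) p φ ψ W) (hσ : σ = 1 ∨ σ = -1)
    {W' : Set Λ} (hW' : W' ∈ 𝓝 p) (hs : W' ⊆ W) :
    ∀ᶠ u in 𝓝 (L.x p), u ≠ L.x p → SwallowFiber L σ φ W' u := by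
  obtain ⟨s, hs0, hsr⟩ := h.exists_radius h.mem hW'
  rw [h.map_eq_zero] at hsr
  simp only [PiLp.zero_apply, sub_zero] at hsr
  obtain ⟨η, hη0, hη, hηs⟩ : ∃ η > 0, η * (2 * s + 1) < 4 * s ^ 3 ∧ η ≤ s := by
    refine ⟨min (2 * s ^ 3 / (2 * s + 1)) s, by positivity, ?_, min_le_right _ _⟩
    calc min (2 * s ^ 3 / (2 * s + 1)) s * (2 * s + 1) ≤ 2 * s ^ 3 / (2 * s + 1) * (2 * s + 1) := by
          gcongr; exact min_le_left _ _
      _ = 2 * s ^ 3 := by field_simp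
      _ < 4 * s ^ 3 := by nlinarith [pow_pos hs0 3]
  filter_upwards [h.eventually_base hη0] with u ⟨hu, hu0, hu1⟩ hup
  set x := ψ u 0 with hx
  set y := ψ u 1 with hy
  have hmk : ∀ e : ℝ, 2 * x * e - 4 * e ^ 3 = y → ∃ q, q ∈ W' ∧ L.x q = u ∧ φ q 0 = x ∧ φ q 1 = e := by
    intro e he
    obtain ⟨a1, a2, a3⟩ := hsr !₂[x, e] (by simpa using lt_of_lt_of_le hu0 hηs)
      (by simpa using cubic_root_lt hs0 hη hu0 hu1 he)
    refine ⟨_, a1, (h.sw_x_eq_iff a2 hu).2 ?_, ?_, ?_⟩ <;> rw [a3]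
    · exact ⟨by simp [hx], by simpa using he⟩
    · simp
    · simp
  have hroot : ∀ q ∈ W', L.x q = u → φ q 0 = x ∧ 2 * x * φ q 1 - 4 * φ q 1 ^ 3 = y :=
    fun q hq hqu => (h.sw_x_eq_iff (hs hq) hu).1 hqu
  have heq : ∀ {q q'}, q ∈ W' → q' ∈ W' → L.x q = u → L.x q' = u → (q = q' ↔ φ q 1 = φ q' 1) :=
    fun hq hq' e e' => h.eq_iff (hs hq) (hs hq') (e.trans e'.symm)
  have hreg : ∀ q ∈ W', disc φ q ≠ 0 → q ∈ L.regular := fun q hq hd =>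
    hL.regular_of_injOn (h.sw_injOn (hs hq) hd)
  -- three distinct roots
  have hthree : ∀ e1 e2 e3 : ℝ, e1 < e2 → e2 < e3 → e1 + e2 + e3 = 0 → 2 * x * e1 - 4 * e1 ^ 3 = y →
      2 * x * e2 - 4 * e2 ^ 3 = y → SwallowFiber L σ φ W' u := by
    intro e1 e2 e3 h12 h23 hsum h1 h2
    have hxx := swallow_double (h1.trans h2.symm) h12.ne
    obtain rfl : e3 = -(e1 + e2) := by linarith
    have h3 : 2 * x * (-(e1 + e2)) - 4 * (-(e1 + e2)) ^ 3 = y := by rw [← h1, hxx]; ring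
    obtain ⟨a, ha, hau, ha0, ha1⟩ := hmk _ h2
    obtain ⟨b, hb, hbu, hb0, hb1⟩ := hmk _ h1
    obtain ⟨c, hc, hcu, hc0, hc1⟩ := hmk _ h3
    have hda : 0 < disc φ a := by
      rw [disc, ha0, ha1, hxx]; nlinarith [mul_pos (sub_pos.2 h12) (sub_pos.2 h23)]
    have hdb : disc φ b < 0 := by
      rw [disc, hb0, hb1, hxx]; nlinarith [mul_pos (sub_pos.2 h12) (sub_pos.2 (h12.trans h23))]
    have hdc : disc φ c < 0 := by
      rw [disc, hc0, hc1, hxx]; nlinarith [mul_pos (sub_pos.2 h23) (sub_pos.2 (h12.trans h23))]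
    refine .three a b c (hreg a ha hda.ne') (hreg b hb hdb.ne) (hreg c hc hdc.ne) ?_ hda hdb hdc ?_ ?_
      ?_
    · rw [Ne, heq hb hc hbu hcu, hb1, hc1]; linarith
    · rw [h.sw_lt_iff hσ (hs ha) (hs hb) (hau.trans hbu.symm) (by rw [ha1, hb1]; exact h12.ne'),
        ha1, hb1]
      nlinarith [mul_pos (pow_pos (sub_pos.2 h12) 3) (by linarith : 0 < -(e1 + e2))]
    · rw [h.sw_lt_iff hσ (hs ha) (hs hc) (hau.trans hcu.symm) (by rw [ha1, hc1]; exact h23.ne),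
        ha1, hc1]
      have : 0 < -(e1 + e2) - e2 := by linarith
      nlinarith [mul_pos (pow_pos this 3) (by linarith : 0 < -e1)]
    · ext q
      constructor
      · rintro ⟨hq, hqu⟩
        have hqr := (hroot q hq hqu).2
        by_cases e1' : φ q 1 = e2
        · left; rw [heq hq ha hqu hau, ha1, e1']
        by_cases e2' : φ q 1 = e1
        · right; left; rw [heq hq hb hqu hbu, hb1, e2']
        · right; right
          rw [mem_singleton_iff, heq hq hc hqu hcu, hc1]
          have := swallow_triple (h1.trans h2.symm) (h1.trans hqr.symm) h12.ne (Ne.symm e2')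
            (Ne.symm e1')
          linarith
      · rintro (rfl | rfl | rfl)
        exacts [⟨ha, hau⟩, ⟨hb, hbu⟩, ⟨hc, hcu⟩]
  -- a double root `e` and the simple root `-2 e`
  have htwo : ∀ e : ℝ, x = 6 * e ^ 2 → 2 * x * e - 4 * e ^ 3 = y → SwallowFiber L σ φ W' u := by
    intro e hxe he
    have he0 : e ≠ 0 := by
      rintro rfl
      refine hup (ψ.injOn hu h.base_mem ?_)
      rw [h.base_eq_zero]
      exact Plane.ext (by simpa using hxe) (by simpa using he.symm)
    have he' : 2 * x * (-2 * e) - 4 * (-2 * e) ^ 3 = y := by rw [← he, hxe]; ring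
    have hpos : 0 < e ^ 2 := by positivity
    obtain ⟨c, hc, hcu, hc0, hc1⟩ := hmk _ he
    obtain ⟨q, hq, hqu, hq0, hq1⟩ := hmk _ he'
    have hdq : disc φ q < 0 := by rw [disc, hq0, hq1, hxe]; nlinarith
    refine .two c q (hL.cusp_of_not_injOn (h.sw_not_injOn (hs hc) (by rw [hc0, hc1, hxe]; ring))
      (h.sw_not_hasTriples (hs hc) (by rwa [hc1]))) (hreg q hq hdq.ne) hdq ?_ ?_
    · rw [h.sw_lt_iff hσ (hs hc) (hs hq) (hcu.trans hqu.symm)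
        (by rw [hc1, hq1]; intro h; apply he0; linarith), hc1, hq1]
      have : -((e - -2 * e) ^ 3 * (e + -2 * e)) = 27 * (e ^ 2 * e ^ 2) := by ring
      rw [this]; positivity
    · ext a
      constructor
      · rintro ⟨ha, hau⟩
        have har := (hroot a ha hau).2
        by_cases e1 : φ a 1 = e
        · left; rw [heq ha hc hau hcu, hc1, e1]
        · right
          rw [mem_singleton_iff, heq ha hq hau hqu, hq1]
          have := swallow_double (he.trans har.symm) (Ne.symm e1)
          have h2 : (φ a 1 - e) * (φ a 1 + 2 * e) = 0 := by nlinarith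
          rcases mul_eq_zero.1 h2 with h2 | h2
          · exact absurd (by linarith) e1
          · linarith
      · rintro (rfl | rfl)
        exacts [⟨hc, hcu⟩, ⟨hq, hqu⟩]
  obtain ⟨e0, he0⟩ := exists_cubic_root hs0 hη hu0 hu1
  by_cases hex : ∃ e1, e1 ≠ e0 ∧ 2 * x * e1 - 4 * e1 ^ 3 = y
  · obtain ⟨e1, hne, he1⟩ := hex
    have hxx := swallow_double (he0.trans he1.symm) hne.symm
    set e2 := -(e0 + e1) with he2
    have he2' : 2 * x * e2 - 4 * e2 ^ 3 = y := by rw [← he0, hxx, he2]; ring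
    by_cases h02 : e2 = e0
    · have : e1 = -2 * e0 := by linarith
      exact htwo e0 (by rw [hxx, this]; ring) he0
    by_cases h12 : e2 = e1
    · have : e0 = -2 * e1 := by linarith
      exact htwo e1 (by rw [hxx, this]; ring) he1
    rcases lt_or_gt_of_ne hne with a | a <;> rcases lt_or_gt_of_ne h02 with b | b <;>
      rcases lt_or_gt_of_ne h12 with c | c
    · exact hthree e2 e1 e0 c a (by linarith) he2' he1
    · exact hthree e1 e2 e0 c b (by linarith) he1 he2'
    · linarith
    · exact hthree e1 e0 e2 a b (by linarith) he1 he0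
    · exact hthree e2 e0 e1 b a (by linarith) he2' he0
    · linarith
    · exact hthree e0 e2 e1 b c (by linarith) he0 he2'
    · exact hthree e0 e1 e2 a c (by linarith) he0 he1
  · push Not at hex
    obtain ⟨q, hq, hqu, hq0, hq1⟩ := hmk _ he0
    rcases lt_trichotomy (disc φ q) 0 with hd | hd | hd
    · refine .one q (hreg q hq hd.ne) hd (eq_singleton_iff_unique_mem.2 ⟨⟨hq, hqu⟩, ?_⟩)
      rintro a ⟨ha, hau⟩
      rw [heq ha hq hau hqu, hq1]
      by_contra hc
      exact hex _ hc (hroot a ha hau).2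
    · rw [disc, hq0, hq1] at hd
      exact htwo e0 (by linarith) he0
    · exfalso
      rw [disc, hq0, hq1] at hd
      have hΔ : 0 ≤ 2 * x - 3 * e0 ^ 2 := by nlinarith [sq_nonneg e0]
      have hsq := Real.sq_sqrt hΔ
      refine hex ((-e0 + √(2 * x - 3 * e0 ^ 2)) / 2) ?_ ?_
      · intro h
        have : √(2 * x - 3 * e0 ^ 2) = 3 * e0 := by linarith
        rw [this] at hsq; nlinarith
      · set w := √(2 * x - 3 * e0 ^ 2)
        have : x = (w ^ 2 + 3 * e0 ^ 2) / 2 := by linarith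
        rw [← he0, this]; ring

end Fibers

end LegendrianSurface

namespace LegendrianSurface

variable {S Λ : Type*} [TopologicalSpace S] [ChartedSpace Plane S] [IsManifold (𝓡 2) ∞ S]
  [TopologicalSpace Λ] [ChartedSpace Plane Λ] {L : LegendrianSurface S Λ}

lemma IsGeneric.exists_isolating (hL : L.IsGeneric) (p : Λ) :
    ∃ W ∈ 𝓝 p, ∀ q ∈ W, L.x q = L.x p → q = p := by
  rcases hL.cases p with h | h | h
  · obtain ⟨W, hW, hi⟩ := exists_injOn_of_regular h
    exact ⟨W, hW, fun q hq he => hi hq (mem_of_mem_nhds hW) he⟩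
  · obtain ⟨φ, ψ, W, h⟩ := exists_isLocalForm_of_cusp h
    refine ⟨W, h.mem_nhds, fun q hq he => ?_⟩
    obtain ⟨h0, h1⟩ := (cuspForm_eq_iff _ _).1 ((h.x_eq_iff hq h.mem).1 he)
    refine h.eq_of_map_eq hq h.mem (Plane.ext h0 ?_)
    rw [h.map_eq_zero] at h1 ⊢
    simpa using h1
  · obtain ⟨φ, ψ, W, h⟩ := exists_isLocalForm_of_swallow h
    refine ⟨W, h.mem_nhds, fun q hq he => ?_⟩
    obtain ⟨h0, h1⟩ := (swForm_eq_iff _ _ _).1 ((h.x_eq_iff hq h.mem).1 he)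
    refine h.eq_of_map_eq hq h.mem (Plane.ext h0 ?_)
    rw [h.map_eq_zero] at h0 h1 ⊢
    simp only [PiLp.zero_apply] at h0
    rw [h0] at h1
    simpa using h1

lemma IsGeneric.finite_fiber [T2Space S] (hL : L.IsGeneric) (u : S) : (L.x ⁻¹' {u}).Finite := by
  have hc : IsCompact (L.x ⁻¹' {u}) := L.isProperMap.isCompact_preimage isCompact_singleton
  choose W hW hi using hL.exists_isolating
  obtain ⟨t, htm, ht⟩ := hc.elim_nhds_subcover W fun p _ => hW p
  refine t.finite_toSet.subset fun q hq => ?_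
  obtain ⟨p, hp, hqp⟩ := mem_iUnion₂.1 (ht hq)
  have hpt := htm p hp
  rw [hi p q hqp ((show L.x q = u from hq).trans (show L.x p = u from hpt).symm)]
  exact hp

lemma isOpen_regular : IsOpen L.regular := by
  rw [isOpen_iff_mem_nhds]
  rintro p ⟨Φ, hΦ, h⟩
  exact mem_of_superset (Φ.open_source.mem_nhds hΦ) fun q hq => ⟨Φ, hq, h⟩

section Isolation

variable [T2Space S]

/-- Connected sets above a small neighbourhood of a point stay close to one point of the fibre. -/
lemma IsGeneric.exists_nhds_of_fiber (hL : L.IsGeneric) (u : S) (N : Λ → Set Λ)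
    (hN : ∀ p, L.x p = u → N p ∈ 𝓝 p) :
    ∃ U ∈ 𝓝 u, ∀ T : Set Λ, IsPreconnected T → T.Nonempty → (∀ q ∈ T, L.x q ∈ U) →
      ∃ p, L.x p = u ∧ T ⊆ N p := by
  have := L.t2Space
  obtain ⟨V, hV, hd⟩ := (hL.finite_fiber u).t2_separation
  set V' : Λ → Set Λ := fun p => V p ∩ interior (N p) with hV'
  have hVo : ∀ p, IsOpen (V' p) := fun p => (hV p).2.inter isOpen_interior
  set K : Set Λ := (⋃ p ∈ L.x ⁻¹' {u}, V' p)ᶜ with hK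
  have hKc : IsClosed K := (isOpen_biUnion fun p _ => hVo p).isClosed_compl
  have hxK : IsClosed (L.x '' K) := L.isProperMap.isClosedMap K hKc
  refine ⟨(L.x '' K)ᶜ, hxK.isOpen_compl.mem_nhds ?_, fun T hT hne hTU => ?_⟩
  · rintro ⟨q, hq, rfl⟩
    exact hq (mem_biUnion (show q ∈ L.x ⁻¹' {L.x q} from rfl)
      ⟨(hV q).1, mem_interior_iff_mem_nhds.2 (hN q rfl)⟩)
  · have hcov : T ⊆ ⋃ p ∈ L.x ⁻¹' {u}, V' p := fun q hq => by
      by_contra hc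
      exact hTU q hq ⟨q, hc, rfl⟩
    obtain ⟨q, hq⟩ := hne
    obtain ⟨p, hp, hqp⟩ := mem_iUnion₂.1 (hcov hq)
    refine ⟨p, hp, ?_⟩
    have hsub : T ⊆ V' p := by
      refine hT.subset_left_of_subset_union (hVo p)
        (isOpen_biUnion (s := L.x ⁻¹' {u} \ {p}) fun p' _ => hVo p') ?_ ?_ ⟨q, hq, hqp⟩
      · rw [disjoint_left]
        intro a ha ha'
        obtain ⟨p', hp', hap'⟩ := mem_iUnion₂.1 ha'
        exact disjoint_left.1 (hd hp hp'.1 (fun e => hp'.2 e.symm)) ha.1 hap'.1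
      · intro a ha
        obtain ⟨p', hp', hap'⟩ := mem_iUnion₂.1 (hcov ha)
        by_cases e : p' = p
        · left; rwa [← e]
        · right; exact mem_biUnion (show p' ∈ L.x ⁻¹' {u} \ {p} from ⟨hp', e⟩) hap'
    exact hsub.trans (inter_subset_right.trans interior_subset)

lemma IsGeneric.exists_isolation (hL : L.IsGeneric) (p : Λ) :
    ∃ W₀ ∈ 𝓝 p, ∀ W ∈ 𝓝 p, W ⊆ W₀ → ∃ U ∈ 𝓝 (L.x p), ∀ T : Set Λ, IsPreconnected T →
      (∀ q ∈ T, L.x q ∈ U) → T ⊆ W ∨ Disjoint T W₀ := by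
  have := L.t2Space
  obtain ⟨V, hV, hd⟩ := (hL.finite_fiber (L.x p)).t2_separation
  refine ⟨V p, (hV p).2.mem_nhds (hV p).1, fun W hW hWV => ?_⟩
  obtain ⟨U, hU, h⟩ := hL.exists_nhds_of_fiber (L.x p) (fun q => if q = p then W else V q) (by
    intro q _
    by_cases e : q = p
    · subst e; simpa using hW
    · simpa [e] using (hV q).2.mem_nhds (hV q).1)
  refine ⟨U, hU, fun T hT hTU => ?_⟩
  rcases T.eq_empty_or_nonempty with rfl | hne
  · left; exact empty_subset _
  obtain ⟨q, hq, hTq⟩ := h T hT hne hTU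
  by_cases e : q = p
  · left; simpa [e] using hTq
  · right
    simp only [e, if_false] at hTq
    exact (hd hq (show p ∈ L.x ⁻¹' {L.x p} from rfl) e).mono_left hTq

end Isolation

/-! ### Above open cells -/

section Cells

variable [CWComplex (univ : Set S)]

lemma regular_of_two_cell (hC : IsCompatible L) {α : Cell S 2} {p : Λ} (hp : L.x p ∈ openCell 2 α) :
    p ∈ L.regular := by
  by_contra h
  obtain ⟨n, hn, e, he⟩ := hC _ (mem_baseSingularSet h)
  have := dim_eq_of_mem_openCell he hp
  omega

variable [T2Space S]

lemma swallow_not_over_one_cell (hC : IsCompatible L) {p : Λ}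
    (hp : p ∈ L.swallowtail) (β : Cell S 1) : L.x p ∉ openCell 1 β := by
  intro hβ
  obtain ⟨φ, ψ, W, h⟩ := exists_isLocalForm_of_swallow hp
  obtain ⟨r, hr, hs⟩ := h.exists_radius h.mem h.mem_nhds
  rw [h.map_eq_zero] at hs
  simp only [PiLp.zero_apply, sub_zero] at hs
  set ε := min r 1 / 6 with hε
  have hε0 : 0 < ε := by positivity
  have hεr : 6 * ε ≤ r := by rw [hε]; linarith [min_le_left r 1]
  have hε1 : 6 * ε ≤ 1 := by rw [hε]; linarith [min_le_right r 1]
  have hsm : ∀ t ∈ Ioo (-ε) ε, ∀ c : ℝ, 0 ≤ c → c ≤ 6 → φ.symm !₂[c * t ^ 2, t] ∈ W ∧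
      φ (φ.symm !₂[c * t ^ 2, t]) = !₂[c * t ^ 2, t] := by
    intro t ht c hc hc6
    have h1 : c * t ^ 2 < r := by nlinarith [ht.1, ht.2]
    exact (hs !₂[c * t ^ 2, t] (abs_lt_of (by simpa using h1) (by simp; nlinarith [sq_nonneg t]))
      (abs_lt_of (by simp; linarith [ht.2]) (by simp; linarith [ht.1]))).2
  have hcont : ∀ c : ℝ, 0 ≤ c → c ≤ 6 →
      ContinuousOn (fun t : ℝ => L.x (φ.symm !₂[c * t ^ 2, t])) (Ioo (-ε) ε) := by
    intro c hc hc6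
    refine L.continuous_x.comp_continuousOn (φ.continuousOn_symm.comp (s := Ioo (-ε) ε)
      (f := fun t : ℝ => (!₂[c * t ^ 2, t] : Plane)) ?_ ?_)
    · refine Continuous.continuousOn ?_
      refine (PiLp.continuous_toLp 2 _).comp (continuous_pi fun i => ?_)
      fin_cases i
      · show Continuous fun t : ℝ => c * t ^ 2
        fun_prop
      · exact continuous_id
    · intro t ht
      have := hsm t ht c hc hc6
      show (!₂[c * t ^ 2, t] : Plane) ∈ φ.target
      rw [← this.2]
      exact φ.map_source (h.source this.1)
  have h0m : (0 : ℝ) ∈ Ioo (-ε) ε := ⟨by linarith, hε0⟩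
  have hx0 : ∀ c : ℝ, L.x (φ.symm !₂[c * 0 ^ 2, 0]) = L.x p := by
    intro c
    have : (!₂[c * 0 ^ 2, 0] : Plane) = φ p := by
      rw [h.map_eq_zero]; exact Plane.ext (by simp) (by simp)
    rw [this, φ.left_inv h.mem_source]
  have hpath := eventually_mem_image_of_path (β := β) hε0 (hcont 6 (by norm_num) le_rfl) (by
    intro t ht t' ht' he
    obtain ⟨a1, a2⟩ := hsm t ht 6 (by norm_num) le_rfl
    obtain ⟨b1, b2⟩ := hsm t' ht' 6 (by norm_num) le_rfl
    obtain ⟨-, e1⟩ := (swForm_eq_iff _ _ _).1 ((h.x_eq_iff a1 b1).1 he)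
    rw [a2, b2] at e1
    simp only [Matrix.cons_val_zero, Matrix.cons_val_one, Matrix.cons_val_fin_one] at e1
    have : t ^ 3 = t' ^ 3 := by linarith
    exact (Odd.strictMono_pow (by decide : Odd 3)).injective this) (by rw [hx0]; exact hβ) (by
    intro t ht
    obtain ⟨a1, a2⟩ := hsm t ht 6 (by norm_num) le_rfl
    refine hC _ (mem_baseSingularSet fun hr => ?_)
    obtain ⟨W', hW', hi⟩ := exists_injOn_of_regular hr
    exact h.sw_not_injOn a1 (by rw [a2]; simp) W' hW' hi)
  rw [hx0] at hpath
  have hc2 := hcont 2 (by norm_num) (by norm_num)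
  have hc20 : ContinuousAt (fun t : ℝ => L.x (φ.symm !₂[2 * t ^ 2, t])) 0 :=
    hc2.continuousAt (Ioo_mem_nhds (by linarith) hε0)
  have hc2t : Tendsto (fun t : ℝ => L.x (φ.symm !₂[2 * t ^ 2, t])) (𝓝 0) (𝓝 (L.x p)) := by
    have := hc20.tendsto
    rwa [hx0] at this
  have hev := hc2t.eventually hpath
  have hev2 := hc2t.eventually (eventually_mem_openCell_one hβ)
  have hev3 : ∀ᶠ t in 𝓝 (0 : ℝ), t ∈ Ioo (-ε) ε := Ioo_mem_nhds (by linarith) hε0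
  have hpos : ∃ᶠ t in 𝓝 (0 : ℝ), 0 < t := frequently_gt_nhds 0
  obtain ⟨t, ht0, ht1, ht2, ht3⟩ := (hpos.and_eventually (hev.and (hev2.and hev3))).exists
  obtain ⟨a1, a2⟩ := hsm t ht3 2 (by norm_num) (by norm_num)
  obtain ⟨b1, b2⟩ := hsm (-t) ⟨by linarith [ht3.2], by linarith [ht3.1]⟩ 2 (by norm_num) (by norm_num)
  have hxe : L.x (φ.symm !₂[2 * t ^ 2, t]) = L.x (φ.symm !₂[2 * (-t) ^ 2, -t]) :=
    (h.x_eq_iff a1 b1).2 ((swForm_eq_iff _ _ _).2 (by rw [a2, b2]; simp; ring))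
  have hze : L.z (φ.symm !₂[2 * t ^ 2, t]) = L.z (φ.symm !₂[2 * (-t) ^ 2, -t]) := by
    have hne : φ (φ.symm !₂[2 * t ^ 2, t]) 1 ≠ φ (φ.symm !₂[2 * (-t) ^ 2, -t]) 1 := by
      rw [a2, b2]; simp; linarith
    have h1 := swForm_height ((h.x_eq_iff a1 b1).1 hxe) hne
    have h3 : (swForm (L.swSign p) (φ (φ.symm !₂[2 * t ^ 2, t]))).2 =
        (swForm (L.swSign p) (φ (φ.symm !₂[2 * (-t) ^ 2, -t]))).2 := by
      rw [← sub_eq_zero, h1, a2, b2]; simp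
    refine le_antisymm (not_lt.1 fun hlt => ?_) (not_lt.1 fun hlt => ?_)
    · exact absurd ((h.order _ b1 _ a1 hxe.symm).1 hlt) (by rw [h3]; exact lt_irrefl _)
    · exact absurd ((h.order _ a1 _ b1 hxe).1 hlt) (by rw [h3]; exact lt_irrefl _)
  have hne : φ.symm !₂[2 * t ^ 2, t] ≠ φ.symm !₂[2 * (-t) ^ 2, -t] := by
    intro e
    have := congrArg (fun q => φ q 1) e
    simp only [a2, b2] at this
    simp at this
    linarith
  obtain ⟨t', ht', he⟩ := ht1 (ht2 (hC _ (mem_baseSingularSet_of_ne hne hxe hze)))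
  obtain ⟨c1, c2⟩ := hsm t' ht' 6 (by norm_num) le_rfl
  obtain ⟨e0, e1⟩ := (swForm_eq_iff _ _ _).1 ((h.x_eq_iff c1 a1).1 he)
  rw [a2, c2] at e0 e1
  simp only [Matrix.cons_val_zero, Matrix.cons_val_one, Matrix.cons_val_fin_one] at e0 e1
  have h3 : t' ^ 3 = 0 := by nlinarith
  have h4 : t' = 0 := pow_eq_zero_iff (by norm_num) |>.1 h3
  rw [h4] at e0
  nlinarith

lemma eventually_cusp_coord (hC : IsCompatible L) {p : Λ}
    {φ : OpenPartialHomeomorph Λ Plane} {ψ : OpenPartialHomeomorph S Plane} {W : Set Λ}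
    (h : L.IsLocalForm cuspForm p φ ψ W) {β : Cell S 1} (hβ : L.x p ∈ openCell 1 β) :
    ∀ᶠ u in 𝓝 (L.x p), u ∈ openCell 1 β → ψ u 1 = 0 := by
  obtain ⟨r, hr, hs⟩ := h.exists_radius h.mem h.mem_nhds
  rw [h.map_eq_zero] at hs
  simp only [PiLp.zero_apply, sub_zero] at hs
  have hsm : ∀ t ∈ Ioo (-r) r, φ.symm !₂[t, 0] ∈ W ∧ φ (φ.symm !₂[t, 0]) = !₂[t, 0] := by
    intro t ht
    exact (hs !₂[t, 0] (by simpa using abs_lt.2 ht) (by simpa using hr)).2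
  have h0 : φ.symm !₂[0, 0] = p := by
    have : (!₂[0, 0] : Plane) = φ p := by
      rw [h.map_eq_zero]; exact Plane.ext (by simp) (by simp)
    rw [this, φ.left_inv h.mem_source]
  have hpath := eventually_mem_image_of_path (β := β) (γ := fun t : ℝ => L.x (φ.symm !₂[t, 0])) hr
    (by
      refine L.continuous_x.comp_continuousOn (φ.continuousOn_symm.comp (s := Ioo (-r) r)
        (f := fun t : ℝ => (!₂[t, 0] : Plane)) ?_ ?_)
      · refine Continuous.continuousOn ?_
        refine (PiLp.continuous_toLp 2 _).comp (continuous_pi fun i => ?_)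
        fin_cases i
        · exact continuous_id
        · exact continuous_const
      · intro t ht
        have := hsm t ht
        show (!₂[t, 0] : Plane) ∈ φ.target
        rw [← this.2]
        exact φ.map_source (h.source this.1))
    (by
      intro t ht t' ht' he
      obtain ⟨a1, a2⟩ := hsm t ht
      obtain ⟨b1, b2⟩ := hsm t' ht'
      obtain ⟨e0, -⟩ := (cuspForm_eq_iff _ _).1 ((h.x_eq_iff a1 b1).1 he)
      rw [a2, b2] at e0
      simpa using e0) (by simp only [h0]; exact hβ) (by
      intro t ht
      obtain ⟨a1, a2⟩ := hsm t ht
      refine hC _ (mem_baseSingularSet fun hr => ?_)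
      obtain ⟨W', hW', hi⟩ := exists_injOn_of_regular hr
      exact h.cusp_not_injOn a1 (by rw [a2]; simp) W' hW' hi)
  simp only [h0] at hpath
  filter_upwards [hpath] with u hu hu'
  obtain ⟨t, ht, rfl⟩ := hu hu'
  obtain ⟨a1, a2⟩ := hsm t ht
  simp only
  rw [(h.base _ a1).2, a2]
  simp [cuspForm]

/-- The sheets that cross at a point of a 1-cell cross all along this cell. -/
lemma eventually_crossing [IsManifold (𝓡 2) ∞ Λ] (hC : IsCompatible L) {p q : Λ}
    (hp : p ∈ L.regular) (hq : q ∈ L.regular)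
    (hpq : p ≠ q) (hx : L.x p = L.x q) (hz : L.z p = L.z q) {β : Cell S 1}
    (hβ : L.x p ∈ openCell 1 β) {W W' : Set Λ} (hW : W ∈ 𝓝 p) (hW' : W' ∈ 𝓝 q) :
    ∀ᶠ u in 𝓝 (L.x p), u ∈ openCell 1 β → ∃ p' ∈ W, ∃ q' ∈ W', L.x p' = u ∧ L.x q' = u ∧
      L.z p' = L.z q' := by
  have := L.t2Space
  obtain ⟨A, B, hA, hB, hAB⟩ := t2_separation_nhds hpq
  obtain ⟨ε, hε, γ, hγc, hγi, hγ0, hγ⟩ := exists_crossing_path hp hq hpq hx hz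
    (inter_mem hW hA) (inter_mem hW' hB)
  have := eventually_mem_image_of_path (β := β) hε hγc hγi (by rwa [hγ0]) (by
    intro t ht
    obtain ⟨p', hp', q', hq', h1, h2, h3⟩ := hγ t ht
    rw [← h1]
    exact hC _ (mem_baseSingularSet_of_ne (disjoint_iff_forall_ne.1 hAB hp'.2 hq'.2)
      (h1.trans h2.symm) h3))
  rw [hγ0] at this
  filter_upwards [this] with u hu hu'
  obtain ⟨t, ht, rfl⟩ := hu hu'
  obtain ⟨p', hp', q', hq', h⟩ := hγ t ht
  exact ⟨p', hp'.1, q', hq'.1, h⟩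

end Cells

end LegendrianSurface

section

open LegendrianSurface

section LocalHomeo

variable {X Y : Type*} [TopologicalSpace X] [TopologicalSpace Y] {f : X → Y} {K : Set Y}

/-- A map with continuous local sections over `K` is a local homeomorphism over `K`. -/
lemma isLocalHomeomorph_restrictPreimage (hf : Continuous f)
    (h : ∀ p, f p ∈ K → ∃ N, IsOpen N ∧ p ∈ N ∧ ∃ U, IsOpen U ∧ f p ∈ U ∧ ∃ s : Y → X,
      ContinuousOn s (U ∩ K) ∧ (∀ u ∈ U ∩ K, s u ∈ N ∧ f (s u) = u) ∧
        ∀ q ∈ N, f q ∈ U ∩ K → s (f q) = q) :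
    IsLocalHomeomorph (K.restrictPreimage f) := by
  refine IsLocalHomeomorph.mk _ ?_
  rintro ⟨p, hp⟩
  obtain ⟨N, hN, hpN, U, hU, hpU, s, hsc, hs1, hs2⟩ := h p hp
  have hfc : Continuous (K.restrictPreimage f) := hf.restrictPreimage
  refine ⟨{ toFun := K.restrictPreimage f
            invFun := fun u => if hu : (u : Y) ∈ U then
              ⟨s u, by rw [mem_preimage, (hs1 u ⟨hu, u.2⟩).2]; exact u.2⟩ else ⟨p, hp⟩
            source := {q | (q : X) ∈ N ∧ f q ∈ U}
            target := {u | (u : Y) ∈ U}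
            map_source' := fun q hq => hq.2
            map_target' := ?_
            left_inv' := ?_
            right_inv' := ?_
            open_source := ?_
            open_target := hU.preimage continuous_subtype_val
            continuousOn_toFun := hfc.continuousOn
            continuousOn_invFun := ?_ }, ⟨hpN, hpU⟩, fun q _ => rfl⟩
  · intro u hu
    have hu' : (u : Y) ∈ U := hu
    simp only [hu', dite_true]
    exact ⟨(hs1 u ⟨hu, u.2⟩).1, by rw [(hs1 u ⟨hu, u.2⟩).2]; exact hu⟩
  · intro q hq
    have hu' : ((K.restrictPreimage f q : K) : Y) ∈ U := hq.2
    simp only [hu', dite_true]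
    exact Subtype.ext (hs2 q hq.1 ⟨hq.2, q.2⟩)
  · intro u hu
    have hu' : (u : Y) ∈ U := hu
    simp only [hu', dite_true]
    exact Subtype.ext (hs1 u ⟨hu, u.2⟩).2
  · rw [IsInducing.subtypeVal.continuousOn_iff]
    have : ContinuousOn (fun u : K => s u) {u : K | (u : Y) ∈ U} :=
      hsc.comp continuous_subtype_val.continuousOn fun u hu => ⟨hu, u.2⟩
    refine this.congr fun u hu => ?_
    have hu' : (u : Y) ∈ U := hu
    simp only [Function.comp_apply, hu', dite_true]
  · exact (hN.preimage continuous_subtype_val).inter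
      (hU.preimage (hf.comp continuous_subtype_val))

lemma eqOn_of_isCoveringMap_restrictPreimage (h : IsCoveringMap (K.restrictPreimage f))
    {A : Type*} [TopologicalSpace A] {T : Set A} (hT : IsPreconnected T) {g₁ g₂ : A → X}
    (h₁ : ContinuousOn g₁ T) (h₂ : ContinuousOn g₂ T) (he : ∀ a ∈ T, f (g₁ a) = f (g₂ a))
    (hK : ∀ a ∈ T, f (g₁ a) ∈ K) {a : A} (ha : a ∈ T) (hga : g₁ a = g₂ a) : EqOn g₁ g₂ T := by
  have hK2 : ∀ a ∈ T, f (g₂ a) ∈ K := fun a ha => he a ha ▸ hK a ha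
  have : PreconnectedSpace T := isPreconnected_iff_preconnectedSpace.1 hT
  have key := h.eq_of_comp_eq (A := T) (g₁ := fun a => ⟨g₁ a, hK a a.2⟩)
    (g₂ := fun a => ⟨g₂ a, hK2 a a.2⟩)
    ((continuousOn_iff_continuous_domRestrict.1 h₁).subtype_mk _)
    ((continuousOn_iff_continuous_domRestrict.1 h₂).subtype_mk _)
    (by funext b; exact Subtype.ext (he b b.2)) ⟨a, ha⟩ (Subtype.ext hga)
  intro b hb
  exact congrArg Subtype.val (congrFun key ⟨b, hb⟩)

end LocalHomeo

variable {S Λ : Type*} [TopologicalSpace S] [ChartedSpace Plane S] [IsManifold (𝓡 2) ∞ S]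
  [TopologicalSpace Λ] [ChartedSpace Plane Λ] [CWComplex (univ : Set S)]
  {L : LegendrianSurface S Λ}

/-- A generic Legendrian surface with a compatible decomposition of the base into cells of dimension
at most two. -/
structure IsCellular (L : LegendrianSurface S Λ) : Prop where
  generic : L.IsGeneric
  compatible : IsCompatible L
  dim_le : ∀ n, Cell S n → n ≤ 2

namespace IsCellular

variable (h : IsCellular L)
include h

lemma regular_of_two {α : Cell S 2} {p : Λ} (hp : L.x p ∈ openCell 2 α) : p ∈ L.regular :=
  regular_of_two_cell h.compatible hp

variable [T2Space S]

lemma regular_or_cusp_of_one {β : Cell S 1} {p : Λ} (hp : L.x p ∈ openCell 1 β) :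
    p ∈ L.regular ∨ p ∈ L.cuspEdge := by
  rcases h.generic.cases p with hr | hr | hr
  · exact Or.inl hr
  · exact Or.inr hr
  · exact absurd hp (swallow_not_over_one_cell h.compatible hr β)

lemma exists_local_section {n : ℕ} (e : Cell S n) (p : Λ) (hp : L.x p ∈ openCell n e) :
    ∃ N, IsOpen N ∧ p ∈ N ∧ ∃ U, IsOpen U ∧ L.x p ∈ U ∧ ∃ s : S → Λ,
      ContinuousOn s (U ∩ openCell n e) ∧ (∀ u ∈ U ∩ openCell n e, s u ∈ N ∧ L.x (s u) = u) ∧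
        ∀ q ∈ N, L.x q ∈ U ∩ openCell n e → s (L.x q) = q := by
  have hreg : p ∈ L.regular → ∃ N, IsOpen N ∧ p ∈ N ∧ ∃ U, IsOpen U ∧ L.x p ∈ U ∧ ∃ s : S → Λ,
      ContinuousOn s (U ∩ openCell n e) ∧ (∀ u ∈ U ∩ openCell n e, s u ∈ N ∧ L.x (s u) = u) ∧
        ∀ q ∈ N, L.x q ∈ U ∩ openCell n e → s (L.x q) = q := by
    intro hr
    obtain ⟨f, hf, hfx⟩ := exists_homeo_of_regular hr
    refine ⟨f.source, f.open_source, hf, f.target, f.open_target, hfx p hf ▸ f.map_source hf,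
      f.symm, f.continuousOn_symm.mono inter_subset_left, fun u hu => ?_, fun q hq _ => ?_⟩
    · exact ⟨f.map_target hu.1, by rw [← hfx _ (f.map_target hu.1), f.right_inv hu.1]⟩
    · rw [← hfx q hq, f.left_inv hq]
  have hn := h.dim_le n e
  interval_cases n
  · obtain ⟨W, hW, hi⟩ := h.generic.exists_isolating p
    refine ⟨interior W, isOpen_interior, mem_interior_iff_mem_nhds.2 hW, univ, isOpen_univ, trivial,
      fun _ => p, continuousOn_const, ?_, ?_⟩
    · rintro u ⟨-, hu⟩
      refine ⟨mem_interior_iff_mem_nhds.2 hW, ?_⟩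
      obtain ⟨a, -, ha⟩ := hp
      obtain ⟨b, -, hb⟩ := hu
      rw [← ha, ← hb, Subsingleton.elim a b]
    · rintro q hq ⟨-, hu⟩
      refine (hi q (interior_subset hq) ?_).symm
      obtain ⟨a, -, ha⟩ := hp
      obtain ⟨b, -, hb⟩ := hu
      rw [← ha, ← hb, Subsingleton.elim a b]
  · rcases h.regular_or_cusp_of_one hp with hr | hr
    · exact hreg hr
    obtain ⟨φ, ψ, W, hf⟩ := exists_isLocalForm_of_cusp hr
    obtain ⟨r, hr0, hrs⟩ := hf.exists_radius hf.mem hf.mem_nhds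
    rw [hf.map_eq_zero] at hrs
    simp only [PiLp.zero_apply, sub_zero] at hrs
    obtain ⟨U, hUs, hU, hpU⟩ := mem_nhds_iff.1 ((hf.eventually_base hr0).and
      (eventually_cusp_coord h.compatible hf hp))
    have hsec : ∀ u ∈ U ∩ openCell 1 e, φ.symm !₂[ψ u 0, 0] ∈ W ∧
        φ (φ.symm !₂[ψ u 0, 0]) = !₂[ψ u 0, 0] := by
      rintro u ⟨hu, -⟩
      exact (hrs _ (by simpa using (hUs hu).1.2.1) (by simpa using hr0)).2
    refine ⟨W, hf.isOpen, hf.mem, U, hU, hpU, fun u => φ.symm !₂[ψ u 0, 0], ?_, ?_, ?_⟩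
    · refine φ.continuousOn_symm.comp (f := fun u => (!₂[ψ u 0, 0] : Plane)) ?_ ?_
      · refine (PiLp.continuous_toLp 2 _).comp_continuousOn (continuousOn_pi.2 fun i => ?_)
        fin_cases i
        · exact (EuclideanSpace.proj (𝕜 := ℝ) (0 : Fin 2)).continuous.comp_continuousOn
            (ψ.continuousOn.mono fun u hu => (hUs hu.1).1.1)
        · exact continuousOn_const
      · intro u hu
        show (!₂[ψ u 0, 0] : Plane) ∈ φ.target
        rw [← (hsec u hu).2]
        exact φ.map_source (hf.source (hsec u hu).1)
    · intro u hu
      refine ⟨(hsec u hu).1, (hf.x_eq_iff' (hsec u hu).1 (hUs hu.1).1.1).2 ?_⟩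
      rw [(hsec u hu).2]
      exact Plane.ext (by simp [cuspForm]) (by simp [cuspForm, (hUs hu.1).2 hu.2])
    · intro q hq hu
      refine hf.eq_of_map_eq (hsec _ hu).1 hq ?_
      have h1 := (hf.base q hq).2
      have h2 := (hUs hu.1).2 hu.2
      rw [(hsec _ hu).2]
      rw [h1] at h2 ⊢
      have h3 : φ q 1 = 0 := by simpa [cuspForm] using h2
      exact Plane.ext (by simp [cuspForm]) (by simp [h3])
  · exact hreg (h.regular_of_two hp)

lemma isCoveringMap {n : ℕ} (e : Cell S n) :
    IsCoveringMap ((openCell n e).restrictPreimage L.x) := by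
  have := L.t2Space
  rw [isCoveringMap_iff_isCoveringMapOn_univ]
  refine IsClosedMap.isCoveringMapOn_of_isLocalHomeomorphOn
    (L.isProperMap.isClosedMap.restrictPreimage _) (fun u _ => ?_) ?_
  · refine Set.Finite.of_finite_image (f := Subtype.val) ?_ Subtype.val_injective.injOn
    refine (h.generic.finite_fiber (u : S)).subset ?_
    rintro _ ⟨q, hq, rfl⟩
    exact congrArg Subtype.val hq
  · rw [preimage_univ, ← isLocalHomeomorph_iff_isLocalHomeomorphOn_univ]
    exact isLocalHomeomorph_restrictPreimage L.continuous_x (h.exists_local_section e)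

lemma exists_tendsto {A : Type*} {l : Filter A} [l.NeBot] {G : A → Λ} {u : S}
    (hc : ∀ B ∈ l, ∃ B' ∈ l, B' ⊆ B ∧ IsPreconnected (G '' B'))
    (hx : Tendsto (fun a => L.x (G a)) l (𝓝 u)) : ∃ p, L.x p = u ∧ Tendsto G l (𝓝 p) := by
  choose W₀ hW₀ hW using h.generic.exists_isolation
  have hshrink : ∀ U ∈ 𝓝 u, ∀ B ∈ l, ∃ B' ∈ l, B' ⊆ B ∧ IsPreconnected (G '' B') ∧
      ∀ q ∈ G '' B', L.x q ∈ U := by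
    intro U hU B hB
    obtain ⟨B', hB', hs, hp⟩ := hc _ (inter_mem hB (hx hU))
    exact ⟨B', hB', hs.trans inter_subset_left, hp, by rintro _ ⟨a, ha, rfl⟩; exact (hs ha).2⟩
  obtain ⟨U, hU, hUp⟩ := h.generic.exists_nhds_of_fiber u W₀ fun p _ => hW₀ p
  obtain ⟨B, hB, -, hBp, hBU⟩ := hshrink U hU univ univ_mem
  obtain ⟨p, hp, hpB⟩ := hUp _ hBp ((Filter.nonempty_of_mem hB).image G) hBU
  refine ⟨p, hp, fun N hN => ?_⟩
  obtain ⟨U', hU', hUW⟩ := hW p _ (inter_mem hN (hW₀ p)) inter_subset_right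
  obtain ⟨B', hB', hs, hBp', hBU'⟩ := hshrink U' (hp ▸ hU') B hB
  rcases hUW _ hBp' hBU' with hc | hc
  · refine mem_map.2 (mem_of_superset hB' fun a ha => ?_)
    exact (hc (mem_image_of_mem G ha)).1
  · obtain ⟨a, ha⟩ := Filter.nonempty_of_mem hB'
    exact absurd (hpB (mem_image_of_mem G (hs ha))) (disjoint_left.1 hc (mem_image_of_mem G ha))

end IsCellular

/-! ### Lifts of characteristic maps -/

/-- `F` is a lift to `L` of the characteristic map of the cell `e`. -/
structure IsLift (L : LegendrianSurface S Λ) {n : ℕ} (e : Cell S n) (F : (Fin n → ℝ) → Λ) :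
    Prop where
  continuousOn : ContinuousOn F (closedBall 0 1)
  x_eq : ∀ θ ∈ closedBall (0 : Fin n → ℝ) 1, L.x (F θ) = map n e θ

lemma neBot_nhdsWithin_ball {n : ℕ} {θ : Fin n → ℝ} (hθ : θ ∈ closedBall (0 : Fin n → ℝ) 1) :
    (𝓝[ball 0 1] θ).NeBot := by
  rw [← mem_closure_iff_nhdsWithin_neBot, closure_ball _ one_ne_zero]
  exact hθ

lemma closedBall_subset_closure_ball {n : ℕ} :
    closedBall (0 : Fin n → ℝ) 1 ⊆ closure (ball (0 : Fin n → ℝ) 1) := by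
  rw [closure_ball _ one_ne_zero]

lemma isPreconnected_ball {n : ℕ} (r : ℝ) : IsPreconnected (ball (0 : Fin n → ℝ) r) :=
  (convex_ball _ _).isPreconnected

namespace IsLift

variable {n : ℕ} {e : Cell S n} {F F' : (Fin n → ℝ) → Λ}

lemma continuousOn_ball (hF : IsLift L e F) : ContinuousOn F (ball 0 1) :=
  hF.continuousOn.mono ball_subset_closedBall

lemma mem (hF : IsLift L e F) {θ : Fin n → ℝ} (hθ : θ ∈ ball (0 : Fin n → ℝ) 1) :
    L.x (F θ) ∈ openCell n e := by
  rw [hF.x_eq θ (ball_subset_closedBall hθ)]; exact map_mem_openCell e hθ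

lemma symm_x (hF : IsLift L e F) {θ : Fin n → ℝ} (hθ : θ ∈ ball (0 : Fin n → ℝ) 1) :
    (map n e).symm (L.x (F θ)) = θ := by
  rw [hF.x_eq θ (ball_subset_closedBall hθ), symm_map e hθ]

variable [T2Space S]

lemma eqOn (h : IsCellular L) (hF : IsLift L e F) (hF' : IsLift L e F') {θ : Fin n → ℝ}
    (hθ : θ ∈ ball (0 : Fin n → ℝ) 1) (he : F θ = F' θ) : EqOn F F' (closedBall 0 1) := by
  have := L.t2Space
  refine Set.EqOn.of_subset_closure (s := ball 0 1) ?_ hF.continuousOn hF'.continuousOn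
    ball_subset_closedBall closedBall_subset_closure_ball
  refine eqOn_of_isCoveringMap_restrictPreimage (h.isCoveringMap e) (isPreconnected_ball 1)
    hF.continuousOn_ball hF'.continuousOn_ball (fun a ha => ?_) (fun a ha => hF.mem ha) hθ he
  rw [hF.x_eq a (ball_subset_closedBall ha), hF'.x_eq a (ball_subset_closedBall ha)]

lemma component (h : IsCellular L) (hF : IsLift L e F) {θ : Fin n → ℝ}
    (hθ : θ ∈ ball (0 : Fin n → ℝ) 1) :
    connectedComponentIn (L.x ⁻¹' openCell n e) (F θ) = F '' ball 0 1 := by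
  have hm : F θ ∈ L.x ⁻¹' openCell n e := hF.mem hθ
  refine Subset.antisymm ?_ ?_
  · have hsub := connectedComponentIn_subset (L.x ⁻¹' openCell n e) (F θ)
    have hE : EqOn (fun q => F ((map n e).symm (L.x q))) id
        (connectedComponentIn (L.x ⁻¹' openCell n e) (F θ)) := by
      refine eqOn_of_isCoveringMap_restrictPreimage (h.isCoveringMap e)
        isPreconnected_connectedComponentIn ?_ continuousOn_id (fun q hq => ?_) (fun q hq => ?_)
        (mem_connectedComponentIn hm) ?_
      · refine hF.continuousOn_ball.comp ((continuousOn_symm' e).comp L.continuous_x.continuousOn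
          fun q hq => hsub hq) fun q hq => symm_mem_ball e (hsub hq)
      · rw [hF.x_eq _ (ball_subset_closedBall (symm_mem_ball e (hsub hq))), map_symm e (hsub hq)]
        rfl
      · exact hF.mem (symm_mem_ball e (hsub hq))
      · simp only [hF.symm_x hθ, id]
    intro q hq
    exact ⟨_, symm_mem_ball e (hsub hq), hE hq⟩
  · refine ((isPreconnected_ball 1).image F hF.continuousOn_ball).subset_connectedComponentIn
      (mem_image_of_mem F hθ) ?_
    rintro _ ⟨a, ha, rfl⟩
    exact hF.mem ha

end IsLift

lemma IsCellular.exists_isLift (h : IsCellular L) [T2Space S] {n : ℕ} (e : Cell S n) {p : Λ}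
    (hp : L.x p ∈ openCell n e) : ∃ F, IsLift L e F ∧ F ((map n e).symm (L.x p)) = p := by
  have := L.t2Space
  have : LocallyCompactSpace Λ := ChartedSpace.locallyCompactSpace Plane Λ
  set B := ball (0 : Fin n → ℝ) 1 with hB
  have hconv : Convex ℝ B := convex_ball _ _
  have : ContractibleSpace B := hconv.contractibleSpace ⟨0, mem_ball_self one_pos⟩
  have : LocallyPathConnectedSpace B := isOpen_ball.locallyPathConnectedSpace
  have hmc : ContinuousOn (map n e) (closedBall 0 1) := continuousOn n e
  set c : C(B, openCell n e) := ⟨fun θ => ⟨map n e θ, map_mem_openCell e θ.2⟩,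
    (continuousOn_iff_continuous_domRestrict.1 (hmc.mono ball_subset_closedBall)).subtype_mk _⟩
  obtain ⟨F, ⟨hF0, hF⟩, -⟩ := (h.isCoveringMap e).existsUnique_continuousMap_lifts c
    ⟨_, symm_mem_ball e hp⟩ ⟨p, hp⟩ (Subtype.ext (map_symm e hp).symm)
  set G : (Fin n → ℝ) → Λ := fun θ => if hθ : θ ∈ B then (F ⟨θ, hθ⟩ : Λ) else p with hG
  have hGF : ∀ θ : B, G θ = F θ := fun θ => by simp [hG, θ.2]
  have hGc : ContinuousOn G B := by
    rw [continuousOn_iff_continuous_domRestrict]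
    refine (continuous_subtype_val.comp F.continuous).congr fun θ => ?_
    exact (hGF θ).symm
  have hGx : ∀ θ ∈ B, L.x (G θ) = map n e θ := by
    intro θ hθ
    rw [hGF ⟨θ, hθ⟩]
    have := congrFun hF ⟨θ, hθ⟩
    exact congrArg Subtype.val this
  have hlim : ∀ θ ∈ closedBall (0 : Fin n → ℝ) 1, ∃ q, L.x q = map n e θ ∧
      Tendsto G (𝓝[B] θ) (𝓝 q) := by
    intro θ hθ
    have := neBot_nhdsWithin_ball hθ
    refine h.exists_tendsto (fun A hA => ?_) ?_
    · obtain ⟨r, hr, hrA⟩ := Metric.mem_nhdsWithin_iff.1 hA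
      refine ⟨ball θ r ∩ B, inter_mem (mem_nhdsWithin_of_mem_nhds (ball_mem_nhds θ hr))
        self_mem_nhdsWithin, hrA, ?_⟩
      exact ((convex_ball θ r).inter hconv).isPreconnected.image _
        (hGc.mono inter_subset_right)
    · refine (((hmc θ hθ).mono ball_subset_closedBall).tendsto).congr' ?_
      filter_upwards [self_mem_nhdsWithin] with a ha
      exact (hGx a ha).symm
  have : Nonempty Λ := ⟨p⟩
  choose! q hqx hq using hlim
  have hext : ∀ θ ∈ closedBall (0 : Fin n → ℝ) 1, extendFrom B G θ = q θ := fun θ hθ =>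
    extendFrom_eq (closedBall_subset_closure_ball hθ) (hq θ hθ)
  refine ⟨extendFrom B G, ⟨continuousOn_extendFrom closedBall_subset_closure_ball
    fun θ hθ => ⟨q θ, hq θ hθ⟩, fun θ hθ => by rw [hext θ hθ, hqx θ hθ]⟩, ?_⟩
  have hp' := symm_mem_ball e hp
  rw [extendFrom_eq (closedBall_subset_closure_ball (ball_subset_closedBall hp'))
    (hGc _ hp').tendsto, hGF ⟨_, hp'⟩, hF0]

end

section

open LegendrianSurface

variable {S Λ : Type*} [TopologicalSpace S] [ChartedSpace Plane S] [IsManifold (𝓡 2) ∞ S]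
  [TopologicalSpace Λ] [ChartedSpace Plane Λ] [CWComplex (univ : Set S)]
  {L : LegendrianSurface S Λ} {n : ℕ} {e : Cell S n}

/-- A locally constant property is constant on the unit ball. -/
lemma forall_ball {p : (Fin n → ℝ) → Prop}
    (h1 : ∀ θ ∈ ball (0 : Fin n → ℝ) 1, p θ → ∀ᶠ θ' in 𝓝 θ, p θ')
    (h2 : ∀ θ ∈ ball (0 : Fin n → ℝ) 1, ¬ p θ → ∀ᶠ θ' in 𝓝 θ, ¬ p θ') {θ₀ : Fin n → ℝ}
    (hθ₀ : θ₀ ∈ ball (0 : Fin n → ℝ) 1) (h0 : p θ₀) : ∀ θ ∈ ball (0 : Fin n → ℝ) 1, p θ := by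
  have := (isPreconnected_ball (n := n) 1).subset_left_of_subset_union
    (u := {θ | ∀ᶠ θ' in 𝓝 θ, p θ'}) (v := {θ | ∀ᶠ θ' in 𝓝 θ, ¬ p θ'})
    isOpen_setOfPred_eventually_nhds isOpen_setOfPred_eventually_nhds ?_ ?_ ⟨θ₀, hθ₀, h1 θ₀ hθ₀ h0⟩
  · exact fun θ hθ => (this hθ).self_of_nhds
  · rw [disjoint_left]
    exact fun θ ha hb => hb.self_of_nhds ha.self_of_nhds
  · intro θ hθ
    by_cases hp : p θ
    · exact Or.inl (h1 θ hθ hp)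
    · exact Or.inr (h2 θ hθ hp)

namespace IsCellular

variable (h : IsCellular L) [T2Space S]
include h

/-- Above a 1-cell, the points near a point of a cusp edge lie on the cusp edge. -/
lemma eventually_cusp {β : Cell S 1} {p : Λ} (hp : p ∈ L.cuspEdge) (hβ : L.x p ∈ openCell 1 β) :
    ∀ᶠ q in 𝓝 p, L.x q ∈ openCell 1 β → q ∈ L.cuspEdge := by
  obtain ⟨φ, ψ, W, hf⟩ := exists_isLocalForm_of_cusp hp
  filter_upwards [hf.mem_nhds, L.continuous_x.continuousAt.eventually
    (eventually_cusp_coord h.compatible hf hβ)] with q hq hq' hx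
  have h1 := hq' hx
  rw [(hf.base q hq).2] at h1
  have h2 : φ q 1 = 0 := by simpa [LegendrianSurface.cuspForm] using h1
  exact h.generic.cusp_of_not_injOn (hf.cusp_not_injOn hq h2) (hf.cusp_not_hasTriples hq)

end IsCellular

namespace Sheet

lemma exists_lift (h : IsCellular L) [T2Space S] (s : Sheet L n e) :
    ∃ F, IsLift L e F ∧ s.1 = F '' ball 0 1 := by
  obtain ⟨⟨p, hp, hs⟩, -⟩ := s.2
  obtain ⟨F, hF, hFp⟩ := h.exists_isLift e hp
  refine ⟨F, hF, ?_⟩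
  rw [← hF.component h (symm_mem_ball e hp), hFp, hs]

/-- The lift to the sheet `s` of the characteristic map of the cell. -/
def lift (s : Sheet L n e) : (Fin n → ℝ) → Λ :=
  if h : ∃ F, IsLift L e F ∧ s.1 = F '' ball 0 1 then h.choose else fun _ => s.2.1.choose

variable (h : IsCellular L) [T2Space S] (s t : Sheet L n e)
include h

lemma isLift : IsLift L e s.lift := by
  rw [lift, dif_pos (s.exists_lift h)]
  exact (s.exists_lift h).choose_spec.1

lemma eq_image : s.1 = s.lift '' ball 0 1 := by
  rw [lift, dif_pos (s.exists_lift h)]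
  exact (s.exists_lift h).choose_spec.2

lemma x_lift {θ : Fin n → ℝ} (hθ : θ ∈ closedBall (0 : Fin n → ℝ) 1) :
    L.x (s.lift θ) = map n e θ := (s.isLift h).x_eq θ hθ

lemma lift_mem {θ : Fin n → ℝ} (hθ : θ ∈ ball (0 : Fin n → ℝ) 1) : s.lift θ ∈ s.1 := by
  rw [s.eq_image h]; exact mem_image_of_mem _ hθ

lemma mem_openCell {s : Sheet L n e} {p : Λ} (hp : p ∈ s.1) : L.x p ∈ openCell n e := by
  rw [s.eq_image h] at hp
  obtain ⟨θ, hθ, rfl⟩ := hp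
  exact (s.isLift h).mem hθ

lemma lift_symm {s : Sheet L n e} {p : Λ} (hp : p ∈ s.1) :
    s.lift ((map n e).symm (L.x p)) = p := by
  rw [s.eq_image h] at hp
  obtain ⟨θ, hθ, rfl⟩ := hp
  rw [(s.isLift h).symm_x hθ]

lemma eq_lift {s : Sheet L n e} {p : Λ} (hp : p ∈ s.1) {θ : Fin n → ℝ}
    (hθ : θ ∈ ball (0 : Fin n → ℝ) 1) (hx : L.x p = map n e θ) : p = s.lift θ := by
  rw [← lift_symm h hp, hx, symm_map e hθ]

variable {s t} in
lemma eq_of_lift_eq {θ : Fin n → ℝ} (hθ : θ ∈ ball (0 : Fin n → ℝ) 1)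
    (he : s.lift θ = t.lift θ) : s = t := by
  refine Subtype.ext ?_
  rw [s.eq_image h, t.eq_image h]
  exact ((s.isLift h).eqOn h (t.isLift h) hθ he |>.mono ball_subset_closedBall).image_eq

variable {s t} in
lemma eq_of_mem {p : Λ} (hp : p ∈ s.1) (hp' : p ∈ t.1) : s = t := by
  have hx := mem_openCell h hp
  refine eq_of_lift_eq h (symm_mem_ball e hx) ?_
  rw [lift_symm h hp, lift_symm h hp']

lemma continuousAt_lift {θ : Fin n → ℝ} (hθ : θ ∈ ball (0 : Fin n → ℝ) 1) :
    ContinuousAt s.lift θ :=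
  (s.isLift h).continuousOn.continuousAt (mem_of_superset (isOpen_ball.mem_nhds hθ)
    ball_subset_closedBall)

lemma tendsto_lift {θ : Fin n → ℝ} (hθ : θ ∈ closedBall (0 : Fin n → ℝ) 1) :
    Tendsto s.lift (𝓝[ball 0 1] θ) (𝓝 (s.lift θ)) :=
  ((s.isLift h).continuousOn θ hθ).mono ball_subset_closedBall

lemma limit_eq {θ : Fin n → ℝ} (hθ : θ ∈ closedBall (0 : Fin n → ℝ) 1) :
    s.limit θ = s.lift θ := by
  have := L.t2Space
  have := neBot_nhdsWithin_ball hθ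
  have hF := s.isLift h
  have hfil : 𝓟 s.1 ⊓ comap L.x (Filter.map (map n e) (𝓝[ball 0 1] θ)) =
      Filter.map s.lift (𝓝[ball 0 1] θ) := by
    refine le_antisymm ?_ (le_inf ?_ ?_)
    · intro A hA
      have hA' : s.lift ⁻¹' A ∩ ball 0 1 ∈ 𝓝[ball 0 1] θ := inter_mem hA self_mem_nhdsWithin
      refine mem_of_superset (inter_mem_inf (mem_principal_self _)
        (preimage_mem_comap (image_mem_map hA'))) ?_
      rintro q ⟨hq, θ', ⟨h1, h2⟩, h3⟩
      rw [eq_lift h hq h2 h3.symm]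
      exact h1
    · rw [le_principal_iff]
      exact mem_map.2 (mem_of_superset self_mem_nhdsWithin fun θ' hθ' => s.lift_mem h hθ')
    · rw [← map_le_iff_le_comap, Filter.map_map]
      refine le_of_eq (Filter.map_congr ?_)
      filter_upwards [self_mem_nhdsWithin] with θ' hθ'
      exact s.x_lift h (ball_subset_closedBall hθ')
  have hiff : ∀ p, s.Adherent θ p ↔ p = s.lift θ := by
    intro p
    unfold Adherent
    rw [hfil]
    constructor
    · intro hc
      have hle : 𝓝 p ⊓ Filter.map s.lift (𝓝[ball 0 1] θ) ≤ 𝓝 p ⊓ 𝓝 (s.lift θ) :=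
        inf_le_inf_left _ (s.tendsto_lift h hθ)
      have : (𝓝 p ⊓ 𝓝 (s.lift θ)).NeBot := Filter.NeBot.mono hc hle
      exact eq_of_nhds_neBot this
    · rintro rfl
      exact ClusterPt.of_le_nhds (s.tendsto_lift h hθ)
  unfold limit
  have hex : ∃ p, s.Adherent θ p := ⟨_, (hiff _).2 rfl⟩
  rw [dif_pos hex]
  exact (hiff _).1 hex.choose_spec

lemma not_cusp_of_mem {s : Sheet L n e} {p : Λ} (hp : p ∈ s.1) : p ∉ L.cuspEdge := by
  have hn := h.dim_le n e
  intro hc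
  refine s.2.2 ?_
  have hx := mem_openCell h hp
  obtain rfl | rfl | rfl : n = 0 ∨ n = 1 ∨ n = 2 := by omega
  · rw [s.eq_image h] at hp ⊢
    rintro _ ⟨θ, -, rfl⟩
    obtain ⟨θ', -, rfl⟩ := hp
    rwa [Subsingleton.elim θ θ']
  · rw [s.eq_image h]
    rintro _ ⟨θ, hθ, rfl⟩
    refine forall_ball (p := fun θ => s.lift θ ∈ L.cuspEdge) (fun θ hθ h1 => ?_) (fun θ hθ h1 => ?_)
      (symm_mem_ball e hx) (by simp only [lift_symm h hp]; exact hc) θ hθ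
    · filter_upwards [(s.continuousAt_lift h hθ).eventually
        (h.eventually_cusp h1 ((s.isLift h).mem hθ)), isOpen_ball.mem_nhds hθ] with θ' h2 h3
      exact h2 ((s.isLift h).mem h3)
    · have hr := (h.regular_or_cusp_of_one ((s.isLift h).mem hθ)).resolve_right h1
      filter_upwards [(s.continuousAt_lift h hθ).eventually (isOpen_regular.mem_nhds hr)] with θ' h2
      exact fun h3 => not_regular_of_cusp h3 h2
  · exact absurd (h.regular_of_two hx) (not_regular_of_cusp hc)

omit h [T2Space S] in
lemma exists_mem {p : Λ} (hp : L.x p ∈ openCell n e)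
    (hc : p ∉ L.cuspEdge) : ∃ s : Sheet L n e, p ∈ s.1 :=
  ⟨⟨connectedComponentIn (L.x ⁻¹' openCell n e) p, ⟨p, hp, rfl⟩,
    fun hs => hc (hs (mem_connectedComponentIn hp))⟩, mem_connectedComponentIn hp⟩

lemma regular_of_mem {s : Sheet L n e} (hn : n ≠ 0) {p : Λ} (hp : p ∈ s.1) : p ∈ L.regular := by
  have hn2 := h.dim_le n e
  have hx := mem_openCell h hp
  obtain rfl | rfl : n = 1 ∨ n = 2 := by omega
  · exact (h.regular_or_cusp_of_one hx).resolve_right (not_cusp_of_mem h hp)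
  · exact h.regular_of_two hx

lemma continuousAt_z_lift {θ : Fin n → ℝ} (hθ : θ ∈ ball (0 : Fin n → ℝ) 1) :
    ContinuousAt (fun θ => L.z (s.lift θ)) θ :=
  L.continuous_z.continuousAt.comp (s.continuousAt_lift h hθ)

variable [IsManifold (𝓡 2) ∞ Λ]

variable {s t} in
lemma trichotomy (hst : s ≠ t) : (∀ θ ∈ ball (0 : Fin n → ℝ) 1, L.z (t.lift θ) < L.z (s.lift θ)) ∨
    (∀ θ ∈ ball (0 : Fin n → ℝ) 1, L.z (s.lift θ) < L.z (t.lift θ)) ∨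
    n ≠ 2 ∧ ∀ θ ∈ ball (0 : Fin n → ℝ) 1, L.z (s.lift θ) = L.z (t.lift θ) := by
  have h0 : (0 : Fin n → ℝ) ∈ ball (0 : Fin n → ℝ) 1 := mem_ball_self one_pos
  have hne : ∀ θ ∈ ball (0 : Fin n → ℝ) 1, s.lift θ ≠ t.lift θ := fun θ hθ he =>
    hst (eq_of_lift_eq h hθ he)
  have hxx : ∀ θ ∈ ball (0 : Fin n → ℝ) 1, L.x (s.lift θ) = L.x (t.lift θ) := fun θ hθ => by
    rw [s.x_lift h (ball_subset_closedBall hθ), t.x_lift h (ball_subset_closedBall hθ)]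
  by_cases hz : ∃ θ₀ ∈ ball (0 : Fin n → ℝ) 1, L.z (s.lift θ₀) = L.z (t.lift θ₀)
  · obtain ⟨θ₀, hθ₀, hz⟩ := hz
    refine Or.inr (Or.inr ?_)
    obtain ⟨m, hm, e', he'⟩ := h.compatible _
      (mem_baseSingularSet_of_ne (hne θ₀ hθ₀) (hxx θ₀ hθ₀) hz)
    have hnm := dim_eq_of_mem_openCell he' ((s.isLift h).mem hθ₀)
    refine ⟨by omega, ?_⟩
    obtain rfl | rfl : n = 0 ∨ n = 1 := by omega
    · intro θ _
      rwa [Subsingleton.elim θ θ₀]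
    · refine forall_ball (p := fun θ => L.z (s.lift θ) = L.z (t.lift θ)) (fun θ hθ h1 => ?_)
        (fun θ hθ h1 => ?_) hθ₀ hz
      · have hrs := regular_of_mem h (s := s) one_ne_zero (s.lift_mem h hθ)
        have hrt := regular_of_mem h (s := t) one_ne_zero (t.lift_mem h hθ)
        obtain ⟨W, hW, hi⟩ := exists_injOn_of_regular hrs
        obtain ⟨W', hW', hi'⟩ := exists_injOn_of_regular hrt
        have hev := eventually_crossing h.compatible hrs hrt (hne θ hθ) (hxx θ hθ) h1
          ((s.isLift h).mem hθ) hW hW'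
        filter_upwards [(L.continuous_x.continuousAt.comp (s.continuousAt_lift h hθ)).eventually hev,
          (s.continuousAt_lift h hθ).eventually hW, (t.continuousAt_lift h hθ).eventually hW',
          isOpen_ball.mem_nhds hθ] with θ' a1 a2 a3 a4
        obtain ⟨p, hp, q, hq, b1, b2, b3⟩ := a1 ((s.isLift h).mem a4)
        rw [← hi hp a2 b1, ← hi' hq a3 (b2.trans (hxx θ' a4)), b3]
      · filter_upwards [((s.continuousAt_z_lift h hθ).sub (t.continuousAt_z_lift h hθ)).eventually_ne
          (sub_ne_zero.2 h1)] with θ' h2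
        exact sub_ne_zero.1 h2
  · push Not at hz
    rcases lt_or_gt_of_ne (hz 0 h0) with hlt | hlt
    · refine Or.inr (Or.inl (forall_ball (p := fun θ => L.z (s.lift θ) < L.z (t.lift θ))
        (fun θ hθ h1 => (s.continuousAt_z_lift h hθ).eventually_lt (t.continuousAt_z_lift h hθ) h1)
        (fun θ hθ h1 => ?_) h0 hlt))
      filter_upwards [(t.continuousAt_z_lift h hθ).eventually_lt (s.continuousAt_z_lift h hθ)
        (lt_of_le_of_ne (not_lt.1 h1) (hz θ hθ).symm)] with θ' h2
      exact h2.not_gt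
    · refine Or.inl (forall_ball (p := fun θ => L.z (t.lift θ) < L.z (s.lift θ))
        (fun θ hθ h1 => (t.continuousAt_z_lift h hθ).eventually_lt (s.continuousAt_z_lift h hθ) h1)
        (fun θ hθ h1 => ?_) h0 hlt)
      filter_upwards [(s.continuousAt_z_lift h hθ).eventually_lt (t.continuousAt_z_lift h hθ)
        (lt_of_le_of_ne (not_lt.1 h1) (hz θ hθ))] with θ' h2
      exact h2.not_gt

variable {s t}

omit [IsManifold (𝓡 2) ∞ Λ] in
lemma above_iff_forall : s.Above t ↔
    ∀ θ ∈ ball (0 : Fin n → ℝ) 1, L.z (t.lift θ) < L.z (s.lift θ) := by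
  constructor
  · intro ha θ hθ
    exact ha _ (s.lift_mem h hθ) _ (t.lift_mem h hθ) (by
      rw [s.x_lift h (ball_subset_closedBall hθ), t.x_lift h (ball_subset_closedBall hθ)])
  · intro ha p hp q hq hx
    have := ha _ (symm_mem_ball e (mem_openCell h hp))
    rw [lift_symm h hp] at this
    rwa [hx, lift_symm h hq] at this

lemma above_iff {θ : Fin n → ℝ} (hθ : θ ∈ ball (0 : Fin n → ℝ) 1) :
    s.Above t ↔ L.z (t.lift θ) < L.z (s.lift θ) := by
  rw [above_iff_forall h]
  refine ⟨fun ha => ha θ hθ, fun hz => ?_⟩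
  have hst : s ≠ t := fun e => by rw [e] at hz; exact lt_irrefl _ hz
  rcases trichotomy h hst with ha | ha | ⟨-, ha⟩
  · exact ha
  · exact absurd (ha θ hθ) hz.not_gt
  · exact absurd (ha θ hθ) hz.ne'

lemma above_of_z_lt {θ : Fin n → ℝ} (hθ : θ ∈ closedBall (0 : Fin n → ℝ) 1)
    (hz : L.z (t.lift θ) < L.z (s.lift θ)) : s.Above t := by
  have := neBot_nhdsWithin_ball hθ
  have h1 := (L.continuous_z.continuousAt.tendsto.comp (t.tendsto_lift h hθ)).eventually_lt
    (L.continuous_z.continuousAt.tendsto.comp (s.tendsto_lift h hθ)) hz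
  obtain ⟨θ', h2, h3⟩ := (h1.and self_mem_nhdsWithin).exists
  exact (above_iff h h3).2 h2

lemma Above.ne (ha : s.Above t) : s ≠ t := by
  rintro rfl
  exact lt_irrefl _ ((above_iff h (mem_ball_self one_pos)).1 ha)

lemma Above.asymm (ha : s.Above t) : ¬ t.Above s := fun hb =>
  lt_asymm ((above_iff h (mem_ball_self one_pos)).1 ha) ((above_iff h (mem_ball_self one_pos)).1 hb)

lemma Above.trans {r : Sheet L n e} (ha : s.Above t) (hb : t.Above r) : s.Above r :=
  (above_iff h (mem_ball_self one_pos)).2 (((above_iff h (mem_ball_self one_pos)).1 hb).trans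
    ((above_iff h (mem_ball_self one_pos)).1 ha))

lemma above_or_above {α : Cell S 2} {s t : Sheet L 2 α} (hst : s ≠ t) : s.Above t ∨ t.Above s := by
  rcases trichotomy h hst with ha | ha | ⟨hc, -⟩
  · exact Or.inl ((above_iff_forall h).2 ha)
  · exact Or.inr ((above_iff_forall h).2 ha)
  · exact absurd rfl hc

omit [IsManifold (𝓡 2) ∞ Λ] in
lemma finite : Finite (Sheet L n e) := by
  have h0 : (0 : Fin n → ℝ) ∈ ball (0 : Fin n → ℝ) 1 := mem_ball_self one_pos
  have := (h.generic.finite_fiber (map n e 0)).to_subtype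
  exact Finite.of_injective (β := L.x ⁻¹' {map n e 0})
    (fun s => ⟨s.lift 0, s.x_lift h (ball_subset_closedBall h0)⟩)
    fun s t hst => eq_of_lift_eq h h0 (congrArg Subtype.val hst)

end Sheet

lemma IsCellular.nonempty_enumeration (h : IsCellular L) [T2Space S] [IsManifold (𝓡 2) ∞ Λ] (n : ℕ)
    (e : Cell S n) : Nonempty (Enumeration L n e) := by
  have := Sheet.finite h (e := e)
  obtain ⟨k, ⟨g⟩⟩ := Finite.exists_equiv_fin (Sheet L n e)
  let key : Sheet L n e → ℝ ×ₗ Fin k := fun s => toLex (-L.z (s.lift 0), g s)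
  have hkey : Function.Injective key := fun s t hst => g.injective (congrArg (fun a => (ofLex a).2) hst)
  have := Fintype.ofFinite (Sheet L n e)
  let A : Finset (ℝ ×ₗ Fin k) := Finset.univ.image key
  let g' : Sheet L n e ≃ A := Equiv.ofBijective
    (fun s => ⟨key s, Finset.mem_image_of_mem key (Finset.mem_univ s)⟩)
    ⟨fun s t hst => hkey (congrArg Subtype.val hst), fun ⟨a, ha⟩ => by
      obtain ⟨s, -, hs⟩ := Finset.mem_image.1 ha
      exact ⟨s, Subtype.ext hs⟩⟩
  let o := A.orderIsoOfFin rfl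
  refine ⟨⟨_, o.toEquiv.trans g'.symm, fun i j ha => o.lt_iff_lt.1 ?_⟩⟩
  have hg : ∀ i, (o i : ℝ ×ₗ Fin k) = key (g'.symm (o i)) := fun i =>
    congrArg Subtype.val (g'.apply_symm_apply (o i)).symm
  change (o i : ℝ ×ₗ Fin k) < o j
  rw [hg i, hg j]
  exact Prod.Lex.toLex_lt_toLex.2
    (Or.inl (neg_lt_neg ((Sheet.above_iff h (mem_ball_self one_pos)).1 ha)))

end

section

open LegendrianSurface

variable {S Λ : Type*} [TopologicalSpace S] [ChartedSpace Plane S] [IsManifold (𝓡 2) ∞ S]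
  [TopologicalSpace Λ] [ChartedSpace Plane Λ] [CWComplex (univ : Set S)]
  {L : LegendrianSurface S Λ} {n : ℕ} {e : Cell S n}

lemma tendsto_map {θ : Fin n → ℝ} (hθ : θ ∈ closedBall (0 : Fin n → ℝ) 1) :
    Tendsto (map n e) (𝓝[ball 0 1] θ) (𝓝 (map n e θ)) :=
  ((continuousOn n e) θ hθ).mono ball_subset_closedBall

namespace Sheet

variable (h : IsCellular L) [T2Space S]
include h

lemma eventually_mem_iff {θ : Fin n → ℝ} (hθ : θ ∈ closedBall (0 : Fin n → ℝ) 1) {p : Λ}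
    (hp : L.x p = map n e θ) : ∃ W₀ ∈ 𝓝 p, ∀ W ∈ 𝓝 p, W ⊆ W₀ →
      ∀ᶠ θ' in 𝓝[ball 0 1] θ, ∀ s : Sheet L n e, s.lift θ' ∈ W ↔ s.lift θ = p := by
  have := L.t2Space
  have := Sheet.finite h (e := e)
  obtain ⟨V, hV, hd⟩ := (h.generic.finite_fiber (L.x p)).t2_separation
  refine ⟨V p, (hV p).2.mem_nhds (hV p).1, fun W hW hWV => ?_⟩
  rw [Filter.eventually_all]
  intro s
  by_cases hs : s.lift θ = p
  · filter_upwards [s.tendsto_lift h hθ (hs ▸ hW)] with θ' h1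
    exact ⟨fun _ => hs, fun _ => h1⟩
  · filter_upwards [s.tendsto_lift h hθ ((hV (s.lift θ)).2.mem_nhds (hV _).1)] with θ' h1
    refine ⟨fun h2 => absurd (hWV h2) ?_, fun h2 => absurd h2 hs⟩
    exact disjoint_left.1 (hd ((s.x_lift h hθ).trans hp.symm) (mem_singleton _) hs) h1

lemma exists_lift_eq {θ : Fin n → ℝ} (hθ : θ ∈ ball (0 : Fin n → ℝ) 1) {q : Λ}
    (hx : L.x q = map n e θ) (hq : q ∉ L.cuspEdge) : ∃ s : Sheet L n e, s.lift θ = q := by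
  obtain ⟨s, hs⟩ := Sheet.exists_mem (e := e) (p := q) (by rw [hx]; exact map_mem_openCell e hθ) hq
  exact ⟨s, (eq_lift h hs hθ hx).symm⟩

lemma lift_not_cusp (s : Sheet L n e) {θ : Fin n → ℝ} (hθ : θ ∈ ball (0 : Fin n → ℝ) 1) :
    s.lift θ ∉ L.cuspEdge := not_cusp_of_mem h (s.lift_mem h hθ)

variable {θ : Fin n → ℝ} (hθ : θ ∈ closedBall (0 : Fin n → ℝ) 1) {p : Λ}
include hθ

/-- A point over the boundary of a cell with standard neighbourhoods has nearby fibres that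
consist of the sheets with this point as limit and of points of cusp edges. -/
lemma exists_near (hp : L.x p = map n e θ) {Q : Set Λ → S → Prop} {W₁ : Set Λ} (hW₁ : W₁ ∈ 𝓝 p)
    (hQ : ∀ W ∈ 𝓝 p, W ⊆ W₁ → ∀ᶠ u in 𝓝 (L.x p), u ∈ openCell n e → Q W u) :
    ∃ W ∈ 𝓝 p, W ⊆ W₁ ∧ ∃ θ' ∈ ball (0 : Fin n → ℝ) 1, Q W (map n e θ') ∧
      (∀ s : Sheet L n e, s.lift θ' ∈ W ↔ s.lift θ = p) := by
  have := neBot_nhdsWithin_ball hθ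
  obtain ⟨W₀, hW₀, hW⟩ := eventually_mem_iff h hθ hp
  have hWi : W₀ ∩ W₁ ∈ 𝓝 p := inter_mem hW₀ hW₁
  have h1 := hW _ hWi inter_subset_left
  have h2 := tendsto_map (e := e) hθ
  rw [← hp] at h2
  have h3 := h2.eventually (hQ _ hWi inter_subset_right)
  obtain ⟨θ', ⟨a1, a2⟩, a3⟩ := ((h1.and h3).and self_mem_nhdsWithin).exists
  exact ⟨_, hWi, inter_subset_right, θ', a3, a2 (map_mem_openCell e a3), a1⟩

lemma existsUnique_of_regular (hp : L.x p = map n e θ) (hr : p ∈ L.regular) :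
    ∃! s : Sheet L n e, s.lift θ = p := by
  obtain ⟨W₁, hW₁, hi⟩ := exists_injOn_of_regular hr
  obtain ⟨W, hW, hWs, θ', hθ', ⟨q, hq⟩, hiff⟩ := exists_near h hθ hp
    (Q := fun W u => ∃ q, W ∩ L.x ⁻¹' {u} = {q})
    (inter_mem hW₁ (isOpen_regular.mem_nhds hr)) fun W hW hWs => by
      filter_upwards [eventually_fiber_of_regular hr hW
        (hi.mono (hWs.trans inter_subset_left))] with u hu _ using hu
  have hq' : q ∈ W ∩ L.x ⁻¹' {map n e θ'} := hq ▸ mem_singleton q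
  obtain ⟨s, hs⟩ := exists_lift_eq h hθ' hq'.2 fun hc => not_regular_of_cusp hc (hWs hq'.1).2
  refine ⟨s, (hiff s).1 (hs ▸ hq'.1), fun t ht => ?_⟩
  have : t.lift θ' ∈ W ∩ L.x ⁻¹' {map n e θ'} :=
    ⟨(hiff t).2 ht, t.x_lift h (ball_subset_closedBall hθ')⟩
  rw [hq] at this
  exact eq_of_lift_eq h hθ' (this.trans hs.symm)

variable [IsManifold (𝓡 2) ∞ Λ]

lemma cases_of_cusp (hp : L.x p = map n e θ) (hc : p ∈ L.cuspEdge) :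
    (∀ s : Sheet L n e, s.lift θ ≠ p) ∨ ∃ s t : Sheet L n e, s.Above t ∧ s.lift θ = p ∧
      t.lift θ = p ∧ ∀ r : Sheet L n e, r.lift θ = p → r = s ∨ r = t := by
  obtain ⟨φ, ψ, W₁, hf⟩ := exists_isLocalForm_of_cusp hc
  obtain ⟨W, hW, hWs, θ', hθ', hQ, hiff⟩ := exists_near h hθ hp
    (Q := fun W u => W ∩ L.x ⁻¹' {u} = ∅ ∨ (∃ q ∈ L.cuspEdge, W ∩ L.x ⁻¹' {u} = {q}) ∨
      ∃ q ∈ L.regular, ∃ q' ∈ L.regular, L.z q' < L.z q ∧ W ∩ L.x ⁻¹' {u} = {q, q'})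
    hf.mem_nhds fun W hW hWs => by
      filter_upwards [h.generic.eventually_fiber_of_cusp hf hW hWs] with u hu _ using hu
  have hmem : ∀ s : Sheet L n e, s.lift θ = p → s.lift θ' ∈ W ∩ L.x ⁻¹' {map n e θ'} :=
    fun s hs => ⟨(hiff s).2 hs, s.x_lift h (ball_subset_closedBall hθ')⟩
  rcases hQ with hQ | ⟨q, hq, hQ⟩ | ⟨q, hq, q', hq', hz, hQ⟩
  · refine Or.inl fun s hs => ?_
    have := hmem s hs
    rw [hQ] at this
    exact this
  · refine Or.inl fun s hs => ?_
    have := hmem s hs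
    rw [hQ] at this
    exact s.lift_not_cusp h hθ' (this ▸ hq)
  · right
    have m1 : q ∈ W ∩ L.x ⁻¹' {map n e θ'} := hQ ▸ mem_insert _ _
    have m2 : q' ∈ W ∩ L.x ⁻¹' {map n e θ'} := hQ ▸ mem_insert_of_mem _ rfl
    obtain ⟨s, hs⟩ := exists_lift_eq h hθ' m1.2 fun hc => not_regular_of_cusp hc hq
    obtain ⟨t, ht⟩ := exists_lift_eq h hθ' m2.2 fun hc => not_regular_of_cusp hc hq'
    refine ⟨s, t, (above_iff h hθ').2 (by rw [hs, ht]; exact hz), (hiff s).1 (hs ▸ m1.1),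
      (hiff t).1 (ht ▸ m2.1), fun r hr => ?_⟩
    have := hmem r hr
    rw [hQ] at this
    rcases this with h1 | h1
    · exact Or.inl (eq_of_lift_eq h hθ' (h1.trans hs.symm))
    · exact Or.inr (eq_of_lift_eq h hθ' (h1.trans ht.symm))

/-- Either a single sheet, or three sheets `a`, `b`, `c` have a given swallowtail point as limit; in
the latter case `a` is separated from the other ones by the cusp edges, and it is above them at an
upward swallowtail point and below them at a downward one. -/
lemma cases_of_swallow (hn : n ≠ 0) (hp : L.x p = map n e θ) {σ : ℝ} (hσ : σ = 1 ∨ σ = -1)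
    {φ : OpenPartialHomeomorph Λ Plane} {ψ : OpenPartialHomeomorph S Plane} {W₁ W₂ : Set Λ}
    (hsw : p ∈ L.swallowtail) (hf : L.IsLocalForm (swForm σ) p φ ψ W₁) (hW₂ : W₂ ∈ 𝓝 p) :
    ∃ θ' ∈ ball (0 : Fin n → ℝ) 1,
      (∃ s : Sheet L n e, s.lift θ = p ∧ (∀ r : Sheet L n e, r.lift θ = p → r = s) ∧
        s.lift θ' ∈ W₂ ∧ disc φ (s.lift θ') < 0) ∨
      ∃ a b c : Sheet L n e, a.lift θ = p ∧ b.lift θ = p ∧ c.lift θ = p ∧ b ≠ c ∧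
        (∀ r : Sheet L n e, r.lift θ = p → r = a ∨ r = b ∨ r = c) ∧
        (σ = 1 → a.Above b ∧ a.Above c) ∧ (σ = -1 → b.Above a ∧ c.Above a) ∧
        (a.lift θ' ∈ W₂ ∧ b.lift θ' ∈ W₂ ∧ c.lift θ' ∈ W₂) ∧
        0 < disc φ (a.lift θ') ∧ disc φ (b.lift θ') < 0 ∧ disc φ (c.lift θ') < 0 := by
  have hn2 := h.dim_le n e
  have hxp : L.x p ∉ openCell n e := by
    obtain rfl | rfl : n = 1 ∨ n = 2 := by omega
    · exact swallow_not_over_one_cell h.compatible hsw e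
    · exact fun hx => not_regular_of_swallow hsw (h.regular_of_two hx)
  obtain ⟨W, hW, hWs, θ', hθ', hQ, hiff⟩ := exists_near h hθ hp
    (Q := fun W u => SwallowFiber L σ φ W u) (inter_mem hf.mem_nhds hW₂) fun W hW hWs => by
      filter_upwards [h.generic.eventually_fiber_of_swallow hf hσ hW
        (hWs.trans inter_subset_left)] with u hu hue
      exact hu fun hc => hxp (hc ▸ hue)
  have hmem : ∀ s : Sheet L n e, s.lift θ = p → s.lift θ' ∈ W ∩ L.x ⁻¹' {map n e θ'} :=
    fun s hs => ⟨(hiff s).2 hs, s.x_lift h (ball_subset_closedBall hθ')⟩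
  have hex : ∀ q ∈ L.regular, q ∈ W ∩ L.x ⁻¹' {map n e θ'} → ∃ s : Sheet L n e,
      s.lift θ' = q ∧ s.lift θ = p ∧ s.lift θ' ∈ W₂ := by
    intro q hq m
    obtain ⟨s, hs⟩ := exists_lift_eq h hθ' m.2 fun hc => not_regular_of_cusp hc hq
    exact ⟨s, hs, (hiff s).1 (hs ▸ m.1), hs ▸ (hWs m.1).2⟩
  refine ⟨θ', hθ', ?_⟩
  cases hQ with
  | one q hq hd hQ =>
    obtain ⟨s, hs, hsp, hsW⟩ := hex q hq (hQ ▸ mem_singleton q)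
    refine Or.inl ⟨s, hsp, fun r hr => ?_, hsW, hs ▸ hd⟩
    have := hmem r hr
    rw [hQ] at this
    exact eq_of_lift_eq h hθ' (this.trans hs.symm)
  | two c q hc hq hd hz hQ =>
    obtain ⟨s, hs, hsp, hsW⟩ := hex q hq (hQ ▸ mem_insert_of_mem _ rfl)
    refine Or.inl ⟨s, hsp, fun r hr => ?_, hsW, hs ▸ hd⟩
    have := hmem r hr
    rw [hQ] at this
    rcases this with h1 | h1
    · exact absurd (h1 ▸ hc) (r.lift_not_cusp h hθ')
    · exact eq_of_lift_eq h hθ' (h1.trans hs.symm)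
  | three a b c ha hb hc hbc hda hdb hdc hzb hzc hQ =>
    obtain ⟨s, hs, hsp, hsW⟩ := hex a ha (hQ ▸ mem_insert _ _)
    obtain ⟨t, ht, htp, htW⟩ := hex b hb (hQ ▸ mem_insert_of_mem _ (mem_insert _ _))
    obtain ⟨r, hr, hrp, hrW⟩ := hex c hc
      (hQ ▸ mem_insert_of_mem _ (mem_insert_of_mem _ rfl))
    refine Or.inr ⟨s, t, r, hsp, htp, hrp, ?_, fun r' hr' => ?_, ?_, ?_, ⟨hsW, htW, hrW⟩,
      hs ▸ hda, ht ▸ hdb, hr ▸ hdc⟩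
    · rintro rfl
      exact hbc (ht.symm.trans hr)
    · have := hmem r' hr'
      rw [hQ] at this
      rcases this with h1 | h1 | h1
      · exact Or.inl (eq_of_lift_eq h hθ' (h1.trans hs.symm))
      · exact Or.inr (Or.inl (eq_of_lift_eq h hθ' (h1.trans ht.symm)))
      · exact Or.inr (Or.inr (eq_of_lift_eq h hθ' (h1.trans hr.symm)))
    · rintro rfl
      rw [one_mul] at hzb hzc
      rw [above_iff h hθ', above_iff h hθ', hs, ht, hr]
      constructor <;> linarith
    · rintro rfl
      rw [above_iff h hθ', above_iff h hθ', hs, ht, hr]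
      constructor <;> linarith

end Sheet

end

section

open LegendrianSurface

lemma trigVector_ne_zero (t : ℝ) : (![Real.cos t, Real.sin t] : Fin 2 → ℝ) ≠ 0 := by
  intro h
  have h0 : Real.cos t = 0 := congrFun h 0
  have h1 : Real.sin t = 0 := congrFun h 1
  have := Real.cos_sq_add_sin_sq t
  rw [h0, h1] at this
  norm_num at this

lemma continuous_circlePoint : Continuous circlePoint := by
  have h : Continuous fun t : ℝ => (![Real.cos t, Real.sin t] : Fin 2 → ℝ) := by
    refine continuous_pi fun i => ?_
    fin_cases i
    · exact Real.continuous_cos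
    · exact Real.continuous_sin
  exact (h.norm.inv₀ fun t => norm_ne_zero_iff.2 (trigVector_ne_zero t)).smul h

lemma norm_circlePoint (t : ℝ) : ‖circlePoint t‖ = 1 := by
  rw [circlePoint, norm_smul, norm_inv, norm_norm,
    inv_mul_cancel₀ (norm_ne_zero_iff.2 (trigVector_ne_zero t))]

lemma circlePoint_mem (t : ℝ) : circlePoint t ∈ closedBall (0 : Fin 2 → ℝ) 1 := by
  rw [mem_closedBall_zero_iff, norm_circlePoint]

lemma circlePoint_add_two_pi (t : ℝ) : circlePoint (t + 2 * Real.pi) = circlePoint t := by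
  simp only [circlePoint, Real.cos_add_two_pi, Real.sin_add_two_pi]

lemma endPoint_mem (ε : Bool) : endPoint ε ∈ closedBall (0 : Fin 1 → ℝ) 1 := by
  rw [mem_closedBall_zero_iff]
  refine (pi_norm_le_iff_of_nonneg zero_le_one).2 fun i => ?_
  cases ε <;> simp [endPoint]

/-- A continuous injective map of an open interval onto `(-1, 1)` is monotone and tends to the
corresponding ends. -/
lemma tendsto_ends {g : ℝ → ℝ} {a b : ℝ} (hab : a < b) (hc : ContinuousOn g (Ioo a b))
    (hg : BijOn g (Ioo a b) (Ioo (-1) 1)) :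
    (StrictMonoOn g (Ioo a b) → Tendsto g (𝓝[>] a) (𝓝 (-1)) ∧ Tendsto g (𝓝[<] b) (𝓝 1)) ∧
    (¬ StrictMonoOn g (Ioo a b) → Tendsto g (𝓝[>] a) (𝓝 1) ∧ Tendsto g (𝓝[<] b) (𝓝 (-1))) := by
  have key : ∀ g : ℝ → ℝ, StrictMonoOn g (Ioo a b) → BijOn g (Ioo a b) (Ioo (-1) 1) →
      Tendsto g (𝓝[>] a) (𝓝 (-1)) ∧ Tendsto g (𝓝[<] b) (𝓝 1) := by
    intro g hm hg
    constructor
    · rw [tendsto_order]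
      refine ⟨fun y hy => ?_, fun y hy => ?_⟩
      · filter_upwards [Ioo_mem_nhdsGT hab] with t ht
        exact hy.trans (hg.mapsTo ht).1
      · obtain ⟨t, ht, hty⟩ := hg.surjOn (show min y 1 / 2 - 1 / 2 ∈ Ioo (-1 : ℝ) 1 by
          constructor
          · have : -1 < min y 1 := lt_min hy (by norm_num)
            linarith
          · linarith [min_le_right y 1])
        filter_upwards [Ioo_mem_nhdsGT ht.1] with t' ht'
        have := hm ⟨ht'.1, ht'.2.trans ht.2⟩ ht ht'.2
        have h1 : -1 < min y 1 := lt_min hy (by norm_num)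
        linarith [min_le_left y 1]
    · rw [tendsto_order]
      refine ⟨fun y hy => ?_, fun y hy => ?_⟩
      · obtain ⟨t, ht, hty⟩ := hg.surjOn (show max y (-1) / 2 + 1 / 2 ∈ Ioo (-1 : ℝ) 1 by
          constructor
          · linarith [le_max_right y (-1)]
          · have : max y (-1) < 1 := max_lt hy (by norm_num)
            linarith)
        filter_upwards [Ioo_mem_nhdsLT ht.2] with t' ht'
        have := hm ht ⟨ht.1.trans ht'.1, ht'.2⟩ ht'.1
        have h1 : max y (-1) < 1 := max_lt hy (by norm_num)
        linarith [le_max_left y (-1)]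
      · filter_upwards [Ioo_mem_nhdsLT hab] with t ht
        exact (hg.mapsTo ht).2.trans hy
  refine ⟨fun hm => key g hm hg, fun hm => ?_⟩
  rcases hc.strictMonoOn_of_injOn_Ioo hab hg.injOn with h | h
  · exact absurd h hm
  · have h2 : BijOn (fun t => -g t) (Ioo a b) (Ioo (-1) 1) := by
      refine ⟨fun t ht => ?_, fun t ht t' ht' he => hg.injOn ht ht' (neg_injective he),
        fun y hy => ?_⟩
      · have := hg.mapsTo ht
        exact ⟨by linarith [this.2], by linarith [this.1]⟩
      · obtain ⟨t, ht, hty⟩ := hg.surjOn (show -y ∈ Ioo (-1 : ℝ) 1 from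
          ⟨by linarith [hy.2], by linarith [hy.1]⟩)
        exact ⟨t, ht, by simp [hty]⟩
    obtain ⟨h3, h4⟩ := key _ h.neg h2
    exact ⟨by simpa using h3.neg, by simpa using h4.neg⟩

namespace PolygonalDecomposition

variable {S : Type*} [TopologicalSpace S] [ChartedSpace Plane S] [CWComplex (univ : Set S)]
  (P : PolygonalDecomposition S) (α : Cell S 2) (k : ℤ)

/-- The parameter in the side `k` of the 2-cell `α` of the point with angle `t`. -/
def sideParam (t : ℝ) : Fin 1 → ℝ := (map 1 (P.side α k)).symm (map 2 α (circlePoint t))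

/-- The corner at which side `k` starts (`false`) or finishes (`true`). -/
def sideCorner (k : ℤ) (b : Bool) : ℤ := if b then k + 1 else k

/-- The end of the 1-cell at the corner at which side `k` starts (`false`) or finishes (`true`). -/
def sideEnd (b : Bool) : Bool := if b then P.finishEnd α k else P.startEnd α k

/-- The angles of the points of side `k` that tend to one of the ends of this side. -/
def sideFilter (b : Bool) : Filter ℝ :=
  if b then 𝓝[<] (P.angle α (k + 1)) else 𝓝[>] (P.angle α k)

variable {α k}

lemma angle_lt : P.angle α k < P.angle α (k + 1) := P.strictMono_angle α (by omega)

instance (b : Bool) : (P.sideFilter α k b).NeBot := by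
  cases b
  · exact inferInstanceAs (𝓝[>] (P.angle α k)).NeBot
  · exact inferInstanceAs (𝓝[<] (P.angle α (k + 1))).NeBot

lemma Ioo_mem_sideFilter (b : Bool) :
    Ioo (P.angle α k) (P.angle α (k + 1)) ∈ P.sideFilter α k b := by
  cases b
  · exact Ioo_mem_nhdsGT P.angle_lt
  · exact Ioo_mem_nhdsLT P.angle_lt

lemma tendsto_circlePoint (b : Bool) : Tendsto circlePoint (P.sideFilter α k b)
    (𝓝[closedBall 0 1] (P.cornerPoint α (sideCorner k b))) := by
  refine tendsto_nhdsWithin_iff.2 ⟨?_, Eventually.of_forall circlePoint_mem⟩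
  cases b
  · exact (continuous_circlePoint.tendsto _).mono_left nhdsWithin_le_nhds
  · exact (continuous_circlePoint.tendsto _).mono_left nhdsWithin_le_nhds

lemma cornerPoint_mem (j : ℤ) : P.cornerPoint α j ∈ closedBall (0 : Fin 2 → ℝ) 1 :=
  circlePoint_mem _

lemma sidePoint_mem : P.sidePoint α k ∈ closedBall (0 : Fin 2 → ℝ) 1 := circlePoint_mem _

lemma mid_mem : (P.angle α k + P.angle α (k + 1)) / 2 ∈
    Ioo (P.angle α k) (P.angle α (k + 1)) := by
  have := P.angle_lt (α := α) (k := k)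
  constructor <;> linarith

lemma map_mem_side {t : ℝ} (ht : t ∈ Ioo (P.angle α k) (P.angle α (k + 1))) :
    map 2 α (circlePoint t) ∈ openCell 1 (P.side α k) := (P.bijOn_side α k).mapsTo ht

lemma sideParam_mem {t : ℝ} (ht : t ∈ Ioo (P.angle α k) (P.angle α (k + 1))) :
    P.sideParam α k t ∈ ball (0 : Fin 1 → ℝ) 1 := symm_mem_ball _ (P.map_mem_side ht)

lemma map_sideParam {t : ℝ} (ht : t ∈ Ioo (P.angle α k) (P.angle α (k + 1))) :
    map 1 (P.side α k) (P.sideParam α k t) = map 2 α (circlePoint t) :=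
  map_symm _ (P.map_mem_side ht)

omit [ChartedSpace Plane S] in
lemma continuous_map_circlePoint :
    Continuous fun t => map 2 α (circlePoint t) :=
  continuousOn_univ.1 ((continuousOn 2 α).comp continuous_circlePoint.continuousOn
    fun t _ => circlePoint_mem t)

lemma continuousOn_sideParam :
    ContinuousOn (P.sideParam α k) (Ioo (P.angle α k) (P.angle α (k + 1))) :=
  (continuousOn_symm' _).comp continuous_map_circlePoint.continuousOn fun _ ht =>
    P.map_mem_side ht

lemma bijOn_sideParam : BijOn (fun t => P.sideParam α k t 0)
    (Ioo (P.angle α k) (P.angle α (k + 1))) (Ioo (-1) 1) := by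
  have hmem : ∀ θ : Fin 1 → ℝ, θ ∈ ball (0 : Fin 1 → ℝ) 1 ↔ θ 0 ∈ Ioo (-1 : ℝ) 1 := by
    intro θ
    rw [mem_ball_zero_iff, pi_norm_lt_iff one_pos, Fin.forall_fin_one, Real.norm_eq_abs, abs_lt]
    rfl
  have hb := P.bijOn_side α k
  refine ⟨fun t ht => (hmem _).1 (P.sideParam_mem ht), fun t ht t' ht' he => ?_, fun y hy => ?_⟩
  · refine hb.injOn ht ht' ?_
    have : P.sideParam α k t = P.sideParam α k t' := by
      funext i; rw [Subsingleton.elim i 0]; exact he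
    rw [← P.map_sideParam ht, ← P.map_sideParam ht', this]
  · have hy' : (fun _ => y : Fin 1 → ℝ) ∈ ball (0 : Fin 1 → ℝ) 1 := (hmem _).2 hy
    obtain ⟨t, ht, he⟩ := hb.surjOn (map_mem_openCell (P.side α k) hy')
    refine ⟨t, ht, ?_⟩
    simp only [sideParam]
    simp only at he
    rw [he, symm_map _ hy']

lemma tendsto_sideParam (b : Bool) : Tendsto (P.sideParam α k) (P.sideFilter α k b)
    (𝓝 (endPoint (P.sideEnd α k b))) := by
  have hc : ContinuousOn (fun t => P.sideParam α k t 0)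
      (Ioo (P.angle α k) (P.angle α (k + 1))) :=
    (continuous_apply (0 : Fin 1)).comp_continuousOn P.continuousOn_sideParam
  obtain ⟨h1, h2⟩ := tendsto_ends P.angle_lt hc P.bijOn_sideParam
  rw [tendsto_pi_nhds]
  intro i
  rw [Subsingleton.elim i 0]
  by_cases hp : P.SidePositive α k
  · obtain ⟨h3, h4⟩ := h1 hp
    cases b
    · simpa [sideEnd, sideFilter, startEnd, endPoint, hp] using h3
    · simpa [sideEnd, sideFilter, finishEnd, endPoint, hp] using h4
  · obtain ⟨h3, h4⟩ := h2 hp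
    cases b
    · simpa [sideEnd, sideFilter, startEnd, endPoint, hp] using h3
    · simpa [sideEnd, sideFilter, finishEnd, endPoint, hp] using h4

end PolygonalDecomposition

end

section

open LegendrianSurface

variable {S Λ : Type*} [TopologicalSpace S] [ChartedSpace Plane S] [IsManifold (𝓡 2) ∞ S]
  [TopologicalSpace Λ] [ChartedSpace Plane Λ] [CWComplex (univ : Set S)]
  {L : LegendrianSurface S Λ} {P : PolygonalDecomposition S}

open PolygonalDecomposition

/-! ### Sheets above a 2-cell and above its sides -/

/-- The sheet `s` above the 2-cell `α` has the sheet `T` above the side `k` in its closure. -/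
def Over (P : PolygonalDecomposition S) {α : Cell S 2} {k : ℤ} (s : Sheet L 2 α)
    (T : Sheet L 1 (P.side α k)) : Prop := s.lift (P.sidePoint α k) ∈ T.1

/-- The sheet `s` above the 2-cell `α` meets another sheet at a cusp edge above the side `k`. -/
def CuspAlong (P : PolygonalDecomposition S) {α : Cell S 2} (k : ℤ) (s : Sheet L 2 α) : Prop :=
  s.lift (P.sidePoint α k) ∈ L.cuspEdge

omit [CWComplex (univ : Set S)] in
lemma swSign_cases (L : LegendrianSurface S Λ) (p : Λ) : L.swSign p = 1 ∨ L.swSign p = -1 := by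
  unfold swSign; split_ifs <;> simp

variable (h : IsCellular L) [T2Space S] {α : Cell S 2} {k : ℤ} {s t : Sheet L 2 α}
include h

lemma x_lift_circlePoint (s : Sheet L 2 α) (τ : ℝ) :
    L.x (s.lift (circlePoint τ)) = map 2 α (circlePoint τ) := s.x_lift h (circlePoint_mem τ)

lemma continuous_lift_circlePoint (s : Sheet L 2 α) :
    Continuous fun τ => s.lift (circlePoint τ) :=
  continuousOn_univ.1 ((s.isLift h).continuousOn.comp continuous_circlePoint.continuousOn
    fun τ _ => circlePoint_mem τ)

lemma eqOn_side {f g : ℝ → Λ} (hf : ContinuousOn f (Ioo (P.angle α k) (P.angle α (k + 1))))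
    (hg : ContinuousOn g (Ioo (P.angle α k) (P.angle α (k + 1))))
    (hfx : ∀ τ ∈ Ioo (P.angle α k) (P.angle α (k + 1)), L.x (f τ) = map 2 α (circlePoint τ))
    (hgx : ∀ τ ∈ Ioo (P.angle α k) (P.angle α (k + 1)), L.x (g τ) = map 2 α (circlePoint τ))
    {τ₀ : ℝ} (hτ₀ : τ₀ ∈ Ioo (P.angle α k) (P.angle α (k + 1))) (he : f τ₀ = g τ₀) :
    EqOn f g (Ioo (P.angle α k) (P.angle α (k + 1))) :=
  eqOn_of_isCoveringMap_restrictPreimage (h.isCoveringMap (P.side α k)) isPreconnected_Ioo hf hg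
    (fun τ hτ => (hfx τ hτ).trans (hgx τ hτ).symm)
    (fun τ hτ => by rw [hfx τ hτ]; exact P.map_mem_side hτ) hτ₀ he

lemma continuousOn_lift_sideParam (T : Sheet L 1 (P.side α k)) :
    ContinuousOn (fun τ => T.lift (P.sideParam α k τ))
      (Ioo (P.angle α k) (P.angle α (k + 1))) :=
  (T.isLift h).continuousOn_ball.comp P.continuousOn_sideParam fun _ hτ => P.sideParam_mem hτ

lemma x_lift_sideParam (T : Sheet L 1 (P.side α k)) {τ : ℝ}
    (hτ : τ ∈ Ioo (P.angle α k) (P.angle α (k + 1))) :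
    L.x (T.lift (P.sideParam α k τ)) = map 2 α (circlePoint τ) := by
  rw [T.x_lift h (ball_subset_closedBall (P.sideParam_mem hτ)), P.map_sideParam hτ]

lemma lift_circlePoint_eq {T : Sheet L 1 (P.side α k)} {τ₀ : ℝ}
    (hτ₀ : τ₀ ∈ Ioo (P.angle α k) (P.angle α (k + 1))) (hs : s.lift (circlePoint τ₀) ∈ T.1) {τ : ℝ}
    (hτ : τ ∈ Ioo (P.angle α k) (P.angle α (k + 1))) :
    s.lift (circlePoint τ) = T.lift (P.sideParam α k τ) := by
  refine eqOn_side h (continuous_lift_circlePoint h s).continuousOn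
    (continuousOn_lift_sideParam h T) (fun τ _ => x_lift_circlePoint h s τ)
    (fun τ hτ => x_lift_sideParam h T hτ) hτ₀ ?_ hτ
  exact Sheet.eq_lift h hs (P.sideParam_mem hτ₀)
    (by rw [x_lift_circlePoint h, P.map_sideParam hτ₀])

lemma over_iff {T : Sheet L 1 (P.side α k)} {τ : ℝ}
    (hτ : τ ∈ Ioo (P.angle α k) (P.angle α (k + 1))) :
    Over P s T ↔ s.lift (circlePoint τ) ∈ T.1 := by
  constructor
  · intro hs
    rw [lift_circlePoint_eq h P.mid_mem hs hτ]
    exact T.lift_mem h (P.sideParam_mem hτ)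
  · intro hs
    have := lift_circlePoint_eq h hτ hs P.mid_mem
    unfold Over PolygonalDecomposition.sidePoint
    rw [this]
    exact T.lift_mem h (P.sideParam_mem P.mid_mem)

lemma exists_over_or_cuspAlong (P : PolygonalDecomposition S) (k : ℤ) (s : Sheet L 2 α) :
    (∃ T : Sheet L 1 (P.side α k), Over P s T) ∨ CuspAlong P k s := by
  by_cases hc : s.lift (P.sidePoint α k) ∈ L.cuspEdge
  · exact Or.inr hc
  · refine Or.inl (Sheet.exists_mem ?_ hc)
    rw [s.x_lift h (P.sidePoint_mem)]
    exact P.map_mem_side P.mid_mem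

lemma Over.not_cuspAlong {T : Sheet L 1 (P.side α k)} (hs : Over P s T) : ¬ CuspAlong P k s :=
  Sheet.not_cusp_of_mem h hs

lemma Over.unique {T T' : Sheet L 1 (P.side α k)} (hs : Over P s T) (hs' : Over P s T') : T = T' :=
  Sheet.eq_of_mem h hs hs'

lemma Over.lift_sidePoint {T : Sheet L 1 (P.side α k)} (hs : Over P s T) :
    s.lift (P.sidePoint α k) = T.lift (P.sideParam α k ((P.angle α k + P.angle α (k + 1)) / 2)) :=
  lift_circlePoint_eq h P.mid_mem hs P.mid_mem

lemma existsUnique_over (T : Sheet L 1 (P.side α k)) : ∃! s : Sheet L 2 α, Over P s T := by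
  have hm := T.lift_mem h (P.sideParam_mem (P.mid_mem (α := α) (k := k)))
  obtain ⟨s, hs, hu⟩ := Sheet.existsUnique_of_regular h (P.sidePoint_mem (α := α) (k := k))
    (x_lift_sideParam h T P.mid_mem) (Sheet.regular_of_mem h one_ne_zero hm)
  refine ⟨s, show s.lift (P.sidePoint α k) ∈ T.1 from hs ▸ hm, fun s' hs' => hu s' ?_⟩
  exact Over.lift_sidePoint h hs'

lemma Over.eq {T : Sheet L 1 (P.side α k)} (hs : Over P s T) (ht : Over P t T) : s = t :=
  (existsUnique_over h T).unique hs ht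

lemma cuspAlong_iff {τ : ℝ} (hτ : τ ∈ Ioo (P.angle α k) (P.angle α (k + 1))) :
    CuspAlong P k s ↔ s.lift (circlePoint τ) ∈ L.cuspEdge := by
  constructor
  · intro hs
    by_contra hc
    obtain ⟨T, hT⟩ := Sheet.exists_mem (e := P.side α k) (p := s.lift (circlePoint τ))
      (by rw [x_lift_circlePoint h]; exact P.map_mem_side hτ) hc
    exact Over.not_cuspAlong h ((over_iff h hτ).2 hT) hs
  · intro hs
    rcases exists_over_or_cuspAlong h P k s with ⟨T, hT⟩ | hc
    · exact absurd hs (Sheet.not_cusp_of_mem h ((over_iff h hτ).1 hT))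
    · exact hc

lemma lift_circlePoint_congr {τ₀ : ℝ} (hτ₀ : τ₀ ∈ Ioo (P.angle α k) (P.angle α (k + 1)))
    (he : s.lift (circlePoint τ₀) = t.lift (circlePoint τ₀)) {τ : ℝ}
    (hτ : τ ∈ Ioo (P.angle α k) (P.angle α (k + 1))) :
    s.lift (circlePoint τ) = t.lift (circlePoint τ) :=
  eqOn_side h (continuous_lift_circlePoint h s).continuousOn
    (continuous_lift_circlePoint h t).continuousOn (fun τ _ => x_lift_circlePoint h s τ)
    (fun τ _ => x_lift_circlePoint h t τ) hτ₀ he hτ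

lemma tendsto_lift_corner (P : PolygonalDecomposition S) (k : ℤ) (s : Sheet L 2 α) (b : Bool) :
    Tendsto (fun τ => s.lift (circlePoint τ)) (P.sideFilter α k b)
      (𝓝 (s.lift (P.cornerPoint α (sideCorner k b)))) :=
  Tendsto.comp ((s.isLift h).continuousOn _ (P.cornerPoint_mem _)) (P.tendsto_circlePoint b)

lemma Over.lift_corner {T : Sheet L 1 (P.side α k)} (hs : Over P s T) (b : Bool) :
    s.lift (P.cornerPoint α (sideCorner k b)) = T.lift (endPoint (P.sideEnd α k b)) := by
  have := L.t2Space
  refine tendsto_nhds_unique (tendsto_lift_corner h P k s b) ?_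
  have h1 : Tendsto (P.sideParam α k) (P.sideFilter α k b)
      (𝓝[closedBall 0 1] (endPoint (P.sideEnd α k b))) :=
    tendsto_nhdsWithin_iff.2 ⟨P.tendsto_sideParam b,
      mem_of_superset (P.Ioo_mem_sideFilter b) fun τ hτ =>
        ball_subset_closedBall (P.sideParam_mem hτ)⟩
  refine (((T.isLift h).continuousOn _ (endPoint_mem _)).tendsto.comp h1).congr' ?_
  filter_upwards [P.Ioo_mem_sideFilter b] with τ hτ
  exact (lift_circlePoint_eq h P.mid_mem hs hτ).symm

lemma lift_corner_congr (he : s.lift (P.sidePoint α k) = t.lift (P.sidePoint α k)) (b : Bool) :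
    s.lift (P.cornerPoint α (sideCorner k b)) = t.lift (P.cornerPoint α (sideCorner k b)) := by
  have := L.t2Space
  refine tendsto_nhds_unique_of_eventuallyEq (tendsto_lift_corner h P k s b)
    (tendsto_lift_corner h P k t b) ?_
  filter_upwards [P.Ioo_mem_sideFilter b] with τ hτ
  exact lift_circlePoint_congr h P.mid_mem he hτ

lemma not_regular_corner_of_cuspAlong (hs : CuspAlong P k s) (b : Bool) :
    s.lift (P.cornerPoint α (sideCorner k b)) ∉ L.regular := by
  intro hr
  obtain ⟨τ, h1, h2⟩ := (((tendsto_lift_corner h P k s b).eventually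
    (isOpen_regular.mem_nhds hr)).and (P.Ioo_mem_sideFilter b)).exists
  exact not_regular_of_cusp ((cuspAlong_iff h h2).1 hs) h1

variable [IsManifold (𝓡 2) ∞ Λ]

lemma Over.above {T T' : Sheet L 1 (P.side α k)} (hs : Over P s T) (ht : Over P t T')
    (ha : T.Above T') : s.Above t := by
  refine Sheet.above_of_z_lt h (P.sidePoint_mem (α := α) (k := k)) ?_
  rw [hs.lift_sidePoint h, ht.lift_sidePoint h]
  exact (Sheet.above_iff h (P.sideParam_mem P.mid_mem)).1 ha

lemma CuspAlong.exists_partner (hs : CuspAlong P k s) : ∃ t : Sheet L 2 α, t ≠ s ∧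
    t.lift (P.sidePoint α k) = s.lift (P.sidePoint α k) ∧
    ∀ r : Sheet L 2 α, r.lift (P.sidePoint α k) = s.lift (P.sidePoint α k) → r = s ∨ r = t := by
  rcases Sheet.cases_of_cusp h P.sidePoint_mem (s.x_lift h P.sidePoint_mem) hs with
    hc | ⟨a, b, hab, ha, hb, hr⟩
  · exact absurd rfl (hc s)
  · rcases hr s rfl with rfl | rfl
    · exact ⟨b, (hab.ne h).symm, hb, hr⟩
    · exact ⟨a, hab.ne h, ha, fun r hr' => (hr r hr').symm⟩

/-- Three sheets that meet at a swallowtail point above a corner either are all continued by sheets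
above a given side at this corner, or two of them meet at a cusp edge above this side. -/
lemma swallow_corner {b : Bool} {p : Λ} (hp : p ∈ L.swallowtail) {a₁ a₂ a₃ : Sheet L 2 α}
    (h₁ : a₁.lift (P.cornerPoint α (sideCorner k b)) = p)
    (h₂ : a₂.lift (P.cornerPoint α (sideCorner k b)) = p)
    (h₃ : a₃.lift (P.cornerPoint α (sideCorner k b)) = p)
    (h₁₂ : a₁ ≠ a₂) (h₁₃ : a₁ ≠ a₃) (h₂₃ : a₂ ≠ a₃) (hc : CuspAlong P k a₁) :
    ∃ r, ∃ T : Sheet L 1 (P.side α k), Over P r T ∧ (r = a₂ ∨ r = a₃) ∧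
      (L.swSign p = 1 → a₁.Above r) ∧ (L.swSign p = -1 → r.Above a₁) := by
  obtain ⟨φ, ψ, W, hf⟩ := exists_isLocalForm_of_swallow hp
  have hxp : L.x p = map 2 α (P.cornerPoint α (sideCorner k b)) := by
    rw [← h₁, a₁.x_lift h (P.cornerPoint_mem _)]
  have hcont : Tendsto (fun τ => map 2 α (circlePoint τ)) (P.sideFilter α k b) (𝓝 (L.x p)) := by
    rw [hxp]
    exact Tendsto.comp ((continuousOn 2 α) _ (P.cornerPoint_mem _)) (P.tendsto_circlePoint b)
  have hev := hcont.eventually (h.generic.eventually_fiber_of_swallow hf (swSign_cases L p)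
    hf.mem_nhds Subset.rfl)
  have hmem : ∀ a : Sheet L 2 α, a.lift (P.cornerPoint α (sideCorner k b)) = p →
      ∀ᶠ τ in P.sideFilter α k b, a.lift (circlePoint τ) ∈ W := fun a ha => by
    have := tendsto_lift_corner h P k a b
    rw [ha] at this
    exact this hf.mem_nhds
  obtain ⟨τ, hQ, m₁, m₂, m₃, hτ⟩ := (hev.and ((hmem a₁ h₁).and ((hmem a₂ h₂).and
    ((hmem a₃ h₃).and (P.Ioo_mem_sideFilter b))))).exists
  have hne : map 2 α (circlePoint τ) ≠ L.x p := by
    intro he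
    exact swallow_not_over_one_cell h.compatible hp (P.side α k) (he ▸ P.map_mem_side hτ)
  have hc' := (cuspAlong_iff h hτ).1 hc
  have M₁ : a₁.lift (circlePoint τ) ∈ W ∩ L.x ⁻¹' {map 2 α (circlePoint τ)} :=
    ⟨m₁, x_lift_circlePoint h _ τ⟩
  have M₂ : a₂.lift (circlePoint τ) ∈ W ∩ L.x ⁻¹' {map 2 α (circlePoint τ)} :=
    ⟨m₂, x_lift_circlePoint h _ τ⟩
  have M₃ : a₃.lift (circlePoint τ) ∈ W ∩ L.x ⁻¹' {map 2 α (circlePoint τ)} :=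
    ⟨m₃, x_lift_circlePoint h _ τ⟩
  cases hQ hne with
  | one q hq hd hQ =>
    rw [hQ] at M₁
    exact absurd (M₁ ▸ hq) (not_regular_of_cusp hc')
  | three q₁ q₂ q₃ hq₁ hq₂ hq₃ hbc hda hdb hdc hzb hzc hQ =>
    rw [hQ] at M₁
    rcases M₁ with M | M | M
    · exact absurd (M ▸ hq₁) (not_regular_of_cusp hc')
    · exact absurd (M ▸ hq₂) (not_regular_of_cusp hc')
    · exact absurd (M ▸ hq₃) (not_regular_of_cusp hc')
  | two c q hcc hq hd hz hQ =>
    rw [hQ] at M₁ M₂ M₃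
    have e₁ : a₁.lift (circlePoint τ) = c := by
      rcases M₁ with M | M
      · exact M
      · exact absurd (M ▸ hq) (not_regular_of_cusp hc')
    have key : ∀ r : Sheet L 2 α, r.lift (circlePoint τ) = q → (r = a₂ ∨ r = a₃) →
        ∃ r, ∃ T : Sheet L 1 (P.side α k), Over P r T ∧ (r = a₂ ∨ r = a₃) ∧
          (L.swSign p = 1 → a₁.Above r) ∧ (L.swSign p = -1 → r.Above a₁) := by
      intro r hr hr'
      rcases exists_over_or_cuspAlong h P k r with ⟨T, hT⟩ | hcr
      · refine ⟨r, T, hT, hr', fun hσ => ?_, fun hσ => ?_⟩ <;> rw [hσ] at hz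
        · refine Sheet.above_of_z_lt h (circlePoint_mem τ) ?_
          rw [e₁, hr]; linarith
        · refine Sheet.above_of_z_lt h (circlePoint_mem τ) ?_
          rw [e₁, hr]; linarith
      · exact absurd (hr ▸ hq) (not_regular_of_cusp ((cuspAlong_iff h hτ).1 hcr))
    rcases M₂ with M₂ | M₂
    · rcases M₃ with M₃ | M₃
      · exfalso
        rcases Sheet.cases_of_cusp h (circlePoint_mem τ) (x_lift_circlePoint h a₁ τ) hc' with
          hn | ⟨s, t, -, -, -, hst⟩
        · exact hn a₁ rfl
        · have b₁ := hst a₁ rfl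
          have b₂ := hst a₂ (M₂.trans e₁.symm)
          have b₃ := hst a₃ (M₃.trans e₁.symm)
          rcases b₁ with rfl | rfl <;> rcases b₂ with rfl | rfl <;> rcases b₃ with rfl | rfl <;>
            simp_all
      · exact key a₃ M₃ (Or.inr rfl)
    · exact key a₂ M₂ (Or.inl rfl)

end

section

open LegendrianSurface

variable {S Λ : Type*} [TopologicalSpace S] [ChartedSpace Plane S] [IsManifold (𝓡 2) ∞ S]
  [TopologicalSpace Λ] [ChartedSpace Plane Λ] [CWComplex (univ : Set S)]
  {L : LegendrianSurface S Λ} {P : PolygonalDecomposition S}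

open PolygonalDecomposition

omit [CWComplex (univ : Set S)] in
/-- A swallowtail point is the only singular point above its projection to the base. -/
lemma LegendrianSurface.IsGeneric.eq_of_swallow (hL : L.IsGeneric) {p q : Λ}
    (hp : p ∈ L.swallowtail) (hq : q ∉ L.regular) (hx : L.x q = L.x p) : q = p := by
  have hsm : ∀ q : Λ, q ∉ L.regular → ¬ L.IsSmoothFront (L.x q) (L.z q) := by
    intro q hq
    have hm : q ∈ L.frontFiber (L.x q) (L.z q) := ⟨rfl, rfl⟩
    rintro (h | ⟨r, hr, h⟩) <;> rw [h] at hm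
    · exact hm
    · rw [mem_singleton_iff.1 hm] at hq; exact hq hr
  have hpr := not_regular_of_swallow hp
  have hmp : p ∈ L.frontFiber (L.x p) (L.z p) := ⟨rfl, rfl⟩
  have hc1 : ¬ L.IsCodimOne (L.x p) (L.z p) := by
    rintro (⟨a, ha, b, hb, -, h⟩ | ⟨a, ha, h⟩) <;> rw [h] at hmp
    · rcases hmp with rfl | rfl
      · exact hpr ha
      · exact hpr hb
    · rw [mem_singleton_iff.1 hmp] at hp
      exact not_swallow_of_cusp ha hp
  by_cases hz : L.z q = L.z p
  · have hmq : q ∈ L.frontFiber (L.x p) (L.z p) := ⟨hx, hz⟩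
    rcases hL.front (L.x p) (L.z p) with h | h | ⟨a, ha, b, hb, c, hc, h, -⟩ |
      ⟨a, ha, b, hb, h, -⟩ | ⟨a, ha, h⟩
    · exact absurd h (hsm p hpr)
    · exact absurd h hc1
    · rw [h] at hmp
      rcases hmp with rfl | rfl | rfl
      · exact absurd ha hpr
      · exact absurd hb hpr
      · exact absurd hc hpr
    · rw [h] at hmp
      rcases hmp with rfl | rfl
      · exact absurd hp (not_swallow_of_cusp ha)
      · exact absurd hb hpr
    · rw [h] at hmp hmq
      rw [mem_singleton_iff.1 hmp, mem_singleton_iff.1 hmq]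
  · exact absurd (hL.base (L.x p) (L.z p) (L.z q) (Ne.symm hz) (hsm p hpr) (hx ▸ hsm q hq)).1 hc1

section Cancel

variable {n : ℕ} {e : Cell S n}

/-- The sheets `s` and `t` cancel above the boundary point `θ`: either they meet at a cusp edge or
they are the two upper (lower) ones of three sheets that meet at an upward (downward)
swallowtail point. -/
def Cancel (θ : Fin n → ℝ) (s t : Sheet L n e) : Prop :=
  s.lift θ = t.lift θ ∧ s.Above t ∧ (s.lift θ ∈ L.cuspEdge ∨
    (s.lift θ ∈ L.swallowUp ∧ ∃ r : Sheet L n e, r.lift θ = s.lift θ ∧ t.Above r) ∨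
    (s.lift θ ∈ L.swallowtail ∧ s.lift θ ∉ L.swallowUp ∧
      ∃ r : Sheet L n e, r.lift θ = s.lift θ ∧ r.Above s))

/-- The sheet `s` cancels with another sheet above `θ`. -/
def Cancelled (θ : Fin n → ℝ) (s : Sheet L n e) : Prop := ∃ t, Cancel θ s t ∨ Cancel θ t s

/-- Sheets that meet at a swallowtail point above `θ` do not cross. -/
def IsOrdered (L : LegendrianSurface S Λ) (e : Cell S n) (θ : Fin n → ℝ) : Prop :=
  ∀ s t : Sheet L n e, s ≠ t → s.lift θ = t.lift θ → s.lift θ ∈ L.swallowtail →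
    s.Above t ∨ t.Above s

lemma Cancel.not_regular {θ : Fin n → ℝ} {s t : Sheet L n e} (hc : Cancel θ s t) :
    s.lift θ ∉ L.regular := by
  rcases hc.2.2 with h1 | h1 | h1
  · exact not_regular_of_cusp h1
  · exact not_regular_of_swallow (Or.inl h1.1)
  · exact not_regular_of_swallow h1.1

lemma Cancelled.not_regular {θ : Fin n → ℝ} {s : Sheet L n e} (hc : Cancelled θ s) :
    s.lift θ ∉ L.regular := by
  obtain ⟨t, ht | ht⟩ := hc
  · exact ht.not_regular
  · rw [← ht.1]; exact ht.not_regular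

variable (h : IsCellular L) [T2Space S] [IsManifold (𝓡 2) ∞ Λ] {θ : Fin n → ℝ}
  (hθ : θ ∈ closedBall (0 : Fin n → ℝ) 1)
include h hθ

lemma swallow_triple (hn : n ≠ 0) {p : Λ} (hp : p ∈ L.swallowtail) (hx : L.x p = map n e θ) :
    (∃! s : Sheet L n e, s.lift θ = p) ∨ ∃ a b c : Sheet L n e, a.lift θ = p ∧ b.lift θ = p ∧
      c.lift θ = p ∧ a ≠ b ∧ a ≠ c ∧ b ≠ c ∧
      (∀ r : Sheet L n e, r.lift θ = p → r = a ∨ r = b ∨ r = c) ∧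
      (p ∈ L.swallowUp → a.Above b ∧ a.Above c) ∧ (p ∉ L.swallowUp → b.Above a ∧ c.Above a) := by
  obtain ⟨φ, ψ, W, hf⟩ := exists_isLocalForm_of_swallow hp
  obtain ⟨θ', -, hh⟩ := Sheet.cases_of_swallow h hθ hn hx (swSign_cases L p) hp hf hf.mem_nhds
  rcases hh with ⟨s, hs, hu, -⟩ | ⟨a, b, c, ha, hb, hc, hbc, hall, h1, h2, -⟩
  · exact Or.inl ⟨s, hs, hu⟩
  · have hup : p ∈ L.swallowUp → a.Above b ∧ a.Above c := fun hu => h1 (by simp [swSign, hu])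
    have hdn : p ∉ L.swallowUp → b.Above a ∧ c.Above a := fun hu => h2 (by simp [swSign, hu])
    refine Or.inr ⟨a, b, c, ha, hb, hc, ?_, ?_, hbc, hall, hup, hdn⟩ <;>
      by_cases hu : p ∈ L.swallowUp
    · exact (hup hu).1.ne h
    · exact ((hdn hu).1.ne h).symm
    · exact (hup hu).2.ne h
    · exact ((hdn hu).2.ne h).symm

lemma exists_third (hn : n ≠ 0) {s t : Sheet L n e} (hp : s.lift θ ∈ L.swallowtail) (hst : s ≠ t)
    (he : t.lift θ = s.lift θ) : ∃ r : Sheet L n e, r ≠ s ∧ r ≠ t ∧ r.lift θ = s.lift θ ∧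
      ∀ r' : Sheet L n e, r'.lift θ = s.lift θ → r' = s ∨ r' = t ∨ r' = r := by
  rcases swallow_triple h hθ hn hp (s.x_lift h hθ) with hu | ⟨a, b, c, ha, hb, hc, hab, hac, hbc,
    hall, -, -⟩
  · exact absurd (hu.unique rfl he) hst
  · rcases hall s rfl with rfl | rfl | rfl <;> rcases hall t he with rfl | rfl | rfl
    · exact absurd rfl hst
    · exact ⟨c, hac.symm, hbc.symm, hc, hall⟩
    · exact ⟨b, hab.symm, hbc, hb, fun r hr => by rcases hall r hr with h | h | h <;> simp [h]⟩
    · exact ⟨c, hbc.symm, hac.symm, hc, fun r hr => by rcases hall r hr with h | h | h <;> simp [h]⟩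
    · exact absurd rfl hst
    · exact ⟨a, hab, hac, ha, fun r hr => by rcases hall r hr with h | h | h <;> simp [h]⟩
    · exact ⟨b, hbc, hab.symm, hb, fun r hr => by rcases hall r hr with h | h | h <;> simp [h]⟩
    · exact ⟨a, hac, hab, ha, fun r hr => by rcases hall r hr with h | h | h <;> simp [h]⟩
    · exact absurd rfl hst

lemma eq_or_of_three (hn : n ≠ 0) {s t r : Sheet L n e} (hp : s.lift θ ∈ L.swallowtail)
    (hst : s ≠ t) (hsr : s ≠ r) (htr : t ≠ r) (ht : t.lift θ = s.lift θ) (hr : r.lift θ = s.lift θ)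
    {r' : Sheet L n e} (hr' : r'.lift θ = s.lift θ) : r' = s ∨ r' = t ∨ r' = r := by
  obtain ⟨r₀, h1, h2, h3, h4⟩ := exists_third h hθ hn hp hst ht
  rcases h4 r hr with e | e | rfl
  · exact absurd e.symm hsr
  · exact absurd e.symm htr
  · exact h4 r' hr'

lemma ordered_triple (hn : n ≠ 0) (hO : IsOrdered L e θ) {p : Λ} (hp : p ∈ L.swallowtail)
    (hx : L.x p = map n e θ) :
    (∃! s : Sheet L n e, s.lift θ = p) ∨ ∃ s₁ s₂ s₃ : Sheet L n e, s₁.lift θ = p ∧ s₂.lift θ = p ∧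
      s₃.lift θ = p ∧ s₁.Above s₂ ∧ s₂.Above s₃ ∧
      ∀ r : Sheet L n e, r.lift θ = p → r = s₁ ∨ r = s₂ ∨ r = s₃ := by
  rcases swallow_triple h hθ hn hp hx with hu | ⟨a, b, c, ha, hb, hc, hab, hac, hbc, hall, hup, hdn⟩
  · exact Or.inl hu
  · right
    have hbc' := hO b c hbc (hb.trans hc.symm) (hb ▸ hp)
    by_cases hu : p ∈ L.swallowUp
    · rcases hbc' with hbc' | hbc'
      · exact ⟨a, b, c, ha, hb, hc, (hup hu).1, hbc', hall⟩
      · exact ⟨a, c, b, ha, hc, hb, (hup hu).2, hbc', fun r hr => by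
          rcases hall r hr with h | h | h <;> simp [h]⟩
    · rcases hbc' with hbc' | hbc'
      · exact ⟨b, c, a, hb, hc, ha, hbc', (hdn hu).2, fun r hr => by
          rcases hall r hr with h | h | h <;> simp [h]⟩
      · exact ⟨c, b, a, hc, hb, ha, hbc', (hdn hu).1, fun r hr => by
          rcases hall r hr with h | h | h <;> simp [h]⟩

omit hθ in
lemma cancel_iff_of_triple {p : Λ} (hp : p ∈ L.swallowtail) {s₁ s₂ s₃ : Sheet L n e}
    (h₁ : s₁.lift θ = p) (h₂ : s₂.lift θ = p) (h₃ : s₃.lift θ = p) (h₁₂ : s₁.Above s₂)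
    (h₂₃ : s₂.Above s₃) (hall : ∀ r : Sheet L n e, r.lift θ = p → r = s₁ ∨ r = s₂ ∨ r = s₃)
    {s t : Sheet L n e} (hs : s.lift θ = p) : Cancel θ s t ↔
      if p ∈ L.swallowUp then s = s₁ ∧ t = s₂ else s = s₂ ∧ t = s₃ := by
  have h₁₃ := h₁₂.trans h h₂₃
  have n₂₁ := h₁₂.asymm h
  have n₃₂ := h₂₃.asymm h
  have n₃₁ := h₁₃.asymm h
  have n₁₁ : ¬ s₁.Above s₁ := fun ha => ha.ne h rfl
  have n₂₂ : ¬ s₂.Above s₂ := fun ha => ha.ne h rfl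
  have n₃₃ : ¬ s₃.Above s₃ := fun ha => ha.ne h rfl
  constructor
  · rintro ⟨hst, ha, hc⟩
    rw [hs] at hst hc
    have hs' := hall s hs
    have ht' := hall t hst.symm
    rcases hc with hc | ⟨hu, r, hr, hr'⟩ | ⟨-, hu, r, hr, hr'⟩
    · exact absurd hp (not_swallow_of_cusp hc)
    · rw [if_pos hu]
      rcases hs' with rfl | rfl | rfl <;> rcases ht' with rfl | rfl | rfl <;>
        rcases hall r hr with rfl | rfl | rfl <;> first | exact ⟨rfl, rfl⟩ | contradiction
    · rw [if_neg hu]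
      rcases hs' with rfl | rfl | rfl <;> rcases ht' with rfl | rfl | rfl <;>
        rcases hall r hr with rfl | rfl | rfl <;> first | exact ⟨rfl, rfl⟩ | contradiction
  · intro hc
    split_ifs at hc with hu
    · obtain ⟨rfl, rfl⟩ := hc
      exact ⟨h₁.trans h₂.symm, h₁₂, Or.inr (Or.inl ⟨h₁ ▸ hu, s₃, h₃.trans h₁.symm, h₂₃⟩)⟩
    · obtain ⟨rfl, rfl⟩ := hc
      exact ⟨h₂.trans h₃.symm, h₂₃, Or.inr (Or.inr ⟨h₂ ▸ hp, h₂ ▸ hu, s₁, h₁.trans h₂.symm, h₁₂⟩)⟩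

lemma Cancel.not_cancel (hn : n ≠ 0) (hO : IsOrdered L e θ) {s t r : Sheet L n e}
    (hst : Cancel θ s t) : ¬ Cancel θ t r := by
  intro htr
  have hsr := hst.1.trans htr.1
  rcases h.generic.cases (s.lift θ) with hr | hc | hp
  · exact hst.not_regular hr
  · rcases Sheet.cases_of_cusp h hθ (s.x_lift h hθ) hc with hno | ⟨a, b, hab, -, -, hall⟩
    · exact hno s rfl
    · have h1 := hst.2.1
      have h2 := htr.2.1
      have n1 := h1.asymm h
      have n2 := h2.asymm h
      have n3 := h1.ne h
      have n4 := h2.ne h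
      have n5 := (h1.trans h h2).ne h
      rcases hall s rfl with rfl | rfl <;> rcases hall t hst.1.symm with rfl | rfl <;>
        rcases hall r hsr.symm with rfl | rfl <;> simp_all
  · rcases ordered_triple h hθ hn hO hp (s.x_lift h hθ) with hu | ⟨a, b, c, ha, hb, hc, hab, hbc, hall⟩
    · exact hst.2.1.ne h (hu.unique rfl hst.1.symm)
    · rw [cancel_iff_of_triple h hp ha hb hc hab hbc hall rfl] at hst
      rw [cancel_iff_of_triple h hp ha hb hc hab hbc hall (by
        split_ifs at hst <;> rw [hst.2, hst.1] <;> simp_all)] at htr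
      split_ifs at hst htr
      · exact hab.ne h (htr.1.symm.trans hst.2)
      · exact hbc.ne h (htr.1.symm.trans hst.2)

/-- Each point above `θ` outside of the cusp edges is the limit of exactly one sheet that is not
cancelled. -/
lemma existsUnique_not_cancelled (hn : n ≠ 0) (hO : IsOrdered L e θ) {p : Λ} (hp : p ∉ L.cuspEdge)
    (hx : L.x p = map n e θ) : ∃! s : Sheet L n e, s.lift θ = p ∧ ¬ Cancelled θ s := by
  rcases h.generic.cases p with hr | hc | hp
  · obtain ⟨s, hs, hu⟩ := Sheet.existsUnique_of_regular h hθ hx hr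
    exact ⟨s, ⟨hs, fun hc => hc.not_regular (hs ▸ hr)⟩, fun t ht => hu t ht.1⟩
  · exact absurd hc hp
  · rcases ordered_triple h hθ hn hO hp hx with hu | ⟨a, b, c, ha, hb, hc, hab, hbc, hall⟩
    · obtain ⟨s, hs, hu⟩ := hu
      refine ⟨s, ⟨hs, ?_⟩, fun t ht => hu t ht.1⟩
      rintro ⟨t, ht | ht⟩
      · exact ht.2.1.ne h (hu t (ht.1.symm.trans hs)).symm
      · exact ht.2.1.ne h (hu t (ht.1.trans hs))
    · have key := fun (s t : Sheet L n e) (hs : s.lift θ = p) =>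
        cancel_iff_of_triple h hp ha hb hc hab hbc hall (s := s) (t := t) hs
      have hab' := hab.ne h
      have hbc' := hbc.ne h
      have hac' := (hab.trans h hbc).ne h
      by_cases hu : p ∈ L.swallowUp
      · simp only [hu, if_true] at key
        refine ⟨c, ⟨hc, ?_⟩, ?_⟩
        · rintro ⟨t, ht | ht⟩
          · exact hac' ((key c t hc).1 ht).1.symm
          · exact hbc' ((key t c (ht.1.trans hc)).1 ht).2.symm
        · rintro t ⟨ht, htc⟩
          rcases hall t ht with rfl | rfl | rfl
          · exact absurd ⟨b, Or.inl ((key _ _ ha).2 ⟨rfl, rfl⟩)⟩ htc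
          · exact absurd ⟨a, Or.inr ((key _ _ ha).2 ⟨rfl, rfl⟩)⟩ htc
          · rfl
      · simp only [hu, if_false] at key
        refine ⟨a, ⟨ha, ?_⟩, ?_⟩
        · rintro ⟨t, ht | ht⟩
          · exact hab' ((key a t ha).1 ht).1
          · exact hac' ((key t a (ht.1.trans ha)).1 ht).2
        · rintro t ⟨ht, htc⟩
          rcases hall t ht with rfl | rfl | rfl
          · rfl
          · exact absurd ⟨c, Or.inl ((key _ _ hb).2 ⟨rfl, rfl⟩)⟩ htc
          · exact absurd ⟨b, Or.inr ((key _ _ hb).2 ⟨rfl, rfl⟩)⟩ htc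

end Cancel

section Corner

variable (h : IsCellular L) [T2Space S] [IsManifold (𝓡 2) ∞ Λ] {α : Cell S 2} {k : ℤ} {b : Bool}
  {s t : Sheet L 2 α}
include h

lemma isOrdered_two (α : Cell S 2) (θ : Fin 2 → ℝ) : IsOrdered L α θ := fun _ _ hst _ _ =>
  Sheet.above_or_above h hst

omit [IsManifold (𝓡 2) ∞ Λ] in
lemma isOrdered_of_not_crossing {β : Cell S 1} {ε : Bool} (hc : ¬ IsCrossingEnd L β ε) :
    IsOrdered L β (endPoint ε) := by
  intro s t hst he hp
  by_contra hn
  push Not at hn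
  refine hc ⟨s, t, hst, hn.1, hn.2, ?_, ?_⟩
  · rw [s.limit_eq h (endPoint_mem ε), t.limit_eq h (endPoint_mem ε), he]
  · rwa [s.limit_eq h (endPoint_mem ε)]

/-- The order in which the sheets meet at a cusp edge along a side determines which of them cancel
at the corners of this side. -/
lemma cancel_iff_of_cuspAlong (hs : CuspAlong P k s) (b : Bool) (t : Sheet L 2 α) :
    (Cancel (P.cornerPoint α (sideCorner k b)) s t ↔
      t.lift (P.sidePoint α k) = s.lift (P.sidePoint α k) ∧ s.Above t) ∧
    (Cancel (P.cornerPoint α (sideCorner k b)) t s ↔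
      t.lift (P.sidePoint α k) = s.lift (P.sidePoint α k) ∧ t.Above s) := by
  obtain ⟨s', hs's, hsp, hall⟩ := hs.exists_partner h
  set θ := P.cornerPoint α (sideCorner k b) with hθdef
  have hθ : θ ∈ closedBall (0 : Fin 2 → ℝ) 1 := P.cornerPoint_mem _
  have hlim : s'.lift θ = s.lift θ := lift_corner_congr h hsp b
  have hpart : ∀ r : Sheet L 2 α, r ≠ s → r.lift (P.sidePoint α k) = s.lift (P.sidePoint α k) →
      r = s' := fun r hr hr' => (hall r hr').resolve_left hr
  rcases h.generic.cases (s.lift θ) with hr | hc | hp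
  · exact absurd hr (not_regular_corner_of_cuspAlong h hs b)
  · rcases Sheet.cases_of_cusp h hθ (s.x_lift h hθ) hc with hno | ⟨x, y, hxy, -, -, hall'⟩
    · exact absurd rfl (hno s)
    · have hu : ∀ r : Sheet L 2 α, r ≠ s → r.lift θ = s.lift θ → r = s' := by
        intro r hrs hr
        rcases hall' r hr with rfl | rfl <;> rcases hall' s rfl with rfl | rfl <;>
          rcases hall' s' hlim with rfl | rfl <;> simp_all
      constructor <;> constructor
      · rintro ⟨h1, h2, -⟩
        obtain rfl := hu t (h2.ne h).symm h1.symm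
        exact ⟨hsp, h2⟩
      · rintro ⟨h1, h2⟩
        obtain rfl := hpart t (h2.ne h).symm h1
        exact ⟨hlim.symm, h2, Or.inl hc⟩
      · rintro ⟨h1, h2, -⟩
        obtain rfl := hu t (h2.ne h) h1
        exact ⟨hsp, h2⟩
      · rintro ⟨h1, h2⟩
        obtain rfl := hpart t (h2.ne h) h1
        exact ⟨hlim, h2, Or.inl (hlim ▸ hc)⟩
  · obtain ⟨r, hrs, hrs', hrl, hr⟩ := exists_third h hθ two_ne_zero hp hs's.symm hlim
    have hs' : CuspAlong P k s' := by unfold CuspAlong; rw [hsp]; exact hs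
    have hthird : ∀ a a' : Sheet L 2 α, CuspAlong P k a → CuspAlong P k a' → a ≠ a' → a ≠ r →
        a' ≠ r → a.lift θ = s.lift θ → a'.lift θ = s.lift θ →
        (L.swSign (s.lift θ) = 1 → a.Above r) ∧ (L.swSign (s.lift θ) = -1 → r.Above a) := by
      intro a a' ha ha' haa har ha'r hal hal'
      obtain ⟨r', T, hT, h1, h2⟩ := swallow_corner h hp hal hal' hrl haa har ha'r ha
      rcases h1 with rfl | rfl
      · exact absurd ha' (hT.not_cuspAlong h)
      · exact h2
    have k1 := hthird s s' hs hs' hs's.symm hrs.symm hrs'.symm rfl hlim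
    have k2 := hthird s' s hs' hs hs's hrs'.symm hrs.symm hlim rfl
    by_cases hu : s.lift θ ∈ L.swallowUp
    · have k1 : s.Above r := k1.1 (by simp [swSign, hu])
      have k2 : s'.Above r := k2.1 (by simp [swSign, hu])
      constructor <;> constructor
      · rintro ⟨h1, h2, h3⟩
        rcases hr t h1.symm with rfl | rfl | rfl
        · exact absurd rfl (h2.ne h)
        · exact ⟨hsp, h2⟩
        · rcases h3 with h3 | ⟨-, r', h3, h4⟩ | h3
          · exact absurd hp (not_swallow_of_cusp h3)
          · rcases hr r' h3 with rfl | rfl | rfl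
            · exact absurd h4 (k1.asymm h)
            · exact absurd h4 (k2.asymm h)
            · exact absurd rfl (h4.ne h)
          · exact absurd hu h3.2.1
      · rintro ⟨h1, h2⟩
        obtain rfl := hpart t (h2.ne h).symm h1
        exact ⟨hlim.symm, h2, Or.inr (Or.inl ⟨hu, r, hrl, k2⟩)⟩
      · rintro ⟨h1, h2, -⟩
        rcases hr t h1 with rfl | rfl | rfl
        · exact absurd rfl (h2.ne h)
        · exact ⟨hsp, h2⟩
        · exact absurd h2 (k1.asymm h)
      · rintro ⟨h1, h2⟩
        obtain rfl := hpart t (h2.ne h) h1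
        exact ⟨hlim, h2, Or.inr (Or.inl ⟨hlim ▸ hu, r, hrl.trans hlim.symm, k1⟩)⟩
    · have k1 : r.Above s := k1.2 (by simp [swSign, hu])
      have k2 : r.Above s' := k2.2 (by simp [swSign, hu])
      constructor <;> constructor
      · rintro ⟨h1, h2, -⟩
        rcases hr t h1.symm with rfl | rfl | rfl
        · exact absurd rfl (h2.ne h)
        · exact ⟨hsp, h2⟩
        · exact absurd h2 (k1.asymm h)
      · rintro ⟨h1, h2⟩
        obtain rfl := hpart t (h2.ne h).symm h1
        exact ⟨hlim.symm, h2, Or.inr (Or.inr ⟨hp, hu, r, hrl, k1⟩)⟩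
      · rintro ⟨h1, h2, h3⟩
        rcases hr t h1 with rfl | rfl | rfl
        · exact absurd rfl (h2.ne h)
        · exact ⟨hsp, h2⟩
        · rw [h1] at h3
          rcases h3 with h3 | h3 | ⟨-, -, r', h3, h4⟩
          · exact absurd hp (not_swallow_of_cusp h3)
          · exact absurd h3.1 hu
          · rcases hr r' h3 with rfl | rfl | rfl
            · exact absurd h4 (k1.asymm h)
            · exact absurd h4 (k2.asymm h)
            · exact absurd rfl (h4.ne h)
      · rintro ⟨h1, h2⟩
        obtain rfl := hpart t (h2.ne h) h1
        exact ⟨hlim, h2, Or.inr (Or.inr ⟨hlim ▸ hp, hlim ▸ hu, r, hrl.trans hlim.symm, k2⟩)⟩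

variable {T T' : Sheet L 1 (P.side α k)}

lemma cancel_iff_of_over (hO : IsOrdered L (P.side α k) (endPoint (P.sideEnd α k b)))
    (hs : Over P s T) (ht : Over P t T') :
    Cancel (P.cornerPoint α (sideCorner k b)) s t ↔ Cancel (endPoint (P.sideEnd α k b)) T T' := by
  have es := hs.lift_corner h b
  have et := ht.lift_corner h b
  have hθ : P.cornerPoint α (sideCorner k b) ∈ closedBall (0 : Fin 2 → ℝ) 1 := P.cornerPoint_mem _
  constructor
  · rintro ⟨h1, h2, h3⟩
    have hTT : T ≠ T' := by
      rintro rfl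
      exact h2.ne h (hs.eq h ht)
    have hl : T.lift (endPoint (P.sideEnd α k b)) = T'.lift (endPoint (P.sideEnd α k b)) := by
      rw [← es, ← et, h1]
    have hno : ¬ T'.Above T := fun ha => h2.asymm h (ht.above h hs ha)
    have hsw : s.lift (P.cornerPoint α (sideCorner k b)) ∈ L.swallowtail → T.Above T' := fun hp =>
      (hO T T' hTT hl (es ▸ hp)).resolve_right hno
    have hother : ∀ r : Sheet L 2 α, r ≠ s → r ≠ t →
        s.lift (P.cornerPoint α (sideCorner k b)) ∈ L.swallowtail →
        r.lift (P.cornerPoint α (sideCorner k b)) = s.lift (P.cornerPoint α (sideCorner k b)) →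
        ∃ R : Sheet L 1 (P.side α k), Over P r R := by
      intro r hrs hrt hp hrl
      rcases exists_over_or_cuspAlong h P k r with hR | hc
      · exact hR
      · exfalso
        obtain ⟨r', hr', hrr, -⟩ := hc.exists_partner h
        have hrl' := (lift_corner_congr h hrr b).trans hrl
        have hc' : CuspAlong P k r' := by unfold CuspAlong; rw [hrr]; exact hc
        rcases eq_or_of_three h hθ two_ne_zero hp (h2.ne h) hrs.symm hrt.symm h1.symm hrl hrl' with
          rfl | rfl | rfl
        · exact hs.not_cuspAlong h hc'
        · exact ht.not_cuspAlong h hc'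
        · exact hr' rfl
    refine ⟨hl, ?_⟩
    rw [es] at h3
    rcases h3 with h3 | ⟨h3, r, h4, h5⟩ | ⟨h3, h6, r, h4, h5⟩
    · refine ⟨?_, Or.inl h3⟩
      rcases Sheet.cases_of_cusp h (endPoint_mem _) (T.x_lift h (endPoint_mem _)) h3 with
        hn | ⟨x, y, hxy, -, -, hall⟩
      · exact absurd rfl (hn T)
      · rcases hall T rfl with rfl | rfl <;> rcases hall T' hl.symm with rfl | rfl
        · exact absurd rfl hTT
        · exact hxy
        · exact absurd hxy hno
        · exact absurd rfl hTT
    · have hp : s.lift (P.cornerPoint α (sideCorner k b)) ∈ L.swallowtail := Or.inl (es ▸ h3)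
      refine ⟨hsw hp, Or.inr (Or.inl ⟨h3, ?_⟩)⟩
      have hrs : r ≠ s := ((h2.trans h h5).ne h).symm
      have hrt : r ≠ t := (h5.ne h).symm
      obtain ⟨R, hR⟩ := hother r hrs hrt hp (h4.trans es.symm)
      have er := hR.lift_corner h b
      have hRT : R.lift (endPoint (P.sideEnd α k b)) = T.lift (endPoint (P.sideEnd α k b)) := by
        rw [← er, h4]
      refine ⟨R, hRT, (hO R T' ?_ (hRT.trans hl) ?_).resolve_left fun ha => ?_⟩
      · rintro rfl; exact hrt (hR.eq h ht)
      · rw [hRT, ← es]; exact hp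
      · exact h5.asymm h (hR.above h ht ha)
    · have hp : s.lift (P.cornerPoint α (sideCorner k b)) ∈ L.swallowtail := es ▸ h3
      refine ⟨hsw hp, Or.inr (Or.inr ⟨h3, h6, ?_⟩)⟩
      have hrs : r ≠ s := h5.ne h
      have hrt : r ≠ t := (h5.trans h h2).ne h
      obtain ⟨R, hR⟩ := hother r hrs hrt hp (h4.trans es.symm)
      have er := hR.lift_corner h b
      have hRT : R.lift (endPoint (P.sideEnd α k b)) = T.lift (endPoint (P.sideEnd α k b)) := by
        rw [← er, h4]
      refine ⟨R, hRT, (hO R T ?_ hRT ?_).resolve_right fun ha => ?_⟩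
      · rintro rfl; exact hrs (hR.eq h hs)
      · rw [hRT, ← es]; exact hp
      · exact h5.asymm h (hs.above h hR ha)
  · rintro ⟨h1, h2, h3⟩
    refine ⟨by rw [es, et, h1], hs.above h ht h2, ?_⟩
    rw [es]
    rcases h3 with h3 | ⟨h3, R, h4, h5⟩ | ⟨h3, h6, R, h4, h5⟩
    · exact Or.inl h3
    · obtain ⟨r, hr, -⟩ := existsUnique_over h R
      exact Or.inr (Or.inl ⟨h3, r, by rw [Over.lift_corner h hr b, h4], ht.above h hr h5⟩)
    · obtain ⟨r, hr, -⟩ := existsUnique_over h R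
      exact Or.inr (Or.inr ⟨h3, h6, r, by rw [Over.lift_corner h hr b, h4], Over.above h hr hs h5⟩)

lemma CuspAlong.cancelled (hs : CuspAlong P k s) (b : Bool) :
    Cancelled (P.cornerPoint α (sideCorner k b)) s := by
  obtain ⟨t, hts, hsp, -⟩ := hs.exists_partner h
  rcases Sheet.above_or_above h hts with ha | ha
  · exact ⟨t, Or.inr ((cancel_iff_of_cuspAlong h hs b t).2.2 ⟨hsp, ha⟩)⟩
  · exact ⟨t, Or.inl ((cancel_iff_of_cuspAlong h hs b t).1.2 ⟨hsp, ha⟩)⟩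

lemma cancelled_iff_of_over (hO : IsOrdered L (P.side α k) (endPoint (P.sideEnd α k b)))
    (hs : Over P s T) : Cancelled (P.cornerPoint α (sideCorner k b)) s ↔
      Cancelled (endPoint (P.sideEnd α k b)) T := by
  constructor
  · rintro ⟨t, ht⟩
    rcases exists_over_or_cuspAlong h P k t with ⟨T', hT'⟩ | hc
    · exact ⟨T', ht.imp (cancel_iff_of_over h hO hs hT').1 (cancel_iff_of_over h hO hT' hs).1⟩
    · exfalso
      have hk := cancel_iff_of_cuspAlong h hc b s
      have hst : s.lift (P.sidePoint α k) = t.lift (P.sidePoint α k) :=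
        ht.elim (fun h1 => (hk.2.1 h1).1) (fun h1 => (hk.1.1 h1).1)
      refine hs.not_cuspAlong h ?_
      unfold CuspAlong
      rw [hst]; exact hc
  · rintro ⟨T', hT'⟩
    obtain ⟨t, ht, -⟩ := existsUnique_over h T'
    exact ⟨t, hT'.imp (cancel_iff_of_over h hO hs ht).2 (cancel_iff_of_over h hO ht hs).2⟩

end Corner

end

section

open LegendrianSurface

lemma exists_circlePoint_eq {θ : Fin 2 → ℝ} (hθ : ‖θ‖ = 1) (a : ℝ) :
    ∃ τ ∈ Ico a (a + 2 * Real.pi), circlePoint τ = θ := by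
  set w : ℂ := ⟨θ 0, θ 1⟩ with hw
  have hw0 : w ≠ 0 := by
    intro h0
    have h1 : θ = 0 := by
      funext i
      fin_cases i
      · exact congrArg Complex.re h0
      · exact congrArg Complex.im h0
    rw [h1, norm_zero] at hθ
    exact zero_ne_one hθ
  have hr : 0 < ‖w‖ := norm_pos_iff.2 hw0
  have key : circlePoint w.arg = θ := by
    have h1 : (![Real.cos w.arg, Real.sin w.arg] : Fin 2 → ℝ) = ‖w‖⁻¹ • θ := by
      funext i
      fin_cases i
      · show Real.cos w.arg = ‖w‖⁻¹ * θ 0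
        rw [Complex.cos_arg hw0, div_eq_inv_mul]
      · show Real.sin w.arg = ‖w‖⁻¹ * θ 1
        rw [Complex.sin_arg, div_eq_inv_mul]
    rw [circlePoint, h1, norm_smul, hθ, mul_one, norm_inv, norm_norm, inv_inv, smul_smul,
      mul_inv_cancel₀ hr.ne', one_smul]
  refine ⟨toIcoMod Real.two_pi_pos a w.arg, toIcoMod_mem_Ico _ _ _, ?_⟩
  have hper : Function.Periodic circlePoint (2 * Real.pi) := circlePoint_add_two_pi
  rw [toIcoMod, hper.sub_zsmul_eq, key]

variable {S Λ : Type*} [TopologicalSpace S] [ChartedSpace Plane S] [IsManifold (𝓡 2) ∞ S]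
  [TopologicalSpace Λ] [ChartedSpace Plane Λ] [CWComplex (univ : Set S)]
  {L : LegendrianSurface S Λ} {P : PolygonalDecomposition S}

namespace PolygonalDecomposition

omit [IsManifold (𝓡 2) ∞ S] in
lemma exists_angle_le (P : PolygonalDecomposition S) (α : Cell S 2) {τ : ℝ} (h0 : P.angle α 0 ≤ τ)
    (N : ℕ) (hN : τ < P.angle α N) :
    ∃ j < N, P.angle α (j : ℤ) ≤ τ ∧ τ < P.angle α ((j : ℤ) + 1) := by
  induction N with
  | zero => exact absurd hN (not_lt.2 (by simpa using h0))
  | succ N ih =>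
    by_cases h : τ < P.angle α N
    · obtain ⟨j, hj, h1⟩ := ih h
      exact ⟨j, by omega, h1⟩
    · exact ⟨N, by omega, not_lt.1 h, by exact_mod_cast hN⟩

omit [IsManifold (𝓡 2) ∞ S] in
lemma finite_preimage (P : PolygonalDecomposition S) (α : Cell S 2) {β : Cell S 1} {m : S}
    (hm : m ∈ openCell 1 β) : {θ ∈ closedBall (0 : Fin 2 → ℝ) 1 | map 2 α θ = m}.Finite := by
  refine Set.Finite.subset (s := ⋃ j ∈ Finset.range (P.corners α), circlePoint ''
    {τ ∈ Ioo (P.angle α (j : ℤ)) (P.angle α ((j : ℤ) + 1)) | map 2 α (circlePoint τ) = m}) ?_ ?_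
  · refine Set.Finite.biUnion (Finset.finite_toSet _) fun j _ => Set.Finite.image _ ?_
    refine Set.Subsingleton.finite fun τ hτ τ' hτ' => ?_
    exact (P.bijOn_side α j).injOn hτ.1 hτ'.1 (hτ.2.trans hτ'.2.symm)
  · rintro θ ⟨hθ, hθm⟩
    have h1 : ‖θ‖ = 1 := by
      refine le_antisymm (mem_closedBall_zero_iff.1 hθ) (not_lt.1 fun hlt => ?_)
      have := dim_eq_of_mem_openCell (map_mem_openCell α (mem_ball_zero_iff.2 hlt)) (hθm ▸ hm)
      omega
    obtain ⟨τ, hτ, rfl⟩ := exists_circlePoint_eq h1 (P.angle α 0)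
    have hN : τ < P.angle α (P.corners α) := by
      have := P.angle_add α 0
      rw [zero_add] at this
      rw [this]; exact hτ.2
    obtain ⟨j, hj, h2, h3⟩ := P.exists_angle_le α hτ.1 _ hN
    rcases h2.eq_or_lt with he | hlt
    · obtain ⟨v, hv⟩ := P.angle_mem α j
      rw [he, hθm] at hv
      have := dim_eq_of_mem_openCell hv hm
      omega
    · exact mem_biUnion (Finset.mem_coe.2 (Finset.mem_range.2 hj))
        (mem_image_of_mem _ ⟨⟨hlt, h3⟩, hθm⟩)

end PolygonalDecomposition

open PolygonalDecomposition

omit [IsManifold (𝓡 2) ∞ S] in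
/-- Two boundary points of a 2-cell that are mapped to the same point of a 1-cell are mapped to
different sides of it. -/
lemma not_folded [T2Space S] (P : PolygonalDecomposition S) {α : Cell S 2} {β : Cell S 1} {m : S}
    (hm : m ∈ openCell 1 β)
    {θ₁ θ₂ : Fin 2 → ℝ} (h₁ : θ₁ ∈ closedBall (0 : Fin 2 → ℝ) 1)
    (h₂ : θ₂ ∈ closedBall (0 : Fin 2 → ℝ) 1)
    (h12 : θ₁ ≠ θ₂)
    (hH : ∀ N ∈ 𝓝 m, ∃ H ⊆ N, IsPreconnected H ∧ (∀ u ∈ H, ¬ ∃ n ≤ 1, ∃ e : Cell S n, u ∈ openCell n e) ∧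
      (∀ᶠ θ in 𝓝[ball 0 1] θ₁, map 2 α θ ∈ H) ∧ (∀ᶠ θ in 𝓝[ball 0 1] θ₂, map 2 α θ ∈ H)) :
    False := by
  have n₁ := neBot_nhdsWithin_ball h₁
  have n₂ := neBot_nhdsWithin_ball h₂
  have hfin := P.finite_preimage α hm
  have hd : 0 < dist θ₂ θ₁ := dist_pos.2 h12.symm
  obtain ⟨ρ, ⟨hρ0, hρd⟩, hρ⟩ := ((Ioo_infinite hd).sdiff (hfin.image fun θ => dist θ θ₁)).nonempty
  set K := closedBall (0 : Fin 2 → ℝ) 1 ∩ sphere θ₁ ρ with hK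
  have hKc : IsCompact K := (isCompact_closedBall _ _).inter_right isClosed_sphere
  have hKi : IsClosed (map 2 α '' K) :=
    (hKc.image_of_continuousOn ((continuousOn 2 α).mono inter_subset_left)).isClosed
  have hmK : m ∉ map 2 α '' K := by
    rintro ⟨θ, ⟨hθ, hs⟩, he⟩
    exact hρ ⟨θ, ⟨hθ, he⟩, hs⟩
  obtain ⟨H, hHN, hHp, hHs, hH₁, hH₂⟩ := hH _ (hKi.isOpen_compl.mem_nhds hmK)
  have e₁ : ∀ᶠ θ in 𝓝[ball 0 1] θ₁, θ ∈ ball θ₁ ρ := nhdsWithin_le_nhds (ball_mem_nhds θ₁ hρ0)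
  have e₂ : ∀ᶠ θ in 𝓝[ball 0 1] θ₂, θ ∈ (closedBall θ₁ ρ)ᶜ := nhdsWithin_le_nhds
    (isClosed_closedBall.isOpen_compl.mem_nhds (show θ₂ ∈ (closedBall θ₁ ρ)ᶜ by simpa using hρd))
  have b₁ : ∀ᶠ θ in 𝓝[ball 0 1] θ₁, θ ∈ ball (0 : Fin 2 → ℝ) 1 := self_mem_nhdsWithin
  have b₂ : ∀ᶠ θ in 𝓝[ball 0 1] θ₂, θ ∈ ball (0 : Fin 2 → ℝ) 1 := self_mem_nhdsWithin
  obtain ⟨θ, hθ1, hθ2, hθ3⟩ := (hH₁.and (e₁.and b₁)).exists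
  obtain ⟨θ', hθ'1, hθ'2, hθ'3⟩ := (hH₂.and (e₂.and b₂)).exists
  have hdim := P.isEmpty_cell
  have hsub : H ⊆ openCell 2 α := by
    refine hHp.subset_left_of_subset_union (isOpen_openCell_two hdim α)
      (isOpen_iUnion fun α' : {a : Cell S 2 // a ≠ α} => isOpen_openCell_two hdim α'.1) ?_ ?_
      ⟨_, hθ1, map_mem_openCell α hθ3⟩
    · rw [disjoint_left]
      rintro u hu hu'
      obtain ⟨⟨α', hα'⟩, hu'⟩ := mem_iUnion.1 hu'
      exact hα' (cell_eq_of_mem_openCell hu' hu)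
    · intro u hu
      obtain ⟨n, e, he⟩ := exists_mem_openCell u
      have hn1 : ¬ n ≤ 1 := fun hn => hHs u hu ⟨n, hn, e, he⟩
      have hn2 : ¬ 2 < n := fun hn => (hdim n hn).elim e
      obtain rfl : n = 2 := by omega
      by_cases hα : e = α
      · left; rwa [← hα]
      · right; exact mem_iUnion.2 ⟨⟨e, hα⟩, he⟩
  have hG : IsPreconnected ((map 2 α).symm '' H) :=
    hHp.image _ ((continuousOn_symm' α).mono hsub)
  have hGb : ∀ η ∈ (map 2 α).symm '' H, η ∈ ball (0 : Fin 2 → ℝ) 1 ∧ map 2 α η ∈ H := by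
    rintro _ ⟨u, hu, rfl⟩
    exact ⟨symm_mem_ball α (hsub hu), by rw [map_symm α (hsub hu)]; exact hu⟩
  have hs := hG.subset_left_of_subset_union (u := ball θ₁ ρ) (v := (closedBall θ₁ ρ)ᶜ) isOpen_ball
    isClosed_closedBall.isOpen_compl
    (disjoint_compl_right.mono_left ball_subset_closedBall) ?_
    (show ((map 2 α).symm '' H ∩ ball θ₁ ρ).Nonempty from
      ⟨θ, ⟨map 2 α θ, hθ1, symm_map α hθ3⟩, hθ2⟩)
  · exact hθ'2 (ball_subset_closedBall (hs ⟨_, hθ'1, symm_map α hθ'3⟩))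
  · intro η hη
    obtain ⟨a1, a2⟩ := hGb η hη
    by_contra hc
    simp only [mem_union, not_or, mem_compl_iff, not_not] at hc
    refine hHN a2 ⟨η, ⟨ball_subset_closedBall a1, ?_⟩, rfl⟩
    rw [mem_sphere]
    exact le_antisymm (mem_closedBall.1 hc.2) (not_lt.1 fun h => hc.1 (mem_ball.2 h))

section LocalForm

variable {σ : ℝ} {p : Λ} {φ : OpenPartialHomeomorph Λ Plane} {ψ : OpenPartialHomeomorph S Plane}
  {W : Set Λ}

omit [CWComplex (univ : Set S)] in
lemma LegendrianSurface.IsLocalForm.sw_z_eq_iff (hf : L.IsLocalForm (swForm σ) p φ ψ W)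
    (hσ : σ = 1 ∨ σ = -1) {q q' : Λ} (hq : q ∈ W) (hq' : q' ∈ W) (hx : L.x q = L.x q')
    (hne : q ≠ q') : L.z q = L.z q' ↔ φ q 1 + φ q' 1 = 0 := by
  have he : φ q 1 ≠ φ q' 1 := fun e => hne ((hf.eq_iff hq hq' hx).2 e)
  have h1 := hf.sw_lt_iff hσ hq hq' hx he
  have h2 := hf.sw_lt_iff hσ hq' hq hx.symm he.symm
  have hd : φ q 1 - φ q' 1 ≠ 0 := sub_ne_zero.2 he
  have hσ0 : σ ≠ 0 := by rcases hσ with rfl | rfl <;> norm_num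
  constructor
  · intro hz
    rw [hz, sub_self, mul_zero] at h1
    rw [hz, sub_self, mul_zero] at h2
    have h3 : ¬ (0 : ℝ) < -((φ q 1 - φ q' 1) ^ 3 * (φ q 1 + φ q' 1)) := fun h => lt_irrefl _ (h1.2 h)
    have h4 : ¬ (0 : ℝ) < -((φ q' 1 - φ q 1) ^ 3 * (φ q' 1 + φ q 1)) := fun h => lt_irrefl _ (h2.2 h)
    have h5 : (φ q 1 - φ q' 1) ^ 3 * (φ q 1 + φ q' 1) = 0 := by
      have e1 : -((φ q' 1 - φ q 1) ^ 3 * (φ q' 1 + φ q 1)) =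
        (φ q 1 - φ q' 1) ^ 3 * (φ q 1 + φ q' 1) := by ring
      rw [e1] at h4
      linarith
    exact (mul_eq_zero.1 h5).resolve_left (pow_ne_zero 3 hd)
  · intro hs
    rw [hs, mul_zero, neg_zero] at h1
    rw [add_comm, hs, mul_zero, neg_zero] at h2
    have h3 : ¬ 0 < σ * (L.z q - L.z q') := fun h => lt_irrefl _ (h1.1 h)
    have h4 : ¬ 0 < σ * (L.z q' - L.z q) := fun h => lt_irrefl _ (h2.1 h)
    have h5 : σ * (L.z q - L.z q') = 0 := by linarith
    exact sub_eq_zero.1 ((mul_eq_zero.1 h5).resolve_left hσ0)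

omit [CWComplex (univ : Set S)] in
lemma LegendrianSurface.IsLocalForm.sw_coord_of_z_eq (hf : L.IsLocalForm (swForm σ) p φ ψ W)
    (hσ : σ = 1 ∨ σ = -1) {q q' : Λ} (hq : q ∈ W) (hq' : q' ∈ W) (hx : L.x q = L.x q')
    (hne : q ≠ q') (hz : L.z q = L.z q') : 0 < ψ (L.x q) 0 ∧ ψ (L.x q) 1 = 0 := by
  have hs := (hf.sw_z_eq_iff hσ hq hq' hx hne).1 hz
  have hu := (hf.base q hq).1
  obtain ⟨a0, a1⟩ := (hf.sw_x_eq_iff hq hu).1 rfl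
  obtain ⟨b0, b1⟩ := (hf.sw_x_eq_iff hq' hu).1 hx.symm
  have he : φ q 1 ≠ φ q' 1 := fun e => hne ((hf.eq_iff hq hq' hx).2 e)
  have hx' := swallow_double (a1.trans b1.symm) he
  have hb : φ q' 1 = -φ q 1 := by linarith
  rw [hb] at hx' b1 he
  have hq0 : φ q 1 ≠ 0 := fun h0 => he (by rw [h0]; simp)
  refine ⟨?_, by linarith⟩
  rw [hx']
  have := pow_pos (abs_pos.2 hq0) 2
  rw [sq_abs] at this
  nlinarith

omit [CWComplex (univ : Set S)] in
lemma LegendrianSurface.IsLocalForm.sw_coord_ne_zero (hf : L.IsLocalForm (swForm σ) p φ ψ W)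
    (hσ : σ = 1 ∨ σ = -1) {q₁ q₂ q₃ : Λ} (h₁ : q₁ ∈ W) (h₂ : q₂ ∈ W) (h₃ : q₃ ∈ W)
    (h₁₂ : L.x q₁ = L.x q₂) (h₁₃ : L.x q₁ = L.x q₃) (z₁₂ : L.z q₁ ≠ L.z q₂)
    (z₁₃ : L.z q₁ ≠ L.z q₃) (z₂₃ : L.z q₂ ≠ L.z q₃) : ψ (L.x q₁) 1 ≠ 0 := by
  have n₁₂ : q₁ ≠ q₂ := fun e => z₁₂ (by rw [e])
  have n₁₃ : q₁ ≠ q₃ := fun e => z₁₃ (by rw [e])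
  have n₂₃ : q₂ ≠ q₃ := fun e => z₂₃ (by rw [e])
  have h₂₃ : L.x q₂ = L.x q₃ := h₁₂.symm.trans h₁₃
  rw [Ne, hf.sw_z_eq_iff hσ h₁ h₂ h₁₂ n₁₂] at z₁₂
  rw [Ne, hf.sw_z_eq_iff hσ h₁ h₃ h₁₃ n₁₃] at z₁₃
  rw [Ne, hf.sw_z_eq_iff hσ h₂ h₃ h₂₃ n₂₃] at z₂₃
  rw [Ne, hf.eq_iff h₁ h₂ h₁₂] at n₁₂
  rw [Ne, hf.eq_iff h₁ h₃ h₁₃] at n₁₃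
  rw [Ne, hf.eq_iff h₂ h₃ h₂₃] at n₂₃
  have hu := (hf.base q₁ h₁).1
  obtain ⟨-, a₁⟩ := (hf.sw_x_eq_iff h₁ hu).1 rfl
  obtain ⟨-, a₂⟩ := (hf.sw_x_eq_iff h₂ hu).1 h₁₂.symm
  obtain ⟨-, a₃⟩ := (hf.sw_x_eq_iff h₃ hu).1 h₁₃.symm
  intro h0
  have hs := LegendrianSurface.swallow_triple (a₁.trans a₂.symm) (a₁.trans a₃.symm) n₁₂ n₁₃ n₂₃
  have e₁ : φ q₁ 1 ≠ 0 := fun h => z₂₃ (by rw [hs, h]; ring)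
  have e₂ : φ q₂ 1 ≠ 0 := fun h => z₁₃ (by rw [hs, h]; ring)
  rw [h0] at a₁ a₂
  have b₁ : ψ (L.x q₁) 0 = 2 * φ q₁ 1 ^ 2 := by
    have : φ q₁ 1 * (ψ (L.x q₁) 0 - 2 * φ q₁ 1 ^ 2) = 0 := by linarith
    linarith [(mul_eq_zero.1 this).resolve_left e₁]
  have b₂ : ψ (L.x q₁) 0 = 2 * φ q₂ 1 ^ 2 := by
    have : φ q₂ 1 * (ψ (L.x q₁) 0 - 2 * φ q₂ 1 ^ 2) = 0 := by linarith
    linarith [(mul_eq_zero.1 this).resolve_left e₂]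
  have : (φ q₁ 1 - φ q₂ 1) * (φ q₁ 1 + φ q₂ 1) = 0 := by linarith
  rcases mul_eq_zero.1 this with h | h
  · exact n₁₂ (by linarith)
  · exact z₁₂ h

end LocalForm

end

section

open LegendrianSurface PolygonalDecomposition

lemma circlePoint_ne {τ τ' : ℝ} (h : τ < τ') (h' : τ' < τ + Real.pi) :
    circlePoint τ ≠ circlePoint τ' := by
  intro he
  have hn : ∀ t : ℝ, 0 < ‖(![Real.cos t, Real.sin t] : Fin 2 → ℝ)‖⁻¹ := fun t =>
    inv_pos.2 (norm_pos_iff.2 (trigVector_ne_zero t))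
  have e0 := congrFun he 0
  have e1 := congrFun he 1
  simp only [circlePoint, Pi.smul_apply, Matrix.cons_val_zero, Matrix.cons_val_one, smul_eq_mul]
    at e0 e1
  have hs : Real.sin (τ' - τ) = 0 := by
    have : (‖(![Real.cos τ, Real.sin τ] : Fin 2 → ℝ)‖⁻¹ *
        ‖(![Real.cos τ', Real.sin τ'] : Fin 2 → ℝ)‖⁻¹) * Real.sin (τ' - τ) = 0 := by
      rw [Real.sin_sub]
      linear_combination (‖(![Real.cos τ', Real.sin τ'] : Fin 2 → ℝ)‖⁻¹ * Real.sin τ') * e0 -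
        (‖(![Real.cos τ', Real.sin τ'] : Fin 2 → ℝ)‖⁻¹ * Real.cos τ') * e1
    exact (mul_eq_zero.1 this).resolve_left (mul_pos (hn τ) (hn τ')).ne'
  exact (Real.sin_pos_of_pos_of_lt_pi (by linarith) (by linarith)).ne' hs

lemma exists_sign_of_isPreconnected {X : Type*} [TopologicalSpace X] {B : Set X}
    (hB : IsPreconnected B) {f : X → ℝ} (hf : ContinuousOn f B) (h0 : ∀ x ∈ B, f x ≠ 0) :
    ∃ ς : ℝ, (ς = 1 ∨ ς = -1) ∧ ∀ x ∈ B, 0 < ς * f x := by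
  by_cases hx : ∃ x ∈ B, 0 < f x
  · obtain ⟨x, hx, hp⟩ := hx
    refine ⟨1, Or.inl rfl, fun y hy => ?_⟩
    rw [one_mul]
    by_contra hn
    obtain ⟨w, hw, hw0⟩ := hB.intermediate_value hy hx hf ⟨not_lt.1 hn, hp.le⟩
    exact h0 w hw hw0
  · push Not at hx
    exact ⟨-1, Or.inr rfl, fun y hy => by linarith [lt_of_le_of_ne (hx y hy) (h0 y hy)]⟩

lemma exists_half_disc {S : Type*} [TopologicalSpace S] (ψ : OpenPartialHomeomorph S Plane) {m : S}
    (hm : m ∈ ψ.source) (ς : ℝ) {N : Set S} (hN : N ∈ 𝓝 m) :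
    ∃ H ⊆ N, IsPreconnected H ∧ (∀ u ∈ H, 0 < ς * ψ u 1) ∧
      ∀ᶠ u in 𝓝 m, 0 < ς * ψ u 1 → u ∈ H := by
  have h1 : ψ.symm ⁻¹' N ∩ ψ.target ∈ 𝓝 (ψ m) := by
    refine Filter.inter_mem ((ψ.continuousAt_symm (ψ.map_source hm)).preimage_mem_nhds ?_)
      (ψ.open_target.mem_nhds (ψ.map_source hm))
    rwa [ψ.left_inv hm]
  obtain ⟨r, hr, hs⟩ := Metric.mem_nhds_iff.1 h1
  have hconv : Convex ℝ (ball (ψ m) r ∩ {y : Plane | 0 < ς * y 1}) := by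
    refine (convex_ball _ _).inter ?_
    intro y hy y' hy' a b ha hb hab
    simp only [mem_ofPred_eq, PiLp.add_apply, PiLp.smul_apply, smul_eq_mul] at hy hy' ⊢
    rcases ha.eq_or_lt with rfl | ha
    · obtain rfl : b = 1 := by linarith
      simpa using hy'
    · have := mul_pos ha hy
      have := mul_nonneg hb hy'.le
      nlinarith
  refine ⟨ψ.symm '' (ball (ψ m) r ∩ {y : Plane | 0 < ς * y 1}), ?_, ?_, ?_, ?_⟩
  · rintro _ ⟨y, hy, rfl⟩
    exact (hs hy.1).1
  · exact hconv.isPreconnected.image _ (ψ.continuousOn_symm.mono fun y hy => (hs hy.1).2)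
  · rintro _ ⟨y, hy, rfl⟩
    rw [ψ.right_inv (hs hy.1).2]
    exact hy.2
  · filter_upwards [ψ.open_source.mem_nhds hm,
      (ψ.continuousAt hm).preimage_mem_nhds (ball_mem_nhds (ψ m) hr)] with u hu hu' hp
    exact ⟨ψ u, ⟨hu', hp⟩, ψ.left_inv hu⟩

variable {S Λ : Type*} [TopologicalSpace S] [ChartedSpace Plane S] [IsManifold (𝓡 2) ∞ S]
  [TopologicalSpace Λ] [ChartedSpace Plane Λ] [CWComplex (univ : Set S)]
  {L : LegendrianSurface S Λ} {P : PolygonalDecomposition S}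

variable (h : IsCellular L) [T2Space S] [IsManifold (𝓡 2) ∞ Λ]
include h

omit [IsManifold (𝓡 2) ∞ Λ] in
lemma crossAt_iff {β : Cell S 1} {ε : Bool} {s t : Sheet L 1 β} : CrossAt L β ε s t ↔
    s ≠ t ∧ ¬ s.Above t ∧ ¬ t.Above s ∧ s.lift (endPoint ε) = t.lift (endPoint ε) ∧
      s.lift (endPoint ε) ∈ L.swallowtail := by
  rw [CrossAt, Sheet.limit_eq h s (endPoint_mem ε), Sheet.limit_eq h t (endPoint_mem ε)]

lemma CrossAt.exists_third {β : Cell S 1} {ε : Bool} {s t : Sheet L 1 β} (hc : CrossAt L β ε s t) :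
    ∃ r : Sheet L 1 β, r.lift (endPoint ε) = s.lift (endPoint ε) ∧ r ≠ s ∧ r ≠ t ∧
      (∀ r' : Sheet L 1 β, r'.lift (endPoint ε) = s.lift (endPoint ε) → r' = r ∨ r' = s ∨ r' = t) ∧
      (s.lift (endPoint ε) ∈ L.swallowUp → r.Above s ∧ r.Above t) ∧
      (s.lift (endPoint ε) ∉ L.swallowUp → s.Above r ∧ t.Above r) := by
  obtain ⟨hst, h1, h2, he, hp⟩ := (crossAt_iff h).1 hc
  rcases swallow_triple h (endPoint_mem ε) one_ne_zero hp (s.x_lift h (endPoint_mem ε)) with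
    ⟨r, -, hu⟩ | ⟨a, b, c, ha, hb, hcc, hab, hac, hbc, hall, hup, hdn⟩
  · exact absurd ((hu s rfl).trans (hu t he.symm).symm) hst
  · have key : ∀ x, x = b ∨ x = c → (a.Above x ∨ x.Above a) := by
      rintro x hx
      by_cases hu : s.lift (endPoint ε) ∈ L.swallowUp
      · rcases hx with rfl | rfl
        · exact Or.inl (hup hu).1
        · exact Or.inl (hup hu).2
      · rcases hx with rfl | rfl
        · exact Or.inr (hdn hu).1
        · exact Or.inr (hdn hu).2
    have hsa : s ≠ a := by
      rintro rfl
      rcases key t ((hall t he.symm).resolve_left (Ne.symm hst)) with hk | hk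
      · exact h1 hk
      · exact h2 hk
    have hta : t ≠ a := by
      rintro rfl
      rcases key s ((hall s rfl).resolve_left hst) with hk | hk
      · exact h2 hk
      · exact h1 hk
    refine ⟨a, ha, hsa.symm, hta.symm, ?_⟩
    rcases (hall s rfl).resolve_left hsa with rfl | rfl <;>
      rcases (hall t he.symm).resolve_left hta with rfl | rfl
    · exact absurd rfl hst
    · exact ⟨hall, hup, hdn⟩
    · exact ⟨fun r' hr' => (hall r' hr').imp_right Or.symm, fun hu => (hup hu).symm,
        fun hu => (hdn hu).symm⟩
    · exact absurd rfl hst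

variable {α : Cell S 2} {k : ℤ} {b : Bool}

/-- Above a crossing arc that ends at a swallowtail point, there are no cusps. -/
lemma not_cuspAlong_of_crossing (hc : IsCrossingEnd L (P.side α k) (P.sideEnd α k b))
    (s : Sheet L 2 α) : ¬ CuspAlong P k s := by
  obtain ⟨A, B, hAB⟩ := hc
  obtain ⟨C, hC, hCA, hCB, -⟩ := hAB.exists_third h
  obtain ⟨hne, -, -, he, hp⟩ := (crossAt_iff h).1 hAB
  obtain ⟨A', hA', -⟩ := existsUnique_over h A
  obtain ⟨B', hB', -⟩ := existsUnique_over h B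
  obtain ⟨C', hC', -⟩ := existsUnique_over h C
  have hA₁ := hA'.lift_corner h b
  have hB₁ := (hB'.lift_corner h b).trans he.symm
  have hC₁ := (hC'.lift_corner h b).trans hC
  have n₁ : A' ≠ B' := fun e => hne (hA'.unique h (e ▸ hB'))
  have n₂ : A' ≠ C' := fun e => hCA (hC'.unique h (e ▸ hA'))
  have n₃ : B' ≠ C' := fun e => hCB (hC'.unique h (e ▸ hB'))
  intro hs
  have hq := not_regular_corner_of_cuspAlong h hs b
  have hsp : s.lift (P.cornerPoint α (sideCorner k b)) =
      A'.lift (P.cornerPoint α (sideCorner k b)) := by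
    rw [hA₁]
    refine h.generic.eq_of_swallow hp hq ?_
    rw [← hA₁, s.x_lift h (P.cornerPoint_mem _), A'.x_lift h (P.cornerPoint_mem _)]
  rcases eq_or_of_three h (P.cornerPoint_mem _) two_ne_zero (by rw [hA₁]; exact hp) n₁ n₂ n₃
    (hB₁.trans hA₁.symm) (hC₁.trans hA₁.symm) hsp with rfl | rfl | rfl
  · exact hA'.not_cuspAlong h hs
  · exact hB'.not_cuspAlong h hs
  · exact hC'.not_cuspAlong h hs

lemma exists_over_of_crossing (hc : IsCrossingEnd L (P.side α k) (P.sideEnd α k b))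
    (s : Sheet L 2 α) : ∃ T : Sheet L 1 (P.side α k), Over P s T :=
  (exists_over_or_cuspAlong h P k s).resolve_right (not_cuspAlong_of_crossing h hc s)

/-- Along a crossing arc that ends at a swallowtail point, the coordinates of the base. -/
lemma exists_crossing_sheets (hc : IsCrossingEnd L (P.side α k) (P.sideEnd α k b)) :
    ∃ p ∈ L.swallowtail, ∃ s t r : Sheet L 2 α, s ≠ t ∧ s ≠ r ∧ t ≠ r ∧
      s.lift (P.cornerPoint α (sideCorner k b)) = p ∧
      t.lift (P.cornerPoint α (sideCorner k b)) = p ∧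
      r.lift (P.cornerPoint α (sideCorner k b)) = p ∧
      ∀ τ ∈ Ioo (P.angle α k) (P.angle α (k + 1)), s.lift (circlePoint τ) ≠ t.lift (circlePoint τ) ∧
        L.z (s.lift (circlePoint τ)) = L.z (t.lift (circlePoint τ)) := by
  obtain ⟨A, B, hAB⟩ := hc
  obtain ⟨C, hC, hCA, hCB, -⟩ := hAB.exists_third h
  obtain ⟨hne, h1, h2, he, hp⟩ := (crossAt_iff h).1 hAB
  obtain ⟨A', hA', -⟩ := existsUnique_over h A
  obtain ⟨B', hB', -⟩ := existsUnique_over h B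
  obtain ⟨C', hC', -⟩ := existsUnique_over h C
  refine ⟨_, hp, A', B', C', fun e => hne (hA'.unique h (e ▸ hB')),
    fun e => hCA (hC'.unique h (e ▸ hA')), fun e => hCB (hC'.unique h (e ▸ hB')),
    hA'.lift_corner h b, (hB'.lift_corner h b).trans he.symm, (hC'.lift_corner h b).trans hC, ?_⟩
  intro τ hτ
  have hb := P.sideParam_mem hτ
  have hA₂ := lift_circlePoint_eq h hτ ((over_iff h hτ).1 hA') hτ
  have hB₂ := lift_circlePoint_eq h hτ ((over_iff h hτ).1 hB') hτ
  rw [hA₂, hB₂]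
  refine ⟨fun e => hne (Sheet.eq_of_lift_eq h hb e), ?_⟩
  rcases Sheet.trichotomy h hne with hh | hh | ⟨-, hh⟩
  · exact absurd ((Sheet.above_iff h hb).2 (hh _ hb)) h1
  · exact absurd ((Sheet.above_iff h hb).2 (hh _ hb)) h2
  · exact hh _ hb

/-- Near a corner at which a crossing arc starts or ends at a swallowtail point, this arc is the
positive half of the first coordinate axis. -/
lemma eventually_coord_crossing {j : ℤ} (hj : sideCorner k b = j)
    (hc : IsCrossingEnd L (P.side α k) (P.sideEnd α k b))
    {p : Λ} (hp : p ∈ L.swallowtail) (hx : L.x p = map 2 α (P.cornerPoint α j)) {σ : ℝ}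
    (hσ : σ = 1 ∨ σ = -1) {φ : OpenPartialHomeomorph Λ Plane} {ψ : OpenPartialHomeomorph S Plane}
    {W : Set Λ} (hf : L.IsLocalForm (swForm σ) p φ ψ W) :
    (∀ᶠ τ in P.sideFilter α k b, τ ∈ Ioo (P.angle α k) (P.angle α (k + 1)) ∧
      0 < ψ (map 2 α (circlePoint τ)) 0 ∧ ψ (map 2 α (circlePoint τ)) 1 = 0) ∧
    ∀ᶠ θ in 𝓝[ball 0 1] (P.cornerPoint α j), ψ (map 2 α θ) 1 ≠ 0 := by
  subst hj
  obtain ⟨p', hp', s, t, r, hst, hsr, htr, hs, ht, hr, hz⟩ := exists_crossing_sheets h hc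
  obtain rfl : p' = p := by
    refine h.generic.eq_of_swallow hp (not_regular_of_swallow hp') ?_
    rw [hx, ← hs, s.x_lift h (P.cornerPoint_mem _)]
  constructor
  · have ms := tendsto_lift_corner h P k s b
    have mt := tendsto_lift_corner h P k t b
    rw [hs] at ms
    rw [ht] at mt
    filter_upwards [ms hf.mem_nhds, mt hf.mem_nhds, P.Ioo_mem_sideFilter b] with τ h1 h2 hτ
    obtain ⟨h3, h4⟩ := hz τ hτ
    have := hf.sw_coord_of_z_eq hσ h1 h2
      ((x_lift_circlePoint h s τ).trans (x_lift_circlePoint h t τ).symm) h3 h4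
    rw [x_lift_circlePoint h] at this
    exact ⟨hτ, this⟩
  · have hθ := P.cornerPoint_mem (α := α) (sideCorner k b)
    have ms := s.tendsto_lift h hθ
    have mt := t.tendsto_lift h hθ
    have mr := r.tendsto_lift h hθ
    rw [hs] at ms
    rw [ht] at mt
    rw [hr] at mr
    filter_upwards [ms hf.mem_nhds, mt hf.mem_nhds, mr hf.mem_nhds, self_mem_nhdsWithin]
      with θ h1 h2 h3 hb
    have hz : ∀ {a c : Sheet L 2 α}, a ≠ c → L.z (a.lift θ) ≠ L.z (c.lift θ) := by
      intro a c hac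
      rcases Sheet.above_or_above h hac with hh | hh
      · exact ((Sheet.above_iff h hb).1 hh).ne'
      · exact ((Sheet.above_iff h hb).1 hh).ne
    have hX : ∀ a : Sheet L 2 α, L.x (a.lift θ) = map 2 α θ := fun a =>
      a.x_lift h (ball_subset_closedBall hb)
    rw [← hX s]
    exact hf.sw_coord_ne_zero hσ h1 h2 h3 (by rw [hX, hX]) (by rw [hX, hX]) (hz hst) (hz hsr)
      (hz htr)

/-- The two sides at a corner are not both a crossing arc that ends at a swallowtail point. -/
lemma not_crossing_in_out (P : PolygonalDecomposition S) (α : Cell S 2) (k : ℤ)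
    (hi : CrossingIn L P α k) (ho : CrossingOut L P α k) : False := by
  have hk : sideCorner (k - 1) true = k := by simp [sideCorner]
  have hk' : sideCorner k false = k := by simp [sideCorner]
  have hi' : IsCrossingEnd L (P.side α (k - 1)) (P.sideEnd α (k - 1) true) := by
    simpa [sideEnd, CrossingIn] using hi
  have ho' : IsCrossingEnd L (P.side α k) (P.sideEnd α k false) := by
    simpa [sideEnd, CrossingOut] using ho
  obtain ⟨p, hp, s, -, -, -, -, -, hs, -⟩ := exists_crossing_sheets h ho'
  rw [hk'] at hs
  have hθ := P.cornerPoint_mem (α := α) k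
  have hx : L.x p = map 2 α (P.cornerPoint α k) := by rw [← hs, s.x_lift h hθ]
  obtain ⟨φ, ψ, W, hf⟩ := exists_isLocalForm_of_swallow hp
  have hσ := swSign_cases L p
  obtain ⟨hin, hne⟩ := eventually_coord_crossing h hk hi' hp hx hσ hf
  obtain ⟨hout, -⟩ := eventually_coord_crossing h hk' ho' hp hx hσ hf
  have hin' : ∀ᶠ τ in 𝓝[<] (P.angle α k), τ ∈ Ioo (P.angle α (k - 1)) (P.angle α k) ∧
      0 < ψ (map 2 α (circlePoint τ)) 0 ∧ ψ (map 2 α (circlePoint τ)) 1 = 0 := by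
    simpa [sideFilter] using hin
  have hout' : ∀ᶠ τ in 𝓝[>] (P.angle α k), τ ∈ Ioo (P.angle α k) (P.angle α (k + 1)) ∧
      0 < ψ (map 2 α (circlePoint τ)) 0 ∧ ψ (map 2 α (circlePoint τ)) 1 = 0 := by
    simpa [sideFilter] using hout
  clear hin hout
  have hsrc : map 2 α (P.cornerPoint α k) ∈ ψ.source := hx ▸ hf.base_mem
  have hcl : ∀ᶠ θ in 𝓝[closedBall 0 1] (P.cornerPoint α k), map 2 α θ ∈ ψ.source :=
    (continuousOn 2 α) _ hθ (ψ.open_source.mem_nhds hsrc)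
  obtain ⟨ρ₁, hρ₁, h1⟩ := Metric.mem_nhdsWithin_iff.1 hcl
  obtain ⟨ρ₂, hρ₂, h2⟩ := Metric.mem_nhdsWithin_iff.1 hne
  set ρ := min ρ₁ ρ₂ with hρ
  have hρ0 : 0 < ρ := lt_min hρ₁ hρ₂
  set B := ball (0 : Fin 2 → ℝ) 1 ∩ ball (P.cornerPoint α k) ρ with hB
  have hBs : ∀ θ ∈ B, map 2 α θ ∈ ψ.source := fun θ hθ =>
    h1 ⟨ball_subset_ball (min_le_left _ _) hθ.2, ball_subset_closedBall hθ.1⟩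
  have hBc : IsPreconnected B := ((convex_ball _ _).inter (convex_ball _ _)).isPreconnected
  have hcoord : Continuous fun y : Plane => y 1 := by fun_prop
  have hBf : ContinuousOn (fun θ => ψ (map 2 α θ) 1) B := by
    refine hcoord.comp_continuousOn (ψ.continuousOn.comp ((continuousOn 2 α).mono fun θ hθ =>
      ball_subset_closedBall hθ.1) hBs)
  obtain ⟨ς, -, hς⟩ := exists_sign_of_isPreconnected hBc hBf fun θ hθ =>
    h2 ⟨ball_subset_ball (min_le_right _ _) hθ.2, hθ.1⟩
  obtain ⟨δ₁, hδ₁, h3⟩ := Metric.mem_nhdsWithin_iff.1 hin'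
  obtain ⟨δ₂, hδ₂, h4⟩ := Metric.mem_nhdsWithin_iff.1 hout'
  obtain ⟨δ₃, hδ₃, h5⟩ := Metric.mem_nhds_iff.1
    (continuous_circlePoint.continuousAt.preimage_mem_nhds
      (ball_mem_nhds (circlePoint (P.angle α k)) hρ0))
  obtain ⟨δ, hδ, hδm⟩ : ∃ δ > 0, δ < min (min δ₁ δ₂) (min δ₃ (Real.pi / 2)) :=
    exists_between (lt_min (lt_min hδ₁ hδ₂) (lt_min hδ₃ (by positivity)))
  simp only [lt_min_iff] at hδm
  obtain ⟨⟨d1, d2⟩, d3, d4⟩ := hδm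
  set g : ℝ → ℝ := fun τ => ψ (map 2 α (circlePoint τ)) 0 with hg
  have hgs : ∀ τ ∈ Icc (P.angle α k - δ) (P.angle α k + δ),
      circlePoint τ ∈ ball (P.cornerPoint α k) ρ ∧ map 2 α (circlePoint τ) ∈ ψ.source := by
    intro τ hτ
    have hm : circlePoint τ ∈ ball (P.cornerPoint α k) ρ := h5 (by
      rw [mem_ball, Real.dist_eq, abs_lt]
      constructor <;> linarith [hτ.1, hτ.2])
    exact ⟨hm, h1 ⟨ball_subset_ball (min_le_left _ _) hm, circlePoint_mem τ⟩⟩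
  have hgc : ContinuousOn g (Icc (P.angle α k - δ) (P.angle α k + δ)) := by
    have hcoord : Continuous fun y : Plane => y 0 := by fun_prop
    exact hcoord.comp_continuousOn (ψ.continuousOn.comp (PolygonalDecomposition.continuous_map_circlePoint (α := α)).continuousOn
      fun τ hτ => (hgs τ hτ).2)
  have hg0 : g (P.angle α k) = 0 := by
    show ψ (map 2 α (P.cornerPoint α k)) 0 = 0
    rw [← hx, hf.base_eq_zero]; rfl
  have hneg : ∀ τ ∈ Ico (P.angle α k - δ) (P.angle α k),
      τ ∈ Ioo (P.angle α (k - 1)) (P.angle α k) ∧ 0 < g τ ∧ ψ (map 2 α (circlePoint τ)) 1 = 0 :=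
    fun τ hτ => h3 ⟨by rw [mem_ball, Real.dist_eq, abs_lt]; constructor <;> linarith [hτ.1, hτ.2],
      hτ.2⟩
  have hpos : ∀ τ ∈ Ioc (P.angle α k) (P.angle α k + δ),
      τ ∈ Ioo (P.angle α k) (P.angle α (k + 1)) ∧ 0 < g τ ∧ ψ (map 2 α (circlePoint τ)) 1 = 0 :=
    fun τ hτ => h4 ⟨by rw [mem_ball, Real.dist_eq, abs_lt]; constructor <;> linarith [hτ.1, hτ.2],
      hτ.1⟩
  have ga := (hneg (P.angle α k - δ) ⟨le_rfl, by linarith⟩).2.1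
  have gb := (hpos (P.angle α k + δ) ⟨by linarith, le_rfl⟩).2.1
  obtain ⟨v, hv0, hv⟩ : ∃ v > 0, v < min (g (P.angle α k - δ)) (g (P.angle α k + δ)) :=
    exists_between (lt_min ga gb)
  obtain ⟨hva, hvb⟩ := lt_min_iff.1 hv
  obtain ⟨τ₁, hτ₁, hτ₁v⟩ := intermediate_value_Ioo' (by linarith)
    (hgc.mono (Icc_subset_Icc_right (by linarith : P.angle α k ≤ P.angle α k + δ)))
    (show v ∈ Ioo (g (P.angle α k)) (g (P.angle α k - δ)) from ⟨by rw [hg0]; exact hv0, hva⟩)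
  obtain ⟨τ₂, hτ₂, hτ₂v⟩ := intermediate_value_Ioo (by linarith)
    (hgc.mono (Icc_subset_Icc_left (by linarith : P.angle α k - δ ≤ P.angle α k)))
    (show v ∈ Ioo (g (P.angle α k)) (g (P.angle α k + δ)) from ⟨by rw [hg0]; exact hv0, hvb⟩)
  obtain ⟨a1, -, a3⟩ := hneg τ₁ ⟨hτ₁.1.le, hτ₁.2⟩
  obtain ⟨-, -, b3⟩ := hpos τ₂ ⟨hτ₂.1, hτ₂.2.le⟩
  obtain ⟨a4, a5⟩ := hgs τ₁ ⟨hτ₁.1.le, by linarith [hτ₁.2]⟩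
  obtain ⟨b4, b5⟩ := hgs τ₂ ⟨by linarith [hτ₂.1], hτ₂.2.le⟩
  have hm : map 2 α (circlePoint τ₂) = map 2 α (circlePoint τ₁) :=
    ψ.injOn b5 a5 (Plane.ext (hτ₂v.trans hτ₁v.symm) (b3.trans a3.symm))
  have hmβ : map 2 α (circlePoint τ₁) ∈ openCell 1 (P.side α (k - 1)) :=
    P.map_mem_side (by simpa using a1)
  refine not_folded P (α := α) hmβ (circlePoint_mem τ₁) (circlePoint_mem τ₂)
    (circlePoint_ne (hτ₁.2.trans hτ₂.1) (by linarith [hτ₁.1, hτ₂.2])) fun N hN => ?_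
  -- the points near `m` of the 1-skeleton are on the first coordinate axis
  have hskel : ∀ᶠ u in 𝓝 (map 2 α (circlePoint τ₁)),
      (∃ n ≤ 1, ∃ e : Cell S n, u ∈ openCell n e) → ψ u 1 = 0 := by
    obtain ⟨ε, hε, hεm⟩ : ∃ ε > 0, ε < min (τ₁ - (P.angle α k - δ)) (P.angle α k - τ₁) :=
      exists_between (lt_min (by linarith [hτ₁.1]) (by linarith [hτ₁.2]))
    obtain ⟨ε1, ε2⟩ := lt_min_iff.1 hεm
    have hin : ∀ t ∈ Ioo (-ε) ε, τ₁ + t ∈ Ico (P.angle α k - δ) (P.angle α k) := fun t ht =>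
      ⟨by linarith [ht.1], by linarith [ht.2]⟩
    have hside : ∀ t ∈ Ioo (-ε) ε, τ₁ + t ∈ Ioo (P.angle α (k - 1)) (P.angle α (k - 1 + 1)) :=
      fun t ht => by simpa using (hneg _ (hin t ht)).1
    have hpath := eventually_mem_image_of_path (β := P.side α (k - 1))
      (γ := fun t => map 2 α (circlePoint (τ₁ + t))) hε
      ((PolygonalDecomposition.continuous_map_circlePoint (α := α)).comp (continuous_const.add continuous_id)).continuousOn
      (fun t ht t' ht' he => by
        have := (P.bijOn_side α (k - 1)).injOn (hside t ht) (hside t' ht') he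
        linarith)
      (by simpa using hmβ) fun t ht => ⟨1, le_rfl, _, P.map_mem_side (hside t ht)⟩
    simp only [add_zero] at hpath
    filter_upwards [hpath, eventually_mem_openCell_one hmβ] with u hu hu' hs
    obtain ⟨t, ht, rfl⟩ := hu (hu' hs)
    exact (hneg _ (hin t ht)).2.2
  obtain ⟨H, hHN, hHp, hH0, hHm⟩ := exists_half_disc ψ a5 ς (Filter.inter_mem hN hskel)
  refine ⟨H, fun u hu => (hHN hu).1, hHp, fun u hu hs => ?_, ?_, ?_⟩
  · have := hH0 u hu
    rw [(hHN hu).2 hs, mul_zero] at this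
    exact lt_irrefl _ this
  · have hB₁ : ∀ᶠ θ in 𝓝[ball 0 1] (circlePoint τ₁), θ ∈ B := inter_mem self_mem_nhdsWithin
      (nhdsWithin_le_nhds (isOpen_ball.mem_nhds a4))
    filter_upwards [hB₁, tendsto_map (e := α) (circlePoint_mem τ₁) hHm] with θ hθ hθ'
    exact hθ' (hς θ hθ)
  · have hB₂ : ∀ᶠ θ in 𝓝[ball 0 1] (circlePoint τ₂), θ ∈ B := inter_mem self_mem_nhdsWithin
      (nhdsWithin_le_nhds (isOpen_ball.mem_nhds b4))
    have ht := tendsto_map (e := α) (circlePoint_mem τ₂)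
    rw [hm] at ht
    filter_upwards [hB₂, ht hHm] with θ hθ hθ'
    exact hθ' (hς θ hθ)

end

section Maslov

open LegendrianSurface

variable {S Λ : Type*} [TopologicalSpace S] [ChartedSpace Plane S] [IsManifold (𝓡 2) ∞ S]
  [TopologicalSpace Λ] [ChartedSpace Plane Λ] {L : LegendrianSurface S Λ}

lemma isPreconnected_subset_range_val {X : Type*} [TopologicalSpace X] {A T : Set X}
    (hT : IsPreconnected T) (hA : T ⊆ A) : IsPreconnected ((↑) ⁻¹' T : Set A) := by
  rw [← Topology.IsInducing.subtypeVal.isPreconnected_image, Subtype.image_preimage_coe,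
    inter_eq_right.2 hA]
  exact hT

namespace LegendrianSurface.MaslovPotential

variable (μ : L.MaslovPotential)

lemma eq_of_isPreconnected {T : Set Λ} (hT : IsPreconnected T) (hr : T ⊆ L.regular) {p q : Λ}
    (hp : p ∈ T) (hq : q ∈ T) : μ.toFun ⟨p, hr hp⟩ = μ.toFun ⟨q, hr hq⟩ :=
  μ.isLocallyConstant.apply_eq_of_isPreconnected (isPreconnected_subset_range_val hT hr) hp hq

lemma eventually_eq {p : Λ} (hp : p ∈ L.regular) :
    ∀ᶠ q in 𝓝 p, ∀ hq : q ∈ L.regular, μ.toFun ⟨q, hq⟩ = μ.toFun ⟨p, hp⟩ := by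
  have h1 : ∀ᶠ q in 𝓝 (⟨p, hp⟩ : L.regular), μ.toFun q = μ.toFun ⟨p, hp⟩ :=
    (μ.isLocallyConstant.isOpen_fiber (μ.toFun ⟨p, hp⟩)).mem_nhds rfl
  rw [nhds_subtype_eq_comap, eventually_comap] at h1
  filter_upwards [h1] with q hq hr
  exact hq ⟨q, hr⟩ rfl

lemma hasValueAt_iff_of_regular {p : Λ} (hp : p ∈ L.regular) (v : ZMod L.maslovNumber) :
    μ.HasValueAt p v ↔ μ.toFun ⟨p, hp⟩ = v := by
  constructor
  · rintro ⟨W, -, hf⟩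
    obtain ⟨q, ⟨hq, -, h1⟩, h2⟩ := (hf.and_eventually (μ.eventually_eq hp)).exists
    rw [← h2 hq, h1]
  · intro hv
    obtain ⟨W, hW, hi⟩ := exists_injOn_of_regular hp
    refine ⟨W, hW, Eventually.frequently ?_⟩
    filter_upwards [μ.eventually_eq hp, isOpen_regular.mem_nhds hp, hW] with q h1 h2 h3
    exact ⟨h2, fun q' hq' hx => hi hq' h3 hx, (h1 h2).trans hv⟩

lemma onSheet_eq {s : Set Λ} {v : ZMod L.maslovNumber} (h1 : ∃ p ∈ s, μ.HasValueAt p v)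
    (h2 : ∀ p ∈ s, ∀ w, μ.HasValueAt p w → w = v) : μ.onSheet s = v := by
  have : ∃ w, ∃ p ∈ s, μ.HasValueAt p w := ⟨v, h1⟩
  obtain ⟨p, hp, hw⟩ := Classical.epsilon_spec this
  exact h2 p hp _ hw

lemma onSheet_of_regular {s : Set Λ} (hs : IsPreconnected s) (hr : s ⊆ L.regular) {p : Λ}
    (hp : p ∈ s) : μ.onSheet s = μ.toFun ⟨p, hr hp⟩ := by
  refine μ.onSheet_eq ⟨p, hp, (μ.hasValueAt_iff_of_regular (hr hp) _).2 rfl⟩ fun q hq w hw => ?_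
  rw [← (μ.hasValueAt_iff_of_regular (hr hq) _).1 hw]
  exact μ.eq_of_isPreconnected hs hr hq hp

end LegendrianSurface.MaslovPotential

/-- `1` at an upward swallowtail point and `-1` at a downward one. -/
def maslovJump (L : LegendrianSurface S Λ) (p : Λ) : ZMod L.maslovNumber :=
  if p ∈ L.swallowUp then 1 else -1

variable {p : Λ} {φ : OpenPartialHomeomorph Λ Plane} {ψ : OpenPartialHomeomorph S Plane}
  {W : Set Λ}

set_option maxHeartbeats 1000000 in
/-- The values of a Maslov potential near a swallowtail point. -/
lemma LegendrianSurface.MaslovPotential.exists_value_of_swallow (μ : L.MaslovPotential)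
    (hL : L.IsGeneric) (hp : p ∈ L.swallowtail)
    (hf : L.IsLocalForm (swForm (L.swSign p)) p φ ψ W) :
    ∃ v, (∀ w, μ.HasValueAt p w ↔ w = v) ∧ ∃ W' ∈ 𝓝 p, ∀ q ∈ W', ∀ hq : q ∈ L.regular,
      (disc φ q < 0 → μ.toFun ⟨q, hq⟩ = v) ∧
      (0 < disc φ q → μ.toFun ⟨q, hq⟩ = v + maslovJump L p) := by
  set σ := L.swSign p with hσd
  have hσ : σ = 1 ∨ σ = -1 := by rw [hσd, swSign]; split_ifs <;> simp
  obtain ⟨r, hr, hsr⟩ := hf.exists_radius hf.mem hf.mem_nhds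
  rw [hf.map_eq_zero] at hsr
  simp only [PiLp.zero_apply, sub_zero] at hsr
  obtain ⟨δ, hδ, hδr⟩ : ∃ δ > 0, δ < min 1 (r / 8) := exists_between (lt_min one_pos (by positivity))
  obtain ⟨hδ1, hδr⟩ := lt_min_iff.1 hδr
  set G : ℝ × ℝ → Λ := fun a => φ.symm !₂[a.1 + 6 * a.2 ^ 2, a.2] with hG
  have hbox : ∀ a : ℝ × ℝ, |a.1| < δ → |a.2| < δ → G a ∈ W ∧ φ (G a) = !₂[a.1 + 6 * a.2 ^ 2, a.2] := by
    intro a h1 h2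
    have h3 : a.2 ^ 2 < δ := by
      rw [← sq_abs]; nlinarith [abs_nonneg a.2]
    obtain ⟨h4, h5⟩ := abs_lt.1 h1
    obtain ⟨-, b2, b3⟩ := hsr !₂[a.1 + 6 * a.2 ^ 2, a.2]
      (by
        show |a.1 + 6 * a.2 ^ 2| < r
        rw [abs_lt]; constructor <;> nlinarith [sq_nonneg a.2])
      (by show |a.2| < r; linarith)
    exact ⟨b2, b3⟩
  have hdisc : ∀ a : ℝ × ℝ, |a.1| < δ → |a.2| < δ → disc φ (G a) = a.1 := by
    intro a h1 h2
    rw [disc, (hbox a h1 h2).2]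
    show a.1 + 6 * a.2 ^ 2 - 6 * a.2 ^ 2 = a.1
    ring
  have hGc : ∀ R : Set (ℝ × ℝ), (∀ a ∈ R, |a.1| < δ ∧ |a.2| < δ) → ContinuousOn G R := by
    intro R hR
    have hc : Continuous fun a : ℝ × ℝ => (!₂[a.1 + 6 * a.2 ^ 2, a.2] : Plane) := by fun_prop
    refine φ.continuousOn_symm.comp hc.continuousOn fun a ha => ?_
    obtain ⟨h1, h2⟩ := hbox a (hR a ha).1 (hR a ha).2
    rw [← h2]
    exact φ.map_source (hf.source h1)
  have hreg : ∀ q ∈ W, disc φ q ≠ 0 → q ∈ L.regular := fun q hq hd =>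
    hL.regular_of_injOn (hf.sw_injOn hq hd)
  have hconst : ∀ I : Set ℝ, Convex ℝ I → (∀ s ∈ I, |s| < δ ∧ s ≠ 0) → ∀ q ∈ W, ∀ q' ∈ W,
      |φ q 1| < δ → |φ q' 1| < δ → disc φ q ∈ I → disc φ q' ∈ I → ∀ hq : q ∈ L.regular,
      ∀ hq' : q' ∈ L.regular, μ.toFun ⟨q, hq⟩ = μ.toFun ⟨q', hq'⟩ := by
    intro I hI hI0 q hqW q' hqW' h1 h1' hd hd' hq hq'
    have hsub : ∀ a ∈ I ×ˢ Ioo (-δ) δ, |a.1| < δ ∧ |a.2| < δ := fun a ha =>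
      ⟨(hI0 _ ha.1).1, abs_lt.2 ha.2⟩
    have hpre : IsPreconnected (G '' (I ×ˢ Ioo (-δ) δ)) :=
      (hI.prod (convex_Ioo _ _)).isPreconnected.image _ (hGc _ hsub)
    have hr : G '' (I ×ˢ Ioo (-δ) δ) ⊆ L.regular := by
      rintro _ ⟨a, ha, rfl⟩
      refine hreg _ (hbox a (hsub a ha).1 (hsub a ha).2).1 ?_
      rw [hdisc a (hsub a ha).1 (hsub a ha).2]
      exact (hI0 _ ha.1).2
    have hmem : ∀ q ∈ W, |φ q 1| < δ → disc φ q ∈ I → q ∈ G '' (I ×ˢ Ioo (-δ) δ) := by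
      intro q hq h1 hd
      refine ⟨(disc φ q, φ q 1), ⟨hd, abs_lt.1 h1⟩, ?_⟩
      obtain ⟨h2, h3⟩ := hbox (disc φ q, φ q 1) (hI0 _ hd).1 h1
      refine hf.eq_of_map_eq h2 hq ?_
      rw [h3]
      refine Plane.ext ?_ rfl
      show disc φ q + 6 * φ q 1 ^ 2 = φ q 0
      rw [disc]; ring
    exact μ.eq_of_isPreconnected hpre hr (hmem q hqW h1 hd) (hmem q' hqW' h1' hd')
  have hIneg : ∀ s ∈ Ioo (-δ) 0, |s| < δ ∧ s ≠ 0 := fun s hs =>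
    ⟨abs_lt.2 ⟨hs.1, by linarith [hs.2]⟩, hs.2.ne⟩
  have hIpos : ∀ s ∈ Ioo 0 δ, |s| < δ ∧ s ≠ 0 := fun s hs =>
    ⟨abs_lt.2 ⟨by linarith [hs.1], hs.2⟩, hs.1.ne'⟩
  -- a cusp edge near the swallowtail point
  set t : ℝ := δ / 2 with ht
  have ht0 : 0 < t := by positivity
  obtain ⟨c1, c2⟩ := hbox (0, t) (by simpa using hδ) (by rw [abs_of_pos ht0]; linarith)
  have hcd : φ (G (0, t)) 1 = t := by rw [c2]; rfl
  have hcusp : G (0, t) ∈ L.cuspEdge := hL.cusp_of_not_injOn (hf.sw_not_injOn c1 (by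
      rw [c2]; show (0 : ℝ) + 6 * t ^ 2 - 6 * t ^ 2 = 0; ring))
    (hf.sw_not_hasTriples c1 (by rw [hcd]; exact ht0.ne'))
  obtain ⟨Wc, hWc, hjump⟩ := μ.cusp _ hcusp
  obtain ⟨ρ, hρ, hsρ⟩ := hf.exists_radius c1 hWc
  obtain ⟨η, hη, hηm⟩ : ∃ η > 0, η < min (min (t / 100) 1) (min (ρ / 2) (δ / 100)) :=
    exists_between (by positivity)
  simp only [lt_min_iff] at hηm
  obtain ⟨⟨e1, e1'⟩, e2, e3⟩ := hηm
  have hη2 : η ^ 2 < η := by nlinarith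
  have hpt : ∀ ε : ℝ, |ε| = 1 → φ.symm !₂[6 * t ^ 2 + 2 * η ^ 2, t + ε * η] ∈ Wc ∧
      φ.symm !₂[6 * t ^ 2 + 2 * η ^ 2, t + ε * η] ∈ W ∧
      φ (φ.symm !₂[6 * t ^ 2 + 2 * η ^ 2, t + ε * η]) = !₂[6 * t ^ 2 + 2 * η ^ 2, t + ε * η] := by
    intro ε hε
    refine hsρ _ ?_ ?_ <;> rw [c2]
    · show |6 * t ^ 2 + 2 * η ^ 2 - (0 + 6 * t ^ 2)| < ρ
      rw [abs_lt]; constructor <;> nlinarith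
    · show |t + ε * η - t| < ρ
      rw [add_sub_cancel_left, abs_mul, hε, abs_of_pos hη]; linarith
  obtain ⟨q1, q2, q3⟩ := hpt 1 (by simp)
  obtain ⟨q1', q2', q3'⟩ := hpt (-1) (by simp)
  set q := φ.symm !₂[6 * t ^ 2 + 2 * η ^ 2, t + 1 * η] with hqd
  set q' := φ.symm !₂[6 * t ^ 2 + 2 * η ^ 2, t + -1 * η] with hqd'
  have hφ : φ q 0 = 6 * t ^ 2 + 2 * η ^ 2 ∧ φ q 1 = t + η := by rw [q3]; simp
  have hφ' : φ q' 0 = 6 * t ^ 2 + 2 * η ^ 2 ∧ φ q' 1 = t - η := by rw [q3']; simp [sub_eq_add_neg]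
  have hd : disc φ q = -(4 * η ^ 2 + 12 * t * η) := by rw [disc, hφ.1, hφ.2]; ring
  have hd' : disc φ q' = 12 * t * η - 4 * η ^ 2 := by rw [disc, hφ'.1, hφ'.2]; ring
  have htη : 0 < t * η := by positivity
  have htη2 : t * η ≤ η := by nlinarith
  have hηt : η ^ 2 < t * η := by nlinarith
  have hdI : disc φ q ∈ Ioo (-δ) 0 := by rw [hd]; constructor <;> nlinarith
  have hdI' : disc φ q' ∈ Ioo 0 δ := by rw [hd']; constructor <;> nlinarith
  have hqr := hreg q q2 (hIneg _ hdI).2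
  have hqr' := hreg q' q2' (hIpos _ hdI').2
  have hb : |φ q 1| < δ := by rw [hφ.2, abs_lt]; constructor <;> linarith
  have hb' : |φ q' 1| < δ := by rw [hφ'.2, abs_lt]; constructor <;> linarith
  have hxx : L.x q = L.x q' := (hf.x_eq_iff q2 q2').2 ((swForm_eq_iff _ _ _).2 (by
    rw [hφ.1, hφ.2, hφ'.1, hφ'.2]; exact ⟨rfl, by ring⟩))
  have hzz : 0 < σ * (L.z q' - L.z q) := by
    rw [hf.sw_lt_iff hσ q2' q2 hxx.symm (by rw [hφ.2, hφ'.2]; intro h; linarith), hφ.2, hφ'.2]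
    have : -((t - η - (t + η)) ^ 3 * (t - η + (t + η))) = 16 * η ^ 3 * t := by ring
    rw [this]; positivity
  have hmu : μ.toFun ⟨q', hqr'⟩ = μ.toFun ⟨q, hqr⟩ + maslovJump L p := by
    by_cases hu : p ∈ L.swallowUp
    · have hσ1 : σ = 1 := by rw [hσd, swSign, if_pos hu]
      rw [hσ1] at hzz
      rw [maslovJump, if_pos hu]
      exact hjump ⟨q', hqr'⟩ ⟨q, hqr⟩ q1' q1 hxx.symm (by linarith)
    · have hσ1 : σ = -1 := by rw [hσd, swSign, if_neg hu]
      rw [hσ1] at hzz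
      rw [maslovJump, if_neg hu, hjump ⟨q, hqr⟩ ⟨q', hqr'⟩ q1 q1' hxx (by linarith)]
      ring
  have hW'n : {q : Λ | q ∈ W ∧ |φ q 1| < δ ∧ |disc φ q| < δ} ∈ 𝓝 p := by
    filter_upwards [hf.nhds_of_radius hf.mem (by positivity : 0 < δ / 8)] with a ha
    rw [hf.map_eq_zero] at ha
    simp only [PiLp.zero_apply, sub_zero] at ha
    refine ⟨ha.1, by linarith [ha.2.2], ?_⟩
    have h2 : (φ a 1) ^ 2 < δ / 8 := by
      rw [← sq_abs]; nlinarith [abs_nonneg (φ a 1), ha.2.2]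
    have h3 := abs_lt.1 ha.2.1
    rw [disc, abs_lt]
    constructor <;> nlinarith [sq_nonneg (φ a 1)]
  have hval : ∀ a ∈ {q : Λ | q ∈ W ∧ |φ q 1| < δ ∧ |disc φ q| < δ}, ∀ ha : a ∈ L.regular,
      (disc φ a < 0 → μ.toFun ⟨a, ha⟩ = μ.toFun ⟨q, hqr⟩) ∧
      (0 < disc φ a → μ.toFun ⟨a, ha⟩ = μ.toFun ⟨q, hqr⟩ + maslovJump L p) := by
    rintro a ⟨haW, ha1, had⟩ ha
    refine ⟨fun hn => ?_, fun hn => ?_⟩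
    · exact hconst _ (convex_Ioo _ _) hIneg a haW q q2 ha1 hb ⟨(abs_lt.1 had).1, hn⟩ hdI ha hqr
    · rw [← hmu]
      exact hconst _ (convex_Ioo _ _) hIpos a haW q' q2' ha1 hb' ⟨hn, (abs_lt.1 had).2⟩ hdI' ha hqr'
  refine ⟨μ.toFun ⟨q, hqr⟩, fun w => ⟨?_, ?_⟩, _, hW'n, hval⟩
  · rintro ⟨V, hV, hfr⟩
    obtain ⟨W₁, hW₁, hiso⟩ := hL.exists_isolating p
    have hev := (L.continuous_x.tendsto p).eventually
      (hL.eventually_fiber_of_swallow hf hσ (Filter.inter_mem hV hf.mem_nhds) inter_subset_right)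
    obtain ⟨a, ⟨har, halone, hav⟩, haW, hsf, ha₁, haV⟩ := (hfr.and_eventually
      ((show ∀ᶠ a in 𝓝 p, a ∈ {q : Λ | q ∈ W ∧ |φ q 1| < δ ∧ |disc φ q| < δ} from hW'n).and
        (hev.and ((show ∀ᶠ a in 𝓝 p, a ∈ W₁ from hW₁).and
          (show ∀ᶠ a in 𝓝 p, a ∈ V from hV))))).exists
    rw [← hav]
    refine (hval a haW har).1 ?_
    have hne : L.x a ≠ L.x p := fun he => not_regular_of_swallow hp (hiso a ha₁ he ▸ har)
    have ham : a ∈ V ∩ W ∩ L.x ⁻¹' {L.x a} := ⟨⟨haV, haW.1⟩, rfl⟩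
    have hal : ∀ b ∈ V ∩ W ∩ L.x ⁻¹' {L.x a}, b = a := fun b hb => halone b hb.1.1 hb.2
    cases hsf hne with
    | one q₁ hq₁ hdq hh => rw [hh] at ham; rwa [mem_singleton_iff.1 ham]
    | two c q₁ hc hq₁ hdq hz hh =>
      rw [hh] at hal
      exact absurd ((hal c (by simp)).symm ▸ har) (not_regular_of_cusp hc)
    | three a' b c ha' hb hc hbc hda hdb hdc hzb hzc hh =>
      rw [hh] at hal
      exact absurd ((hal b (by simp)).trans (hal c (by simp)).symm) hbc
  · rintro rfl
    refine ⟨W, hf.mem_nhds, ?_⟩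
    rw [frequently_nhds_iff]
    intro U hpU hU
    obtain ⟨ρ', hρ', hsρ'⟩ := hf.exists_radius hf.mem (hU.mem_nhds hpU)
    rw [hf.map_eq_zero] at hsρ'
    simp only [PiLp.zero_apply, sub_zero] at hsρ'
    obtain ⟨κ, hκ, hκm⟩ := exists_between (lt_min hρ' hδ)
    obtain ⟨k1, k2⟩ := lt_min_iff.1 hκm
    obtain ⟨b1, b2, b3⟩ := hsρ' !₂[-κ, 0] (by show |-κ| < ρ'; rw [abs_neg, abs_of_pos hκ]; exact k1)
      (by show |(0 : ℝ)| < ρ'; simpa using hρ')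
    have hb0 : φ (φ.symm !₂[-κ, 0]) 0 = -κ ∧ φ (φ.symm !₂[-κ, 0]) 1 = 0 := by rw [b3]; simp
    have hbd : disc φ (φ.symm !₂[-κ, 0]) = -κ := by rw [disc, hb0.1, hb0.2]; ring
    have hbr := hreg _ b2 (by rw [hbd]; linarith)
    refine ⟨_, b1, hbr, fun a ha hx => ?_, (hval _ ⟨b2, ?_, ?_⟩ hbr).1 (by rw [hbd]; linarith)⟩
    · obtain ⟨x0, x1⟩ := (swForm_eq_iff _ _ _).1 ((hf.x_eq_iff ha b2).1 hx)
      refine hf.eq_of_map_eq ha b2 (Plane.ext x0 ?_)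
      rw [x0, hb0.1, hb0.2] at x1
      rw [hb0.2]
      have : φ a 1 * (κ + 2 * φ a 1 ^ 2) = 0 := by linarith
      exact (mul_eq_zero.1 this).resolve_right (by positivity)
    · rw [hb0.2]; simpa using hδ
    · rw [hbd, abs_neg, abs_of_pos hκ]; exact k2

end Maslov

section MaslovSheets

open LegendrianSurface PolygonalDecomposition

variable {S Λ : Type*} [TopologicalSpace S] [ChartedSpace Plane S] [IsManifold (𝓡 2) ∞ S]
  [TopologicalSpace Λ] [ChartedSpace Plane Λ] [CWComplex (univ : Set S)]
  {L : LegendrianSurface S Λ} {P : PolygonalDecomposition S}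
  (h : IsCellular L) [T2Space S] (μ : L.MaslovPotential)
include h

omit h [T2Space S] in
lemma Sheet.isPreconnected {n : ℕ} {e : Cell S n} (s : Sheet L n e) : IsPreconnected s.1 := by
  obtain ⟨p, -, hp⟩ := s.2.1
  rw [hp]
  exact isPreconnected_connectedComponentIn

lemma Sheet.subset_regular {n : ℕ} {e : Cell S n} (s : Sheet L n e) (hn : n ≠ 0) :
    s.1 ⊆ L.regular := fun _ hp => Sheet.regular_of_mem h hn hp

lemma onSheet_eq_of_mem {n : ℕ} {e : Cell S n} (s : Sheet L n e) (hn : n ≠ 0) {p : Λ}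
    (hp : p ∈ s.1) : μ.onSheet s.1 = μ.toFun ⟨p, s.subset_regular h hn hp⟩ :=
  μ.onSheet_of_regular (s.isPreconnected) (s.subset_regular h hn) hp

lemma Sheet.eq_of_mem_zero {v : Cell S 0} {s : Sheet L 0 v} {p q : Λ} (hp : p ∈ s.1)
    (hq : q ∈ s.1) : p = q := by
  rw [Sheet.eq_image h s] at hp hq
  obtain ⟨a, -, rfl⟩ := hp
  obtain ⟨b, -, rfl⟩ := hq
  rw [Subsingleton.elim a b]

lemma hasValueAt_onSheet_zero {v : Cell S 0} {s : Sheet L 0 v} {p : Λ} (hp : p ∈ s.1)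
    {w : ZMod L.maslovNumber} (hw : ∀ w', μ.HasValueAt p w' ↔ w' = w) : μ.onSheet s.1 = w :=
  μ.onSheet_eq ⟨p, hp, (hw w).2 rfl⟩ fun _ hq w' hw' =>
    (hw w').1 (Sheet.eq_of_mem_zero h hp hq ▸ hw')

variable [IsManifold (𝓡 2) ∞ Λ] {n : ℕ} {e : Cell S n} {θ : Fin n → ℝ}
  (hθ : θ ∈ closedBall (0 : Fin n → ℝ) 1)
include hθ

omit [IsManifold (𝓡 2) ∞ Λ] in
lemma onSheet_eq_of_lift_regular {s : Sheet L n e} (hn : n ≠ 0) (hr : s.lift θ ∈ L.regular) :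
    μ.onSheet s.1 = μ.toFun ⟨s.lift θ, hr⟩ := by
  have := neBot_nhdsWithin_ball hθ
  obtain ⟨θ', h1, h2⟩ := (((s.tendsto_lift h hθ).eventually (μ.eventually_eq hr)).and
    (show ∀ᶠ θ' in 𝓝[ball 0 1] θ, θ' ∈ ball (0 : Fin n → ℝ) 1 from self_mem_nhdsWithin)).exists
  have hm := s.lift_mem h h2
  rw [onSheet_eq_of_mem h μ s hn hm]
  exact h1 _

lemma onSheet_eq_of_cusp {s t : Sheet L n e} (hn : n ≠ 0) (ha : s.Above t)
    (he : s.lift θ = t.lift θ) (hc : s.lift θ ∈ L.cuspEdge) :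
    μ.onSheet s.1 = μ.onSheet t.1 + 1 := by
  have := neBot_nhdsWithin_ball hθ
  obtain ⟨W, hW, hj⟩ := μ.cusp _ hc
  obtain ⟨θ', h1, h2, h3⟩ := ((show ∀ᶠ θ' in 𝓝[ball 0 1] θ, s.lift θ' ∈ W from
    s.tendsto_lift h hθ hW).and
    ((show ∀ᶠ θ' in 𝓝[ball 0 1] θ, t.lift θ' ∈ W from t.tendsto_lift h hθ (he ▸ hW)).and
    (show ∀ᶠ θ' in 𝓝[ball 0 1] θ, θ' ∈ ball (0 : Fin n → ℝ) 1 from self_mem_nhdsWithin))).exists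
  have hb := ball_subset_closedBall h3
  rw [onSheet_eq_of_mem h μ s hn (s.lift_mem h h3), onSheet_eq_of_mem h μ t hn (t.lift_mem h h3)]
  exact hj ⟨_, _⟩ ⟨_, _⟩ h1 h2 (by
    show L.x _ = L.x _
    rw [s.x_lift h hb, t.x_lift h hb]) ((Sheet.above_iff h h3).1 ha)

/-- The values of a Maslov potential on the sheets that meet at a swallowtail point. -/
lemma onSheet_of_swallow (hn : n ≠ 0) {p : Λ} (hp : p ∈ L.swallowtail) (hx : L.x p = map n e θ) :
    ∃ v, (∀ w, μ.HasValueAt p w ↔ w = v) ∧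
      ((∃ s : Sheet L n e, s.lift θ = p ∧ (∀ r : Sheet L n e, r.lift θ = p → r = s) ∧
        μ.onSheet s.1 = v) ∨
      ∃ a b c : Sheet L n e, a.lift θ = p ∧ b.lift θ = p ∧ c.lift θ = p ∧ b ≠ c ∧
        (∀ r : Sheet L n e, r.lift θ = p → r = a ∨ r = b ∨ r = c) ∧
        (p ∈ L.swallowUp → a.Above b ∧ a.Above c) ∧ (p ∉ L.swallowUp → b.Above a ∧ c.Above a) ∧
        μ.onSheet a.1 = v + maslovJump L p ∧ μ.onSheet b.1 = v ∧ μ.onSheet c.1 = v) := by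
  obtain ⟨φ, ψ, W, hf⟩ := exists_isLocalForm_of_swallow hp
  obtain ⟨v, hv, W', hW', hval⟩ := μ.exists_value_of_swallow h.generic hp hf
  refine ⟨v, hv, ?_⟩
  obtain ⟨θ', hθ', hh⟩ := Sheet.cases_of_swallow h hθ hn hx (swSign_cases L p) hp hf hW'
  have key : ∀ s : Sheet L n e, s.lift θ' ∈ W' →
      (disc φ (s.lift θ') < 0 → μ.onSheet s.1 = v) ∧
      (0 < disc φ (s.lift θ') → μ.onSheet s.1 = v + maslovJump L p) := fun s hs => by
    rw [onSheet_eq_of_mem h μ s hn (s.lift_mem h hθ')]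
    exact hval _ hs _
  rcases hh with ⟨s, hs, hu, hm, hd⟩ | ⟨a, b, c, ha, hb, hc, hbc, hall, h1, h2, ⟨ma, mb, mc⟩, da,
    db, dc⟩
  · exact Or.inl ⟨s, hs, hu, (key s hm).1 hd⟩
  · exact Or.inr ⟨a, b, c, ha, hb, hc, hbc, hall, fun hu => h1 (by simp [swSign, hu]),
      fun hu => h2 (by simp [swSign, hu]), (key a ma).2 da, (key b mb).1 db, (key c mc).1 dc⟩

/-- Of two sheets that cancel, the value of a Maslov potential on the upper one is greater by `1`. -/
lemma Cancel.onSheet_eq (hn : n ≠ 0) {s t : Sheet L n e} (hc : Cancel θ s t) :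
    μ.onSheet s.1 = μ.onSheet t.1 + 1 := by
  obtain ⟨he, ha, hc⟩ := hc
  have hst := ha.ne h
  have hx := s.x_lift h hθ
  rcases hc with hc | ⟨hu, r, hr, htr⟩ | ⟨hp, hu, r, hr, hrs⟩
  · exact onSheet_eq_of_cusp h μ hθ hn ha he hc
  · obtain ⟨v, -, ⟨x, -, hux, -⟩ | ⟨a, b, c, -, -, -, -, hall, hup, -, va, vb, vc⟩⟩ :=
      onSheet_of_swallow h μ hθ hn (Or.inl hu) hx
    · exact absurd ((hux s rfl).trans (hux t he.symm).symm) hst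
    · have hsr := (ha.trans h htr)
      have key : s = a ∧ (t = b ∨ t = c) := by
        have h1 := hup hu
        rcases hall s rfl with rfl | rfl | rfl <;> rcases hall t he.symm with rfl | rfl | rfl
        · exact absurd rfl hst
        · exact ⟨rfl, Or.inl rfl⟩
        · exact ⟨rfl, Or.inr rfl⟩
        · exact absurd h1.1 (ha.asymm h)
        · exact absurd rfl hst
        · rcases hall r hr with rfl | rfl | rfl
          · exact absurd h1.1 (hsr.asymm h)
          · exact absurd rfl (hsr.ne h)
          · exact absurd rfl (htr.ne h)
        · exact absurd h1.2 (ha.asymm h)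
        · rcases hall r hr with rfl | rfl | rfl
          · exact absurd h1.2 (hsr.asymm h)
          · exact absurd rfl (htr.ne h)
          · exact absurd rfl (hsr.ne h)
        · exact absurd rfl hst
      obtain ⟨rfl, rfl | rfl⟩ := key
      · rw [va, vb, maslovJump, if_pos hu]
      · rw [va, vc, maslovJump, if_pos hu]
  · obtain ⟨v, -, ⟨x, -, hux, -⟩ | ⟨a, b, c, -, -, -, -, hall, -, hdn, va, vb, vc⟩⟩ :=
      onSheet_of_swallow h μ hθ hn hp hx
    · exact absurd ((hux s rfl).trans (hux t he.symm).symm) hst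
    · have hrt := (hrs.trans h ha)
      have key : t = a ∧ (s = b ∨ s = c) := by
        have h1 := hdn hu
        rcases hall t he.symm with rfl | rfl | rfl <;> rcases hall s rfl with rfl | rfl | rfl
        · exact absurd rfl hst
        · exact ⟨rfl, Or.inl rfl⟩
        · exact ⟨rfl, Or.inr rfl⟩
        · exact absurd h1.1 (ha.asymm h)
        · exact absurd rfl hst
        · rcases hall r hr with rfl | rfl | rfl
          · exact absurd h1.1 (hrt.asymm h)
          · exact absurd rfl (hrt.ne h)
          · exact absurd rfl (hrs.ne h)
        · exact absurd h1.2 (ha.asymm h)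
        · rcases hall r hr with rfl | rfl | rfl
          · exact absurd h1.2 (hrt.asymm h)
          · exact absurd rfl (hrs.ne h)
          · exact absurd rfl (hrt.ne h)
        · exact absurd rfl hst
      obtain ⟨rfl, rfl | rfl⟩ := key
      · rw [va, vb, maslovJump, if_neg hu]; ring
      · rw [va, vc, maslovJump, if_neg hu]; ring

/-- A Maslov potential has the same value on a sheet that is not cancelled as on the sheet above a
boundary cell that is in its closure. -/
lemma onSheet_eq_of_not_cancelled (hn : n ≠ 0) (hO : IsOrdered L e θ) {s : Sheet L n e}
    (hs : ¬ Cancelled θ s) {m : ℕ} {e' : Cell S m} {T : Sheet L m e'} (hT : s.lift θ ∈ T.1) :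
    μ.onSheet s.1 = μ.onSheet T.1 := by
  have hx := s.x_lift h hθ
  rcases h.generic.cases (s.lift θ) with hr | hc | hp
  · rw [onSheet_eq_of_lift_regular h μ hθ hn hr]
    by_cases hm : m = 0
    · subst hm
      refine (hasValueAt_onSheet_zero h μ hT fun w' => ?_).symm
      rw [μ.hasValueAt_iff_of_regular hr, eq_comm]
    · rw [onSheet_eq_of_mem h μ T hm hT]
  · exact absurd hc (Sheet.not_cusp_of_mem h hT)
  · have hm : m = 0 := by
      by_contra hm
      exact not_regular_of_swallow hp (T.subset_regular h hm hT)
    subst hm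
    obtain ⟨v, hv, hh⟩ := onSheet_of_swallow h μ hθ hn hp hx
    rw [hasValueAt_onSheet_zero h μ hT hv]
    rcases hh with ⟨r, -, hu, hr⟩ | ⟨a, b, c, ha, hb, hc, hbc, hall, hup, hdn, va, vb, vc⟩
    · rw [hu s rfl, hr]
    · rcases hall s rfl with rfl | rfl | rfl
      · exfalso
        apply hs
        by_cases hu : s.lift θ ∈ L.swallowUp
        · obtain ⟨h1, h2⟩ := hup hu
          rcases hO b c hbc (hb.trans hc.symm) (hb.symm ▸ hp) with h3 | h3
          · exact ⟨b, Or.inl ⟨hb.symm, h1, Or.inr (Or.inl ⟨hu, c, hc, h3⟩)⟩⟩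
          · exact ⟨c, Or.inl ⟨hc.symm, h2, Or.inr (Or.inl ⟨hu, b, hb, h3⟩)⟩⟩
        · obtain ⟨h1, h2⟩ := hdn hu
          rcases hO b c hbc (hb.trans hc.symm) (hb.symm ▸ hp) with h3 | h3
          · exact ⟨c, Or.inr ⟨hc, h2, Or.inr (Or.inr ⟨hc.symm ▸ hp, hc.symm ▸ hu, b,
              hb.trans hc.symm, h3⟩)⟩⟩
          · exact ⟨b, Or.inr ⟨hb, h1, Or.inr (Or.inr ⟨hb.symm ▸ hp, hb.symm ▸ hu, c,
              hc.trans hb.symm, h3⟩)⟩⟩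
      · exact vb
      · exact vc

omit hθ [IsManifold (𝓡 2) ∞ Λ] in
lemma Over.onSheet_eq {α : Cell S 2} {k : ℤ} {s : Sheet L 2 α} {T : Sheet L 1 (P.side α k)}
    (hs : Over P s T) : μ.onSheet s.1 = μ.onSheet T.1 := by
  rw [onSheet_eq_of_lift_regular h μ (P.sidePoint_mem (α := α) (k := k)) two_ne_zero
    (T.subset_regular h one_ne_zero hs), onSheet_eq_of_mem h μ T one_ne_zero hs]

end MaslovSheets

section Mod2

/-- A derivation of a ring of characteristic `2`. -/
structure IsMod2Derivation {R : Type*} [Ring R] (d : R → R) : Prop where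
  add_self : ∀ x : R, x + x = 0
  map_add : ∀ x y, d (x + y) = d x + d y
  map_one : d 1 = 0
  leibniz : ∀ x y, d (x * y) = d x * y + x * d y

namespace IsMod2Derivation

variable {R : Type*} [Ring R] {d : R → R} (hd : IsMod2Derivation d)
include hd

lemma map_zero : d 0 = 0 := by
  have := hd.map_add 0 0
  rw [add_zero] at this
  exact left_eq_add.1 this

lemma map_sum {ι : Type*} (s : Finset ι) (f : ι → R) : d (∑ i ∈ s, f i) = ∑ i ∈ s, d (f i) :=
  _root_.map_sum (⟨⟨d, hd.map_zero⟩, hd.map_add⟩ : R →+ R) f s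

lemma matrix (I : Type*) [Fintype I] [DecidableEq I] :
    IsMod2Derivation fun M : Matrix I I R => M.map d where
  add_self M := by ext i j; exact hd.add_self _
  map_add M N := by ext i j; exact hd.map_add _ _
  map_one := by
    ext i j
    rw [Matrix.map_apply, Matrix.one_apply]
    split_ifs
    · exact hd.map_one
    · exact hd.map_zero
  leibniz M N := by
    ext i j
    simp only [Matrix.map_apply, Matrix.add_apply, Matrix.mul_apply, hd.map_sum, hd.leibniz,
      Finset.sum_add_distrib]

lemma map_mul_rect {I J K : Type*} [Fintype J] (M : Matrix I J R) (N : Matrix J K R) :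
    (M * N).map d = M.map d * N + M * N.map d := by
  ext i j
  simp only [Matrix.map_apply, Matrix.add_apply, Matrix.mul_apply, hd.map_sum, hd.leibniz,
    Finset.sum_add_distrib]

lemma map_sq_conj {u x : R} (hu : u * u = 1) (hdu : d u = 0) (hx : d x = x * x) :
    d (u * x * u) = u * x * u * (u * x * u) := by
  rw [hd.leibniz, hd.leibniz, hdu, hx]
  have : u * x * u * (u * x * u) = u * x * (u * u) * x * u := by noncomm_ring
  rw [this, hu]
  noncomm_ring

lemma map_inverse {y a b : R} (hy : IsUnit y) (h : d y = a * y + y * b) :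
    d (Ring.inverse y) = b * Ring.inverse y + Ring.inverse y * a := by
  set w := Ring.inverse y with hw
  have h1 : y * w = 1 := Ring.mul_inverse_cancel y hy
  have h2 : w * y = 1 := Ring.inverse_mul_cancel y hy
  have h3 := hd.leibniz w y
  rw [h2, hd.map_one, h] at h3
  have h4 : d w = d w * y * w := by rw [mul_assoc, h1, mul_one]
  have h5 : d w * y = w * (a * y + y * b) := by
    have := hd.add_self (d w * y)
    exact add_right_cancel (b := d w * y) (by rw [this, add_comm, ← h3])
  rw [h4, h5]
  calc w * (a * y + y * b) * w = w * a * (y * w) + (w * y) * (b * w) := by noncomm_ring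
    _ = b * w + w * a := by rw [h1, h2, mul_one, one_mul, add_comm]

lemma map_path {z v : ℕ → R} (hz : ∀ i, d (z i) = v (i + 1) * z i + z i * v i) (a n : ℕ) :
    d ((List.range n).map fun i => z (a + i)).reverse.prod =
      v (a + n) * ((List.range n).map fun i => z (a + i)).reverse.prod +
        ((List.range n).map fun i => z (a + i)).reverse.prod * v a := by
  induction n with
  | zero => simp [hd.map_one, hd.add_self]
  | succ n ih =>
    rw [List.range_succ, List.map_append, List.reverse_append, List.map_singleton,
      List.reverse_singleton, List.prod_append, List.prod_singleton, hd.leibniz, ih, hz]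
    set F := ((List.range n).map fun i => z (a + i)).reverse.prod
    have : ∀ p q r : R, p + q + (q + r) = p + r := fun p q r => by
      rw [add_assoc, ← add_assoc q, hd.add_self, zero_add]
    rw [add_mul, mul_add, mul_assoc, mul_assoc, ← mul_assoc (z (a + n)) F, ← add_assoc a n 1]
    rw [this]

lemma map_path_back {w v : ℕ → R} (hw : ∀ i, d (w i) = v i * w i + w i * v (i + 1)) (m n : ℕ)
    (hn : n ≤ m) :
    d ((List.range n).map fun i => w (m - 1 - i)).reverse.prod =
      v (m - n) * ((List.range n).map fun i => w (m - 1 - i)).reverse.prod +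
        ((List.range n).map fun i => w (m - 1 - i)).reverse.prod * v m := by
  induction n with
  | zero => simp [hd.map_one, hd.add_self]
  | succ n ih =>
    rw [List.range_succ, List.map_append, List.reverse_append, List.map_singleton,
      List.reverse_singleton, List.prod_append, List.prod_singleton, hd.leibniz, ih (by omega), hw]
    set F := ((List.range n).map fun i => w (m - 1 - i)).reverse.prod
    have : ∀ p q r : R, p + q + (q + r) = p + r := fun p q r => by
      rw [add_assoc, ← add_assoc q, hd.add_self, zero_add]
    have e1 : m - 1 - n + 1 = m - n := by omega
    have e2 : m - 1 - n = m - (n + 1) := by omega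
    rw [e1, ← e2, add_mul, mul_add, mul_assoc, mul_assoc, ← mul_assoc (w (m - 1 - n)) F]
    rw [this]

lemma map_two_cell {a b c F G : R} (ha : d a = a * a) (hb : d b = b * b)
    (hF : d F = a * F + F * b) (hG : d G = a * G + G * b) (hc : d c = a * c + c * b + F + G) :
    d (a * c + c * b + F + G) = 0 := by
  rw [hd.map_add, hd.map_add, hd.map_add, hd.leibniz, hd.leibniz, ha, hb, hF, hG, hc]
  have h2 := hd.add_self
  calc a * a * c + a * (a * c + c * b + F + G) + ((a * c + c * b + F + G) * b + c * (b * b)) +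
        (a * F + F * b) + (a * G + G * b)
      = (a * a * c + a * a * c) + (a * c * b + a * c * b) + (a * F + a * F) + (a * G + a * G) +
        (c * b * b + c * b * b) + (F * b + F * b) + (G * b + G * b) := by noncomm_ring
    _ = 0 := by simp only [h2]

lemma map_one_cell {a b y : R} (ha : d a = a * a) (hb : d b = b * b) (hy : d y = a * y + y * b) :
    d (a * y + y * b) = 0 := by
  have := hd.map_two_cell (F := 0) (G := 0) ha hb (by simp [hd.map_zero]) (by simp [hd.map_zero])
    (c := y) (by simpa using hy)
  simpa using this

end IsMod2Derivation

section FreeAlgebra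

variable {X : Type*}

lemma freeAlgebra_add_self (a : FreeAlgebra (ZMod 2) X) : a + a = 0 := by
  rw [← two_smul (ZMod 2) a, show (2 : ZMod 2) = 0 from rfl, zero_smul]

/-- The algebra homomorphism `a ↦ a + ε d a` for the derivation `d` with given values on the
generators. -/
def freeDerivationAux (f : X → FreeAlgebra (ZMod 2) X) : FreeAlgebra (ZMod 2) X →ₐ[ZMod 2]
    TrivSqZeroExt (FreeAlgebra (ZMod 2) X) (FreeAlgebra (ZMod 2) X) :=
  FreeAlgebra.lift (ZMod 2) fun x =>
    TrivSqZeroExt.inl (FreeAlgebra.ι (ZMod 2) x) + TrivSqZeroExt.inr (f x)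

lemma fst_freeDerivationAux (f : X → FreeAlgebra (ZMod 2) X) (a : FreeAlgebra (ZMod 2) X) :
    (freeDerivationAux f a).fst = a := by
  have : (TrivSqZeroExt.fstHom (ZMod 2) (FreeAlgebra (ZMod 2) X) (FreeAlgebra (ZMod 2) X)).comp
      (freeDerivationAux f) = AlgHom.id _ _ := by
    apply FreeAlgebra.hom_ext
    funext x
    simp [freeDerivationAux]
  exact congrArg (fun g : FreeAlgebra (ZMod 2) X →ₐ[ZMod 2] FreeAlgebra (ZMod 2) X => g a) this

/-- The derivation of a free algebra with given values on the generators. -/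
def freeDerivation (f : X → FreeAlgebra (ZMod 2) X) :
    FreeAlgebra (ZMod 2) X →ₗ[ZMod 2] FreeAlgebra (ZMod 2) X :=
  (TrivSqZeroExt.sndHom (FreeAlgebra (ZMod 2) X) (FreeAlgebra (ZMod 2) X)).restrictScalars (ZMod 2)
    ∘ₗ (freeDerivationAux f).toLinearMap

lemma freeDerivation_ι (f : X → FreeAlgebra (ZMod 2) X) (x : X) :
    freeDerivation f (FreeAlgebra.ι (ZMod 2) x) = f x := by
  simp [freeDerivation, freeDerivationAux]

lemma freeDerivation_one (f : X → FreeAlgebra (ZMod 2) X) : freeDerivation f 1 = 0 := by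
  simp [freeDerivation]

lemma freeDerivation_mul (f : X → FreeAlgebra (ZMod 2) X) (a b : FreeAlgebra (ZMod 2) X) :
    freeDerivation f (a * b) = freeDerivation f a * b + a * freeDerivation f b := by
  show (freeDerivationAux f (a * b)).snd = (freeDerivationAux f a).snd * b +
    a * (freeDerivationAux f b).snd
  rw [map_mul, TrivSqZeroExt.snd_mul, fst_freeDerivationAux, fst_freeDerivationAux, add_comm]
  rfl

lemma isMod2Derivation_of {d : FreeAlgebra (ZMod 2) X →ₗ[ZMod 2] FreeAlgebra (ZMod 2) X}
    (h1 : d 1 = 0) (h2 : ∀ a b, d (a * b) = d a * b + a * d b) : IsMod2Derivation d :=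
  ⟨freeAlgebra_add_self, map_add d, h1, h2⟩

variable {d d' : FreeAlgebra (ZMod 2) X →ₗ[ZMod 2] FreeAlgebra (ZMod 2) X}

lemma derivation_ext (h1 : d 1 = 0) (h2 : ∀ a b, d (a * b) = d a * b + a * d b)
    (h1' : d' 1 = 0) (h2' : ∀ a b, d' (a * b) = d' a * b + a * d' b)
    (h : ∀ x, d (FreeAlgebra.ι (ZMod 2) x) = d' (FreeAlgebra.ι (ZMod 2) x)) : d = d' := by
  ext a
  induction a using FreeAlgebra.induction with
  | grade0 r => rw [Algebra.algebraMap_eq_smul_one, map_smul, map_smul, h1, h1']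
  | grade1 x => exact h x
  | mul a b ha hb => rw [h2, h2', ha, hb]
  | add a b ha hb => rw [map_add, map_add, ha, hb]

lemma derivation_sq_eq_zero (h1 : d 1 = 0) (h2 : ∀ a b, d (a * b) = d a * b + a * d b)
    (h : ∀ x, d (d (FreeAlgebra.ι (ZMod 2) x)) = 0) (a : FreeAlgebra (ZMod 2) X) : d (d a) = 0 := by
  induction a using FreeAlgebra.induction with
  | grade0 r => rw [Algebra.algebraMap_eq_smul_one, map_smul, h1, smul_zero, map_zero]
  | grade1 x => exact h x
  | mul a b ha hb =>
    rw [h2, map_add, h2, h2, ha, hb, zero_mul, mul_zero, zero_add, add_zero, freeAlgebra_add_self]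
  | add a b ha hb => rw [map_add, map_add, ha, hb, add_zero]

/-! ### The grading by the degrees of the generators -/

variable {G : Type*} [AddCommGroup G] (deg : X → G)

/-- The span of the words in the generators of total degree `k`. -/
def wordSpan (k : G) : Submodule (ZMod 2) (FreeAlgebra (ZMod 2) X) :=
  Submodule.span (ZMod 2) {a | ∃ w : List X, (w.map deg).sum = k ∧
    a = (w.map (FreeAlgebra.ι (ZMod 2))).prod}

lemma one_mem_wordSpan : (1 : FreeAlgebra (ZMod 2) X) ∈ wordSpan deg 0 :=
  Submodule.subset_span ⟨[], by simp, by simp⟩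

lemma ι_mem_wordSpan (x : X) : FreeAlgebra.ι (ZMod 2) x ∈ wordSpan deg (deg x) :=
  Submodule.subset_span ⟨[x], by simp, by simp⟩

lemma mul_mem_wordSpan {k l : G} {a b : FreeAlgebra (ZMod 2) X} (ha : a ∈ wordSpan deg k)
    (hb : b ∈ wordSpan deg l) : a * b ∈ wordSpan deg (k + l) := by
  have : a * b ∈ wordSpan deg k * wordSpan deg l := Submodule.mul_mem_mul ha hb
  rw [wordSpan, wordSpan, Submodule.span_mul_span] at this
  refine Submodule.span_mono ?_ this
  rintro _ ⟨_, ⟨w, hw, rfl⟩, _, ⟨w', hw', rfl⟩, rfl⟩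
  exact ⟨w ++ w', by simp [hw, hw'], by simp⟩

lemma setLike_gradedMonoid_wordSpan : SetLike.GradedMonoid (wordSpan deg) where
  one_mem := one_mem_wordSpan deg
  mul_mem _ _ _ _ ha hb := mul_mem_wordSpan deg ha hb

lemma nonempty_gradedAlgebra_wordSpan [DecidableEq G] : Nonempty (GradedAlgebra (wordSpan deg)) := by
  have := setLike_gradedMonoid_wordSpan deg
  let f : FreeAlgebra (ZMod 2) X →ₐ[ZMod 2] DirectSum G fun i => wordSpan deg i :=
    FreeAlgebra.lift (ZMod 2) fun x =>
      DirectSum.of (fun i => wordSpan deg i) (deg x) ⟨FreeAlgebra.ι (ZMod 2) x, ι_mem_wordSpan deg x⟩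
  have hf : ∀ x, f (FreeAlgebra.ι (ZMod 2) x) = DirectSum.of (fun i => wordSpan deg i) (deg x)
      ⟨FreeAlgebra.ι (ZMod 2) x, ι_mem_wordSpan deg x⟩ := fun x => FreeAlgebra.lift_ι_apply _ _
  have hw : ∀ w : List X, ∀ hm : (w.map (FreeAlgebra.ι (ZMod 2))).prod ∈ wordSpan deg (w.map deg).sum,
      f (w.map (FreeAlgebra.ι (ZMod 2))).prod =
        DirectSum.of (fun i => wordSpan deg i) (w.map deg).sum ⟨_, hm⟩ := by
    intro w
    induction w with
    | nil => intro hm; exact map_one f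
    | cons x w ih =>
      intro hm
      have hm' : (w.map (FreeAlgebra.ι (ZMod 2))).prod ∈ wordSpan deg (w.map deg).sum :=
        Submodule.subset_span ⟨w, rfl, rfl⟩
      simp only [List.map_cons, List.prod_cons, map_mul]
      rw [ih hm', hf, DirectSum.of_mul_of]
      rfl
  have hm : ∀ k : G, ∀ a, ∀ ha : a ∈ wordSpan deg k,
      f a = DirectSum.of (fun i => wordSpan deg i) k ⟨a, ha⟩ := by
    intro k a ha
    induction ha using Submodule.span_induction with
    | mem a ha =>
      obtain ⟨w, rfl, rfl⟩ := ha
      exact hw w _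
    | zero => rw [map_zero]; exact (map_zero (DirectSum.of (fun i => wordSpan deg i) k)).symm
    | add a b ha hb h1 h2 =>
      rw [map_add, h1, h2, ← map_add]
      rfl
    | smul r a ha h1 =>
      rw [map_smul, h1]
      exact (map_smul (DirectSum.lof (ZMod 2) G (fun i => wordSpan deg i) k) r ⟨a, ha⟩).symm
  exact ⟨GradedAlgebra.ofAlgHom _ f (by
    apply FreeAlgebra.hom_ext
    funext x
    simp only [Function.comp_apply, AlgHom.id_apply, AlgHom.coe_comp]
    rw [hf, DirectSum.coeAlgHom_of]) fun i x => hm i x x.2⟩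

lemma map_mem_wordSpan (h1 : d 1 = 0) (h2 : ∀ a b, d (a * b) = d a * b + a * d b) (c : G)
    (h : ∀ x, d (FreeAlgebra.ι (ZMod 2) x) ∈ wordSpan deg (deg x + c)) {k : G}
    {a : FreeAlgebra (ZMod 2) X} (ha : a ∈ wordSpan deg k) : d a ∈ wordSpan deg (k + c) := by
  have hw : ∀ w : List X, d (w.map (FreeAlgebra.ι (ZMod 2))).prod ∈
      wordSpan deg ((w.map deg).sum + c) := by
    intro w
    induction w with
    | nil => simp [h1]
    | cons x w ih =>
      simp only [List.map_cons, List.prod_cons, List.sum_cons, h2]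
      refine add_mem ?_ ?_
      · have := mul_mem_wordSpan deg (h x) (Submodule.subset_span ⟨w, rfl, rfl⟩ :
          (w.map (FreeAlgebra.ι (ZMod 2))).prod ∈ wordSpan deg (w.map deg).sum)
        rwa [add_right_comm] at this
      · rw [add_assoc]
        exact mul_mem_wordSpan deg (ι_mem_wordSpan deg x) ih
  induction ha using Submodule.span_induction with
  | mem a ha => obtain ⟨w, rfl, rfl⟩ := ha; exact hw w
  | zero => rw [map_zero]; exact zero_mem _
  | add a b ha hb h1 h2 => rw [map_add]; exact add_mem h1 h2
  | smul r a ha h1 => rw [map_smul]; exact Submodule.smul_mem _ _ h1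

end FreeAlgebra

end Mod2

section BoundaryMatrix

open LegendrianSurface PolygonalDecomposition

variable {S Λ : Type*} [TopologicalSpace S] [ChartedSpace Plane S] [IsManifold (𝓡 2) ∞ S]
  [TopologicalSpace Λ] [ChartedSpace Plane Λ] [CWComplex (univ : Set S)]
  {L : LegendrianSurface S Λ} {P : PolygonalDecomposition S}

variable (L) in
/-- The generators of a cell, as a matrix indexed by the sheets. -/
def sheetMatrix {n : ℕ} (e : Cell S n) : Matrix (Sheet L n e) (Sheet L n e) (Alg L) :=
  Matrix.of fun s t => if h : s.Above t then FreeAlgebra.ι (ZMod 2) ⟨n, e, s, t, h⟩ else 0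

/-- `s` is related to another element by `K`. -/
def Meets {I : Type*} (K : I → I → Prop) (s : I) : Prop := ∃ r, K s r ∨ K r s

/-- The generators of a boundary cell as a matrix indexed by the sheets above a cell, with blocks
`[0 1; 0 0]` for the pairs of sheets that are related by `K`. -/
def boundaryMatrix {n : ℕ} {e : Cell S n} (θ : Fin n → ℝ) (K : Sheet L n e → Sheet L n e → Prop) :
    Matrix (Sheet L n e) (Sheet L n e) (Alg L) :=
  Matrix.of fun s t => if K s t then 1 else if Meets K s ∨ Meets K t then 0 else
    genAt L (s.lift θ) (t.lift θ)

/-- The incidence matrix of the sheets above a cell that are not met by `K` and the sheets above a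
boundary cell. -/
def incidence {n m : ℕ} {e : Cell S n} (θ : Fin n → ℝ) (K : Sheet L n e → Sheet L n e → Prop)
    (e' : Cell S m) : Matrix (Sheet L n e) (Sheet L m e') (Alg L) :=
  Matrix.of fun s T => if s.lift θ ∈ T.1 ∧ ¬ Meets K s then 1 else 0

/-- The matrix of a relation. -/
def linkMatrix {I : Type*} (R : Type*) [Zero R] [One R] (K : I → I → Prop) : Matrix I I R :=
  Matrix.of fun s t => if K s t then 1 else 0

/-- The relation `K` matches the sheets above `e`, up to one sheet for each sheet above the boundary
cell `e'`. -/
structure IsMatching {n m : ℕ} {e : Cell S n} (θ : Fin n → ℝ)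
    (K : Sheet L n e → Sheet L n e → Prop) (e' : Cell S m) : Prop where
  not_chain : ∀ s t r, K s t → ¬ K t r
  unique : ∀ T : Sheet L m e', ∃! s : Sheet L n e, s.lift θ ∈ T.1 ∧ ¬ Meets K s

lemma Sheet.x_eq_openCell {m : ℕ} {e' : Cell S m} {T : Sheet L m e'} {p : Λ} (hp : p ∈ T.1) :
    L.x p ∈ openCell m e' := by
  obtain ⟨q, -, hq⟩ := T.2.1
  rw [hq] at hp
  exact connectedComponentIn_subset (L.x ⁻¹' openCell m e') q hp

section GenAt

lemma exists_gen_of_genAt_ne_zero {p q : Λ} (hg : genAt L p q ≠ 0) :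
    ∃ g : Gen L, p ∈ g.upper.1 ∧ q ∈ g.lower.1 := by
  by_contra hn
  exact hg (dif_neg hn)

variable (h : IsCellular L) [T2Space S]
include h

lemma genAt_of_mem {m : ℕ} {e' : Cell S m} {T T' : Sheet L m e'} {p q : Λ} (hp : p ∈ T.1)
    (hq : q ∈ T'.1) : genAt L p q = sheetMatrix L e' T T' := by
  have key : ∀ g : Gen L, p ∈ g.upper.1 → q ∈ g.lower.1 →
      ∃ ha : T.Above T', g = ⟨m, e', T, T', ha⟩ := by
    rintro ⟨n, e, s, t, ha⟩ h1 h2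
    obtain rfl := dim_eq_of_mem_openCell (Sheet.x_eq_openCell h1) (Sheet.x_eq_openCell hp)
    obtain rfl := cell_eq_of_mem_openCell (Sheet.x_eq_openCell h1) (Sheet.x_eq_openCell hp)
    obtain rfl := Sheet.eq_of_mem h h1 hp
    obtain rfl := Sheet.eq_of_mem h h2 hq
    exact ⟨ha, rfl⟩
  by_cases ha : T.Above T'
  · have hg : ∃ g : Gen L, p ∈ g.upper.1 ∧ q ∈ g.lower.1 := ⟨⟨m, e', T, T', ha⟩, hp, hq⟩
    obtain ⟨h1, h2⟩ := key hg.choose hg.choose_spec.1 hg.choose_spec.2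
    rw [genAt, dif_pos hg, h2]
    simp [sheetMatrix, ha]
  · have hg : ¬ ∃ g : Gen L, p ∈ g.upper.1 ∧ q ∈ g.lower.1 := by
      rintro ⟨g, h1, h2⟩
      exact ha (key g h1 h2).1
    rw [genAt, dif_neg hg]
    simp [sheetMatrix, ha]

omit h [T2Space S] in
lemma genAt_eq_zero_left {m : ℕ} {e' : Cell S m} {p q : Λ} (hx : L.x p ∈ openCell m e')
    (hp : ∀ T : Sheet L m e', p ∉ T.1) : genAt L p q = 0 := by
  by_contra hg
  obtain ⟨⟨n, e, s, t, ha⟩, h1, h2⟩ := exists_gen_of_genAt_ne_zero hg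
  obtain rfl := dim_eq_of_mem_openCell (Sheet.x_eq_openCell h1) hx
  obtain rfl := cell_eq_of_mem_openCell (Sheet.x_eq_openCell h1) hx
  exact hp s h1

omit h [T2Space S] in
lemma genAt_eq_zero_right {m : ℕ} {e' : Cell S m} {p q : Λ} (hx : L.x q ∈ openCell m e')
    (hp : ∀ T : Sheet L m e', q ∉ T.1) : genAt L p q = 0 := by
  by_contra hg
  obtain ⟨⟨n, e, s, t, ha⟩, h1, h2⟩ := exists_gen_of_genAt_ne_zero hg
  obtain rfl := dim_eq_of_mem_openCell (Sheet.x_eq_openCell h2) hx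
  obtain rfl := cell_eq_of_mem_openCell (Sheet.x_eq_openCell h2) hx
  exact hp t h2

omit h [T2Space S] in
lemma z_lt_of_genAt_ne_zero {p q : Λ} (hx : L.x p = L.x q) (hg : genAt L p q ≠ 0) :
    L.z q < L.z p := by
  obtain ⟨g, h1, h2⟩ := exists_gen_of_genAt_ne_zero hg
  exact g.above p h1 q h2 hx

lemma genAt_eq_zero_of_cusp {p q : Λ} (hc : p ∈ L.cuspEdge ∨ q ∈ L.cuspEdge) :
    genAt L p q = 0 := by
  by_contra hg
  obtain ⟨g, h1, h2⟩ := exists_gen_of_genAt_ne_zero hg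
  rcases hc with hc | hc
  · exact Sheet.not_cusp_of_mem h h1 hc
  · exact Sheet.not_cusp_of_mem h h2 hc

end GenAt

section Incidence

variable [∀ (n : ℕ) (e : Cell S n), Fintype (Sheet L n e)] {n m : ℕ} {e : Cell S n}
  {e' : Cell S m} {θ : Fin n → ℝ} {K : Sheet L n e → Sheet L n e → Prop} {J : Type*}

lemma incidence_mul_eq_zero (M : Matrix (Sheet L m e') J (Alg L)) {s : Sheet L n e}
    (hs : ∀ T : Sheet L m e', s.lift θ ∈ T.1 → Meets K s) (j : J) :
    (incidence θ K e' * M) s j = 0 := by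
  rw [Matrix.mul_apply]
  refine Finset.sum_eq_zero fun T _ => ?_
  rw [incidence, Matrix.of_apply, if_neg fun hh => hh.2 (hs T hh.1), zero_mul]

lemma mul_incidence_eq_zero (M : Matrix J (Sheet L m e') (Alg L)) {s : Sheet L n e}
    (hs : ∀ T : Sheet L m e', s.lift θ ∈ T.1 → Meets K s) (j : J) :
    (M * (incidence θ K e').transpose) j s = 0 := by
  rw [Matrix.mul_apply]
  refine Finset.sum_eq_zero fun T _ => ?_
  rw [Matrix.transpose_apply, incidence, Matrix.of_apply, if_neg fun hh => hh.2 (hs T hh.1),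
    mul_zero]

variable (h : IsCellular L) [T2Space S]
include h

lemma incidence_mul (M : Matrix (Sheet L m e') J (Alg L)) {s : Sheet L n e} {T : Sheet L m e'}
    (hs : s.lift θ ∈ T.1) (hK : ¬ Meets K s) (j : J) : (incidence θ K e' * M) s j = M T j := by
  rw [Matrix.mul_apply, Finset.sum_eq_single T]
  · rw [incidence, Matrix.of_apply, if_pos ⟨hs, hK⟩, one_mul]
  · intro T' _ hT'
    rw [incidence, Matrix.of_apply, if_neg fun hh => hT' (Sheet.eq_of_mem h hh.1 hs), zero_mul]
  · intro hT
    exact absurd (Finset.mem_univ T) hT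

lemma mul_incidence (M : Matrix J (Sheet L m e') (Alg L)) {s : Sheet L n e} {T : Sheet L m e'}
    (hs : s.lift θ ∈ T.1) (hK : ¬ Meets K s) (j : J) :
    (M * (incidence θ K e').transpose) j s = M j T := by
  rw [Matrix.mul_apply, Finset.sum_eq_single T]
  · rw [Matrix.transpose_apply, incidence, Matrix.of_apply, if_pos ⟨hs, hK⟩, mul_one]
  · intro T' _ hT'
    rw [Matrix.transpose_apply, incidence, Matrix.of_apply,
      if_neg fun hh => hT' (Sheet.eq_of_mem h hh.1 hs), mul_zero]
  · intro hT
    exact absurd (Finset.mem_univ T) hT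

lemma boundaryMatrix_eq (hθ : θ ∈ closedBall (0 : Fin n → ℝ) 1) (hx : map n e θ ∈ openCell m e') :
    boundaryMatrix θ K = incidence θ K e' * sheetMatrix L e' * (incidence θ K e').transpose +
      linkMatrix (Alg L) K := by
  ext s t
  have hxs := s.x_lift h hθ
  have hxt := t.x_lift h hθ
  rw [Matrix.add_apply, linkMatrix, Matrix.of_apply, boundaryMatrix, Matrix.of_apply]
  by_cases hM : Meets K s ∨ Meets K t
  · have h0 : (incidence θ K e' * sheetMatrix L e' * (incidence θ K e').transpose) s t = 0 := by
      rcases hM with hM | hM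
      · rw [Matrix.mul_assoc]
        exact incidence_mul_eq_zero _ (fun _ _ => hM) t
      · exact mul_incidence_eq_zero _ (fun _ _ => hM) s
    rw [h0, zero_add, if_pos hM]
  · have hK : ¬ K s t := fun hk => hM (Or.inl ⟨t, Or.inl hk⟩)
    rw [if_neg hK, if_neg hK, if_neg hM, add_zero]
    rw [not_or] at hM
    by_cases hs : ∃ T : Sheet L m e', s.lift θ ∈ T.1
    · obtain ⟨T, hT⟩ := hs
      by_cases ht : ∃ T' : Sheet L m e', t.lift θ ∈ T'.1
      · obtain ⟨T', hT'⟩ := ht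
        rw [mul_incidence h _ hT' hM.2, incidence_mul h _ hT hM.1,
          genAt_of_mem h hT hT']
      · rw [mul_incidence_eq_zero _ (fun T hT => absurd ⟨T, hT⟩ ht) s,
          genAt_eq_zero_right (hxt ▸ hx) fun T hT => ht ⟨T, hT⟩]
    · rw [Matrix.mul_assoc, incidence_mul_eq_zero _ (fun T hT => absurd ⟨T, hT⟩ hs) t,
          genAt_eq_zero_left (hxs ▸ hx) fun T hT => hs ⟨T, hT⟩]

omit h [T2Space S] in
lemma linkMatrix_mul_linkMatrix (hK : IsMatching θ K e') :
    linkMatrix (Alg L) K * linkMatrix (Alg L) K = 0 := by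
  ext s t
  rw [Matrix.mul_apply]
  refine Finset.sum_eq_zero fun r _ => ?_
  rw [linkMatrix, Matrix.of_apply, Matrix.of_apply]
  by_cases hr : K s r
  · rw [if_neg (hK.not_chain _ _ _ hr), mul_zero]
  · rw [if_neg hr, zero_mul]

omit h [T2Space S] in
lemma linkMatrix_mul_incidence : linkMatrix (Alg L) K * incidence θ K e' = 0 := by
  ext s t
  rw [Matrix.mul_apply]
  refine Finset.sum_eq_zero fun r _ => ?_
  rw [linkMatrix, Matrix.of_apply, incidence, Matrix.of_apply]
  by_cases hr : K s r
  · rw [if_neg (fun hh : r.lift θ ∈ t.1 ∧ ¬ Meets K r => hh.2 ⟨s, Or.inr hr⟩), mul_zero]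
  · rw [if_neg hr, zero_mul]

omit h [T2Space S] in
lemma incidence_transpose_mul_linkMatrix :
    (incidence θ K e').transpose * linkMatrix (Alg L) K = 0 := by
  ext s t
  rw [Matrix.mul_apply]
  refine Finset.sum_eq_zero fun r _ => ?_
  rw [linkMatrix, Matrix.of_apply, Matrix.transpose_apply, incidence, Matrix.of_apply]
  by_cases hr : K r t
  · rw [if_neg (fun hh : r.lift θ ∈ s.1 ∧ ¬ Meets K r => hh.2 ⟨t, Or.inl hr⟩), zero_mul]
  · rw [if_neg hr, mul_zero]

lemma incidence_transpose_mul_incidence (hK : IsMatching θ K e') :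
    (incidence θ K e').transpose * incidence θ K e' = 1 := by
  ext T T'
  obtain ⟨s, ⟨hs, hM⟩, hu⟩ := hK.unique T
  rw [Matrix.mul_apply, Finset.sum_eq_single s]
  · rw [Matrix.transpose_apply, incidence, Matrix.of_apply, Matrix.of_apply, if_pos ⟨hs, hM⟩,
      one_mul, Matrix.one_apply]
    by_cases hT : T = T'
    · subst hT; rw [if_pos ⟨hs, hM⟩, if_pos rfl]
    · rw [if_neg hT, if_neg fun hh => hT (Sheet.eq_of_mem h hs hh.1)]
  · intro r _ hr
    rw [Matrix.transpose_apply, incidence, Matrix.of_apply, if_neg fun hh => hr (hu r hh), zero_mul]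
  · intro hs
    exact absurd (Finset.mem_univ s) hs

variable {d : Alg L → Alg L} (hd : IsMod2Derivation d)
include hd

omit h [∀ (n : ℕ) (e : Cell S n), Fintype (Sheet L n e)] [T2Space S] in
lemma map_incidence : (incidence θ K e').map d = 0 := by
  ext s T
  rw [Matrix.map_apply, incidence, Matrix.of_apply]
  split_ifs
  · exact hd.map_one
  · exact hd.map_zero

omit h [∀ (n : ℕ) (e : Cell S n), Fintype (Sheet L n e)] [T2Space S] in
lemma map_linkMatrix : (linkMatrix (Alg L) K).map d = 0 := by
  ext s T
  rw [Matrix.map_apply, linkMatrix, Matrix.of_apply]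
  split_ifs
  · exact hd.map_one
  · exact hd.map_zero

omit h [T2Space S] in
lemma map_incidence_conj (A : Matrix (Sheet L m e') (Sheet L m e') (Alg L)) :
    (incidence θ K e' * A * (incidence θ K e').transpose).map d =
      incidence θ K e' * A.map d * (incidence θ K e').transpose := by
  have ht : (incidence θ K e').transpose.map d = 0 := by
    rw [Matrix.transpose_map, map_incidence hd, Matrix.transpose_zero]
  rw [hd.map_mul_rect, hd.map_mul_rect, map_incidence hd, ht, Matrix.mul_zero, Matrix.zero_mul,
    zero_add, add_zero]

lemma map_boundaryMatrix {v : Cell S 0} (hθ : θ ∈ closedBall (0 : Fin n → ℝ) 1)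
    (hx : map n e θ ∈ openCell 0 v) (hK : IsMatching θ K v)
    (hA : (sheetMatrix L v).map d = sheetMatrix L v * sheetMatrix L v) :
    (boundaryMatrix θ K).map d = boundaryMatrix θ K * boundaryMatrix θ K := by
  have h1 := incidence_transpose_mul_incidence h hK
  have h2 := linkMatrix_mul_linkMatrix hK
  have h3 : linkMatrix (Alg L) K * incidence θ K v = 0 := linkMatrix_mul_incidence
  have h4 : (incidence θ K v).transpose * linkMatrix (Alg L) K = 0 :=
    incidence_transpose_mul_linkMatrix
  rw [boundaryMatrix_eq h hθ hx]
  have hadd : ∀ M N : Matrix (Sheet L n e) (Sheet L n e) (Alg L),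
      (M + N).map d = M.map d + N.map d := (hd.matrix _).map_add
  rw [hadd, map_incidence_conj hd, map_linkMatrix hd, hA, add_zero]
  set Q := incidence θ K v
  set A := sheetMatrix L v
  set N := linkMatrix (Alg L) K
  rw [Matrix.add_mul, Matrix.mul_add, Matrix.mul_add, h2]
  have e1 : Q * A * Q.transpose * (Q * A * Q.transpose) = Q * (A * A) * Q.transpose := by
    calc Q * A * Q.transpose * (Q * A * Q.transpose)
        = Q * A * (Q.transpose * Q) * A * Q.transpose := by simp only [Matrix.mul_assoc]
      _ = Q * (A * A) * Q.transpose := by rw [h1, Matrix.mul_one]; simp only [Matrix.mul_assoc]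
  have e2 : Q * A * Q.transpose * N = 0 := by rw [Matrix.mul_assoc, h4, Matrix.mul_zero]
  have e3 : N * (Q * A * Q.transpose) = 0 := by
    rw [← Matrix.mul_assoc, ← Matrix.mul_assoc, h3, Matrix.zero_mul, Matrix.zero_mul]
  rw [e1, e2, e3, add_zero, add_zero, add_zero]

end Incidence

end BoundaryMatrix

section Matching

open LegendrianSurface PolygonalDecomposition

variable {S Λ : Type*} [TopologicalSpace S] [ChartedSpace Plane S] [IsManifold (𝓡 2) ∞ S]
  [TopologicalSpace Λ] [ChartedSpace Plane Λ] [CWComplex (univ : Set S)]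
  {L : LegendrianSurface S Λ} {P : PolygonalDecomposition S}

/-- The relation between two given elements only. -/
def pairRel {I : Type*} (x y : I) : I → I → Prop := fun s t => s = x ∧ t = y

lemma meets_pairRel {I : Type*} {x y s : I} : Meets (pairRel x y) s ↔ s = x ∨ s = y := by
  constructor
  · rintro ⟨r, hr | hr⟩
    · exact Or.inl hr.1
    · exact Or.inr hr.2
  · rintro (rfl | rfl)
    · exact ⟨y, Or.inl ⟨rfl, rfl⟩⟩
    · exact ⟨x, Or.inr ⟨rfl, rfl⟩⟩

lemma not_meets_bot {I : Type*} (s : I) : ¬ Meets (fun _ _ : I => False) s := by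
  rintro ⟨r, hr | hr⟩ <;> exact hr

omit [ChartedSpace Plane S] [IsManifold (𝓡 2) ∞ S] in
lemma eq_of_mem_openCell_zero [T2Space S] {v : Cell S 0} {u u' : S} (hu : u ∈ openCell 0 v)
    (hu' : u' ∈ openCell 0 v) : u = u' := by
  rw [← map_symm v hu, ← map_symm v hu', Subsingleton.elim ((map 0 v).symm u)]

lemma sheetMatrix_mem_gradedPiece (μ : L.MaslovPotential) {m : ℕ} (e' : Cell S m)
    (T T' : Sheet L m e') : sheetMatrix L e' T T' ∈
      gradedPiece μ (μ.onSheet T.1 - μ.onSheet T'.1 + ((m : ZMod L.maslovNumber) - 1)) := by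
  rw [sheetMatrix, Matrix.of_apply]
  split_ifs with ha
  · have hg : μ.onSheet T.1 - μ.onSheet T'.1 + ((m : ZMod L.maslovNumber) - 1) =
      Gen.degree μ (⟨m, e', T, T', ha⟩ : Gen L) := rfl
    rw [hg]
    exact ι_mem_wordSpan (Gen.degree μ) _
  · exact zero_mem _

variable (h : IsCellular L) [T2Space S] [IsManifold (𝓡 2) ∞ Λ]
include h

omit [IsManifold (𝓡 2) ∞ Λ] in
lemma Sheet.nonempty' {n : ℕ} {e : Cell S n} (T : Sheet L n e) : T.1.Nonempty := by
  rw [Sheet.eq_image h T]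
  exact ⟨_, mem_image_of_mem _ (mem_ball_self one_pos)⟩

section

variable {n : ℕ} {e : Cell S n} {θ : Fin n → ℝ} (hθ : θ ∈ closedBall (0 : Fin n → ℝ) 1)
include hθ

lemma isMatching_cancel (hn : n ≠ 0) (hO : IsOrdered L e θ) {v : Cell S 0}
    (hx : map n e θ ∈ openCell 0 v) : IsMatching θ (Cancel (L := L) (e := e) θ) v where
  not_chain _ _ _ hst := hst.not_cancel h hθ hn hO
  unique T := by
    obtain ⟨p, hp⟩ := T.nonempty' h
    have hxp : L.x p = map n e θ := eq_of_mem_openCell_zero (Sheet.x_eq_openCell hp) hx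
    obtain ⟨s, ⟨hs, hc⟩, hu⟩ := existsUnique_not_cancelled h hθ hn hO
      (Sheet.not_cusp_of_mem h hp) hxp
    exact ⟨s, ⟨hs.symm ▸ hp, hc⟩, fun t ht => hu t ⟨Sheet.eq_of_mem_zero h ht.1 hp, ht.2⟩⟩

/-- Three sheets `x`, `y`, `r` meet at a swallowtail point above `θ`. -/
structure MeetAt (θ : Fin n → ℝ) (x y r : Sheet L n e) : Prop where
  swallow : x.lift θ ∈ L.swallowtail
  eq₁ : y.lift θ = x.lift θ
  eq₂ : r.lift θ = x.lift θ
  ne₁ : x ≠ y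
  ne₂ : x ≠ r
  ne₃ : y ≠ r
  all : ∀ s : Sheet L n e, s.lift θ = x.lift θ → s = x ∨ s = y ∨ s = r

omit h hθ in
omit [IsManifold (𝓡 2) ∞ Λ] [T2Space S] in
lemma MeetAt.rotate {x y r : Sheet L n e} (hm : MeetAt θ x y r) : MeetAt θ y r x where
  swallow := hm.eq₁ ▸ hm.swallow
  eq₁ := hm.eq₂.trans hm.eq₁.symm
  eq₂ := hm.eq₁.symm
  ne₁ := hm.ne₃
  ne₂ := hm.ne₁.symm
  ne₃ := hm.ne₂.symm
  all s hs := by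
    rcases hm.all s (hs.trans hm.eq₁) with h | h | h
    · exact Or.inr (Or.inr h)
    · exact Or.inl h
    · exact Or.inr (Or.inl h)

omit h hθ in
omit [IsManifold (𝓡 2) ∞ Λ] [T2Space S] in
lemma MeetAt.swap {x y r : Sheet L n e} (hm : MeetAt θ x y r) : MeetAt θ x r y where
  swallow := hm.swallow
  eq₁ := hm.eq₂
  eq₂ := hm.eq₁
  ne₁ := hm.ne₂
  ne₂ := hm.ne₁
  ne₃ := hm.ne₃.symm
  all s hs := (hm.all s hs).imp_right Or.symm

omit [IsManifold (𝓡 2) ∞ Λ] in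
lemma isMatching_pairRel {x y r : Sheet L n e} (hm : MeetAt θ x y r) {v : Cell S 0}
    (hx : map n e θ ∈ openCell 0 v) : IsMatching θ (pairRel x y) v where
  not_chain s t r hst htr := hm.ne₁ (htr.1.symm.trans hst.2)
  unique T := by
    obtain ⟨p, hp⟩ := T.nonempty' h
    have hxp : L.x p = map n e θ := eq_of_mem_openCell_zero (Sheet.x_eq_openCell hp) hx
    simp only [meets_pairRel]
    by_cases hpx : p = x.lift θ
    · refine ⟨r, ⟨hm.eq₂.symm ▸ hpx ▸ hp, fun hh => ?_⟩, fun t ht => ?_⟩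
      · rcases hh with hh | hh
        · exact hm.ne₂ hh.symm
        · exact hm.ne₃ hh.symm
      · have ht' := Sheet.eq_of_mem_zero h ht.1 hp
        rcases hm.all t (ht'.trans hpx) with hh | hh | hh
        · exact absurd (Or.inl hh) ht.2
        · exact absurd (Or.inr hh) ht.2
        · exact hh
    · have hr : p ∈ L.regular := by
        by_contra hr
        exact hpx (h.generic.eq_of_swallow hm.swallow hr (hxp.trans (x.x_lift h hθ).symm))
      obtain ⟨s, hs, hu⟩ := Sheet.existsUnique_of_regular h hθ hxp hr
      refine ⟨s, ⟨hs.symm ▸ hp, ?_⟩, fun t ht => hu t (Sheet.eq_of_mem_zero h ht.1 hp)⟩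
      rintro (rfl | rfl)
      · exact hpx hs.symm
      · exact hpx (hs.symm.trans hm.eq₁)

lemma support_boundaryMatrix {K : Sheet L n e → Sheet L n e → Prop}
    (hK : ∀ s t, K s t → s.Above t) {s t : Sheet L n e} (hst : boundaryMatrix θ K s t ≠ 0) :
    s.Above t := by
  rw [boundaryMatrix, Matrix.of_apply] at hst
  split_ifs at hst with h1 h2
  · exact hK s t h1
  · exact absurd rfl hst
  · exact Sheet.above_of_z_lt h hθ
      (z_lt_of_genAt_ne_zero ((s.x_lift h hθ).trans (t.x_lift h hθ).symm) hst)

omit [IsManifold (𝓡 2) ∞ Λ] in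
lemma boundaryMatrix_mem_gradedPiece (μ : L.MaslovPotential)
    {K : Sheet L n e → Sheet L n e → Prop} {m : ℕ} {e' : Cell S m} (hx : map n e θ ∈ openCell m e')
    (hK : ∀ s t, K s t → μ.onSheet s.1 - μ.onSheet t.1 + ((m : ZMod L.maslovNumber) - 1) = 0)
    (hK' : ∀ (s : Sheet L n e) (T : Sheet L m e'), s.lift θ ∈ T.1 → ¬ Meets K s →
      μ.onSheet s.1 = μ.onSheet T.1) (s t : Sheet L n e) :
    boundaryMatrix θ K s t ∈
      gradedPiece μ (μ.onSheet s.1 - μ.onSheet t.1 + ((m : ZMod L.maslovNumber) - 1)) := by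
  rw [boundaryMatrix, Matrix.of_apply]
  split_ifs with h1 h2
  · rw [hK s t h1]
    exact one_mem_wordSpan (Gen.degree μ)
  · exact zero_mem _
  · rw [not_or] at h2
    by_cases hg : genAt L (s.lift θ) (t.lift θ) = 0
    · rw [hg]; exact zero_mem _
    · have hs : ∃ T : Sheet L m e', s.lift θ ∈ T.1 := by
        by_contra hn
        push Not at hn
        exact hg (genAt_eq_zero_left ((s.x_lift h hθ) ▸ hx) hn)
      have ht : ∃ T : Sheet L m e', t.lift θ ∈ T.1 := by
        by_contra hn
        push Not at hn
        exact hg (genAt_eq_zero_right ((t.x_lift h hθ) ▸ hx) hn)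
      obtain ⟨T, hT⟩ := hs
      obtain ⟨T', hT'⟩ := ht
      rw [genAt_of_mem h hT hT'] at hg ⊢
      rw [hK' s T hT h2.1, hK' t T' hT' h2.2]
      exact sheetMatrix_mem_gradedPiece μ e' T T'

end

omit [IsManifold (𝓡 2) ∞ Λ] in
lemma isMatching_side (P : PolygonalDecomposition S) (α : Cell S 2) (k : ℤ) :
    IsMatching (L := L) (P.sidePoint α k) (fun _ _ : Sheet L 2 α => False) (P.side α k) where
  not_chain _ _ _ hst := hst.elim
  unique T := by
    obtain ⟨s, hs, hu⟩ := existsUnique_over h T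
    exact ⟨s, ⟨hs, not_meets_bot s⟩, fun t ht => hu t ht.1⟩

end Matching

section Conversion

open LegendrianSurface PolygonalDecomposition

variable {S Λ : Type*} [TopologicalSpace S] [ChartedSpace Plane S] [IsManifold (𝓡 2) ∞ S]
  [TopologicalSpace Λ] [ChartedSpace Plane Λ] [CWComplex (univ : Set S)]
  {L : LegendrianSurface S Λ} {P : PolygonalDecomposition S} {n : ℕ} {e : Cell S n}
  (E : Enumeration L n e) {θ : Fin n → ℝ}

namespace Enumeration

lemma cellMatrix_eq : E.cellMatrix = (sheetMatrix L e).submatrix E.sheet E.sheet := rfl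

lemma unit_eq (i j : Fin E.num) : E.unit i j =
    (Matrix.single (E.sheet i) (E.sheet j) (1 : Alg L)).submatrix E.sheet E.sheet := by
  ext a b
  simp [unit, Matrix.single_apply, E.sheet.injective.eq_iff]

lemma one_add_unit_eq (i j : Fin E.num) : 1 + E.unit i j =
    (1 + Matrix.single (E.sheet i) (E.sheet j) (1 : Alg L)).submatrix E.sheet E.sheet := by
  rw [Matrix.submatrix_add, unit_eq]
  congr 1
  exact (Matrix.submatrix_one_equiv E.sheet).symm

lemma exists_triple_matrices (ht : ∃ t, E.IsTriple θ t) : ∃ p q r, E.IsTriple θ (p, q, r) ∧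
    E.vertexMatrix θ =
      (if E.lim θ p ∈ L.swallowUp then E.hatMatrix θ p q else E.hatMatrix θ q r) ∧
    E.matrixAS θ = (if E.lim θ p ∈ L.swallowUp then
        (1 + E.unit r q) * E.hatMatrix θ p r * (1 + E.unit r q)
      else (1 + E.unit q p) * E.hatMatrix θ p r * (1 + E.unit q p)) ∧
    E.matrixAT θ = (if E.lim θ p ∈ L.swallowUp then
        (1 + E.unit q r) * E.hatMatrix θ p q * (1 + E.unit q r)
      else (1 + E.unit p q) * E.hatMatrix θ q r * (1 + E.unit p q)) ∧
    E.matrixS θ = (if E.lim θ p ∈ L.swallowUp then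
        1 + E.hatMatrix θ p q * E.unit r p + E.unit q r
      else 1 + E.unit r p * E.hatMatrix θ q r + E.unit p q) ∧
    E.matrixT θ = (if E.lim θ p ∈ L.swallowUp then 1 + E.unit q r else 1 + E.unit p q) :=
  ⟨ht.choose.1, ht.choose.2.1, ht.choose.2.2, ht.choose_spec, by rw [vertexMatrix, dif_pos ht],
    by rw [matrixAS, dif_pos ht], by rw [matrixAT, dif_pos ht], by rw [matrixS, dif_pos ht],
    by rw [matrixT, dif_pos ht]⟩

variable (h : IsCellular L) [T2Space S] (hθ : θ ∈ closedBall (0 : Fin n → ℝ) 1)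
include h hθ

lemma lim_eq (i : Fin E.num) : E.lim θ i = (E.sheet i).lift θ := Sheet.limit_eq h _ hθ

lemma edgeMatrix_eq : E.edgeMatrix θ =
    (boundaryMatrix θ fun _ _ : Sheet L n e => False).submatrix E.sheet E.sheet := by
  ext i j
  rw [Matrix.submatrix_apply, boundaryMatrix, Matrix.of_apply, if_neg not_false, if_neg (by
    rw [not_or]; exact ⟨not_meets_bot _, not_meets_bot _⟩), edgeMatrix, Matrix.of_apply,
    E.lim_eq h hθ, E.lim_eq h hθ]

lemma hatMatrix_eq (k l : Fin E.num) : E.hatMatrix θ k l =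
    (boundaryMatrix θ (pairRel (E.sheet k) (E.sheet l))).submatrix E.sheet E.sheet := by
  ext i j
  rw [Matrix.submatrix_apply, boundaryMatrix, Matrix.of_apply, hatMatrix, Matrix.of_apply,
    E.lim_eq h hθ, E.lim_eq h hθ]
  simp only [meets_pairRel, pairRel, E.sheet.injective.eq_iff, or_assoc]

variable [IsManifold (𝓡 2) ∞ Λ]

lemma _root_.CellularDGA.Enumeration.IsTriple.meetAt (hn : n ≠ 0) {p q r : Fin E.num} (ht : E.IsTriple θ (p, q, r)) :
    MeetAt θ (E.sheet p) (E.sheet q) (E.sheet r) := by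
  obtain ⟨h1, h2, h3, h4, h5⟩ := ht
  simp only [E.lim_eq h hθ] at h3 h4 h5
  have n1 := fun e => h1.ne (E.sheet.injective e)
  have n2 := fun e => (h1.trans h2).ne (E.sheet.injective e)
  have n3 := fun e => h2.ne (E.sheet.injective e)
  exact ⟨h5, h3.symm, (h3.trans h4).symm, n1, n2, n3, fun s hs =>
    eq_or_of_three h hθ hn h5 n1 n2 n3 h3.symm (h3.trans h4).symm hs⟩

omit [IsManifold (𝓡 2) ∞ Λ] in
lemma isTriple_of_meetAt {x y r : Sheet L n e} (hm : MeetAt θ x y r)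
    (h1 : E.sheet.symm x < E.sheet.symm y) (h2 : E.sheet.symm y < E.sheet.symm r) :
    E.IsTriple θ (E.sheet.symm x, E.sheet.symm y, E.sheet.symm r) := by
  refine ⟨h1, h2, ?_, ?_, ?_⟩ <;> simp only [E.lim_eq h hθ, Equiv.apply_symm_apply]
  · exact hm.eq₁.symm
  · exact hm.eq₁.trans hm.eq₂.symm
  · exact hm.swallow

omit [IsManifold (𝓡 2) ∞ Λ] in
lemma exists_isTriple {x y r : Sheet L n e} (hm : MeetAt θ x y r) : ∃ t, E.IsTriple θ t := by
  have n1 : E.sheet.symm x ≠ E.sheet.symm y := fun e => hm.ne₁ (E.sheet.symm.injective e)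
  have n2 : E.sheet.symm x ≠ E.sheet.symm r := fun e => hm.ne₂ (E.sheet.symm.injective e)
  have n3 : E.sheet.symm y ≠ E.sheet.symm r := fun e => hm.ne₃ (E.sheet.symm.injective e)
  rcases n1.lt_or_gt with a | a <;> rcases n2.lt_or_gt with b | b <;>
    rcases n3.lt_or_gt with c | c
  · exact ⟨_, E.isTriple_of_meetAt h hθ hm a c⟩
  · exact ⟨_, E.isTriple_of_meetAt h hθ hm.swap b c⟩
  · exact absurd (a.trans c) b.not_gt
  · exact ⟨_, E.isTriple_of_meetAt h hθ hm.rotate.rotate b a⟩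
  · exact ⟨_, E.isTriple_of_meetAt h hθ hm.rotate.swap a b⟩
  · exact absurd (a.trans b) c.not_gt
  · exact ⟨_, E.isTriple_of_meetAt h hθ hm.rotate c b⟩
  · exact ⟨_, E.isTriple_of_meetAt h hθ hm.rotate.rotate.swap c a⟩

end Enumeration

end Conversion

section SwallowIdentities

section Ring

variable {R : Type*} [Ring R] {H H' pq qp rp qr rq pp qq rr : R}

lemma swallow_up_identity (h2 : ∀ x : R, x + x = 0) (a1 : qr * rq = qq) (a2 : rp * rq = 0)
    (a3 : rq * qq = rq) (a4 : rq * rr = 0) (a5 : rq * qr = rr) (a6 : rq * rq = 0)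
    (a7 : qq * rq = 0) (b1 : rq * H = 0) (b2 : rp * H' = rr)
    (b3 : (1 + qq + rr + qr + rq) * H' = H * (1 + qq + rr + qr + rq)) :
    (1 + H * rp + qr) * ((1 + rq) * H' * (1 + rq)) = H * (1 + qr) := by
  have c1 : (1 + qr) * (1 + rq) = (1 + rq) * (1 + qq + rr + qr + rq) := by
    have e1 : (1 + qr) * (1 + rq) = 1 + rq + qr + qr * rq := by noncomm_ring
    have e2 : (1 + rq) * (1 + qq + rr + qr + rq) = 1 + qq + rr + qr + rq + rq + rq * qq + rq * rr +
      rq * qr + rq * rq := by noncomm_ring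
    rw [e1, e2, a1, a3, a4, a5, a6]
    calc 1 + rq + qr + qq = 1 + rq + qr + qq + 0 + 0 := by abel
      _ = 1 + rq + qr + qq + (rr + rr) + (rq + rq) := by rw [h2, h2]
      _ = _ := by abel
  have c2 : (1 + qq + rr + qr + rq) * (1 + rq) + rr * (1 + rq) = 1 + qr := by
    have e1 : (1 + qq + rr + qr + rq) * (1 + rq) + rr * (1 + rq) = 1 + qr + qq + qr * rq +
      (rr + rr) + (rr * rq + rr * rq) + (rq + rq) + qq * rq + rq * rq := by noncomm_ring
    rw [e1, a1, a7, a6, h2, h2, h2, add_assoc (1 + qr), h2]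
    abel
  calc (1 + H * rp + qr) * ((1 + rq) * H' * (1 + rq))
      = (1 + qr) * (1 + rq) * H' * (1 + rq) + (H * (rp * H') + H * (rp * rq) * H') * (1 + rq) := by
        noncomm_ring
    _ = (1 + rq) * ((1 + qq + rr + qr + rq) * H') * (1 + rq) + H * rr * (1 + rq) := by
        rw [c1, b2, a2, mul_zero, zero_mul, add_zero, ← mul_assoc]
    _ = (H + rq * H) * (1 + qq + rr + qr + rq) * (1 + rq) + H * rr * (1 + rq) := by
        rw [b3]; noncomm_ring
    _ = H * ((1 + qq + rr + qr + rq) * (1 + rq) + rr * (1 + rq)) := by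
        rw [b1, add_zero]; noncomm_ring
    _ = H * (1 + qr) := by rw [c2]

lemma swallow_down_identity (h2 : ∀ x : R, x + x = 0) (a1 : pq * qp = pp) (a3 : qp * pp = qp)
    (a4 : qp * qq = 0) (a5 : qp * pq = qq) (a6 : qp * qp = 0) (a7 : pp * qp = 0) (a8 : qq * qp = qp)
    (c1 : H * qp = 0) (c2 : H * qq = 0) (c3 : qp * H * pq = 0) (c4 : H * rp = qp)
    (c5 : rp * H * pp = 0) (c6 : rp * H * pq = 0) (c7 : rp * H * H * pq = 0)
    (b3 : (1 + pp + qq + pq + qp) * H' = H * (1 + pp + qq + pq + qp)) :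
    H * (1 + rp * H + pq) + (1 + rp * H + pq) * ((1 + qp) * H' * (1 + qp)) = rp * (H * H) := by
  have e1 : (1 + pq) * (1 + qp) = (1 + qp) * (1 + pp + qq + pq + qp) := by
    have e1 : (1 + pq) * (1 + qp) = 1 + qp + pq + pq * qp := by noncomm_ring
    have e2 : (1 + qp) * (1 + pp + qq + pq + qp) = 1 + pp + qq + pq + qp + qp + qp * pp + qp * qq +
      qp * pq + qp * qp := by noncomm_ring
    rw [e1, e2, a1, a3, a4, a5, a6]
    calc 1 + qp + pq + pp = 1 + qp + pq + pp + 0 + 0 := by abel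
      _ = 1 + qp + pq + pp + (qq + qq) + (qp + qp) := by rw [h2, h2]
      _ = _ := by abel
  have e2 : (1 + pp + qq + pq + qp) * (1 + qp) = 1 + pq + qq + qp := by
    have e1 : (1 + pp + qq + pq + qp) * (1 + qp) = 1 + pq + qq + pp + pq * qp +
      (qp + qq * qp) + qp + pp * qp + qp * qp := by noncomm_ring
    rw [e1, a1, a7, a6, a8, h2, add_assoc (1 + pq + qq), h2]
    abel
  have e3 : H * (1 + pp + qq + pq + qp) * (1 + qp) = H * (1 + pq) := by
    rw [mul_assoc, e2]
    calc H * (1 + pq + qq + qp) = H * (1 + pq) + H * qq + H * qp := by noncomm_ring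
      _ = _ := by rw [c1, c2, add_zero, add_zero]
  have e4 : rp * H * (1 + pp + qq + pq + qp) = rp * H := by
    calc rp * H * (1 + pp + qq + pq + qp) = rp * H + rp * H * pp + rp * (H * qq) + rp * H * pq +
          rp * (H * qp) := by noncomm_ring
      _ = rp * H := by rw [c1, c2, c5, c6]; simp
  have e5 : rp * H * H' * (1 + qp) = rp * (H * H) := by
    calc rp * H * H' * (1 + qp) = rp * H * (1 + pp + qq + pq + qp) * H' * (1 + qp) := by rw [e4]
      _ = rp * H * ((1 + pp + qq + pq + qp) * H') * (1 + qp) := by noncomm_ring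
      _ = rp * H * (H * (1 + pp + qq + pq + qp) * (1 + qp)) := by rw [b3]; noncomm_ring
      _ = rp * (H * H) + rp * H * H * pq := by rw [e3]; noncomm_ring
      _ = _ := by rw [c7, add_zero]
  have e6 : (1 + rp * H + pq) * ((1 + qp) * H' * (1 + qp)) =
      H + H * pq + qp * H + rp * (H * H) := by
    calc (1 + rp * H + pq) * ((1 + qp) * H' * (1 + qp))
        = (1 + pq) * (1 + qp) * H' * (1 + qp) + rp * (H * qp) * H' * (1 + qp) +
          rp * H * H' * (1 + qp) := by noncomm_ring
      _ = (1 + qp) * ((1 + pp + qq + pq + qp) * H') * (1 + qp) + rp * (H * H) := by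
          rw [e1, c1, e5]; noncomm_ring
      _ = (1 + qp) * (H * (1 + pp + qq + pq + qp) * (1 + qp)) + rp * (H * H) := by
          rw [b3]; noncomm_ring
      _ = H + H * pq + qp * H + qp * H * pq + rp * (H * H) := by rw [e3]; noncomm_ring
      _ = _ := by rw [c3, add_zero]
  have e7 : H * (1 + rp * H + pq) = H + qp * H + H * pq := by
    calc H * (1 + rp * H + pq) = H + (H * rp) * H + H * pq := by noncomm_ring
      _ = _ := by rw [c4]
  rw [e6, e7]
  calc H + qp * H + H * pq + (H + H * pq + qp * H + rp * (H * H))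
      = (H + H) + (qp * H + qp * H) + (H * pq + H * pq) + rp * (H * H) := by abel
    _ = _ := by simp only [h2, zero_add]

end Ring

section Matrix

variable {I R : Type*} [Fintype I] [DecidableEq I] [Ring R]

lemma single_one_mul_apply {J : Type*} (M : Matrix I J R) (a b i : I) (j : J) :
    (Matrix.single a b (1 : R) * M) i j = if i = a then M b j else 0 := by
  split_ifs with hi
  · subst hi; simp
  · simp [Matrix.single_mul_apply_of_ne, hi]

lemma mul_single_one_apply {J : Type*} (M : Matrix J I R) (a b j : I) (i : J) :
    (M * Matrix.single a b (1 : R)) i j = if j = b then M i a else 0 := by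
  split_ifs with hi
  · subst hi; simp
  · simp [Matrix.mul_single_apply_of_ne, hi]

lemma swap_matrix_identity (h2 : ∀ x : R, x + x = 0) {q r : I} (hqr : q ≠ r) {H H' : Matrix I I R}
    (hH : ∀ i j, H' (Equiv.swap q r i) j = H i (Equiv.swap q r j)) :
    (1 + Matrix.single q q (1 : R) + Matrix.single r r 1 + Matrix.single q r 1 +
      Matrix.single r q 1) * H' =
    H * (1 + Matrix.single q q (1 : R) + Matrix.single r r 1 + Matrix.single q r 1 +
      Matrix.single r q 1) := by
  ext i j
  simp only [add_mul, mul_add, one_mul, mul_one, Matrix.add_apply, single_one_mul_apply,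
    mul_single_one_apply]
  have l : H' i j + (if i = q then H' q j else 0) + (if i = r then H' r j else 0) +
      (if i = q then H' r j else 0) + (if i = r then H' q j else 0) = H' (Equiv.swap q r i) j := by
    by_cases hi : i = q
    · subst hi
      simp [hqr, h2, Equiv.swap_apply_left]
    · by_cases hi' : i = r
      · subst hi'
        simp [hqr.symm, h2, Equiv.swap_apply_right]
      · simp [hi, hi', Equiv.swap_apply_of_ne_of_ne hi hi']
  have r' : H i j + (if j = q then H i q else 0) + (if j = r then H i r else 0) +
      (if j = r then H i q else 0) + (if j = q then H i r else 0) = H i (Equiv.swap q r j) := by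
    by_cases hi : j = q
    · subst hi
      simp [hqr, h2, Equiv.swap_apply_left]
    · by_cases hi' : j = r
      · subst hi'
        simp [hqr.symm, h2, Equiv.swap_apply_right]
      · simp [hi, hi', Equiv.swap_apply_of_ne_of_ne hi hi']
  rw [l, r', hH]

variable {d : R → R} (hd : IsMod2Derivation d)
include hd

omit [Fintype I] in
lemma map_single_one (a b : I) : (Matrix.single a b (1 : R)).map d = 0 := by
  ext i j
  rw [Matrix.map_apply, Matrix.single_apply]
  split_ifs
  · exact hd.map_one
  · exact hd.map_zero

lemma map_swallow_up {p q r : I} (hpr : p ≠ r) (hqr : q ≠ r) {H H' : Matrix I I R}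
    (hH : H.map d = H * H) (h1 : ∀ j, H q j = 0) (h2 : ∀ j, H' p j = if j = r then 1 else 0)
    (h3 : ∀ i j, H' (Equiv.swap q r i) j = H i (Equiv.swap q r j)) :
    (1 + H * Matrix.single r p 1 + Matrix.single q r 1).map d =
      H * (1 + H * Matrix.single r p 1 + Matrix.single q r 1) +
      (1 + H * Matrix.single r p 1 + Matrix.single q r 1) *
        ((1 + Matrix.single r q 1) * H' * (1 + Matrix.single r q 1)) := by
  have hD := hd.matrix I
  have hI := swallow_up_identity (H := H) (H' := H') (qr := Matrix.single q r (1 : R))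
    (rq := Matrix.single r q 1) (rp := Matrix.single r p 1) (qq := Matrix.single q q 1)
    (rr := Matrix.single r r 1) hD.add_self (by simp) (by simp [hpr]) (by simp)
    (by simp [hqr]) (by simp) (by simp [hqr]) (by simp [hqr])
    (by ext i j; simp [single_one_mul_apply, h1])
    (by
      ext i j
      rcases eq_or_ne i r with rfl | hi
      · simp [h2, Matrix.single_apply, eq_comm]
      · simp [hi, hi.symm])
    (swap_matrix_identity hd.add_self hqr h3)
  rw [hI]
  have hadd : ∀ M N : Matrix I I R, (M + N).map d = M.map d + N.map d := hD.map_add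
  have hmul : ∀ M N : Matrix I I R, (M * N).map d = M.map d * N + M * N.map d := hD.leibniz
  have hone : (1 : Matrix I I R).map d = 0 := hD.map_one
  rw [hadd, hadd, hone, hmul]
  simp only [map_single_one hd, hH]
  have e : ∀ x y z : Matrix I I R, x = x + (y + y) + (z + z) := fun x y z => by
    rw [hD.add_self, hD.add_self, add_zero, add_zero]
  rw [mul_zero, add_zero, add_zero, zero_add]
  refine (e (H * H * Matrix.single r p 1) H (H * Matrix.single q r 1)).trans ?_
  noncomm_ring

lemma map_swallow_down {p q r : I} (hpq : p ≠ q) (hpr : p ≠ r) {H H' : Matrix I I R}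
    (hH : H.map d = H * H) (h1 : ∀ i, H i q = 0) (h2 : ∀ i, H i r = if i = q then 1 else 0)
    (h3 : ∀ i j, H' (Equiv.swap p q i) j = H i (Equiv.swap p q j)) (h4 : H p p = 0)
    (h5 : (H * H) p p = 0) :
    (1 + Matrix.single r p 1 * H + Matrix.single p q 1).map d =
      H * (1 + Matrix.single r p 1 * H + Matrix.single p q 1) +
      (1 + Matrix.single r p 1 * H + Matrix.single p q 1) *
        ((1 + Matrix.single q p 1) * H' * (1 + Matrix.single q p 1)) := by
  have hD := hd.matrix I
  have hI := swallow_down_identity (H := H) (H' := H') (pq := Matrix.single p q (1 : R))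
    (qp := Matrix.single q p 1) (rp := Matrix.single r p 1) (qq := Matrix.single q q 1)
    (pp := Matrix.single p p 1) hD.add_self (by simp) (by simp)
    (by simp [hpq]) (by simp) (by simp [hpq]) (by simp [hpq]) (by simp)
    (by ext i j; simp [mul_single_one_apply, h1])
    (by ext i j; simp [mul_single_one_apply, h1])
    (by ext i j; simp [mul_single_one_apply, single_one_mul_apply, h4])
    (by
      ext i j
      rcases eq_or_ne j p with rfl | hi
      · simp [h2, Matrix.single_apply, eq_comm]
      · simp [hi, hi.symm])
    (by ext i j; simp [mul_single_one_apply, single_one_mul_apply, h4])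
    (by ext i j; simp [mul_single_one_apply, single_one_mul_apply, h4])
    (by
      rw [mul_assoc (Matrix.single r p 1)]
      ext i j
      simp [mul_single_one_apply, single_one_mul_apply, h5])
    (swap_matrix_identity hd.add_self hpq h3)
  rw [hI]
  have hadd : ∀ M N : Matrix I I R, (M + N).map d = M.map d + N.map d := hD.map_add
  have hmul : ∀ M N : Matrix I I R, (M * N).map d = M.map d * N + M * N.map d := hD.leibniz
  have hone : (1 : Matrix I I R).map d = 0 := hD.map_one
  rw [hadd, hadd, hone, hmul]
  simp only [map_single_one hd, hH]
  simp

end Matrix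

end SwallowIdentities

section CrossMatrix

open LegendrianSurface PolygonalDecomposition

variable {S Λ : Type*} [TopologicalSpace S] [ChartedSpace Plane S] [IsManifold (𝓡 2) ∞ S]
  [TopologicalSpace Λ] [ChartedSpace Plane Λ] [CWComplex (univ : Set S)]
  {L : LegendrianSurface S Λ} {n : ℕ} {e : Cell S n} {θ : Fin n → ℝ} {s t a : Sheet L n e}

/-- Three sheets meet at a swallowtail point above `θ`, and the sheet `a` is above the other two ones
at an upward swallowtail point, and below them at a downward one. -/
structure SwallowAt (θ : Fin n → ℝ) (s t a : Sheet L n e) : Prop where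
  meet : MeetAt θ a s t
  up : a.lift θ ∈ L.swallowUp → a.Above s ∧ a.Above t
  down : a.lift θ ∉ L.swallowUp → s.Above a ∧ t.Above a

/-- The sheets that form the block `[0 1; 0 0]` of a decorated vertex. -/
def crossRel (θ : Fin n → ℝ) (s t a : Sheet L n e) : Sheet L n e → Sheet L n e → Prop :=
  if a.lift θ ∈ L.swallowUp then pairRel a t else pairRel s a

/-- The matrix of a decorated vertex; the sheet `s` is above `t` in the region labeled `S`. -/
def crossMatrix [Fintype (Sheet L n e)] (θ : Fin n → ℝ) (s t a : Sheet L n e) :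
    Matrix (Sheet L n e) (Sheet L n e) (Alg L) :=
  (1 + Matrix.single t s 1) * boundaryMatrix θ (crossRel θ s t a) * (1 + Matrix.single t s 1)

variable (h : IsCellular L) [T2Space S] [IsManifold (𝓡 2) ∞ Λ]
  (hθ : θ ∈ closedBall (0 : Fin n → ℝ) 1)
include h hθ

omit [IsManifold (𝓡 2) ∞ Λ] in
lemma SwallowAt.isMatching (hm : SwallowAt θ s t a) {v : Cell S 0} (hx : map n e θ ∈ openCell 0 v) :
    IsMatching θ (crossRel θ s t a) v := by
  rw [crossRel]
  split_ifs
  · exact isMatching_pairRel h hθ hm.meet.swap hx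
  · exact isMatching_pairRel h hθ hm.meet.rotate.swap hx

omit [IsManifold (𝓡 2) ∞ Λ] in
lemma SwallowAt.map_crossMatrix [∀ (n : ℕ) (e : Cell S n), Fintype (Sheet L n e)]
    {d : Alg L → Alg L} (hd : IsMod2Derivation d) (hm : SwallowAt θ s t a) {v : Cell S 0}
    (hx : map n e θ ∈ openCell 0 v)
    (hA : (sheetMatrix L v).map d = sheetMatrix L v * sheetMatrix L v) :
    (crossMatrix θ s t a).map d = crossMatrix θ s t a * crossMatrix θ s t a := by
  have hD := hd.matrix (Sheet L n e)
  refine hD.map_sq_conj ?_ ?_ (map_boundaryMatrix h hd hθ hx (hm.isMatching h hθ hx) hA)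
  · have h0 : Matrix.single t s (1 : Alg L) * Matrix.single t s 1 = 0 := by simp [hm.meet.ne₃]
    rw [add_mul, mul_add, mul_add, h0, one_mul, mul_one, add_zero, add_assoc, one_mul, hD.add_self,
      add_zero]
  · exact (hD.map_add _ _).trans (by simp only [hD.map_one, map_single_one hd, add_zero])

lemma SwallowAt.onSheet_eq (hn : n ≠ 0) (hm : SwallowAt θ s t a) (μ : L.MaslovPotential) :
    μ.onSheet t.1 = μ.onSheet s.1 ∧
      (a.lift θ ∈ L.swallowUp → μ.onSheet a.1 = μ.onSheet s.1 + 1) ∧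
      (a.lift θ ∉ L.swallowUp → μ.onSheet s.1 = μ.onSheet a.1 + 1) ∧
      ∀ {v : Cell S 0} {T : Sheet L 0 v}, a.lift θ ∈ T.1 → μ.onSheet s.1 = μ.onSheet T.1 := by
  obtain ⟨w, hw, hh⟩ := onSheet_of_swallow h μ hθ hn hm.meet.swallow (a.x_lift h hθ)
  rcases hh with ⟨s', -, hs', -⟩ | ⟨a', b, c, ha', hb, hc, hbc, hall, hup, hdn, va, vb, vc⟩
  · exact absurd ((hs' a rfl).trans (hs' s hm.meet.eq₁).symm) hm.meet.ne₁
  · have haa : a = a' := by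
      by_contra hne
      have key : a' = s ∨ a' = t := (hm.meet.all a' ha').resolve_left (Ne.symm hne)
      have hbc' : a = b ∨ a = c := (hall a rfl).resolve_left hne
      by_cases hu : a.lift θ ∈ L.swallowUp
      · have h1 : a.Above a' := key.elim (fun e => e ▸ (hm.up hu).1) fun e => e ▸ (hm.up hu).2
        have h2 : a'.Above a := hbc'.elim (fun e => e ▸ (hup hu).1) fun e => e ▸ (hup hu).2
        exact h1.asymm h h2
      · have h1 : a'.Above a := key.elim (fun e => e ▸ (hm.down hu).1) fun e => e ▸ (hm.down hu).2
        have h2 : a.Above a' := hbc'.elim (fun e => e ▸ (hdn hu).1) fun e => e ▸ (hdn hu).2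
        exact h1.asymm h h2
    subst haa
    have val : ∀ r : Sheet L n e, r.lift θ = a.lift θ → r ≠ a → μ.onSheet r.1 = w := by
      intro r hr hra
      rcases hall r hr with rfl | rfl | rfl
      · exact absurd rfl hra
      · exact vb
      · exact vc
    have vs := val s hm.meet.eq₁ hm.meet.ne₁.symm
    have vt := val t hm.meet.eq₂ hm.meet.ne₂.symm
    refine ⟨vt.trans vs.symm, fun hu => ?_, fun hu => ?_, fun hT => ?_⟩
    · rw [va, vs, maslovJump, if_pos hu]
    · rw [va, vs, maslovJump, if_neg hu]; ring
    · rw [vs, hasValueAt_onSheet_zero h μ hT hw]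

namespace Enumeration

variable (E : Enumeration L n e)

lemma IsTriple.eq (hn : n ≠ 0) {p q r : Fin E.num} (ht : E.IsTriple θ (p, q, r))
    {x y z : Sheet L n e} (hm : MeetAt θ x y z) (hxy : E.sheet.symm x < E.sheet.symm y)
    (hyz : E.sheet.symm y < E.sheet.symm z) : E.sheet p = x ∧ E.sheet q = y ∧ E.sheet r = z := by
  have hm' := IsTriple.meetAt E h hθ hn ht
  have he : (E.sheet p).lift θ = x.lift θ := h.generic.eq_of_swallow hm.swallow
    (not_regular_of_swallow hm'.swallow) (((E.sheet p).x_lift h hθ).trans (x.x_lift h hθ).symm)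
  have key : ∀ i, (E.sheet i).lift θ = x.lift θ →
      i = E.sheet.symm x ∨ i = E.sheet.symm y ∨ i = E.sheet.symm z := fun i hi => by
    simpa only [Equiv.eq_symm_apply] using hm.all _ hi
  have h1 := ht.1
  have h2 := ht.2.1
  have kp := key p he
  have kq := key q (hm'.eq₁.trans he)
  have kr := key r (hm'.eq₂.trans he)
  simp only [← Equiv.eq_symm_apply]
  simp only at h1 h2
  omega

lemma matrixAS_eq [Fintype (Sheet L n e)] (hn : n ≠ 0) (hm : SwallowAt θ s t a)
    (hst : E.sheet.symm s < E.sheet.symm t) :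
    E.matrixAS θ = (crossMatrix θ s t a).submatrix E.sheet E.sheet := by
  obtain ⟨p, q, r, ht, -, hA, -⟩ := E.exists_triple_matrices (E.exists_isTriple h hθ hm.meet)
  have lt : ∀ {x y : Sheet L n e}, x.Above y → E.sheet.symm x < E.sheet.symm y := fun ha =>
    E.lt_of_above _ _ (by simpa using ha)
  rw [hA, E.lim_eq h hθ]
  by_cases hu : a.lift θ ∈ L.swallowUp
  · obtain ⟨rfl, rfl, rfl⟩ := IsTriple.eq h hθ E hn ht hm.meet (lt (hm.up hu).1) hst
    rw [if_pos hu, E.one_add_unit_eq, E.hatMatrix_eq h hθ, crossMatrix, crossRel, if_pos hu,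
      Matrix.submatrix_mul_equiv, Matrix.submatrix_mul_equiv]
  · obtain ⟨rfl, rfl, rfl⟩ := IsTriple.eq h hθ E hn ht hm.meet.rotate hst (lt (hm.down hu).2)
    rw [hm.meet.eq₁, if_neg hu, E.one_add_unit_eq, E.hatMatrix_eq h hθ, crossMatrix, crossRel,
      if_neg hu, Matrix.submatrix_mul_equiv, Matrix.submatrix_mul_equiv]

lemma matrixAT_eq [Fintype (Sheet L n e)] (hn : n ≠ 0) (hm : SwallowAt θ s t a)
    (hst : E.sheet.symm t < E.sheet.symm s) :
    E.matrixAT θ = (crossMatrix θ s t a).submatrix E.sheet E.sheet := by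
  obtain ⟨p, q, r, ht, -, -, hA, -⟩ := E.exists_triple_matrices (E.exists_isTriple h hθ hm.meet)
  have lt : ∀ {x y : Sheet L n e}, x.Above y → E.sheet.symm x < E.sheet.symm y := fun ha =>
    E.lt_of_above _ _ (by simpa using ha)
  rw [hA, E.lim_eq h hθ]
  by_cases hu : a.lift θ ∈ L.swallowUp
  · obtain ⟨rfl, rfl, rfl⟩ := IsTriple.eq h hθ E hn ht hm.meet.swap (lt (hm.up hu).2) hst
    rw [if_pos hu, E.one_add_unit_eq, E.hatMatrix_eq h hθ, crossMatrix, crossRel, if_pos hu,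
      Matrix.submatrix_mul_equiv, Matrix.submatrix_mul_equiv]
  · obtain ⟨rfl, rfl, rfl⟩ := IsTriple.eq h hθ E hn ht hm.meet.swap.rotate hst (lt (hm.down hu).1)
    rw [hm.meet.eq₂, if_neg hu, E.one_add_unit_eq, E.hatMatrix_eq h hθ, crossMatrix, crossRel,
      if_neg hu, Matrix.submatrix_mul_equiv, Matrix.submatrix_mul_equiv]

lemma exists_swallowAt_of_isTriple (hn : n ≠ 0) (hO : IsOrdered L e θ) {p q r : Fin E.num}
    (ht : E.IsTriple θ (p, q, r)) : (E.sheet p).Above (E.sheet q) ∧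
      (E.sheet q).Above (E.sheet r) := by
  have hm := IsTriple.meetAt E h hθ hn ht
  exact ⟨(hO _ _ hm.ne₁ hm.eq₁.symm hm.swallow).resolve_right fun hh =>
      ht.1.not_gt (E.lt_of_above _ _ hh),
    (hO _ _ hm.ne₃ (hm.eq₁.trans hm.eq₂.symm) (hm.eq₁ ▸ hm.swallow)).resolve_right fun hh =>
      ht.2.1.not_gt (E.lt_of_above _ _ hh)⟩

lemma vertexMatrix_eq (hn : n ≠ 0) (hO : IsOrdered L e θ) :
    E.vertexMatrix θ = (boundaryMatrix θ (Cancel θ)).submatrix E.sheet E.sheet := by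
  by_cases hT : ∃ t, E.IsTriple θ t
  · obtain ⟨p, q, r, ht, hV, -⟩ := E.exists_triple_matrices hT
    have hm := IsTriple.meetAt E h hθ hn ht
    obtain ⟨h12, h23⟩ := E.exists_swallowAt_of_isTriple h hθ hn hO ht
    rw [hV, E.hatMatrix_eq h hθ, E.hatMatrix_eq h hθ, E.lim_eq h hθ]
    have key : (Cancel θ : Sheet L n e → Sheet L n e → Prop) =
        if (E.sheet p).lift θ ∈ L.swallowUp then pairRel (E.sheet p) (E.sheet q)
        else pairRel (E.sheet q) (E.sheet r) := by
      funext s t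
      refine propext ⟨fun hc => ?_, fun hc => ?_⟩
      · have hs := h.generic.eq_of_swallow hm.swallow hc.not_regular
          ((s.x_lift h hθ).trans ((E.sheet p).x_lift h hθ).symm)
        have := (cancel_iff_of_triple h hm.swallow rfl hm.eq₁ hm.eq₂ h12 h23 hm.all hs).1 hc
        split_ifs at this ⊢ <;> exact this
      · have hs : s.lift θ = (E.sheet p).lift θ := by
          split_ifs at hc
          · rw [hc.1]
          · rw [hc.1, hm.eq₁]
        refine (cancel_iff_of_triple h hm.swallow rfl hm.eq₁ hm.eq₂ h12 h23 hm.all hs).2 ?_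
        split_ifs at hc ⊢ <;> exact hc
    rw [key]
    split_ifs <;> rfl
  · have hcusp : ∀ s t : Sheet L n e, Cancel θ s t → s.lift θ ∈ L.cuspEdge := by
      rintro s t ⟨he, ha, hc | ⟨hu, r, hr, hra⟩ | ⟨hu, -, r, hr, hra⟩⟩
      · exact hc
      · exact absurd (E.exists_isTriple h hθ ⟨Or.inl hu, he.symm, hr, ha.ne h, (ha.trans h hra).ne h,
          hra.ne h, fun _ hr' => eq_or_of_three h hθ hn (Or.inl hu) (ha.ne h) ((ha.trans h hra).ne h)
            (hra.ne h) he.symm hr hr'⟩) hT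
      · exact absurd (E.exists_isTriple h hθ ⟨hu, he.symm, hr, ha.ne h, (hra.ne h).symm,
          ((hra.trans h ha).ne h).symm, fun _ hr' => eq_or_of_three h hθ hn hu (ha.ne h)
            (hra.ne h).symm ((hra.trans h ha).ne h).symm he.symm hr hr'⟩) hT
    rw [vertexMatrix, dif_neg hT]
    ext i j
    rw [plainMatrix, Matrix.of_apply, Matrix.submatrix_apply, boundaryMatrix, Matrix.of_apply,
      E.lim_eq h hθ, E.lim_eq h hθ]
    have hiff : (i < j ∧ (E.sheet i).lift θ = (E.sheet j).lift θ ∧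
        (E.sheet i).lift θ ∈ L.cuspEdge) ↔ Cancel θ (E.sheet i) (E.sheet j) := by
      constructor
      · rintro ⟨hij, he, hc⟩
        refine ⟨he, ?_, Or.inl hc⟩
        rcases Sheet.cases_of_cusp h hθ ((E.sheet i).x_lift h hθ) hc with hno |
          ⟨x, y, hxy, -, -, hall⟩
        · exact absurd rfl (hno _)
        · have hne : E.sheet i ≠ E.sheet j := fun hh => hij.ne (E.sheet.injective hh)
          rcases hall _ rfl with h1 | h1 <;> rcases hall _ he.symm with h2 | h2
          · exact absurd (h1.trans h2.symm) hne
          · rwa [h1, h2]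
          · exact absurd (E.lt_of_above _ _ (h1 ▸ h2 ▸ hxy : (E.sheet j).Above (E.sheet i))) hij.not_gt
          · exact absurd (h1.trans h2.symm) hne
      · exact fun hc => ⟨E.lt_of_above _ _ hc.2.1, hc.1, hcusp _ _ hc⟩
    rw [if_congr hiff rfl rfl]
    by_cases hc : Cancel θ (E.sheet i) (E.sheet j)
    · rw [if_pos hc, if_pos hc]
    · rw [if_neg hc, if_neg hc]
      have hmc : ∀ s : Sheet L n e, Meets (Cancel θ) s → s.lift θ ∈ L.cuspEdge := by
        rintro s ⟨r, hr | hr⟩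
        · exact hcusp _ _ hr
        · exact hr.1 ▸ hcusp _ _ hr
      split_ifs with hM
      · exact genAt_eq_zero_of_cusp h (hM.imp (hmc _) (hmc _))
      · rfl

end Enumeration

end CrossMatrix

section Homogeneous

open LegendrianSurface PolygonalDecomposition

variable {S Λ : Type*} [TopologicalSpace S] [ChartedSpace Plane S] [IsManifold (𝓡 2) ∞ S]
  [TopologicalSpace Λ] [ChartedSpace Plane Λ] [CWComplex (univ : Set S)]
  {L : LegendrianSurface S Λ} {n : ℕ} {e : Cell S n} {I : Type*} {f : I → Sheet L n e} {c c' : ℤ}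

/-- The entries of `M` vanish unless the sheet of the row is above the one of the column, and are
homogeneous for all Maslov potentials, in degree `c` if the degrees of the generators above the
cell are shifted to `μ(S_p) - μ(S_q)`. -/
def IsHom (f : I → Sheet L n e) (c : ℤ) (M : Matrix I I (Alg L)) : Prop :=
  ∀ i j, (M i j ≠ 0 → (f i).Above (f j)) ∧
    ∀ μ : L.MaslovPotential, M i j ∈ gradedPiece μ (μ.onSheet (f i).1 - μ.onSheet (f j).1 + c)

namespace IsHom

variable {M N : Matrix I I (Alg L)}

lemma zero : IsHom f c 0 := fun _ _ => ⟨fun hh => absurd rfl hh, fun _ => zero_mem _⟩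

lemma add (hM : IsHom f c M) (hN : IsHom f c N) : IsHom f c (M + N) := fun i j =>
  ⟨fun hh => by
    by_cases h0 : M i j = 0
    · refine (hN i j).1 fun h1 => hh ?_
      rw [Matrix.add_apply, h0, h1, add_zero]
    · exact (hM i j).1 h0, fun μ => add_mem ((hM i j).2 μ) ((hN i j).2 μ)⟩

lemma neg (hM : IsHom f c M) : IsHom f c (-M) := fun i j =>
  ⟨fun hh => (hM i j).1 fun h0 => hh (by rw [Matrix.neg_apply, h0, neg_zero]),
    fun μ => neg_mem ((hM i j).2 μ)⟩

lemma submatrix {J : Type*} (hM : IsHom f c M) (g : J → I) :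
    IsHom (f ∘ g) c (M.submatrix g g) := fun i j => hM (g i) (g j)

section Single

variable [Fintype I] [DecidableEq I] {a b : I}

lemma single_mul (hM : IsHom f c M)
    (hv : ∀ μ : L.MaslovPotential, μ.onSheet (f b).1 + c = μ.onSheet (f a).1 + c')
    (ha : ∀ j, M b j ≠ 0 → (f a).Above (f j)) : IsHom f c' (Matrix.single a b 1 * M) := by
  intro i j
  rw [single_one_mul_apply]
  split_ifs with hi
  · subst hi
    refine ⟨ha j, fun μ => ?_⟩
    have := (hM b j).2 μ
    rwa [sub_add_eq_add_sub, hv μ, ← sub_add_eq_add_sub] at this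
  · exact zero i j

lemma mul_single (hM : IsHom f c M)
    (hv : ∀ μ : L.MaslovPotential, μ.onSheet (f a).1 + c' = μ.onSheet (f b).1 + c)
    (ha : ∀ i, M i a ≠ 0 → (f i).Above (f b)) : IsHom f c' (M * Matrix.single a b 1) := by
  intro i j
  rw [mul_single_one_apply]
  split_ifs with hj
  · subst hj
    refine ⟨ha i, fun μ => ?_⟩
    have := (hM i a).2 μ
    have e : μ.onSheet (f i).1 - μ.onSheet (f a).1 + c = μ.onSheet (f i).1 - μ.onSheet (f j).1 + c' := by
      linear_combination -(hv μ)
    rwa [e] at this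
  · exact zero i j

omit [Fintype I] in
lemma single_one (ha : (f a).Above (f b))
    (hv : ∀ μ : L.MaslovPotential, μ.onSheet (f a).1 + c = μ.onSheet (f b).1) :
    IsHom f c (Matrix.single a b 1) := by
  intro i j
  rw [Matrix.single_apply]
  split_ifs with hh
  · obtain ⟨rfl, rfl⟩ := hh
    refine ⟨fun _ => ha, fun μ => ?_⟩
    rw [sub_add_eq_add_sub, hv, sub_self]
    exact one_mem_wordSpan (Gen.degree μ)
  · exact zero i j

lemma conj (hM : IsHom f c M)
    (hv : ∀ μ : L.MaslovPotential, μ.onSheet (f a).1 = μ.onSheet (f b).1)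
    (h1 : ∀ j, M b j ≠ 0 → (f a).Above (f j)) (h2 : ∀ i, M i a ≠ 0 → (f i).Above (f b))
    (h3 : M b a = 0) :
    IsHom f c ((1 + Matrix.single a b 1) * M * (1 + Matrix.single a b 1)) := by
  have h0 : Matrix.single a b 1 * (M * Matrix.single a b 1) = 0 := by
    ext i j
    simp [single_one_mul_apply, mul_single_one_apply, h3]
  have : (1 + Matrix.single a b 1) * M * (1 + Matrix.single a b 1) = M + Matrix.single a b 1 * M +
      (M * Matrix.single a b 1 + Matrix.single a b 1 * (M * Matrix.single a b 1)) := by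
    noncomm_ring
  rw [this, h0, add_zero]
  exact (hM.add (hM.single_mul (fun μ => by rw [hv μ]) h1)).add
    (hM.mul_single (fun μ => by rw [hv μ]) h2)

end Single

section Mul

variable (h : IsCellular L) [T2Space S] [IsManifold (𝓡 2) ∞ Λ] [Fintype I] [DecidableEq I]
include h

omit [DecidableEq I] in
lemma mul (hM : IsHom f c M) (hN : IsHom f c' N) : IsHom f (c + c') (M * N) := by
  intro i j
  rw [Matrix.mul_apply]
  refine ⟨fun hh => ?_, fun μ => sum_mem fun k _ => ?_⟩
  · obtain ⟨k, -, hk⟩ := Finset.exists_ne_zero_of_sum_ne_zero hh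
    exact ((hM i k).1 (left_ne_zero_of_mul hk)).trans h ((hN k j).1 (right_ne_zero_of_mul hk))
  · have := mul_mem_wordSpan (Gen.degree μ) ((hM i k).2 μ) ((hN k j).2 μ)
    have e : μ.onSheet (f i).1 - μ.onSheet (f k).1 + c + (μ.onSheet (f k).1 - μ.onSheet (f j).1 + c') =
        μ.onSheet (f i).1 - μ.onSheet (f j).1 + ((c + c' : ℤ) : ZMod L.maslovNumber) := by
      push_cast; ring
    rwa [e] at this

omit [DecidableEq I] in
lemma mul_zero_deg (hM : IsHom f c M) (hN : IsHom f 0 N) : IsHom f c (M * N) := by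
  simpa using hM.mul h hN

omit [DecidableEq I] in
lemma zero_deg_mul (hM : IsHom f 0 M) (hN : IsHom f c N) : IsHom f c (M * N) := by
  simpa using hM.mul h hN

/-- A product with a unipotent factor. -/
lemma uni_mul {Y : Matrix I I (Alg L)} (hY : IsHom f 0 (1 - Y)) (hM : IsHom f c M) :
    IsHom f c (Y * M) := by
  have : Y * M = M + -((1 - Y) * M) := by noncomm_ring
  rw [this]
  exact hM.add (hY.zero_deg_mul h hM).neg

lemma mul_uni {Y : Matrix I I (Alg L)} (hY : IsHom f 0 (1 - Y)) (hM : IsHom f c M) :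
    IsHom f c (M * Y) := by
  have : M * Y = M + -(M * (1 - Y)) := by noncomm_ring
  rw [this]
  exact hM.add (hM.mul_zero_deg h hY).neg

lemma uni_list_prod (l : List (Matrix I I (Alg L))) (hl : ∀ Y ∈ l, IsHom f 0 (1 - Y)) :
    IsHom f 0 (1 - l.prod) := by
  induction l with
  | nil => simpa using zero
  | cons Y l ih =>
    have : 1 - (Y :: l).prod = (1 - Y) + Y * (1 - l.prod) := by
      rw [List.prod_cons]; noncomm_ring
    rw [this]
    exact (hl Y (by simp)).add (uni_mul h (hl Y (by simp)) (ih fun Z hZ => hl Z (by simp [hZ])))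

end Mul

section Inverse

variable (h : IsCellular L) [T2Space S] [IsManifold (𝓡 2) ∞ Λ] {E : Enumeration L n e}
  {X Y : Matrix (Fin E.num) (Fin E.num) (Alg L)}
include h

omit h [T2Space S] [IsManifold (𝓡 2) ∞ Λ] in
lemma pow_eq_zero (hX : IsHom E.sheet c X) : X ^ E.num = 0 := by
  have key : ∀ (m : ℕ) (i j : Fin E.num), (X ^ m) i j ≠ 0 → (i : ℕ) + m ≤ j := by
    intro m
    induction m with
    | zero =>
      intro i j hh
      rw [pow_zero, Matrix.one_apply] at hh
      split_ifs at hh with hij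
      · rw [hij]; rfl
      · exact absurd rfl hh
    | succ m ih =>
      intro i j hh
      rw [pow_succ, Matrix.mul_apply] at hh
      obtain ⟨k, -, hk⟩ := Finset.exists_ne_zero_of_sum_ne_zero hh
      have h1 := ih i k (left_ne_zero_of_mul hk)
      have h2 : k < j := E.lt_of_above _ _ ((hX k j).1 (right_ne_zero_of_mul hk))
      omega
  ext i j
  by_contra hh
  have := key _ i j hh
  omega

lemma uni_inverse (hY : IsHom E.sheet 0 (1 - Y)) :
    IsUnit Y ∧ IsHom E.sheet 0 (1 - Ring.inverse Y) := by
  set X := 1 - Y with hXdef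
  have hY' : Y = 1 - X := by rw [hXdef, sub_sub_cancel]
  have h0 := hY.pow_eq_zero
  set G := ∑ i ∈ Finset.range E.num, X ^ i with hG
  have h1 : Y * G = 1 := by rw [hY', mul_neg_geom_sum, h0, sub_zero]
  have h2 : G * Y = 1 := by rw [hY', geom_sum_mul_neg, h0, sub_zero]
  have hu : IsUnit Y := ⟨⟨Y, G, h1, h2⟩, rfl⟩
  have hinv : Ring.inverse Y = G := by
    calc Ring.inverse Y = Ring.inverse Y * (Y * G) := by rw [h1, mul_one]
      _ = G := by rw [← mul_assoc, Ring.inverse_mul_cancel Y hu, one_mul]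
  have hp : ∀ m : ℕ, IsHom E.sheet 0 (X * X ^ m) := by
    intro m
    induction m with
    | zero => simpa using hY
    | succ m ih => rw [pow_succ, ← mul_assoc]; exact ih.zero_deg_mul h hY
  have hsum : ∀ m : ℕ, IsHom E.sheet 0 (X * ∑ i ∈ Finset.range m, X ^ i) := by
    intro m
    induction m with
    | zero => simpa using zero
    | succ m ih => rw [Finset.sum_range_succ, mul_add]; exact ih.add (hp m)
  refine ⟨hu, ?_⟩
  have h3 : G - X * G = 1 := by rw [← h1, hY']; noncomm_ring
  have : 1 - Ring.inverse Y = -(X * G) := by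
    rw [hinv, ← h3]; abel
  rw [this]
  exact (hsum _).neg

end Inverse

end IsHom

end Homogeneous

section Vertices

open LegendrianSurface PolygonalDecomposition

variable {S Λ : Type*} [TopologicalSpace S] [ChartedSpace Plane S] [IsManifold (𝓡 2) ∞ S]
  [TopologicalSpace Λ] [ChartedSpace Plane Λ] [CWComplex (univ : Set S)]
  {L : LegendrianSurface S Λ} {n : ℕ} {e : Cell S n} {θ : Fin n → ℝ} {s t a : Sheet L n e}

lemma isHom_sheetMatrix (e : Cell S n) : IsHom id ((n : ℤ) - 1) (sheetMatrix L e) := by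
  refine fun s t => ⟨fun hh => ?_, fun μ => ?_⟩
  · by_contra ha
    exact hh (dif_neg ha)
  · simpa using sheetMatrix_mem_gradedPiece μ e s t

variable (h : IsCellular L) [T2Space S] [IsManifold (𝓡 2) ∞ Λ]
  (hθ : θ ∈ closedBall (0 : Fin n → ℝ) 1)
include h hθ

lemma isHom_boundaryMatrix_cancel (hn : n ≠ 0) (hO : IsOrdered L e θ) {v : Cell S 0}
    (hx : map n e θ ∈ openCell 0 v) :
    IsHom id (-1) (boundaryMatrix θ (Cancel (L := L) (e := e) θ)) := fun s t =>
  ⟨support_boundaryMatrix h hθ fun _ _ hc => hc.2.1, fun μ => by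
    simpa using boundaryMatrix_mem_gradedPiece h hθ μ hx
      (fun s t hc => by rw [hc.onSheet_eq h μ hθ hn]; push_cast; ring)
      (fun s T hT hs => onSheet_eq_of_not_cancelled h μ hθ hn hO hs hT) s t⟩

lemma SwallowAt.isHom_crossMatrix [Fintype (Sheet L n e)] (hn : n ≠ 0) (hm : SwallowAt θ s t a)
    {v : Cell S 0} (hx : map n e θ ∈ openCell 0 v) : IsHom id (-1) (crossMatrix θ s t a) := by
  have hK : ∀ x y, crossRel θ s t a x y →
      x.Above y ∧ ∀ μ : L.MaslovPotential, μ.onSheet x.1 = μ.onSheet y.1 + 1 := by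
    intro x y hxy
    rw [crossRel] at hxy
    split_ifs at hxy with hu <;> obtain ⟨rfl, rfl⟩ := hxy
    · refine ⟨(hm.up hu).2, fun μ => ?_⟩
      rw [(hm.onSheet_eq h hθ hn μ).1, (hm.onSheet_eq h hθ hn μ).2.1 hu]
    · exact ⟨(hm.down hu).1, fun μ => (hm.onSheet_eq h hθ hn μ).2.2.1 hu⟩
  have hB : IsHom id (-1) (boundaryMatrix θ (crossRel θ s t a)) := by
    refine fun x y => ⟨support_boundaryMatrix h hθ fun x y hxy => (hK x y hxy).1, fun μ => ?_⟩
    have hv := hm.onSheet_eq h hθ hn μ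
    simpa using boundaryMatrix_mem_gradedPiece h hθ μ hx
      (fun x y hxy => by rw [(hK x y hxy).2 μ]; push_cast; ring)
      (fun x T hT hx' => by
        by_cases hxa : x.lift θ = a.lift θ
        · rw [hxa] at hT
          have hxs : x = s ∨ x = t := by
            rcases hm.meet.all x hxa with rfl | hh
            · exfalso
              refine hx' ?_
              rw [crossRel]
              split_ifs
              · exact meets_pairRel.2 (Or.inl rfl)
              · exact meets_pairRel.2 (Or.inr rfl)
            · exact hh
          rcases hxs with rfl | rfl
          · exact hv.2.2.2 hT
          · rw [hv.1]; exact hv.2.2.2 hT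
        · have hr : x.lift θ ∈ L.regular := by
            by_contra hr
            exact hxa (h.generic.eq_of_swallow hm.meet.swallow hr
              ((x.x_lift h hθ).trans (a.x_lift h hθ).symm))
          rw [onSheet_eq_of_lift_regular h μ hθ hn hr]
          exact (hasValueAt_onSheet_zero h μ hT fun w' =>
            (μ.hasValueAt_iff_of_regular hr w').trans eq_comm).symm) x y
  have hz : ∀ x y : Sheet L n e, genAt L (x.lift θ) (y.lift θ) ≠ 0 →
      L.z (y.lift θ) < L.z (x.lift θ) := fun x y =>
    z_lt_of_genAt_ne_zero ((x.x_lift h hθ).trans (y.x_lift h hθ).symm)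
  have hB' : ∀ x y, boundaryMatrix θ (crossRel θ s t a) x y ≠ 0 → crossRel θ s t a x y ∨
      (¬ Meets (crossRel θ s t a) x ∧ ¬ Meets (crossRel θ s t a) y ∧
        genAt L (x.lift θ) (y.lift θ) ≠ 0) := by
    intro x y hxy
    rw [boundaryMatrix, Matrix.of_apply] at hxy
    split_ifs at hxy with h1 h2
    · exact Or.inl h1
    · exact absurd rfl hxy
    · rw [not_or] at h2
      exact Or.inr ⟨h2.1, h2.2, hxy⟩
  have hval := fun μ => (hm.onSheet_eq h hθ hn μ).1
  have n₁ := hm.meet.ne₁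
  have n₂ := hm.meet.ne₂
  have hK' : (∀ y, crossRel θ s t a s y → t.Above y) ∧ (∀ x, crossRel θ s t a x t → x.Above s) ∧
      ¬ crossRel θ s t a s t ∧ (Meets (crossRel θ s t a) s ∨ Meets (crossRel θ s t a) t) := by
    rw [crossRel]
    split_ifs with hu
    · exact ⟨fun y hy => absurd hy.1.symm n₁, fun x hx => hx.1 ▸ (hm.up hu).1,
        fun hh => n₁ hh.1.symm, Or.inr (meets_pairRel.2 (Or.inr rfl))⟩
    · exact ⟨fun y hy => hy.2 ▸ (hm.down hu).2, fun x hx => absurd hx.2.symm n₂,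
        fun hh => n₂ hh.2.symm, Or.inl (meets_pairRel.2 (Or.inl rfl))⟩
  refine hB.conj hval (fun y hy => ?_) (fun x hx => ?_) ?_
  · rcases hB' _ _ hy with hk | ⟨-, -, hg⟩
    · exact hK'.1 y hk
    · exact Sheet.above_of_z_lt h hθ (by
        simp only [id]; rw [hm.meet.eq₂, ← hm.meet.eq₁]; exact hz _ _ hg)
  · rcases hB' _ _ hx with hk | ⟨-, -, hg⟩
    · exact hK'.2.1 x hk
    · exact Sheet.above_of_z_lt h hθ (by
        simp only [id]; rw [hm.meet.eq₁, ← hm.meet.eq₂]; exact hz _ _ hg)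
  · by_contra h0
    rcases hB' _ _ h0 with hk | ⟨h1, h2, -⟩
    · exact hK'.2.2.1 hk
    · exact hK'.2.2.2.elim h1 h2

namespace Enumeration

variable (E : Enumeration L n e) (hn : n ≠ 0) (hO : IsOrdered L e θ) (hT : ∃ t, E.IsTriple θ t)
include hn hO hT

lemma exists_swallowAt : ∃ p q r, p < q ∧ q < r ∧
    E.lim θ q = E.lim θ p ∧ E.lim θ r = E.lim θ p ∧
    (E.sheet p).Above (E.sheet q) ∧ (E.sheet q).Above (E.sheet r) ∧
    MeetAt θ (E.sheet p) (E.sheet q) (E.sheet r) ∧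
    ((SwallowAt θ (E.sheet q) (E.sheet r) (E.sheet p) ∧ (E.sheet p).lift θ ∈ L.swallowUp ∧
      E.vertexMatrix θ = E.hatMatrix θ p q ∧
      E.matrixAS θ = (1 + E.unit r q) * E.hatMatrix θ p r * (1 + E.unit r q) ∧
      E.matrixAT θ = (1 + E.unit q r) * E.hatMatrix θ p q * (1 + E.unit q r) ∧
      E.matrixS θ = 1 + E.hatMatrix θ p q * E.unit r p + E.unit q r ∧
      E.matrixT θ = 1 + E.unit q r) ∨
    (SwallowAt θ (E.sheet p) (E.sheet q) (E.sheet r) ∧ (E.sheet r).lift θ ∉ L.swallowUp ∧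
      E.vertexMatrix θ = E.hatMatrix θ q r ∧
      E.matrixAS θ = (1 + E.unit q p) * E.hatMatrix θ p r * (1 + E.unit q p) ∧
      E.matrixAT θ = (1 + E.unit p q) * E.hatMatrix θ q r * (1 + E.unit p q) ∧
      E.matrixS θ = 1 + E.unit r p * E.hatMatrix θ q r + E.unit p q ∧
      E.matrixT θ = 1 + E.unit p q)) := by
  obtain ⟨p, q, r, ht, hV, hAS, hAT, hS, hT'⟩ := E.exists_triple_matrices hT
  have hm := IsTriple.meetAt E h hθ hn ht
  obtain ⟨h12, h23⟩ := E.exists_swallowAt_of_isTriple h hθ hn hO ht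
  have h13 := h12.trans h h23
  refine ⟨p, q, r, ht.1, ht.2.1, ht.2.2.1.symm, (ht.2.2.1.trans ht.2.2.2.1).symm, h12, h23, hm, ?_⟩
  by_cases hu : E.lim θ p ∈ L.swallowUp
  · simp only [if_pos hu] at hV hAS hAT hS hT'
    rw [E.lim_eq h hθ] at hu
    exact Or.inl ⟨⟨hm, fun _ => ⟨h12, h13⟩, fun hh => absurd hu hh⟩, hu, hV, hAS, hAT, hS, hT'⟩
  · simp only [if_neg hu] at hV hAS hAT hS hT'
    rw [E.lim_eq h hθ, ← hm.eq₂] at hu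
    exact Or.inr ⟨⟨hm.rotate.rotate, fun hh => absurd hh hu, fun _ => ⟨h13, h23⟩⟩, hu, hV, hAS, hAT,
      hS, hT'⟩

lemma isHom_matrixST {v : Cell S 0} (hx : map n e θ ∈ openCell 0 v) :
    IsHom E.sheet 0 (1 - E.matrixS θ) ∧ IsHom E.sheet 0 (1 - E.matrixT θ) := by
  have hV : IsHom E.sheet (-1) (E.vertexMatrix θ) := by
    rw [E.vertexMatrix_eq h hθ hn hO]
    exact (isHom_boundaryMatrix_cancel h hθ hn hO hx).submatrix E.sheet
  obtain ⟨p, q, r, hpq, hqr, eq, er, h12, h23, hm, ⟨hs, hu, eV, -, -, eS, eT⟩ |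
    ⟨hs, hu, eV, -, -, eS, eT⟩⟩ := E.exists_swallowAt h hθ hn hO hT <;> rw [eS, eT, sub_add_cancel_left]
  · have hU : IsHom E.sheet 0 (E.unit q r) := IsHom.single_one h23 fun μ => by
      rw [(hs.onSheet_eq h hθ hn μ).1]; simp
    refine ⟨?_, hU.neg⟩
    rw [add_assoc, sub_add_cancel_left]
    refine (IsHom.add (IsHom.mul_single (eV ▸ hV) (fun μ => ?_) fun i hi => ?_) hU).neg
    · rw [(hs.onSheet_eq h hθ hn μ).2.1 hu, (hs.onSheet_eq h hθ hn μ).1]; push_cast; ring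
    · rw [hatMatrix, Matrix.of_apply, if_neg fun hh => hqr.ne hh.2.symm] at hi
      split_ifs at hi with hc
      · exact absurd rfl hi
      · rw [er, E.lim_eq h hθ, E.lim_eq h hθ] at hi
        exact Sheet.above_of_z_lt h hθ (z_lt_of_genAt_ne_zero (((E.sheet i).x_lift h hθ).trans
          ((E.sheet p).x_lift h hθ).symm) hi)
  · have hU : IsHom E.sheet 0 (E.unit p q) := IsHom.single_one h12 fun μ => by
      rw [(hs.onSheet_eq h hθ hn μ).1]; simp
    refine ⟨?_, hU.neg⟩
    rw [add_assoc, sub_add_cancel_left]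
    refine (IsHom.add (IsHom.single_mul (eV ▸ hV) (fun μ => ?_) fun i hi => ?_) hU).neg
    · rw [(hs.onSheet_eq h hθ hn μ).2.2.1 hu]; push_cast; ring
    · rw [hatMatrix, Matrix.of_apply, if_neg fun hh => hpq.ne hh.1] at hi
      split_ifs at hi with hc
      · exact absurd rfl hi
      · rw [← er, E.lim_eq h hθ, E.lim_eq h hθ] at hi
        exact Sheet.above_of_z_lt h hθ (z_lt_of_genAt_ne_zero (((E.sheet r).x_lift h hθ).trans
          ((E.sheet i).x_lift h hθ).symm) hi)

omit h hθ hn hO hT [T2Space S] [IsManifold (𝓡 2) ∞ Λ] in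
lemma hatMatrix_swap {k i₁ i₂ : Fin E.num} (he : E.lim θ i₁ = E.lim θ i₂) (h1 : k ≠ i₁)
    (h2 : k ≠ i₂) (i j : Fin E.num) :
    E.hatMatrix θ k i₂ (Equiv.swap i₁ i₂ i) j = E.hatMatrix θ k i₁ i (Equiv.swap i₁ i₂ j) ∧
      E.hatMatrix θ i₂ k (Equiv.swap i₁ i₂ i) j = E.hatMatrix θ i₁ k i (Equiv.swap i₁ i₂ j) := by
  have hl : ∀ i, E.lim θ (Equiv.swap i₁ i₂ i) = E.lim θ i := by
    intro i
    rw [Equiv.swap_apply_def]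
    split_ifs with h1 h2
    · rw [h1, he]
    · rw [h2, he]
    · rfl
  have hk : ∀ i, Equiv.swap i₁ i₂ i = k ↔ i = k := fun i => by
    rw [← Equiv.eq_symm_apply, Equiv.symm_swap, Equiv.swap_apply_of_ne_of_ne h1 h2]
  have hk1 : ∀ i, Equiv.swap i₁ i₂ i = i₁ ↔ i = i₂ := fun i => by
    rw [← Equiv.eq_symm_apply, Equiv.symm_swap, Equiv.swap_apply_left]
  have hk2 : ∀ i, Equiv.swap i₁ i₂ i = i₂ ↔ i = i₁ := fun i => by
    rw [← Equiv.eq_symm_apply, Equiv.symm_swap, Equiv.swap_apply_right]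
  simp only [hatMatrix, Matrix.of_apply, hl, hk, hk1, hk2, and_self]

end Enumeration

end Vertices

section Ends

open LegendrianSurface PolygonalDecomposition

variable {S Λ : Type*} [TopologicalSpace S] [ChartedSpace Plane S] [IsManifold (𝓡 2) ∞ S]
  [TopologicalSpace Λ] [ChartedSpace Plane Λ] [CWComplex (univ : Set S)]
  {L : LegendrianSurface S Λ} {n : ℕ} {e : Cell S n} {θ : Fin n → ℝ}

variable (h : IsCellular L) [T2Space S] [IsManifold (𝓡 2) ∞ Λ]
include h

lemma Enumeration.map_matrixST (hθ : θ ∈ closedBall (0 : Fin n → ℝ) 1)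
    (E : Enumeration L n e) (hn : n ≠ 0) (hO : IsOrdered L e θ) (hT : ∃ t, E.IsTriple θ t)
    {v : Cell S 0} (hx : map n e θ ∈ openCell 0 v) {d : Alg L → Alg L} (hd : IsMod2Derivation d)
    (hV : (E.vertexMatrix θ).map d = E.vertexMatrix θ * E.vertexMatrix θ) :
    (E.matrixS θ).map d = E.vertexMatrix θ * E.matrixS θ + E.matrixS θ * E.matrixAS θ ∧
      (E.matrixT θ).map d = E.vertexMatrix θ * E.matrixT θ + E.matrixT θ * E.matrixAT θ := by
  have hH : IsHom E.sheet (-1) (E.vertexMatrix θ) := by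
    rw [E.vertexMatrix_eq h hθ hn hO]
    exact (isHom_boundaryMatrix_cancel h hθ hn hO hx).submatrix E.sheet
  have hD := hd.matrix (Fin E.num)
  have hUT : ∀ (i j : Fin E.num), i ≠ j → (1 + E.unit i j).map d =
      E.vertexMatrix θ * (1 + E.unit i j) + (1 + E.unit i j) *
        ((1 + E.unit i j) * E.vertexMatrix θ * (1 + E.unit i j)) := by
    intro i j hij
    have h0 : E.unit i j * E.unit i j = 0 := by simp [Enumeration.unit, hij.symm]
    have h1 : (1 + E.unit i j) * (1 + E.unit i j) = 1 := by
      rw [add_mul, mul_add, mul_add, h0, one_mul, mul_one, add_zero, add_assoc, one_mul,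
        hD.add_self, add_zero]
    rw [mul_assoc, ← mul_assoc, ← mul_assoc, h1, one_mul, hD.add_self]
    refine (hD.map_add 1 _).trans ?_
    rw [hD.map_one, zero_add]
    exact map_single_one hd _ _
  obtain ⟨p, q, r, hpq, hqr, eq, er, -, -, -, ⟨-, -, eV, eAS, eAT, eS, eT⟩ |
    ⟨-, -, eV, eAS, eAT, eS, eT⟩⟩ := E.exists_swallowAt h hθ hn hO hT <;>
    rw [eS, eT, eAS, eAT, ← eV] <;> have hpr := hpq.trans hqr
  · refine ⟨map_swallow_up hd hpr.ne hqr.ne hV (fun j => ?_) (fun j => ?_) fun i j => ?_,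
      hUT _ _ hqr.ne⟩
    · rw [eV, Enumeration.hatMatrix, Matrix.of_apply, if_neg fun hh => hpq.ne hh.1.symm,
        if_pos (Or.inr (Or.inl rfl))]
    · rw [Enumeration.hatMatrix, Matrix.of_apply]
      by_cases hj : j = r
      · rw [if_pos ⟨rfl, hj⟩, if_pos hj]
      · rw [if_neg fun hh => hj hh.2, if_neg hj, if_pos (Or.inl rfl)]
    · rw [eV, (E.hatMatrix_swap (eq.trans er.symm) hpq.ne hpr.ne i j).1]
  · refine ⟨map_swallow_down hd hpq.ne hpr.ne hV (fun i => ?_) (fun i => ?_) (fun i j => ?_) ?_ ?_,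
      hUT _ _ hpq.ne⟩
    · rw [eV, Enumeration.hatMatrix, Matrix.of_apply, if_neg fun hh => hqr.ne hh.2,
        if_pos (Or.inr (Or.inr (Or.inl rfl)))]
    · rw [eV, Enumeration.hatMatrix, Matrix.of_apply]
      by_cases hj : i = q
      · rw [if_pos ⟨hj, rfl⟩, if_pos hj]
      · rw [if_neg fun hh => hj hh.1, if_neg hj, if_pos (Or.inr (Or.inr (Or.inr rfl)))]
    · rw [eV, Equiv.swap_comm, (E.hatMatrix_swap eq hqr.ne' hpr.ne' i j).2]
    · by_contra h0
      exact ((hH _ _).1 h0).ne h rfl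
    · rw [Matrix.mul_apply]
      refine Finset.sum_eq_zero fun j _ => ?_
      by_contra h0
      exact ((hH _ _).1 (left_ne_zero_of_mul h0)).asymm h ((hH _ _).1 (right_ne_zero_of_mul h0))

/-- The sheets that meet at the end of a crossing arc at a swallowtail point. -/
lemma CrossAt.exists_swallowAt {β : Cell S 1} {ε : Bool} {s t : Sheet L 1 β}
    (hc : CrossAt L β ε s t) : ∃ a, SwallowAt (endPoint ε) s t a := by
  obtain ⟨hst, -, -, he, hp⟩ := (crossAt_iff h).1 hc
  obtain ⟨a, ha, has, hat, hall, hup, hdn⟩ := hc.exists_third h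
  exact ⟨a, ⟨ha ▸ hp, ha.symm, he.symm.trans ha.symm, has, hat, hst, fun r hr => hall r (hr.trans ha)⟩,
    fun hu => hup (ha ▸ hu), fun hu => hdn (ha ▸ hu)⟩

variable [∀ (n : ℕ) (e : Cell S n), Fintype (Sheet L n e)] (D : Decoration L) {β : Cell S 1}
  (ε : Bool)

omit h [T2Space S] [IsManifold (𝓡 2) ∞ Λ] in
/-- The matrix of an end of a 1-cell is that of an undecorated vertex, or it is a decorated matrix on
the crossing arc that ends at a swallowtail point. -/
def IsEndMatrix (β : Cell S 1) (ε : Bool) (M : Matrix (Sheet L 1 β) (Sheet L 1 β) (Alg L)) : Prop :=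
  (¬ IsCrossingEnd L β ε ∧ M = boundaryMatrix (endPoint ε) (Cancel (endPoint ε))) ∨
  ∃ (hc : IsCrossingEnd L β ε) (t a : Sheet L 1 β), CrossAt L β ε (D β ε hc).1 t ∧
    SwallowAt (endPoint ε) (D β ε hc).1 t a ∧ M = crossMatrix (endPoint ε) (D β ε hc).1 t a

lemma exists_isEndMatrix (β : Cell S 1) : ∃ M, IsEndMatrix D β ε M := by
  by_cases hc : IsCrossingEnd L β ε
  · obtain ⟨t, ht⟩ := (D β ε hc).2
    obtain ⟨a, ha⟩ := ht.exists_swallowAt h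
    exact ⟨_, Or.inr ⟨hc, t, a, ht, ha, rfl⟩⟩
  · exact ⟨_, Or.inl ⟨hc, rfl⟩⟩

variable {D ε} {M : Matrix (Sheet L 1 β) (Sheet L 1 β) (Alg L)} (hM : IsEndMatrix D β ε M)
include hM

lemma IsEndMatrix.endMatrix_eq (E : Enumeration L 1 β) :
    endMatrix D E ε = M.submatrix E.sheet E.sheet := by
  rcases hM with ⟨hc, rfl⟩ | ⟨hc, t, a, ht, ha, rfl⟩
  · rw [endMatrix, dif_neg hc, E.vertexMatrix_eq h (endPoint_mem ε) one_ne_zero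
      (isOrdered_of_not_crossing h hc)]
  · rw [endMatrix, dif_pos hc]
    have hu : ∀ t', CrossAt L β ε (D β ε hc).1 t' → t' = t := by
      intro t' ht'
      obtain ⟨hne, h1, h2, he, hp⟩ := (crossAt_iff h).1 ht'
      rcases ha.meet.all t' (he.symm.trans ha.meet.eq₁) with rfl | rfl | rfl
      · by_cases hu : t'.lift (endPoint ε) ∈ L.swallowUp
        · exact absurd (ha.up hu).1 h2
        · exact absurd (ha.down hu).1 h1
      · exact absurd rfl hne
      · rfl
    split_ifs with hlt
    · obtain ⟨t', ht', hlt⟩ := hlt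
      rw [hu t' ht'] at hlt
      exact E.matrixAS_eq h (endPoint_mem ε) one_ne_zero ha hlt
    · push Not at hlt
      exact E.matrixAT_eq h (endPoint_mem ε) one_ne_zero ha (lt_of_le_of_ne (hlt t ht)
        fun hh => ht.1 (E.sheet.symm.injective hh).symm)

variable {v : Cell S 0} (hx : map 1 β (endPoint ε) ∈ openCell 0 v)
include hx

lemma IsEndMatrix.isHom : IsHom id (-1) M := by
  rcases hM with ⟨hc, rfl⟩ | ⟨hc, t, a, ht, ha, rfl⟩
  · exact isHom_boundaryMatrix_cancel h (endPoint_mem ε) one_ne_zero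
      (isOrdered_of_not_crossing h hc) hx
  · exact ha.isHom_crossMatrix h (endPoint_mem ε) one_ne_zero hx

lemma IsEndMatrix.map_eq {d : Alg L → Alg L} (hd : IsMod2Derivation d)
    (hA : (sheetMatrix L v).map d = sheetMatrix L v * sheetMatrix L v) : M.map d = M * M := by
  rcases hM with ⟨hc, rfl⟩ | ⟨hc, t, a, ht, ha, rfl⟩
  · exact map_boundaryMatrix h hd (endPoint_mem ε) hx (isMatching_cancel h (endPoint_mem ε)
      one_ne_zero (isOrdered_of_not_crossing h hc) hx) hA
  · exact ha.map_crossMatrix h (endPoint_mem ε) hd hx hA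

end Ends

section Sides

open LegendrianSurface PolygonalDecomposition

variable {S Λ : Type*} [TopologicalSpace S] [ChartedSpace Plane S] [IsManifold (𝓡 2) ∞ S]
  [TopologicalSpace Λ] [ChartedSpace Plane Λ] [CWComplex (univ : Set S)]
  {L : LegendrianSurface S Λ} {P : PolygonalDecomposition S} {α : Cell S 2} {k : ℤ} {b : Bool}

/-- The sheets `s` and `t` meet at a cusp edge above the side `k`. -/
def cuspRel (P : PolygonalDecomposition S) (k : ℤ) (s t : Sheet L 2 α) : Prop :=
  CuspAlong P k s ∧ t.lift (P.sidePoint α k) = s.lift (P.sidePoint α k) ∧ s.Above t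

/-- The incidence matrix of the sheets above a 2-cell and above its side `k`. -/
abbrev sideIncidence (L : LegendrianSurface S Λ) (P : PolygonalDecomposition S) (α : Cell S 2)
    (k : ℤ) :
    Matrix (Sheet L 2 α) (Sheet L 1 (P.side α k)) (Alg L) :=
  incidence (P.sidePoint α k) (fun _ _ => False) (P.side α k)

/-- The matrix above a 2-cell that is given by a matrix above a side. -/
def sideMatrix [∀ (n : ℕ) (e : Cell S n), Fintype (Sheet L n e)] (P : PolygonalDecomposition S)
    (k : ℤ) (M : Matrix (Sheet L 1 (P.side α k)) (Sheet L 1 (P.side α k)) (Alg L)) :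
    Matrix (Sheet L 2 α) (Sheet L 2 α) (Alg L) :=
  sideIncidence L P α k * M * (sideIncidence L P α k).transpose + linkMatrix (Alg L) (cuspRel P k)

/-- The matrix of the vertex of `Q` at the corner of side `k` that is an end of this side. -/
def sideVertex (P : PolygonalDecomposition S) (D : Decoration L) (E : Enumeration L 2 α) (k : ℤ)
    (b : Bool) : Matrix (Fin E.num) (Fin E.num) (Alg L) :=
  if IsCrossingEnd L (P.side α k) (P.sideEnd α k b) then decoratedMatrix P D E (sideCorner k b)
  else E.vertexMatrix (P.cornerPoint α (sideCorner k b))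

variable (h : IsCellular L) [T2Space S] [IsManifold (𝓡 2) ∞ Λ]
include h

lemma cornerLabeledS_iff (D : Decoration L)
    (hc : IsCrossingEnd L (P.side α k) (P.sideEnd α k b)) :
    CornerLabeledS P D α (sideCorner k b) ↔ SideLabeledS P D α k (P.sideEnd α k b) := by
  cases b
  · refine ⟨fun hh => hh.resolve_left fun hh => ?_, Or.inr⟩
    exact not_crossing_in_out h P α k hh.1 hc
  · have e : k + 1 - 1 = k := add_sub_cancel_right k 1
    have hi : CrossingIn L P α (k + 1) := by rw [CrossingIn, e]; exact hc
    show CornerLabeledS P D α (k + 1) ↔ _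
    rw [CornerLabeledS, e]
    refine ⟨fun hh => hh.resolve_right fun hh => ?_, Or.inl⟩
    exact not_crossing_in_out h P α (k + 1) hi hh.1

variable [∀ (n : ℕ) (e : Cell S n), Fintype (Sheet L n e)]

omit [IsManifold (𝓡 2) ∞ Λ] in
lemma sideIncidence_mul_single {A B : Sheet L 1 (P.side α k)} {X Y : Sheet L 2 α}
    (hX : Over P X A) (hY : Over P Y B) : sideIncidence L P α k * Matrix.single A B (1 : Alg L) =
      Matrix.single X Y (1 : Alg L) * sideIncidence L P α k ∧
      (sideIncidence L P α k).transpose * Matrix.single Y X (1 : Alg L) =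
      Matrix.single B A (1 : Alg L) * (sideIncidence L P α k).transpose := by
  have h1 : ∀ s : Sheet L 2 α,
      (s.lift (P.sidePoint α k) ∈ A.1 ∧ ¬ Meets (fun _ _ => False) s) ↔ s = X := fun s =>
    ⟨fun hh => Over.eq h (T := A) hh.1 hX, fun hh => hh ▸ ⟨hX, not_meets_bot X⟩⟩
  have h2 : ∀ T, (Y.lift (P.sidePoint α k) ∈ T.1 ∧ ¬ Meets (fun _ _ => False) Y) ↔ T = B := fun T =>
    ⟨fun hh => Over.unique h (T := T) hh.1 hY, fun hh => hh ▸ ⟨hY, not_meets_bot Y⟩⟩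
  constructor <;> ext s T <;> rw [mul_single_one_apply, single_one_mul_apply] <;>
    simp only [sideIncidence, incidence, Matrix.transpose_apply, Matrix.of_apply, h1, h2] <;>
    split_ifs <;> rfl

omit [IsManifold (𝓡 2) ∞ Λ] in
lemma boundaryMatrix_corner {K : Sheet L 2 α → Sheet L 2 α → Prop}
    {K' : Sheet L 1 (P.side α k) → Sheet L 1 (P.side α k) → Prop}
    (H₁ : ∀ s t A B, Over P s A → Over P t B → (K s t ↔ K' A B))
    (H₂ : ∀ s A, Over P s A → (Meets K s ↔ Meets K' A))
    (H₃ : ∀ s, CuspAlong P k s → Meets K s)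
    (H₄ : ∀ s t, CuspAlong P k s ∨ CuspAlong P k t → (K s t ↔ cuspRel P k s t)) :
    boundaryMatrix (P.cornerPoint α (sideCorner k b)) K =
      sideMatrix P k (boundaryMatrix (endPoint (P.sideEnd α k b)) K') := by
  ext s t
  rw [sideMatrix, Matrix.add_apply, linkMatrix, Matrix.of_apply, boundaryMatrix, Matrix.of_apply]
  have hn : CuspAlong P k s ∨ CuspAlong P k t →
      (sideIncidence L P α k * boundaryMatrix (endPoint (P.sideEnd α k b)) K' *
        (sideIncidence L P α k).transpose) s t = 0 := by
    rintro (hc | hc)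
    · rw [Matrix.mul_assoc]
      exact incidence_mul_eq_zero _ (fun T hT => absurd hc (Over.not_cuspAlong h (T := T) hT)) t
    · exact mul_incidence_eq_zero _ (fun T hT => absurd hc (Over.not_cuspAlong h (T := T) hT)) s
  have hcusp : CuspAlong P k s ∨ CuspAlong P k t →
      (if K s t then (1 : Alg L) else if Meets K s ∨ Meets K t then 0 else
        genAt L (s.lift (P.cornerPoint α (sideCorner k b)))
          (t.lift (P.cornerPoint α (sideCorner k b)))) =
      (sideIncidence L P α k * boundaryMatrix (endPoint (P.sideEnd α k b)) K' *
        (sideIncidence L P α k).transpose) s t + if cuspRel P k s t then 1 else 0 := by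
    intro hc
    rw [hn hc, zero_add, if_congr (H₄ s t hc) rfl (if_pos (hc.imp (H₃ s) (H₃ t)))]
  rcases exists_over_or_cuspAlong h P k s with ⟨A, hA⟩ | hs
  · rcases exists_over_or_cuspAlong h P k t with ⟨B, hB⟩ | ht
    · rw [mul_incidence h _ hB (not_meets_bot t), incidence_mul h _ hA (not_meets_bot s),
        if_neg (fun hh : cuspRel P k s t => hA.not_cuspAlong h hh.1), add_zero, boundaryMatrix,
        Matrix.of_apply, hA.lift_corner h b, hB.lift_corner h b]
      simp only [H₁ s t A B hA hB, H₂ s A hA, H₂ t B hB]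
    · exact hcusp (Or.inr ht)
  · exact hcusp (Or.inl hs)

lemma boundaryMatrix_cancel_corner (hc : ¬ IsCrossingEnd L (P.side α k) (P.sideEnd α k b)) :
    boundaryMatrix (P.cornerPoint α (sideCorner k b)) (Cancel (L := L) (e := α)
      (P.cornerPoint α (sideCorner k b))) = sideMatrix P k (boundaryMatrix
        (endPoint (P.sideEnd α k b)) (Cancel (endPoint (P.sideEnd α k b)))) := by
  have hO := isOrdered_of_not_crossing h hc
  refine boundaryMatrix_corner h (fun s t A B hs ht => cancel_iff_of_over h hO hs ht)
    (fun s A hs => cancelled_iff_of_over h hO hs) (fun s hs => hs.cancelled h b) fun s t hst => ?_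
  rcases hst with hs | ht
  · rw [(cancel_iff_of_cuspAlong h hs b t).1]
    exact ⟨fun hh => ⟨hs, hh⟩, fun hh => hh.2⟩
  · rw [(cancel_iff_of_cuspAlong h ht b s).2]
    exact ⟨fun hh => ⟨by rw [CuspAlong, hh.1]; exact ht, hh.1.symm, hh.2⟩,
      fun hh => ⟨hh.2.1.symm, hh.2.2⟩⟩

lemma IsEndMatrix.sideVertex_eq {D : Decoration L}
    {M : Matrix (Sheet L 1 (P.side α k)) (Sheet L 1 (P.side α k)) (Alg L)}
    (hM : IsEndMatrix D (P.side α k) (P.sideEnd α k b) M) (E : Enumeration L 2 α) :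
    ∃ V, sideVertex P D E k b = V.submatrix E.sheet E.sheet ∧ V = sideMatrix P k M ∧
      ∀ v : Cell S 0, map 2 α (P.cornerPoint α (sideCorner k b)) ∈ openCell 0 v →
        IsHom id (-1) V ∧ ∀ d : Alg L → Alg L, IsMod2Derivation d →
          (sheetMatrix L v).map d = sheetMatrix L v * sheetMatrix L v → V.map d = V * V := by
  have hθ : P.cornerPoint α (sideCorner k b) ∈ closedBall (0 : Fin 2 → ℝ) 1 := P.cornerPoint_mem _
  have hO := isOrdered_two h α (P.cornerPoint α (sideCorner k b))
  rcases hM with ⟨hc, rfl⟩ | ⟨hc, B, C, ht, ha, rfl⟩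
  · refine ⟨_, ?_, boundaryMatrix_cancel_corner h hc, fun v hx =>
      ⟨isHom_boundaryMatrix_cancel h hθ two_ne_zero hO hx, fun d hd hA =>
        map_boundaryMatrix h hd hθ hx (isMatching_cancel h hθ two_ne_zero hO hx) hA⟩⟩
    rw [sideVertex, if_neg hc, E.vertexMatrix_eq h hθ two_ne_zero hO]
  · set A := (D (P.side α k) (P.sideEnd α k b) hc).1 with hAdef
    obtain ⟨X, hX, -⟩ := existsUnique_over h A
    obtain ⟨Y, hY, -⟩ := existsUnique_over h B
    obtain ⟨Z, hZ, -⟩ := existsUnique_over h C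
    have lX := hX.lift_corner h b
    have lY := hY.lift_corner h b
    have lZ := hZ.lift_corner h b
    have hne : ∀ {s t : Sheet L 2 α} {A B : Sheet L 1 (P.side α k)}, Over P s A → Over P t B →
        (s = t ↔ A = B) := fun hs ht =>
      ⟨fun hh => Over.unique h hs (hh ▸ ht), fun hh => Over.eq h hs (hh ▸ ht)⟩
    have hS : SwallowAt (P.cornerPoint α (sideCorner k b)) X Y Z := by
      refine ⟨⟨lZ ▸ ha.meet.swallow, by rw [lX, lZ, ha.meet.eq₁], by rw [lY, lZ, ha.meet.eq₂],
        mt (hne hZ hX).1 ha.meet.ne₁, mt (hne hZ hY).1 ha.meet.ne₂, mt (hne hX hY).1 ha.meet.ne₃,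
        fun s hs => ?_⟩, fun hu => ?_, fun hu => ?_⟩
      · obtain ⟨T, hT⟩ := exists_over_of_crossing h hc s
        rw [hT.lift_corner h b, lZ] at hs
        rw [hne hT hZ, hne hT hX, hne hT hY]
        exact ha.meet.all T hs
      · rw [lZ] at hu
        exact ⟨hZ.above h hX (ha.up hu).1, hZ.above h hY (ha.up hu).2⟩
      · rw [lZ] at hu
        exact ⟨hX.above h hZ (ha.down hu).1, hY.above h hZ (ha.down hu).2⟩
    have hlab : SideLabeledS P D α k (P.sideEnd α k b) ↔ X.Above Y := by
      constructor
      · rintro ⟨hc', B', hB', X', Y', hXY, hX', hY'⟩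
        rw [Sheet.limit_eq h _ P.sidePoint_mem] at hX' hY'
        obtain rfl : X' = X := Over.eq h (T := A) hX' hX
        rcases ha.meet.all B' ((((crossAt_iff h).1 hB').2.2.2.1).symm.trans ha.meet.eq₁) with
          rfl | rfl | rfl
        · exfalso
          obtain ⟨-, h1, h2, -⟩ := hB'
          by_cases hu : B'.lift (endPoint (P.sideEnd α k b)) ∈ L.swallowUp
          · exact h2 (ha.up hu).1
          · exact h1 (ha.down hu).1
        · exact absurd rfl hB'.1
        · obtain rfl : Y' = Y := Over.eq h (T := B') hY' hY
          exact hXY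
      · refine fun hXY => ⟨hc, B, ht, X, Y, hXY, ?_, ?_⟩ <;>
          rw [Sheet.limit_eq h _ P.sidePoint_mem]
        exacts [hX, hY]
    have hN : linkMatrix (Alg L) (cuspRel (L := L) (α := α) P k) = 0 := by
      ext s t
      exact if_neg fun hh => not_cuspAlong_of_crossing h hc s hh.1
    have hB : boundaryMatrix (P.cornerPoint α (sideCorner k b))
        (crossRel (P.cornerPoint α (sideCorner k b)) X Y Z) =
        sideMatrix P k (boundaryMatrix (endPoint (P.sideEnd α k b))
          (crossRel (endPoint (P.sideEnd α k b)) A B C)) := by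
      refine boundaryMatrix_corner h (fun s t T T' hs ht => ?_) (fun s T hs => ?_)
        (fun s hs => absurd hs (not_cuspAlong_of_crossing h hc s))
        (fun s t hst => (hst.elim (not_cuspAlong_of_crossing h hc s)
          (not_cuspAlong_of_crossing h hc t)).elim) <;>
      rw [crossRel, crossRel, lZ] <;> split_ifs
      · exact and_congr (hne hs hZ) (hne ht hY)
      · exact and_congr (hne hs hX) (hne ht hZ)
      · rw [meets_pairRel, meets_pairRel, hne hs hZ, hne hs hY]
      · rw [meets_pairRel, meets_pairRel, hne hs hX, hne hs hZ]
    refine ⟨_, ?_, ?_, fun v hx => ⟨hS.isHom_crossMatrix h hθ two_ne_zero hx, fun d hd hA =>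
      hS.map_crossMatrix h hθ hd hx hA⟩⟩
    · rw [sideVertex, if_pos hc, decoratedMatrix, cornerLabeledS_iff h D hc, hlab]
      split_ifs with hXY
      · exact E.matrixAS_eq h hθ two_ne_zero hS (E.lt_of_above _ _ (by simpa using hXY))
      · exact E.matrixAT_eq h hθ two_ne_zero hS (E.lt_of_above _ _ (by
          simpa using (Sheet.above_or_above h hS.meet.ne₃).resolve_left hXY))
    · have e1 := (sideIncidence_mul_single h hY hX).1
      have e2 := (sideIncidence_mul_single h hX hY).2
      rw [crossMatrix, hB, crossMatrix, sideMatrix, sideMatrix, hN, add_zero, add_zero]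
      have e3 : (1 + Matrix.single Y X (1 : Alg L)) * sideIncidence L P α k =
          sideIncidence L P α k * (1 + Matrix.single B A (1 : Alg L)) := by
        rw [Matrix.add_mul, Matrix.mul_add, e1, Matrix.one_mul, Matrix.mul_one]
      have e4 : (sideIncidence L P α k).transpose * (1 + Matrix.single Y X (1 : Alg L)) =
          (1 + Matrix.single B A (1 : Alg L)) * (sideIncidence L P α k).transpose := by
        rw [Matrix.add_mul, Matrix.mul_add, e2, Matrix.one_mul, Matrix.mul_one]
      rw [← Matrix.mul_assoc, ← Matrix.mul_assoc, e3, Matrix.mul_assoc _ _ (1 + _), e4]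
      simp only [Matrix.mul_assoc]

end Sides

section Edges

open LegendrianSurface PolygonalDecomposition

variable {S Λ : Type*} [TopologicalSpace S] [ChartedSpace Plane S] [IsManifold (𝓡 2) ∞ S]
  [TopologicalSpace Λ] [ChartedSpace Plane Λ] [CWComplex (univ : Set S)]
  {L : LegendrianSurface S Λ} {P : PolygonalDecomposition S} {α : Cell S 2} {k : ℤ} {b : Bool}

/-- `d` is a derivation that satisfies the defining equations for the cells of dimension at most
`1`. -/
structure SolvesBoundary [∀ (n : ℕ) (e : Cell S n), Fintype (Sheet L n e)] (D : Decoration L)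
    (d : Alg L → Alg L) : Prop where
  der : IsMod2Derivation d
  zero : ∀ v : Cell S 0, (sheetMatrix L v).map d = sheetMatrix L v * sheetMatrix L v
  one : ∀ (β : Cell S 1) M M', IsEndMatrix D β true M → IsEndMatrix D β false M' →
    (sheetMatrix L β).map d = M * (1 + sheetMatrix L β) + (1 + sheetMatrix L β) * M'

/-- The matrix of the vertex of `Q` at which an edge ends, counter-clockwise. -/
def QEdge.finishMatrix (P : PolygonalDecomposition S) (D : Decoration L) (E : Enumeration L 2 α) :
    QEdge → Matrix (Fin E.num) (Fin E.num) (Alg L)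
  | .side k => if CrossingIn L P α (k + 1) then decoratedMatrix P D E (k + 1)
    else E.vertexMatrix (P.cornerPoint α (k + 1))
  | .corner k => if CrossingOut L P α k then decoratedMatrix P D E k
    else E.vertexMatrix (P.cornerPoint α k)

variable (L) in
/-- The additional edges are at the corners where a crossing arc ends. -/
def QEdge.IsEdge (P : PolygonalDecomposition S) (α : Cell S 2) : QEdge → Prop
  | .side _ => True
  | .corner k => CrossingIn L P α k ∨ CrossingOut L P α k

variable {D : Decoration L} (h : IsCellular L) [T2Space S] [IsManifold (𝓡 2) ∞ Λ]
  [∀ (n : ℕ) (e : Cell S n), Fintype (Sheet L n e)] (E : Enumeration L 2 α)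
include h

omit [IsManifold (𝓡 2) ∞ Λ] in
lemma map_sideMatrix {d : Alg L → Alg L} (hd : IsMod2Derivation d)
    {M M' B : Matrix (Sheet L 1 (P.side α k)) (Sheet L 1 (P.side α k)) (Alg L)}
    (hB : B.map d = M * (1 + B) + (1 + B) * M') :
    (1 + sideIncidence L P α k * B * (sideIncidence L P α k).transpose).map d =
      sideMatrix P k M * (1 + sideIncidence L P α k * B * (sideIncidence L P α k).transpose) +
        (1 + sideIncidence L P α k * B * (sideIncidence L P α k).transpose) * sideMatrix P k M' := by
  have h1 : (sideIncidence L P α k).transpose * sideIncidence L P α k = 1 :=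
    incidence_transpose_mul_incidence h (isMatching_side h P α k)
  have h2 : linkMatrix (Alg L) (cuspRel (L := L) (α := α) P k) * sideIncidence L P α k = 0 := by
    ext s T
    rw [Matrix.mul_apply]
    refine Finset.sum_eq_zero fun r _ => ?_
    by_cases hr : cuspRel P k s r
    · have : ¬ Over P r T := fun ho => ho.not_cuspAlong h (by
        rw [CuspAlong, hr.2.1]; exact hr.1)
      simp only [sideIncidence, incidence, Matrix.of_apply]
      rw [if_neg fun hh => this hh.1, mul_zero]
    · rw [linkMatrix, Matrix.of_apply, if_neg hr, zero_mul]
  have h3 : (sideIncidence L P α k).transpose * linkMatrix (Alg L) (cuspRel (L := L) (α := α) P k) = 0 := by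
    ext T s
    rw [Matrix.mul_apply]
    refine Finset.sum_eq_zero fun r _ => ?_
    by_cases hr : cuspRel P k r s
    · have : ¬ Over P r T := fun ho => ho.not_cuspAlong h hr.1
      simp only [sideIncidence, incidence, Matrix.transpose_apply, Matrix.of_apply]
      rw [if_neg fun hh => this hh.1, zero_mul]
    · rw [linkMatrix, Matrix.of_apply, if_neg hr, mul_zero]
  have hD := hd.matrix (Sheet L 2 α)
  refine (hD.map_add _ _).trans ?_
  rw [hD.map_one, zero_add]
  have h4 : (sideIncidence L P α k * B * (sideIncidence L P α k).transpose).map d =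
      sideIncidence L P α k * B.map d * (sideIncidence L P α k).transpose := map_incidence_conj hd B
  refine h4.trans ?_
  rw [hB, sideMatrix, sideMatrix]
  generalize linkMatrix (Alg L) (cuspRel (L := L) (α := α) P k) = N at *
  clear h4
  generalize sideIncidence L P α k = Q at *
  have h1' : ∀ Z : Matrix (Sheet L 1 (P.side α k)) (Sheet L 2 α) (Alg L), Q.transpose * (Q * Z) = Z :=
    fun Z => by rw [← Matrix.mul_assoc, h1, Matrix.one_mul]
  have h2' : ∀ Z : Matrix (Sheet L 1 (P.side α k)) (Sheet L 2 α) (Alg L), N * (Q * Z) = 0 :=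
    fun Z => by rw [← Matrix.mul_assoc, h2, Matrix.zero_mul]
  simp only [Matrix.add_mul, Matrix.mul_add, Matrix.mul_assoc, Matrix.one_mul, Matrix.mul_one, h1',
    h2', h3, Matrix.mul_zero, add_zero]
  have hN : N + N = 0 := hD.add_self N
  rw [← add_zero (_ + _ + _), ← hN]
  abel

omit [∀ (n : ℕ) (e : Cell S n), Fintype (Sheet L n e)] in
lemma isTriple_of_crossing (hc : IsCrossingEnd L (P.side α k) (P.sideEnd α k b)) :
    ∃ t, E.IsTriple (P.cornerPoint α (sideCorner k b)) t := by
  obtain ⟨p, hp, s, t, r, hst, hsr, htr, hs, ht, hr, -⟩ := exists_crossing_sheets h hc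
  have hθ : P.cornerPoint α (sideCorner k b) ∈ closedBall (0 : Fin 2 → ℝ) 1 := P.cornerPoint_mem _
  subst hs
  exact E.exists_isTriple h hθ ⟨hp, ht, hr, hst, hsr, htr, fun _ h' =>
    eq_or_of_three h hθ two_ne_zero hp hst hsr htr ht hr h'⟩

/-- The matrix of a vertex of `Q` is homogeneous and satisfies the equation of a 0-cell. -/
def IsVertexMatrix (D : Decoration L) (E : Enumeration L 2 α)
    (V : Matrix (Fin E.num) (Fin E.num) (Alg L)) : Prop :=
  IsHom E.sheet (-1) V ∧ ∀ d : Alg L → Alg L, SolvesBoundary D d → V.map d = V * V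

lemma isVertexMatrix_vertexMatrix (k : ℤ) :
    IsVertexMatrix D E (E.vertexMatrix (P.cornerPoint α k)) := by
  have hθ : P.cornerPoint α k ∈ closedBall (0 : Fin 2 → ℝ) 1 := P.cornerPoint_mem _
  have hO := isOrdered_two h α (P.cornerPoint α k)
  obtain ⟨v, hx⟩ := P.angle_mem α k
  rw [E.vertexMatrix_eq h hθ two_ne_zero hO]
  refine ⟨(isHom_boundaryMatrix_cancel h hθ two_ne_zero hO hx).submatrix _, fun d hd => ?_⟩
  rw [Matrix.submatrix_mul_equiv, ← map_boundaryMatrix h hd.der hθ hx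
    (isMatching_cancel h hθ two_ne_zero hO hx) (hd.zero v)]
  rfl

lemma isVertexMatrix_sideVertex (k : ℤ) (b : Bool) : IsVertexMatrix D E (sideVertex P D E k b) := by
  obtain ⟨M, hM⟩ := exists_isEndMatrix h D (P.sideEnd α k b) (P.side α k)
  obtain ⟨V, hV, -, hh⟩ := hM.sideVertex_eq h E
  obtain ⟨v, hx⟩ := P.angle_mem α (sideCorner k b)
  rw [hV]
  refine ⟨(hh v hx).1.submatrix _, fun d hd => ?_⟩
  rw [Matrix.submatrix_mul_equiv, ← (hh v hx).2 d hd.der (hd.zero v)]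
  rfl

lemma QEdge.isVertexMatrix (q : QEdge) : IsVertexMatrix D E (q.startMatrix P D E) := by
  cases q with
  | side k => exact isVertexMatrix_sideVertex h E k false
  | corner k =>
    rw [QEdge.startMatrix]
    split_ifs with hi
    · have := isVertexMatrix_sideVertex (P := P) (D := D) h E (k - 1) true
      have hi' : IsCrossingEnd L (P.side α (k - 1)) (P.sideEnd α (k - 1) true) := hi
      rw [sideVertex, if_pos hi', sideCorner, if_pos rfl, sub_add_cancel] at this
      exact this
    · exact isVertexMatrix_vertexMatrix h E k

omit [∀ (n : ℕ) (e : Cell S n), Fintype (Sheet L n e)] in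
lemma QEdge.isTriple {k : ℤ} (hk : CrossingIn L P α k ∨ CrossingOut L P α k) :
    ∃ t, E.IsTriple (P.cornerPoint α k) t := by
  rcases hk with hi | ho
  · have := isTriple_of_crossing (k := k - 1) (b := true) h E hi
    rwa [sideCorner, if_pos rfl, sub_add_cancel] at this
  · exact isTriple_of_crossing (b := false) h E ho

omit [∀ (n : ℕ) (e : Cell S n), Fintype (Sheet L n e)] in
lemma QEdge.isHom_matrix {q : QEdge} (hq : q.IsEdge L P α) :
    IsHom E.sheet 0 (1 - q.matrix P D E) := by
  cases q with
  | side k =>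
    have hx : map 2 α (P.sidePoint α k) ∈ openCell 1 (P.side α k) :=
      P.map_mem_side P.mid_mem
    rw [QEdge.matrix, sub_add_cancel_left, E.edgeMatrix_eq h P.sidePoint_mem]
    refine (IsHom.submatrix (f := id) (fun s t => ⟨support_boundaryMatrix h P.sidePoint_mem
      fun _ _ hh => hh.elim, fun μ => ?_⟩) E.sheet).neg
    simpa using boundaryMatrix_mem_gradedPiece h P.sidePoint_mem μ hx (fun _ _ hh => hh.elim)
      (fun s T hT _ => Over.onSheet_eq (P := P) h μ hT) s t
  | corner k =>
    obtain ⟨v, hx⟩ := P.angle_mem α k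
    have := E.isHom_matrixST h (P.cornerPoint_mem k) two_ne_zero (isOrdered_two h α _)
      (QEdge.isTriple h E hq) hx
    rw [QEdge.matrix]
    split_ifs
    exacts [this.1, this.2]

lemma QEdge.map_matrix {d : Alg L → Alg L} (hd : SolvesBoundary D d) {q : QEdge}
    (hq : q.IsEdge L P α) : (q.matrix P D E).map d =
      if q.IsCcw L P α then q.finishMatrix P D E * q.matrix P D E + q.matrix P D E * q.startMatrix P D E
      else q.startMatrix P D E * q.matrix P D E + q.matrix P D E * q.finishMatrix P D E := by
  cases q with
  | side k =>
    have hY : QEdge.matrix P D E (.side k) = (1 + sideIncidence L P α k * sheetMatrix L (P.side α k) *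
        (sideIncidence L P α k).transpose).submatrix E.sheet E.sheet := by
      have hx : map 2 α (P.sidePoint α k) ∈ openCell 1 (P.side α k) := P.map_mem_side P.mid_mem
      have h0 : linkMatrix (Alg L) (fun _ _ : Sheet L 2 α => False) = 0 := by
        ext s t; exact if_neg not_false
      rw [QEdge.matrix, E.edgeMatrix_eq h P.sidePoint_mem, boundaryMatrix_eq h P.sidePoint_mem hx, h0,
        add_zero, Matrix.submatrix_add]
      congr 1
      exact (Matrix.submatrix_one_equiv E.sheet).symm
    have hF : QEdge.finishMatrix P D E (.side k) = sideVertex P D E k true := by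
      rw [QEdge.finishMatrix, CrossingIn, add_sub_cancel_right]
      rfl
    have hS : QEdge.startMatrix P D E (.side k) = sideVertex P D E k false := rfl
    have key : ∀ b b', P.sideEnd α k b = true → P.sideEnd α k b' = false →
        (QEdge.matrix P D E (.side k)).map d = sideVertex P D E k b * QEdge.matrix P D E (.side k) +
          QEdge.matrix P D E (.side k) * sideVertex P D E k b' := by
      intro b b' hb hb'
      obtain ⟨M, hM⟩ := exists_isEndMatrix h D (P.sideEnd α k b) (P.side α k)
      obtain ⟨M', hM'⟩ := exists_isEndMatrix h D (P.sideEnd α k b') (P.side α k)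
      obtain ⟨V, hV, hV', -⟩ := hM.sideVertex_eq h E
      obtain ⟨V', hW, hW', -⟩ := hM'.sideVertex_eq h E
      rw [hb] at hM
      rw [hb'] at hM'
      rw [hV, hW, hV', hW', hY, Matrix.submatrix_mul_equiv, Matrix.submatrix_mul_equiv]
      exact congrArg (fun Z => Z.submatrix E.sheet E.sheet)
        (map_sideMatrix h hd.der (hd.one _ M M' hM hM'))
    rw [hF, hS]
    split_ifs with hp <;> rw [QEdge.IsCcw] at hp
    · exact key true false (if_pos hp) (if_pos hp)
    · exact key false true (if_neg hp) (if_neg hp)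
  | corner k =>
    obtain ⟨v, hx⟩ := P.angle_mem α k
    have hST := E.map_matrixST h (P.cornerPoint_mem k) two_ne_zero (isOrdered_two h α _)
      (QEdge.isTriple h E hq) hx hd.der ((isVertexMatrix_vertexMatrix h E k).2 d hd)
    have key : (QEdge.matrix P D E (.corner k)).map d =
        E.vertexMatrix (P.cornerPoint α k) * QEdge.matrix P D E (.corner k) +
          QEdge.matrix P D E (.corner k) * decoratedMatrix P D E k := by
      rw [QEdge.matrix, decoratedMatrix]
      split_ifs
      exacts [hST.1, hST.2]
    rw [QEdge.finishMatrix, QEdge.startMatrix, QEdge.IsCcw, key]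
    by_cases hi : CrossingIn L P α k
    · have ho : ¬ CrossingOut L P α k := not_crossing_in_out h P α k hi
      simp only [if_pos hi, if_neg ho]
    · have ho : CrossingOut L P α k := hq.resolve_left hi
      simp only [if_neg hi, if_pos ho]

end Edges

section EdgePath

variable {X M : Type*} (st fi : X → M)

/-- The edges of the list form a path between the given vertices. -/
def EdgePath : M → List X → M → Prop
  | a, [], b => a = b
  | a, x :: l, b => st x = a ∧ EdgePath (fi x) l b

variable {st fi}

lemma EdgePath.append {a b c : M} {l l' : List X} (h : EdgePath st fi a l b)
    (h' : EdgePath st fi b l' c) : EdgePath st fi a (l ++ l') c := by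
  induction l generalizing a with
  | nil => rw [EdgePath] at h; subst h; exact h'
  | cons x l ih => exact ⟨h.1, ih h.2⟩

lemma EdgePath.flatMap_range {W : ℕ → M} {g : ℕ → List X}
    (h : ∀ k, EdgePath st fi (W k) (g k) (W (k + 1))) (N : ℕ) :
    EdgePath st fi (W 0) ((List.range N).flatMap g) (W N) := by
  induction N with
  | zero => rfl
  | succ N ih =>
    rw [List.range_succ, List.flatMap_append, List.flatMap_singleton]
    exact ih.append (h N)

lemma EdgePath.finish_eq {a b : M} {l : List X} (h : EdgePath st fi a l b) (x : X) {i : ℕ}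
    (hi : i < l.length) :
    fi (l.getD i x) = if i + 1 < l.length then st (l.getD (i + 1) x) else b := by
  induction l generalizing a i with
  | nil => simp at hi
  | cons y l ih =>
    cases i with
    | zero =>
      cases l with
      | nil => simpa [EdgePath] using h.2
      | cons z l => simpa using h.2.1.symm
    | succ i => simpa using ih h.2 (by simpa using hi)

lemma EdgePath.finish_eq_start {a : M} {l : List X} (h : EdgePath st fi a l a) (hl : 0 < l.length)
    (x : X) (i : ℕ) :
    fi (l.getD (i % l.length) x) = st (l.getD ((i + 1) % l.length) x) := by
  have hm := Nat.mod_lt i hl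
  rw [h.finish_eq x hm]
  split_ifs with hi
  · rw [← Nat.mod_add_mod, Nat.mod_eq_of_lt hi]
  · have : i % l.length + 1 = l.length := by omega
    rw [← Nat.mod_add_mod, this, Nat.mod_self]
    cases l with
    | nil => simp at hl
    | cons y l => simpa using h.1.symm

end EdgePath

section Polygon

open LegendrianSurface PolygonalDecomposition

variable {S Λ : Type*} [TopologicalSpace S] [ChartedSpace Plane S] [IsManifold (𝓡 2) ∞ S]
  [TopologicalSpace Λ] [ChartedSpace Plane Λ] [CWComplex (univ : Set S)]
  {L : LegendrianSurface S Λ} {P : PolygonalDecomposition S} {α : Cell S 2} {k : ℤ}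

namespace PolygonalDecomposition

omit [IsManifold (𝓡 2) ∞ S] in
lemma side_add (P : PolygonalDecomposition S) (α : Cell S 2) (k : ℤ) :
    P.cornerPoint α (k + P.corners α) = P.cornerPoint α k ∧
    P.sidePoint α (k + P.corners α) = P.sidePoint α k ∧
    P.side α (k + P.corners α) = P.side α k ∧
    P.finishEnd α (k + P.corners α) = P.finishEnd α k ∧
    P.startEnd α (k + P.corners α) = P.startEnd α k := by
  have h0 := P.angle_add α k
  have h1 := P.angle_add α (k + 1)
  rw [add_right_comm] at h1
  have hp : P.sidePoint α (k + P.corners α) = P.sidePoint α k := by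
    rw [sidePoint, sidePoint, h0, h1, ← circlePoint_add_two_pi ((_ + P.angle α (k + 1)) / 2)]
    congr 1
    ring
  have hs : P.side α (k + P.corners α) = P.side α k := by
    have e1 := P.map_mem_side (α := α) (k := k + P.corners α) P.mid_mem
    have e2 := P.map_mem_side (α := α) (k := k) P.mid_mem
    change map 2 α (P.sidePoint α _) ∈ _ at e1 e2
    rw [hp] at e1
    exact cell_eq_of_mem_openCell e1 e2
  have hpos : P.SidePositive α (k + P.corners α) ↔ P.SidePositive α k := by
    rw [SidePositive, SidePositive, hs, h0, h1]
    constructor <;> intro hm x hx y hy hxy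
    · have := hm (a := x + 2 * Real.pi) ⟨by linarith [hx.1], by linarith [hx.2]⟩
        (b := y + 2 * Real.pi) ⟨by linarith [hy.1], by linarith [hy.2]⟩ (by linarith)
      simpa only [circlePoint_add_two_pi] using this
    · have := hm (a := x - 2 * Real.pi) ⟨by linarith [hx.1], by linarith [hx.2]⟩
        (b := y - 2 * Real.pi) ⟨by linarith [hy.1], by linarith [hy.2]⟩ (by linarith)
      simp only [← circlePoint_add_two_pi (_ - _), sub_add_cancel] at this
      exact this
  refine ⟨by rw [cornerPoint, cornerPoint, h0, circlePoint_add_two_pi], hp, hs, ?_, ?_⟩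
  · rw [finishEnd, finishEnd, hpos]
  · rw [startEnd, startEnd, hpos]

end PolygonalDecomposition

lemma sideLabeledS_add (D : Decoration L) (k : ℤ) (ε : Bool) :
    SideLabeledS P D α (k + P.corners α) ε ↔ SideLabeledS P D α k ε := by
  have : ∀ j, SideLabeledS P D α j ε = (fun (β : Cell S 1) θ => ∃ h : IsCrossingEnd L β ε, ∃ t,
    CrossAt L β ε (D _ ε h).1 t ∧ ∃ X Y : Sheet L 2 α, X.Above Y ∧
      X.limit θ ∈ (D _ ε h).1.1 ∧ Y.limit θ ∈ t.1) (P.side α j) (P.sidePoint α j) := fun _ => rfl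
  rw [this, this, (P.side_add α k).2.1, (P.side_add α k).2.2.1]

/-- The matrix of the vertex at which the additional edge or the side at a corner starts. -/
def cornerStart (P : PolygonalDecomposition S) (D : Decoration L) (E : Enumeration L 2 α) (k : ℤ) :
    Matrix (Fin E.num) (Fin E.num) (Alg L) :=
  if CrossingIn L P α k then decoratedMatrix P D E k else E.vertexMatrix (P.cornerPoint α k)

lemma cornerStart_add (D : Decoration L) (E : Enumeration L 2 α) (k : ℤ) :
    cornerStart P D E (k + P.corners α) = cornerStart P D E k := by
  obtain ⟨h1, -, h3, -, h5⟩ := P.side_add α k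
  obtain ⟨-, -, g3, g4, -⟩ := P.side_add α (k - 1)
  have e : k + P.corners α - 1 = k - 1 + P.corners α := by ring
  rw [cornerStart, cornerStart, decoratedMatrix, decoratedMatrix, CornerLabeledS, CornerLabeledS,
    CrossingIn, CrossingIn, e, g3, g4, h1, h5, sideLabeledS_add, sideLabeledS_add]

lemma edgePath_qEdges (D : Decoration L) (E : Enumeration L 2 α) :
    EdgePath (QEdge.startMatrix P D E) (QEdge.finishMatrix P D E) (cornerStart P D E 0)
      (qEdges L P α) (cornerStart P D E 0) := by
  have := EdgePath.flatMap_range (W := fun k : ℕ => cornerStart P D E k)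
    (st := QEdge.startMatrix P D E) (fi := QEdge.finishMatrix P D E)
    (g := fun k : ℕ => (if CrossingIn L P α (k : ℤ) ∨ CrossingOut L P α (k : ℤ) then
      [QEdge.corner (k : ℤ)] else []) ++ [QEdge.side (k : ℤ)]) (fun k => by
      split_ifs with hc
      · exact ⟨rfl, rfl, by push_cast; rfl⟩
      · rw [not_or] at hc
        refine ⟨?_, by push_cast; rfl⟩
        rw [QEdge.startMatrix, cornerStart, if_neg hc.1, if_neg hc.2]) (P.corners α)
  have e := cornerStart_add (P := P) D E 0
  rw [zero_add] at e
  simp only [e] at this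
  exact this

lemma QEdge.isEdge_of_mem {q : QEdge} (hq : q ∈ qEdges L P α) : q.IsEdge L P α := by
  rw [qEdges, List.mem_flatMap] at hq
  obtain ⟨k, -, hk⟩ := hq
  rw [List.mem_append, List.mem_singleton] at hk
  rcases hk with hk | rfl
  · split_ifs at hk with hc
    · rw [List.mem_singleton] at hk
      subst hk
      exact hc
    · simp at hk
  · trivial

lemma isEdge_qEdge (hl : 0 < (qEdges L P α).length) (i : ℕ) : (qEdge L P α i).IsEdge L P α := by
  refine QEdge.isEdge_of_mem ?_
  rw [qEdge, List.getD_eq_getElem _ _ (Nat.mod_lt i hl)]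
  exact List.getElem_mem _

/-- The factor of an edge in the product along a path. -/
def QEdge.factor (P : PolygonalDecomposition S) (D : Decoration L) (E : Enumeration L 2 α)
    (ccw : Bool) (q : QEdge) : Matrix (Fin E.num) (Fin E.num) (Alg L) :=
  if (q.IsCcw L P α ↔ ccw = true) then q.matrix P D E else Ring.inverse (q.matrix P D E)

lemma pathMatrix_map (D : Decoration L) (E : Enumeration L 2 α) (ccw : Bool) (f : ℕ → ℕ) (n : ℕ) :
    pathMatrix P D E ccw ((List.range n).map fun i => qEdge L P α (f i)) =
      ((List.range n).map fun i => (qEdge L P α (f i)).factor P D E ccw).reverse.prod := by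
  rw [pathMatrix, List.map_map]
  rfl

/-- The right-hand side of the defining equation for a 2-cell. -/
def twoCellMatrix (D : Decoration L) (V : VertexChoice L P) (E : Enumeration L 2 α) :
    Matrix (Fin E.num) (Fin E.num) (Alg L) :=
  (qEdge L P α (V.init α + V.len α)).startMatrix P D E * E.cellMatrix +
    E.cellMatrix * (qEdge L P α (V.init α)).startMatrix P D E +
    pathMatrix P D E true (V.pathPlus α) + pathMatrix P D E false (V.pathMinus α)

variable (h : IsCellular L) [T2Space S] [IsManifold (𝓡 2) ∞ Λ]
  [∀ (n : ℕ) (e : Cell S n), Fintype (Sheet L n e)] {D : Decoration L} (E : Enumeration L 2 α)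
include h

omit [∀ (n : ℕ) (e : Cell S n), Fintype (Sheet L n e)] in
lemma isHom_pathMatrix (hl : 0 < (qEdges L P α).length) (ccw : Bool) (f : ℕ → ℕ) (n : ℕ) :
    IsHom E.sheet 0 (1 - pathMatrix P D E ccw ((List.range n).map fun i => qEdge L P α (f i))) := by
  rw [pathMatrix_map]
  refine IsHom.uni_list_prod h _ fun Y hY => ?_
  rw [List.mem_reverse, List.mem_map] at hY
  obtain ⟨i, -, rfl⟩ := hY
  have := QEdge.isHom_matrix (D := D) h E (isEdge_qEdge hl (f i))
  rw [QEdge.factor]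
  split_ifs
  exacts [this, (IsHom.uni_inverse h this).2]

lemma isHom_twoCellMatrix (V : VertexChoice L P) : IsHom E.sheet 0 (twoCellMatrix D V E) := by
  have hC : IsHom E.sheet 1 E.cellMatrix := by
    simpa [Enumeration.cellMatrix_eq] using (isHom_sheetMatrix (L := L) α).submatrix E.sheet
  have hl := (V.init α).pos
  have hF : IsHom E.sheet 0 (1 - pathMatrix P D E true (V.pathPlus α)) :=
    isHom_pathMatrix h E hl true _ _
  have hG : IsHom E.sheet 0 (1 - pathMatrix P D E false (V.pathMinus α)) :=
    isHom_pathMatrix h E hl false _ _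
  have h2 : (1 : Matrix (Fin E.num) (Fin E.num) (Alg L)) + 1 = 0 := by
    ext i j; exact freeAlgebra_add_self _
  have aux : ∀ A F G : Matrix (Fin E.num) (Fin E.num) (Alg L),
      A + F + G = A + -(1 - F) + -(1 - G) := fun A F G => by
    have : A + F + G - (A + -(1 - F) + -(1 - G)) = 1 + 1 := by abel
    rw [← sub_eq_zero, this, h2]
  rw [twoCellMatrix, aux]
  refine IsHom.add (IsHom.add (IsHom.add ?_ ?_) hF.neg) hG.neg
  · simpa using (QEdge.isVertexMatrix (P := P) (D := D) h E _).1.mul h hC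
  · simpa using hC.mul h (QEdge.isVertexMatrix (P := P) (D := D) h E _).1

/-- The factors of the edges in the two directions satisfy the equation of a 1-cell. -/
lemma map_factor (hl : 0 < (qEdges L P α).length) {d : Alg L → Alg L} (hd : SolvesBoundary D d)
    (i : ℕ) : ((qEdge L P α i).factor P D E true).map d =
      (qEdge L P α (i + 1)).startMatrix P D E * (qEdge L P α i).factor P D E true +
        (qEdge L P α i).factor P D E true * (qEdge L P α i).startMatrix P D E ∧
    ((qEdge L P α i).factor P D E false).map d =
      (qEdge L P α i).startMatrix P D E * (qEdge L P α i).factor P D E false +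
        (qEdge L P α i).factor P D E false * (qEdge L P α (i + 1)).startMatrix P D E := by
  have hq := isEdge_qEdge hl i
  have h1 := QEdge.map_matrix h E hd hq
  have hu := (IsHom.uni_inverse h (QEdge.isHom_matrix (D := D) h E hq)).1
  have hf : (qEdge L P α i).finishMatrix P D E = (qEdge L P α (i + 1)).startMatrix P D E :=
    (edgePath_qEdges D E).finish_eq_start hl _ i
  have hD := hd.der.matrix (Fin E.num)
  rw [hf] at h1
  simp only [QEdge.factor, iff_true, Bool.false_eq_true, iff_false]
  by_cases hc : (qEdge L P α i).IsCcw L P α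
  · rw [if_pos hc] at h1 ⊢
    rw [if_neg (not_not.2 hc)]
    exact ⟨h1, hD.map_inverse hu h1⟩
  · rw [if_neg hc] at h1 ⊢
    rw [if_pos hc]
    exact ⟨hD.map_inverse hu h1, h1⟩

lemma map_twoCellMatrix (V : VertexChoice L P) {d : Alg L → Alg L} (hd : SolvesBoundary D d)
    (hC : E.cellMatrix.map d = twoCellMatrix D V E) : (twoCellMatrix D V E).map d = 0 := by
  have hD := hd.der.matrix (Fin E.num)
  have hlen := (V.len α).isLt
  have hl := (V.init α).pos
  have hper : qEdge L P α (V.init α + (qEdges L P α).length) = qEdge L P α (V.init α) := by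
    rw [qEdge, qEdge, Nat.add_mod_right]
  have hF := hD.map_path (v := fun i => (qEdge L P α i).startMatrix P D E)
    (fun i => (map_factor h E hl hd i).1) (V.init α) (V.len α)
  have hG := hD.map_path_back (v := fun i => (qEdge L P α i).startMatrix P D E)
    (fun i => (map_factor h E hl hd i).2) (V.init α + (qEdges L P α).length)
    ((qEdges L P α).length - V.len α) (by omega)
  have e : (V.init α : ℕ) + (qEdges L P α).length - ((qEdges L P α).length - V.len α) =
    V.init α + V.len α := by omega
  rw [e, hper, ← pathMatrix_map] at hG
  rw [← pathMatrix_map] at hF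
  exact hD.map_two_cell ((QEdge.isVertexMatrix h E _).2 d hd)
    ((QEdge.isVertexMatrix h E _).2 d hd) hF hG hC

end Polygon

section Differential

open LegendrianSurface PolygonalDecomposition

variable {S Λ : Type*} [TopologicalSpace S] [ChartedSpace Plane S] [IsManifold (𝓡 2) ∞ S]
  [TopologicalSpace Λ] [ChartedSpace Plane Λ] [CWComplex (univ : Set S)]
  {L : LegendrianSurface S Λ} {P : PolygonalDecomposition S} {D : Decoration L}
  {V : VertexChoice L P}

omit [ChartedSpace Plane S] [IsManifold (𝓡 2) ∞ S] in
lemma exists_map_endPoint_mem [T2Space S] (β : Cell S 1) (ε : Bool) :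
    ∃ v : Cell S 0, map 1 β (endPoint ε) ∈ openCell 0 v := by
  have hu : map 1 β (endPoint ε) ∈ cellFrontier 1 β := by
    refine mem_image_of_mem _ (mem_sphere_zero_iff_norm.2 ?_)
    show ‖(fun _ : Fin 1 => if ε then (1 : ℝ) else -1)‖ = 1
    rw [pi_norm_const]
    cases ε <;> simp
  obtain ⟨x, y, h⟩ := CWComplex.exists_cellFrontier_one_eq β
  rw [h] at hu
  rcases hu with hu | hu
  · exact ⟨x, by rwa [openCell_zero_eq_singleton, ← closedCell_zero_eq_singleton]⟩
  · exact ⟨y, by rwa [openCell_zero_eq_singleton, ← closedCell_zero_eq_singleton]⟩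

lemma IsCellularDifferential.unique (hP : ∀ n, 2 < n → IsEmpty (Cell S n))
    {E : ∀ (n : ℕ) (e : Cell S n), Enumeration L n e} {d d' : Alg L →ₗ[ZMod 2] Alg L}
    (hd : IsCellularDifferential P D V E d) (hd' : IsCellularDifferential P D V E d') : d = d' := by
  refine derivation_ext hd.map_one hd.leibniz hd'.map_one hd'.leibniz ?_
  rintro ⟨n, e, s, t, ha⟩
  have key : (E n e).cellMatrix.map d = (E n e).cellMatrix.map d' := by
    rcases n with _ | _ | _ | n
    · rw [hd.zero_cell, hd'.zero_cell]
    · rw [hd.one_cell, hd'.one_cell]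
    · rw [hd.two_cell, hd'.two_cell]
    · exact ((hP _ (by omega)).false e).elim
  have := congrFun (congrFun key ((E n e).sheet.symm s)) ((E n e).sheet.symm t)
  simpa [Enumeration.cellMatrix, ha] using this

variable (h : IsCellular L) [T2Space S] [IsManifold (𝓡 2) ∞ Λ]
include h

lemma subsingleton_enumeration (α : Cell S 2) : Subsingleton (Enumeration L 2 α) := by
  constructor
  rintro ⟨m, f, hf⟩ ⟨m', f', hf'⟩
  obtain rfl : m = m' := Fin.equiv_iff_eq.1 ⟨f.trans f'.symm⟩
  have mono : ∀ g g' : Fin m ≃ Sheet L 2 α, (∀ i j, (g i).Above (g j) → i < j) →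
      (∀ i j, (g' i).Above (g' j) → i < j) → StrictMono (g.trans g'.symm) := by
    intro g g' hg hg' i j hij
    refine hg' _ _ ?_
    simp only [Equiv.trans_apply, Equiv.apply_symm_apply]
    exact (Sheet.above_or_above h fun hh => hij.ne (g.injective hh)).resolve_right
      fun hh => hij.not_gt (hg _ _ hh)
  have h1 : ((mono f f' hf hf').orderIsoOfSurjective _ (f.trans f'.symm).surjective) =
      OrderIso.refl (Fin m) := Subsingleton.elim _ _
  have h2 : f = f' := by
    ext1 i
    have := congrArg (fun g : Fin m ≃o Fin m => f' (g i)) h1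
    simpa using this
  subst h2
  rfl

variable [∀ (n : ℕ) (e : Cell S n), Fintype (Sheet L n e)]

lemma IsEndMatrix.unique {β : Cell S 1} {ε : Bool} {M M' : Matrix (Sheet L 1 β) (Sheet L 1 β) (Alg L)}
    (hM : IsEndMatrix D β ε M) (hM' : IsEndMatrix D β ε M') : M = M' := by
  obtain ⟨E⟩ := h.nonempty_enumeration 1 β
  have := (hM.endMatrix_eq h E).symm.trans (hM'.endMatrix_eq h E)
  ext s t
  simpa using congrFun (congrFun this (E.sheet.symm s)) (E.sheet.symm t)

variable (D V) in
/-- The right-hand sides of the defining equations, as matrices indexed by the sheets. -/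
def differentialMatrix : ∀ (n : ℕ) (e : Cell S n), Matrix (Sheet L n e) (Sheet L n e) (Alg L)
  | 0, v => sheetMatrix L v * sheetMatrix L v
  | 1, β => (exists_isEndMatrix h D true β).choose * (1 + sheetMatrix L β) +
      (1 + sheetMatrix L β) * (exists_isEndMatrix h D false β).choose
  | 2, α => (twoCellMatrix D V (h.nonempty_enumeration 2 α).some).submatrix
      (h.nonempty_enumeration 2 α).some.sheet.symm (h.nonempty_enumeration 2 α).some.sheet.symm
  | _, _ => 0

lemma isHom_differentialMatrix (n : ℕ) (e : Cell S n) :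
    IsHom id ((n : ℤ) - 2) (differentialMatrix D V h n e) := by
  match n, e with
  | 0, v =>
    have hA : IsHom id (-1) (sheetMatrix L v) := by simpa using isHom_sheetMatrix (L := L) v
    have : IsHom id (-2) (sheetMatrix L v * sheetMatrix L v) := by simpa using hA.mul h hA
    simpa [differentialMatrix] using this
  | 1, β =>
    have hB : IsHom id 0 (sheetMatrix L β) := by simpa using isHom_sheetMatrix (L := L) β
    have hY : IsHom id 0 (1 - (1 + sheetMatrix L β)) := by
      rw [sub_add_cancel_left]; exact hB.neg
    obtain ⟨v, hv⟩ := exists_map_endPoint_mem β true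
    obtain ⟨w, hw⟩ := exists_map_endPoint_mem β false
    have := (hY.mul_uni h ((exists_isEndMatrix h D true β).choose_spec.isHom h hv)).add
      (hY.uni_mul h ((exists_isEndMatrix h D false β).choose_spec.isHom h hw))
    rw [differentialMatrix]
    norm_num
    exact this
  | 2, α =>
    have := (isHom_twoCellMatrix (D := D) h (h.nonempty_enumeration 2 α).some V).submatrix
      (h.nonempty_enumeration 2 α).some.sheet.symm
    rw [Equiv.self_comp_symm] at this
    rw [differentialMatrix]
    norm_num
    exact this
  | n + 3, e =>
    rw [differentialMatrix]
    · exact IsHom.zero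
    all_goals omega

variable (D V) in
/-- The differential of the cellular algebra. -/
def differential : Alg L →ₗ[ZMod 2] Alg L :=
  freeDerivation fun g => differentialMatrix D V h g.dim g.cell g.upper g.lower

lemma differential_ι (g : Gen L) : differential D V h (FreeAlgebra.ι (ZMod 2) g) =
    differentialMatrix D V h g.dim g.cell g.upper g.lower := freeDerivation_ι _ _

lemma map_sheetMatrix (n : ℕ) (e : Cell S n) :
    (sheetMatrix L e).map (differential D V h) = differentialMatrix D V h n e := by
  ext s t
  rw [Matrix.map_apply, sheetMatrix, Matrix.of_apply]
  split_ifs with ha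
  · exact differential_ι h _
  · rw [map_zero]
    by_contra h0
    exact ha ((isHom_differentialMatrix h n e s t).1 fun h1 => h0 h1.symm)

lemma solvesBoundary_differential : SolvesBoundary D (differential D V h) where
  der := isMod2Derivation_of (freeDerivation_one _) (freeDerivation_mul _)
  zero v := map_sheetMatrix h 0 v
  one β M M' hM hM' := by
    rw [hM.unique h (exists_isEndMatrix h D true β).choose_spec,
      hM'.unique h (exists_isEndMatrix h D false β).choose_spec]
    exact map_sheetMatrix h 1 β

lemma map_cellMatrix_two {α : Cell S 2} (E : Enumeration L 2 α) :
    E.cellMatrix.map (differential D V h) = twoCellMatrix D V E := by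
  obtain rfl := (subsingleton_enumeration h α).elim (h.nonempty_enumeration 2 α).some E
  rw [Enumeration.cellMatrix_eq]
  refine (congrArg (fun Z : Matrix (Sheet L 2 α) (Sheet L 2 α) (Alg L) => Z.submatrix _ _)
    (map_sheetMatrix (D := D) (V := V) h 2 α)).trans ?_
  rw [differentialMatrix, Matrix.submatrix_submatrix, Equiv.symm_comp_self, Matrix.submatrix_id_id]

lemma isCellularDifferential_differential (E : ∀ (n : ℕ) (e : Cell S n), Enumeration L n e) :
    IsCellularDifferential P D V E (differential D V h) where
  map_one := freeDerivation_one _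
  leibniz := freeDerivation_mul _
  zero_cell v := by
    rw [Enumeration.cellMatrix_eq, Matrix.submatrix_mul_equiv]
    exact congrArg (fun Z => Matrix.submatrix Z (E 0 v).sheet (E 0 v).sheet)
      (map_sheetMatrix (D := D) (V := V) h 0 v)
  one_cell β := by
    obtain ⟨M, hM⟩ := exists_isEndMatrix h D true β
    obtain ⟨M', hM'⟩ := exists_isEndMatrix h D false β
    have e1 : (1 : Matrix (Fin (E 1 β).num) (Fin (E 1 β).num) (Alg L)) + (E 1 β).cellMatrix =
        (1 + sheetMatrix L β).submatrix (E 1 β).sheet (E 1 β).sheet := by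
      rw [Matrix.submatrix_add, Enumeration.cellMatrix_eq]
      congr 1
      exact (Matrix.submatrix_one_equiv _).symm
    rw [hM.endMatrix_eq h, hM'.endMatrix_eq h, e1, Matrix.submatrix_mul_equiv,
      Matrix.submatrix_mul_equiv]
    exact congrArg (fun Z => Matrix.submatrix Z (E 1 β).sheet (E 1 β).sheet)
      ((solvesBoundary_differential h).one β M M' hM hM')
  two_cell α := map_cellMatrix_two h (E 2 α)

lemma differential_sq (a : Alg L) : differential D V h (differential D V h a) = 0 := by
  have hd : SolvesBoundary D (differential D V h) := solvesBoundary_differential h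
  refine derivation_sq_eq_zero (d := differential D V h) (freeDerivation_one _)
    (freeDerivation_mul _) (fun g => ?_) a
  have key : ∀ (n : ℕ) (e : Cell S n),
      (differentialMatrix D V h n e).map (differential D V h) = 0 := by
    intro n e
    have hD := hd.der.matrix (Sheet L n e)
    match n, e with
    | 0, v =>
      refine (hD.leibniz _ _).trans ?_
      rw [hd.zero, mul_assoc, hD.add_self]
    | 1, β =>
      have hM := (exists_isEndMatrix h D true β).choose_spec
      have hM' := (exists_isEndMatrix h D false β).choose_spec
      obtain ⟨v, hv⟩ := exists_map_endPoint_mem β true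
      obtain ⟨w, hw⟩ := exists_map_endPoint_mem β false
      refine hD.map_one_cell (hM.map_eq h hv hd.der (hd.zero v))
        (hM'.map_eq h hw hd.der (hd.zero w)) ((hD.map_add _ _).trans ?_)
      have h1 : (1 : Matrix (Sheet L 1 β) (Sheet L 1 β) (Alg L)).map (differential D V h) = 0 :=
        hD.map_one
      rw [h1, zero_add]
      exact hd.one β _ _ hM hM'
    | 2, α =>
      exact congrArg (fun Z => Matrix.submatrix Z (h.nonempty_enumeration 2 α).some.sheet.symm
        (h.nonempty_enumeration 2 α).some.sheet.symm)
        (map_twoCellMatrix h (h.nonempty_enumeration 2 α).some V hd (map_cellMatrix_two h _))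
    | n + 3, e =>
      rw [differentialMatrix]
      · exact Matrix.map_zero _ (map_zero _)
      all_goals omega
  rw [differential_ι]
  exact congrFun (congrFun (key g.dim g.cell) g.upper) g.lower

lemma differential_mem_gradedPiece (μ : L.MaslovPotential) {k : ZMod L.maslovNumber} {a : Alg L}
    (ha : a ∈ gradedPiece μ k) : differential D V h a ∈ gradedPiece μ (k - 1) := by
  rw [sub_eq_add_neg]
  refine map_mem_wordSpan (d := differential D V h) (Gen.degree μ) (freeDerivation_one _) (freeDerivation_mul _) (-1) ?_ ha
  rintro ⟨n, e, s, t, hst⟩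
  have := (isHom_differentialMatrix (D := D) (V := V) h n e s t).2 μ
  have e1 : μ.onSheet s.1 - μ.onSheet t.1 + (((n : ℤ) - 2 : ℤ) : ZMod L.maslovNumber) =
      Gen.degree μ (⟨n, e, s, t, hst⟩ : Gen L) + -1 := by
    rw [Gen.degree]; push_cast; ring
  rw [id, id, e1] at this
  rw [differential_ι]
  exact this

end Differential

end CellularDGA

end

theorem theorem3 {S Λ : Type*}
    [TopologicalSpace S] [T2Space S] [ChartedSpace CellularDGA.Plane S] [IsManifold (𝓡 2) ∞ S]
    [TopologicalSpace Λ] [ChartedSpace CellularDGA.Plane Λ] [IsManifold (𝓡 2) ∞ Λ]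
    [Topology.CWComplex (Set.univ : Set S)]
    (L : CellularDGA.LegendrianSurface S Λ) (hL : L.IsGeneric)
    (P : CellularDGA.PolygonalDecomposition S) (hP : CellularDGA.IsCompatible L)
    (D : CellularDGA.Decoration L) (V : CellularDGA.VertexChoice L P) :
    (∀ (n : ℕ) (e : CellularDGA.Cell S n), Nonempty (CellularDGA.Enumeration L n e)) ∧
    ∃ d : CellularDGA.Alg L →ₗ[ZMod 2] CellularDGA.Alg L,
      (∀ E, CellularDGA.IsCellularDifferential P D V E d) ∧
      (∀ E d', CellularDGA.IsCellularDifferential P D V E d' → d' = d) ∧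
      (∀ a, d (d a) = 0) ∧
      ∀ μ : L.MaslovPotential,
        Nonempty (GradedAlgebra (CellularDGA.gradedPiece μ)) ∧
        ∀ k, ∀ a ∈ CellularDGA.gradedPiece μ k, d a ∈ CellularDGA.gradedPiece μ (k - 1) := by
  have h : CellularDGA.IsCellular L := ⟨hL, hP, fun n e => by
    by_contra hn
    exact (P.isEmpty_cell n (by omega)).false e⟩
  have : ∀ (n : ℕ) (e : CellularDGA.Cell S n), Fintype (CellularDGA.Sheet L n e) :=
    fun n e => @Fintype.ofFinite _ (CellularDGA.Sheet.finite h)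
  exact ⟨h.nonempty_enumeration, CellularDGA.differential D V h,
    fun E => CellularDGA.isCellularDifferential_differential h E,
    fun E d' hd' => hd'.unique P.isEmpty_cell (CellularDGA.isCellularDifferential_differential h E),
    CellularDGA.differential_sq h, fun μ =>
      ⟨CellularDGA.nonempty_gradedAlgebra_wordSpan (CellularDGA.Gen.degree μ),
        fun k a ha => CellularDGA.differential_mem_gradedPiece h μ ha⟩⟩
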